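/- **Setting.** Let $k$ be a field of characteristic zero. All differentials have degree $-1$, gradings are by $\mathbb Z$, and the Koszul sign rule is used. Let $\mathfrak g$ be a finite-dimensional Lie algebra over $k$ (in degree $0$), with dual Lie coalgebra $\mathfrak g^*$, whose cobracket $\varphi\mapsto\sum\varphi'\otimes\varphi''$ is determined by $\varphi([x,y])=\sum\varphi'(x)\varphi''(y)$. * For a DG Lie algebra $\mathfrak b$, let $\mathfrak b_{\mathfrak g}$ be the *representation algebra*: the augmented graded commutative DG algebra generated by $\mathfrak g^*\otimes\mathfrak b$ with the relations $\varphi\otimes[\xi,\eta]=\sum(\varphi'\otimes\xi)(\varphi''\otimes\eta)$, with differential $d(\varphi\otimes\xi)=\varphi\otimes d\xi$ and with augmentation vanishing on the generators. (It represents the functor $B\mapsto\mathrm{Hom}_{\mathrm{DGLA}}(\mathfrak b,\mathfrak g\otimes B)$ on commutative DG algebras.) The Lie algebra $\mathfrak g$ acts on it by derivations through the coadjoint action on $\mathfrak g^*$; let $\mathfrak b_{\mathfrak g}^{\mathrm{ad}\,\mathfrak g}$ be the subalgebra of invariants. * A DG Lie algebra is *cofibrant* if it has the left lifting property with respect to all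 surjective quasi-isomorphisms. A cofibrant resolution of $\mathfrak a$ is a quasi-isomorphism $Q\to\mathfrak a$ with $Q$ cofibrant; put $\mathrm{DRep}_{\mathfrak g}(\mathfrak a):=Q_{\mathfrak g}$ and $\mathrm{DRep}_{\mathfrak g}(\mathfrak a)^{\mathrm{ad}\,\mathfrak g}:=Q_{\mathfrak g}^{\mathrm{ad}\,\mathfrak g}$, and let $\mathrm H_\bullet(\mathfrak a,\mathfrak g)$ and $\mathrm H_\bullet(\mathfrak a,\mathfrak g)^{\mathrm{ad}\,\mathfrak g}$ be the homology algebras of these. * $\mathrm{Ho}(\mathrm{DGCA}_{k/k})$ is the localization of the category of augmented (unital, graded commutative) DG algebras at the quasi-isomorphisms. * Let $C$ be a counital, coaugmented, conilpotent, cocommutative DG coalgebra over $k$, and let $\bar C=C/k$. The DG Lie algebra $\Omega_{\mathrm{Comm}}(C)$ is the free graded Lie algebra on $\bar C[-1]$ (an element of degree $n+1$ of $\bar C$ has degree $n$) with the differential given on generators by $c\mapsto -dc-\tfrac12\sum(-1)^{|c'|}[c',c'']$, where $\sum c'\otimes c''$ is the reduced coproduct of $c$. * $\mathfrak g^*(D)=\mathfrak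 g^*\otimes D$ for a cocommutative DG coalgebra $D$, and $\mathfrak g(B)=\mathfrak g\otimes B$ for a commutative DG algebra $B$, are the DG Lie coalgebra and the DG Lie algebra with structure maps $\varphi\otimes c\mapsto\sum(\varphi'\otimes c')\otimes(\varphi''\otimes c'')$ and $[x\otimes a,y\otimes b]=[x,y]\otimes ab$. * For a DG Lie coalgebra $\mathfrak G$, $\mathcal C^c(\mathfrak G;k)$ is $\mathbf{Sym}(\mathfrak G[-1])$ with the differential $x\mapsto -dx-\tfrac12\sum(-1)^{|x'|}x'x''$ on generators. For a surjection $\mathfrak G\to\mathfrak h^*$ with $\mathfrak h$ a finite-dimensional Lie algebra, $\mathcal C^c(\mathfrak G,\mathfrak h^*;k)=\mathbf{Sym}(\ker(\mathfrak G\to\mathfrak h^*)[-1])^{\mathfrak h}$ is the corresponding relative DG subalgebra; it is used here for $\mathfrak g^*(C)\to\mathfrak g^*$, $\varphi\otimes c\mapsto\varepsilon(c)\varphi$, where $\varepsilon$ is the counit. * For a DG Lie algebra $L$, $\mathcal C(L;k)$ is the Chevalley–Eilenberg DG coalgebra of chains $\mathbf{Sym}^c(L[1])$. For a Lie subalgebra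 $\mathfrak h\subset L$, $\mathcal C(L,\mathfrak h;k)=\mathbf{Sym}^c((L/\mathfrak h)[1])_{\mathfrak h}$ (coinvariants) is the relative complex. **Theorem.** Let $p:\Omega_{\mathrm{Comm}}(C)\to\mathfrak a$ be a quasi-isomorphism of DG Lie algebras, with $\mathfrak g$ and $C$ as above. Then $\mathfrak a$ has a cofibrant resolution, and for every cofibrant resolution $Q\to\mathfrak a$ the following holds. (a) There are isomorphisms in $\mathrm{Ho}(\mathrm{DGCA}_{k/k})$ $$\mathrm{DRep}_{\mathfrak g}(\mathfrak a)\cong\mathcal C^c(\mathfrak g^*(\bar C);k),\qquad \mathrm{DRep}_{\mathfrak g}(\mathfrak a)^{\mathrm{ad}\,\mathfrak g}\cong\mathcal C^c(\mathfrak g^*(C),\mathfrak g^*;k).$$ In particular, there are isomorphisms of graded algebras $\mathrm H_\bullet(\mathfrak a,\mathfrak g)\cong\mathrm H_\bullet(\mathfrak g^*(\bar C);k)$ and $\mathrm H_\bullet(\mathfrak a,\mathfrak g)^{\mathrm{ad}\,\mathfrak g}\cong\mathrm H_\bullet(\mathfrak g^*(C),\mathfrak g^*;k)$, where the right-hand sides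 are the homologies of these two complexes. (b) Suppose moreover that $C$ is finite-dimensional, or that $C$ is bigraded, i.e. equipped with an additional weight grading compatible with the whole structure, for which $\bar C$ is concentrated in positive weights and is finite-dimensional in each weight. Let $A=C^*$ be the dual commutative DG algebra (the direct sum of the duals of the weight components in the bigraded case), and $\bar A$ its augmentation ideal. Then there are isomorphisms in $\mathrm{Ho}(\mathrm{DGCA}_{k/k})$ $$\mathrm{DRep}_{\mathfrak g}(\mathfrak a)\cong\mathcal C(\mathfrak g(\bar A);k)^*,\qquad \mathrm{DRep}_{\mathfrak g}(\mathfrak a)^{\mathrm{ad}\,\mathfrak g}\cong\mathcal C(\mathfrak g(A),\mathfrak g;k)^*.$$ Here, in the finite-dimensional case, $*$ denotes the complex $\bigoplus_{p\ge 0}\mathrm{Hom}_k(\,\cdot\,,k)$ of Lie cochains, where $\mathrm{Hom}_k(\,\cdot\,,k)$ is taken of the component of the chains coming from $\mathbf{Sym}^p$; in the bigraded case, $*$ denotes the bigraded dual, i.e. the direct sum of the duals of the components of given degree and weight. In particular, with $\mathrm H^{-\bullet}$ denoting the cohomology of these complexes of cochains (the continuous Lie algebra cohomology in the bigraded case), there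 are isomorphisms of graded algebras $$\mathrm H_\bullet(\mathfrak a,\mathfrak g)\cong\mathrm H^{-\bullet}(\mathfrak g(\bar A);k),\qquad \mathrm H_\bullet(\mathfrak a,\mathfrak g)^{\mathrm{ad}\,\mathfrak g}\cong\mathrm H^{-\bullet}(\mathfrak g(A),\mathfrak g;k).$$ -/

import Mathlib

open CategoryTheory TensorProduct

set_option linter.unusedSimpArgs false
set_option linter.unusedSectionVars false

universe u

noncomputable section

namespace LieRep

/-! ### Signs and graded vector spaces -/

section Graded

variable (k : Type u) [Field k]

/-- The sign `(-1) ^ n` as an element of the base field. -/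
def sgn (n : ℤ) : k := ((n.negOnePow : ℤˣ) : ℤ)

lemma sgn_add (m n : ℤ) : sgn k (m + n) = sgn k m * sgn k n := by
  simp [sgn, Int.negOnePow_add]

lemma sgn_zero : sgn k 0 = 1 := by simp [sgn]

lemma sgn_one : sgn k 1 = -1 := by simp [sgn]

lemma sgn_cases (n : ℤ) : sgn k n = 1 ∨ sgn k n = -1 := by
  rcases Int.even_or_odd n with h | h
  · left; simp [sgn, Int.negOnePow_even n h]
  · right; simp [sgn, Int.negOnePow_odd n h]

lemma sgn_sq (n : ℤ) : sgn k n * sgn k n = 1 := by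
  rcases sgn_cases k n with h | h <;> simp [h]

lemma sgn_neg (n : ℤ) : sgn k (-n) = sgn k n := by
  simp [sgn, Int.negOnePow_neg]

lemma sgn_sub (m n : ℤ) : sgn k (m - n) = sgn k m * sgn k n := by
  rw [sub_eq_add_neg, sgn_add, sgn_neg]

lemma sgn_mul_self (n : ℤ) : sgn k (n * n) = sgn k n := by
  rcases Int.even_or_odd n with h | h
  · simp [sgn, Int.negOnePow_even n h, Int.negOnePow_even (n * n) (h.mul_left n)]
  · simp [sgn, Int.negOnePow_odd n h, Int.negOnePow_odd (n * n) (h.mul h)]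

variable {k}
variable {X : Type u} [AddCommGroup X] [Module k X] {gr : ℤ → Submodule k X}

lemma hom_induction (h : DirectSum.IsInternal gr) {p : X → Prop} (x : X)
    (mem : ∀ n, ∀ y ∈ gr n, p y) (add : ∀ y z, p y → p z → p (y + z)) : p x := by
  have hx : x ∈ ⨆ n, gr n := by rw [h.submodule_iSup_eq_top]; trivial
  exact Submodule.iSup_induction gr (motive := p) hx mem (mem 0 0 (zero_mem _)) add

lemma ext_gr (h : DirectSum.IsInternal gr) {Z : Type*} [AddCommGroup Z] [Module k Z]
    {f g : X →ₗ[k] Z} (H : ∀ n, ∀ x ∈ gr n, f x = g x) : f = g := by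
  ext x
  exact hom_induction h (p := fun x => f x = g x) x H (fun y z hy hz => by simp [hy, hz])

/-- The decomposition of a graded vector space as a direct sum. -/
def decEquiv (h : DirectSum.IsInternal gr) : (DirectSum ℤ fun n => gr n) ≃ₗ[k] X :=
  LinearEquiv.ofBijective (DirectSum.coeLinearMap gr) (id h)

/-- The linear map which is given by `f n` on the homogeneous elements of degree `n`. -/
def byDeg (h : DirectSum.IsInternal gr) {Z : Type u} [AddCommGroup Z] [Module k Z]
    (f : ℤ → X →ₗ[k] Z) : X →ₗ[k] Z :=
  (DirectSum.toModule k ℤ Z fun n => f n ∘ₗ (gr n).subtype) ∘ₗ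
    (decEquiv h).symm.toLinearMap

lemma byDeg_of_mem (h : DirectSum.IsInternal gr) {Z : Type u} [AddCommGroup Z] [Module k Z]
    (f : ℤ → X →ₗ[k] Z) {n : ℤ} {x : X} (hx : x ∈ gr n) : byDeg h f x = f n x := by
  have : (decEquiv h).symm x = DirectSum.lof k ℤ (fun n => gr n) n ⟨x, hx⟩ := by
    rw [LinearEquiv.symm_apply_eq]
    exact (DirectSum.coeLinearMap_lof gr n ⟨x, hx⟩).symm
  simp [byDeg, this]

/-- The projection onto the component of degree `m`. -/
def proj (h : DirectSum.IsInternal gr) (m : ℤ) : X →ₗ[k] X :=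
  byDeg h fun n => if n = m then LinearMap.id else 0

lemma proj_of_mem (h : DirectSum.IsInternal gr) {m : ℤ} {x : X} (hx : x ∈ gr m) :
    proj h m x = x := by
  simp [proj, byDeg_of_mem h _ hx]

lemma proj_of_ne (h : DirectSum.IsInternal gr) {m n : ℤ} {x : X} (hx : x ∈ gr n) (hn : n ≠ m) :
    proj h m x = 0 := by
  simp [proj, byDeg_of_mem h _ hx, hn]

lemma proj_mem (h : DirectSum.IsInternal gr) (m : ℤ) (x : X) : proj h m x ∈ gr m := by
  refine hom_induction h (p := fun x => proj h m x ∈ gr m) x (fun n y hy => ?_) (fun y z hy hz => ?_)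
  · by_cases hn : n = m
    · subst hn; rwa [proj_of_mem h hy]
    · rw [proj_of_ne h hy hn]; exact zero_mem _
  · rw [map_add]; exact add_mem hy hz

/-- A submodule stable under the projections contains, with `x`, enough to rebuild `x`. -/
lemma mem_iSup_proj (h : DirectSum.IsInternal gr) (x : X) :
    ∃ s : Finset ℤ, x = ∑ n ∈ s, proj h n x ∧ ∀ n ∉ s, proj h n x = 0 := by
  classical
  refine hom_induction h (p := fun x => ∃ s : Finset ℤ, x = ∑ n ∈ s, proj h n x ∧
    ∀ n ∉ s, proj h n x = 0) x (fun n y hy => ?_) (fun y z hy hz => ?_)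
  · refine ⟨{n}, by simp [proj_of_mem h hy], fun m hm => proj_of_ne h hy ?_⟩
    rintro rfl; simp at hm
  · obtain ⟨s, hs, hs'⟩ := hy
    obtain ⟨t, ht, ht'⟩ := hz
    refine ⟨s ∪ t, ?_, fun n hn => ?_⟩
    · simp only [map_add, Finset.sum_add_distrib]
      congr 1
      · conv_lhs => rw [hs]
        exact Finset.sum_subset Finset.subset_union_left fun n _ hn => hs' n hn
      · conv_lhs => rw [ht]
        exact Finset.sum_subset Finset.subset_union_right fun n _ hn => ht' n hn
    · simp only [Finset.mem_union, not_or] at hn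
      rw [map_add, hs' n hn.1, ht' n hn.2, add_zero]

lemma isInternal_of_proj (p : ℤ → X →ₗ[k] X)
    (same : ∀ n, ∀ x ∈ gr n, p n x = x) (ne : ∀ m n, ∀ x ∈ gr n, n ≠ m → p m x = 0)
    (top : ∀ x, x ∈ ⨆ n, gr n) : DirectSum.IsInternal gr := by
  refine DirectSum.isInternal_submodule_of_iSupIndep_of_iSup_eq_top ?_ (eq_top_iff.2 fun x _ => top x)
  intro n
  rw [Submodule.disjoint_def]
  intro x hx hx'
  rw [← same n x hx]
  have : (⨆ j, ⨆ (_ : j ≠ n), gr j) ≤ LinearMap.ker (p n) :=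
    iSup₂_le fun j hj y hy => ne n j y hy hj
  exact this hx'

/-- Multiplication by `(-1) ^ (i * n)` in degree `n`. -/
def tw (h : DirectSum.IsInternal gr) (i : ℤ) : X →ₗ[k] X :=
  byDeg h fun n => sgn k (i * n) • LinearMap.id

lemma tw_of_mem (h : DirectSum.IsInternal gr) (i : ℤ) {n : ℤ} {x : X} (hx : x ∈ gr n) :
    tw h i x = sgn k (i * n) • x := by
  simp [tw, byDeg_of_mem h _ hx]

lemma tw_one_of_mem (h : DirectSum.IsInternal gr) {n : ℤ} {x : X} (hx : x ∈ gr n) :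
    tw h 1 x = sgn k n • x := by
  rw [tw_of_mem h 1 hx, one_mul]

lemma tw_zero (h : DirectSum.IsInternal gr) : tw h 0 = LinearMap.id := by
  refine ext_gr h fun n x hx => ?_
  simp [tw_of_mem h 0 hx, sgn_zero]

lemma tw_tw (h : DirectSum.IsInternal gr) (i : ℤ) (x : X) : tw h i (tw h i x) = x := by
  refine hom_induction h (p := fun x => tw h i (tw h i x) = x) x (fun n y hy => ?_)
    (fun y z hy hz => by simp [hy, hz])
  rw [tw_of_mem h i hy, map_smul, tw_of_mem h i hy, smul_smul, sgn_sq, one_smul]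

lemma tw_mem (h : DirectSum.IsInternal gr) (i : ℤ) {n : ℤ} {x : X} (hx : x ∈ gr n) :
    tw h i x ∈ gr n := by
  rw [tw_of_mem h i hx]; exact Submodule.smul_mem _ _ hx

/-- The homogeneous elements of degree `n` of a tensor product. -/
def tgr {Y : Type u} [AddCommGroup Y] [Module k Y] (gX : ℤ → Submodule k X)
    (gY : ℤ → Submodule k Y) (n : ℤ) : Submodule k (X ⊗[k] Y) :=
  Submodule.span k {t | ∃ i j : ℤ, i + j = n ∧ ∃ x ∈ gX i, ∃ y ∈ gY j, x ⊗ₜ[k] y = t}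

lemma tmul_mem_tgr {Y : Type u} [AddCommGroup Y] [Module k Y] {gX : ℤ → Submodule k X}
    {gY : ℤ → Submodule k Y} {n i j : ℤ} (hn : i + j = n) {x : X} (hx : x ∈ gX i) {y : Y}
    (hy : y ∈ gY j) : x ⊗ₜ[k] y ∈ tgr gX gY n :=
  Submodule.subset_span ⟨i, j, hn, x, hx, y, hy, rfl⟩

/-- The Koszul swap `x ⊗ y ↦ (-1) ^ (|x| * |y|) y ⊗ x`. -/
def swap (h : DirectSum.IsInternal gr) : X ⊗[k] X →ₗ[k] X ⊗[k] X :=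
  TensorProduct.lift
    (byDeg h fun i => (LinearMap.lcomp k (X ⊗[k] X) (tw h i)) ∘ₗ (TensorProduct.mk k X X).flip)

lemma swap_tmul_left (h : DirectSum.IsInternal gr) {i : ℤ} {x : X} (hx : x ∈ gr i) (y : X) :
    swap h (x ⊗ₜ y) = tw h i y ⊗ₜ x := by
  simp [swap, byDeg_of_mem h _ hx]

lemma swap_tmul (h : DirectSum.IsInternal gr) {i j : ℤ} {x y : X} (hx : x ∈ gr i) (hy : y ∈ gr j) :
    swap h (x ⊗ₜ y) = sgn k (i * j) • (y ⊗ₜ[k] x) := by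
  rw [swap_tmul_left h hx, tw_of_mem h i hy, TensorProduct.smul_tmul']

lemma tensor_ext_gr {Y Z : Type u} [AddCommGroup Y] [Module k Y] [AddCommGroup Z] [Module k Z]
    {gY : ℤ → Submodule k Y} (h : DirectSum.IsInternal gr) (h' : DirectSum.IsInternal gY)
    {f g : X ⊗[k] Y →ₗ[k] Z}
    (H : ∀ i j, ∀ x ∈ gr i, ∀ y ∈ gY j, f (x ⊗ₜ y) = g (x ⊗ₜ y)) : f = g := by
  refine TensorProduct.ext (ext_gr h fun i x hx => ext_gr h' fun j y hy => ?_)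
  exact H i j x hx y hy

/-- The gradings of a submodule stable under the projections. -/
lemma sub_internal (h : DirectSum.IsInternal gr) (Y : Submodule k X)
    (hY : ∀ n, ∀ y ∈ Y, proj h n y ∈ Y) :
    DirectSum.IsInternal fun n => (gr n).comap Y.subtype := by
  refine isInternal_of_proj (fun n => (proj h n).restrict (hY n)) ?_ ?_ ?_
  · rintro n ⟨x, hx⟩ hxn
    exact Subtype.ext (proj_of_mem h hxn)
  · rintro m n ⟨x, hx⟩ hxn hne
    exact Subtype.ext (proj_of_ne h hxn hne)
  · intro x
    obtain ⟨s, hs, -⟩ := mem_iSup_proj h (x : X)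
    have : x = ∑ n ∈ s, (proj h n).restrict (hY n) x := by
      apply Subtype.ext
      rw [AddSubmonoidClass.coe_finsetSum]
      exact hs
    rw [this]
    exact Submodule.sum_mem _ fun n _ => Submodule.mem_iSup_of_mem n (proj_mem h n x)

lemma quot_internal (h : DirectSum.IsInternal gr) (N : Submodule k X)
    (hN : ∀ n, ∀ y ∈ N, proj h n y ∈ N) :
    DirectSum.IsInternal fun n => (gr n).map N.mkQ := by
  refine isInternal_of_proj (fun n => N.mapQ N (proj h n) (hN n)) ?_ ?_ ?_
  · rintro n _ ⟨x, hx, rfl⟩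
    simp [proj_of_mem h hx]
  · rintro m n _ ⟨x, hx, rfl⟩ hne
    simp [proj_of_ne h hx hne]
  · intro x
    obtain ⟨x, rfl⟩ := N.mkQ_surjective x
    refine hom_induction h (p := fun x => N.mkQ x ∈ ⨆ n, (gr n).map N.mkQ) x (fun n y hy => ?_)
      (fun y z hy hz => by rw [map_add]; exact add_mem hy hz)
    exact Submodule.mem_iSup_of_mem n (Submodule.mem_map_of_mem hy)

lemma shift_internal (h : DirectSum.IsInternal gr) (m : ℤ) :
    DirectSum.IsInternal fun n => gr (n + m) := by
  refine isInternal_of_proj (fun n => proj h (n + m)) (fun n x hx => proj_of_mem h hx)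
    (fun a n x hx hne => proj_of_ne h hx fun e => hne (by omega)) fun x => ?_
  refine hom_induction h (p := fun x => x ∈ ⨆ n, gr (n + m)) x (fun n y hy => ?_)
    (fun y z hy hz => add_mem hy hz)
  exact Submodule.mem_iSup_of_mem (n - m) (by simpa using hy)

/-- The grading of `M ⊗ X` with `M` in degree zero. -/
def lgr (M : Type u) [AddCommGroup M] [Module k M] (gr : ℤ → Submodule k X) (n : ℤ) :
    Submodule k (M ⊗[k] X) :=
  LinearMap.range ((gr n).subtype.lTensor M)

lemma tmul_mem_lgr {M : Type u} [AddCommGroup M] [Module k M] (m : M) {n : ℤ} {x : X}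
    (hx : x ∈ gr n) : m ⊗ₜ[k] x ∈ lgr M gr n :=
  ⟨m ⊗ₜ ⟨x, hx⟩, by simp⟩

lemma lgr_induction {M : Type u} [AddCommGroup M] [Module k M] {n : ℤ} {p : M ⊗[k] X → Prop}
    {t : M ⊗[k] X} (ht : t ∈ lgr M gr n) (zero : p 0) (tmul : ∀ m, ∀ x ∈ gr n, p (m ⊗ₜ x))
    (add : ∀ s t, p s → p t → p (s + t)) : p t := by
  obtain ⟨t, rfl⟩ := ht
  induction t with
  | zero => simpa using zero
  | tmul m x => simpa using tmul m x x.2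
  | add s t hs ht => rw [map_add]; exact add _ _ hs ht

lemma lgr_internal (h : DirectSum.IsInternal gr) (M : Type u) [AddCommGroup M] [Module k M] :
    DirectSum.IsInternal (lgr M gr) := by
  refine isInternal_of_proj (fun n => (proj h n).lTensor M) ?_ ?_ ?_
  · intro n t ht
    refine lgr_induction (p := fun t => (proj h n).lTensor M t = t) ht (map_zero _)
      (fun m x hx => ?_) (fun s t hs ht => by rw [map_add, hs, ht])
    simp [proj_of_mem h hx]
  · intro m n t ht hne
    refine lgr_induction (p := fun t => (proj h m).lTensor M t = 0) ht (map_zero _)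
      (fun m x hx => ?_) (fun s t hs ht => by rw [map_add, hs, ht, add_zero])
    simp [proj_of_ne h hx hne]
  · intro t
    induction t with
    | zero => exact zero_mem _
    | add s t hs ht => exact add_mem hs ht
    | tmul m x =>
      refine hom_induction h (p := fun x => m ⊗ₜ[k] x ∈ ⨆ n, lgr M gr n) x (fun n y hy => ?_)
        (fun y z hy hz => by rw [TensorProduct.tmul_add]; exact add_mem hy hz)
      exact Submodule.mem_iSup_of_mem n (tmul_mem_lgr m hy)

end Graded

/-! ### The categories of differential graded objects

All objects are `ℤ`-graded with differentials of degree `-1`. -/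

section Natural

variable {k : Type u} [Field k]
variable {X Y : Type u} [AddCommGroup X] [Module k X] [AddCommGroup Y] [Module k Y]
  {gX : ℤ → Submodule k X} {gY : ℤ → Submodule k Y}

lemma tw_map (hX : DirectSum.IsInternal gX) (hY : DirectSum.IsInternal gY) (e : ℤ)
    (f : X →ₗ[k] Y) (hf : ∀ n, ∀ x ∈ gX n, f x ∈ gY (n + e)) (i : ℤ) (x : X) :
    tw hY i (f x) = sgn k (i * e) • f (tw hX i x) := by
  refine hom_induction hX (p := fun x => tw hY i (f x) = sgn k (i * e) • f (tw hX i x)) x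
    (fun n y hy => ?_) (fun y z hy hz => by simp [hy, hz])
  rw [tw_of_mem hY i (hf n y hy), tw_of_mem hX i hy, map_smul, smul_smul, mul_add, sgn_add, mul_comm]

lemma tw_map_zero (hX : DirectSum.IsInternal gX) (hY : DirectSum.IsInternal gY)
    (f : X →ₗ[k] Y) (hf : ∀ n, ∀ x ∈ gX n, f x ∈ gY n) (i : ℤ) (x : X) :
    tw hY i (f x) = f (tw hX i x) := by
  rw [tw_map hX hY 0 f (by simpa using hf), mul_zero, sgn_zero, one_smul]

lemma tw_d (hX : DirectSum.IsInternal gX) (d : X →ₗ[k] X)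
    (hd : ∀ n, ∀ x ∈ gX n, d x ∈ gX (n - 1)) (x : X) : tw hX 1 (d x) = -d (tw hX 1 x) := by
  rw [tw_map hX hX (-1) d (by simpa [sub_eq_add_neg] using hd), one_mul, sgn_neg, sgn_one, neg_smul,
    one_smul]

lemma swap_map (hX : DirectSum.IsInternal gX) (hY : DirectSum.IsInternal gY)
    (f : X →ₗ[k] Y) (hf : ∀ n, ∀ x ∈ gX n, f x ∈ gY n) (t : X ⊗[k] X) :
    swap hY (TensorProduct.map f f t) = TensorProduct.map f f (swap hX t) := by
  have : swap hY ∘ₗ TensorProduct.map f f = TensorProduct.map f f ∘ₗ swap hX := by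
    refine tensor_ext_gr hX hX fun i j x hx y hy => ?_
    simp [swap_tmul hX hx hy, swap_tmul hY (hf i x hx) (hf j y hy)]
  exact LinearMap.congr_fun this t

lemma tgr_map {X' Y' : Type u} [AddCommGroup X'] [Module k X'] [AddCommGroup Y'] [Module k Y']
    {gX' : ℤ → Submodule k X'} {gY' : ℤ → Submodule k Y'} (f : X →ₗ[k] X') (g : Y →ₗ[k] Y')
    (hf : ∀ n, ∀ x ∈ gX n, f x ∈ gX' n) (hg : ∀ n, ∀ x ∈ gY n, g x ∈ gY' n) {n : ℤ} {t : X ⊗[k] Y}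
    (ht : t ∈ tgr gX gY n) : TensorProduct.map f g t ∈ tgr gX' gY' n := by
  suffices h : tgr gX gY n ≤ (tgr gX' gY' n).comap (TensorProduct.map f g) from h ht
  refine Submodule.span_le.2 ?_
  rintro _ ⟨i, j, hij, x, hx, y, hy, rfl⟩
  exact tmul_mem_tgr hij (hf i x hx) (hg j y hy)

end Natural

/-- Differential graded Lie algebras over `k`. -/
structure DGLA (k : Type u) [Field k] : Type (u + 1) where
  X : Type u
  [grp : AddCommGroup X]
  [mod : Module k X]
  gr : ℤ → Submodule k X
  internal : DirectSum.IsInternal gr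
  d : X →ₗ[k] X
  d_mem : ∀ n, ∀ x ∈ gr n, d x ∈ gr (n - 1)
  d_sq : ∀ x, d (d x) = 0
  br : X →ₗ[k] X →ₗ[k] X
  br_mem : ∀ i j, ∀ x ∈ gr i, ∀ y ∈ gr j, br x y ∈ gr (i + j)
  br_skew : ∀ i j, ∀ x ∈ gr i, ∀ y ∈ gr j, br x y = -sgn k (i * j) • br y x
  br_jacobi : ∀ i j l, ∀ x ∈ gr i, ∀ y ∈ gr j, ∀ z ∈ gr l,
    br x (br y z) = br (br x y) z + sgn k (i * j) • br y (br x z)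
  br_leibniz : ∀ i j, ∀ x ∈ gr i, ∀ y ∈ gr j, d (br x y) = br (d x) y + sgn k i • br x (d y)

attribute [instance] DGLA.grp DGLA.mod

/-- Augmented (unital) graded commutative differential graded algebras over `k`. -/
structure ADGCA (k : Type u) [Field k] : Type (u + 1) where
  X : Type u
  [ring : Ring X]
  [alg : Algebra k X]
  gr : ℤ → Submodule k X
  internal : DirectSum.IsInternal gr
  one_mem : (1 : X) ∈ gr 0
  mul_mem : ∀ i j, ∀ x ∈ gr i, ∀ y ∈ gr j, x * y ∈ gr (i + j)
  mul_comm : ∀ i j, ∀ x ∈ gr i, ∀ y ∈ gr j, x * y = sgn k (i * j) • (y * x)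
  d : X →ₗ[k] X
  d_mem : ∀ n, ∀ x ∈ gr n, d x ∈ gr (n - 1)
  d_sq : ∀ x, d (d x) = 0
  d_leibniz : ∀ i, ∀ x ∈ gr i, ∀ y, d (x * y) = d x * y + sgn k i • (x * d y)
  aug : X →ₐ[k] k
  aug_d : ∀ x, aug (d x) = 0
  aug_gr : ∀ n, n ≠ 0 → ∀ x ∈ gr n, aug x = 0

attribute [instance] ADGCA.ring ADGCA.alg

/-- Graded commutative differential graded algebras over `k`, not assumed to have a unit. -/
structure NDGCA (k : Type u) [Field k] : Type (u + 1) where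
  X : Type u
  [grp : AddCommGroup X]
  [mod : Module k X]
  gr : ℤ → Submodule k X
  internal : DirectSum.IsInternal gr
  mul : X →ₗ[k] X →ₗ[k] X
  mul_assoc : ∀ x y z, mul (mul x y) z = mul x (mul y z)
  mul_mem : ∀ i j, ∀ x ∈ gr i, ∀ y ∈ gr j, mul x y ∈ gr (i + j)
  mul_comm : ∀ i j, ∀ x ∈ gr i, ∀ y ∈ gr j, mul x y = sgn k (i * j) • mul y x
  d : X →ₗ[k] X
  d_mem : ∀ n, ∀ x ∈ gr n, d x ∈ gr (n - 1)
  d_sq : ∀ x, d (d x) = 0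
  d_leibniz : ∀ i, ∀ x ∈ gr i, ∀ y, d (mul x y) = mul (d x) y + sgn k i • mul x (d y)

attribute [instance] NDGCA.grp NDGCA.mod

/-- Cocommutative coassociative differential graded coalgebras over `k`, not assumed to have a
counit. -/
structure NDGCC (k : Type u) [Field k] : Type (u + 1) where
  X : Type u
  [grp : AddCommGroup X]
  [mod : Module k X]
  gr : ℤ → Submodule k X
  internal : DirectSum.IsInternal gr
  d : X →ₗ[k] X
  d_mem : ∀ n, ∀ x ∈ gr n, d x ∈ gr (n - 1)
  d_sq : ∀ x, d (d x) = 0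
  comul : X →ₗ[k] X ⊗[k] X
  comul_mem : ∀ n, ∀ x ∈ gr n, comul x ∈ tgr gr gr n
  coassoc : ∀ x, TensorProduct.assoc k X X X (comul.rTensor X (comul x)) =
    comul.lTensor X (comul x)
  cocomm : ∀ x, swap internal (comul x) = comul x
  comul_d : ∀ x, comul (d x) =
    TensorProduct.map d LinearMap.id (comul x) + TensorProduct.map (tw internal 1) d (comul x)

attribute [instance] NDGCC.grp NDGCC.mod

/-- Coaugmented (counital) cocommutative differential graded coalgebras over `k`; the
coaugmentation is given by the group-like element `one`. -/
structure DGCC (k : Type u) [Field k] : Type (u + 1) where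
  X : Type u
  [grp : AddCommGroup X]
  [mod : Module k X]
  [coalg : Coalgebra k X]
  gr : ℤ → Submodule k X
  internal : DirectSum.IsInternal gr
  d : X →ₗ[k] X
  d_mem : ∀ n, ∀ x ∈ gr n, d x ∈ gr (n - 1)
  d_sq : ∀ x, d (d x) = 0
  comul_mem : ∀ n, ∀ x ∈ gr n, Coalgebra.comul (R := k) x ∈ tgr gr gr n
  cocomm : ∀ x, swap internal (Coalgebra.comul x) = Coalgebra.comul (R := k) x
  comul_d : ∀ x, Coalgebra.comul (d x) =
    TensorProduct.map d LinearMap.id (Coalgebra.comul x) +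
      TensorProduct.map (tw internal 1) d (Coalgebra.comul (R := k) x)
  counit_gr : ∀ n, n ≠ 0 → ∀ x ∈ gr n, Coalgebra.counit (R := k) x = 0
  counit_d : ∀ x, Coalgebra.counit (R := k) (d x) = 0
  one : X
  one_mem : one ∈ gr 0
  d_one : d one = 0
  comul_one : Coalgebra.comul (R := k) one = one ⊗ₜ one
  counit_one : Coalgebra.counit (R := k) one = 1

attribute [instance] DGCC.grp DGCC.mod DGCC.coalg

/-- The cyclic permutation `x ⊗ y ⊗ z ↦ ± z ⊗ x ⊗ y`, with the Koszul sign. -/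
def cyc {k : Type u} [Field k] {X : Type u} [AddCommGroup X] [Module k X]
    {gr : ℤ → Submodule k X} (h : DirectSum.IsInternal gr) :
    (X ⊗[k] X) ⊗[k] X →ₗ[k] (X ⊗[k] X) ⊗[k] X :=
  (swap h).rTensor X ∘ₗ (TensorProduct.assoc k X X X).symm.toLinearMap ∘ₗ
    (swap h).lTensor X ∘ₗ (TensorProduct.assoc k X X X).toLinearMap

/-- Differential graded Lie coalgebras over `k`. The cobracket takes values in the graded
antisymmetric tensors, and satisfies the co-Jacobi identity. -/
structure DGLC (k : Type u) [Field k] : Type (u + 1) where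
  X : Type u
  [grp : AddCommGroup X]
  [mod : Module k X]
  gr : ℤ → Submodule k X
  internal : DirectSum.IsInternal gr
  d : X →ₗ[k] X
  d_mem : ∀ n, ∀ x ∈ gr n, d x ∈ gr (n - 1)
  d_sq : ∀ x, d (d x) = 0
  cobr : X →ₗ[k] X ⊗[k] X
  cobr_mem : ∀ n, ∀ x ∈ gr n, cobr x ∈ tgr gr gr n
  cobr_skew : ∀ x, swap internal (cobr x) = -cobr x
  cobr_jacobi : ∀ x, cobr.rTensor X (cobr x) + cyc internal (cobr.rTensor X (cobr x)) +
    cyc internal (cyc internal (cobr.rTensor X (cobr x))) = 0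
  cobr_d : ∀ x, cobr (d x) =
    TensorProduct.map d LinearMap.id (cobr x) + TensorProduct.map (tw internal 1) d (cobr x)

attribute [instance] DGLC.grp DGLC.mod

section Coalgebras

variable {k : Type u} [Field k]

/-- Forget the counit and the coaugmentation. -/
def DGCC.toN (C : DGCC k) : NDGCC k where
  X := C.X
  gr := C.gr
  internal := C.internal
  d := C.d
  d_mem := C.d_mem
  d_sq := C.d_sq
  comul := Coalgebra.comul
  comul_mem := C.comul_mem
  coassoc x := Coalgebra.coassoc_apply x
  cocomm := C.cocomm
  comul_d := C.comul_d

lemma DGCC.proj_span_one (C : DGCC k) (n : ℤ) (x : C.X) (hx : x ∈ k ∙ C.one) :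
    proj C.internal n x ∈ k ∙ C.one := by
  obtain ⟨a, rfl⟩ := Submodule.mem_span_singleton.1 hx
  rw [map_smul]
  by_cases hn : 0 = n
  · subst hn
    rw [proj_of_mem C.internal C.one_mem]
    exact hx
  · rw [proj_of_ne C.internal C.one_mem hn, smul_zero]
    exact zero_mem _

/-- The cokernel `C̄ = C / k` of the coaugmentation. -/
abbrev DGCC.Bar (C : DGCC k) : Type u := C.X ⧸ (k ∙ C.one)

/-- The canonical map `C → C̄`. -/
def DGCC.toBar (C : DGCC k) : C.X →ₗ[k] C.Bar := (k ∙ C.one).mkQ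

lemma DGCC.toBar_surj (C : DGCC k) : Function.Surjective C.toBar := Submodule.mkQ_surjective _

lemma DGCC.toBar_one (C : DGCC k) : C.toBar C.one = 0 := by
  simp [DGCC.toBar, Submodule.mem_span_singleton_self]

/-- The grading of `C̄`. -/
def DGCC.barGr (C : DGCC k) (n : ℤ) : Submodule k C.Bar := (C.gr n).map C.toBar

lemma DGCC.toBar_mem (C : DGCC k) : ∀ n, ∀ x ∈ C.gr n, C.toBar x ∈ C.barGr n :=
  fun _ _ hx => Submodule.mem_map_of_mem hx

lemma DGCC.bar_internal (C : DGCC k) : DirectSum.IsInternal C.barGr :=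
  quot_internal C.internal _ C.proj_span_one

/-- The differential of `C̄`. -/
def DGCC.barD (C : DGCC k) : C.Bar →ₗ[k] C.Bar :=
  Submodule.mapQ _ _ C.d (by
    rw [Submodule.span_singleton_le_iff_mem, Submodule.mem_comap, C.d_one]
    exact zero_mem _)

lemma DGCC.barD_toBar (C : DGCC k) (x : C.X) : C.barD (C.toBar x) = C.toBar (C.d x) := rfl

/-- The reduced coproduct `C̄ → C̄ ⊗ C̄`. -/
def DGCC.barComul (C : DGCC k) : C.Bar →ₗ[k] C.Bar ⊗[k] C.Bar :=
  Submodule.liftQ _ (TensorProduct.map C.toBar C.toBar ∘ₗ Coalgebra.comul) (by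
    rw [Submodule.span_singleton_le_iff_mem, LinearMap.mem_ker, LinearMap.comp_apply, C.comul_one,
      TensorProduct.map_tmul, C.toBar_one, TensorProduct.zero_tmul])

lemma DGCC.barComul_toBar (C : DGCC k) (x : C.X) :
    C.barComul (C.toBar x) = TensorProduct.map C.toBar C.toBar (Coalgebra.comul x) := rfl

/-- The reduced coalgebra `C̄`. -/
def DGCC.reduced (C : DGCC k) : NDGCC k where
  X := C.Bar
  gr := C.barGr
  internal := C.bar_internal
  d := C.barD
  d_mem := by
    rintro n _ ⟨x, hx, rfl⟩
    exact C.toBar_mem _ _ (C.d_mem n x hx)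
  d_sq := by
    intro x
    obtain ⟨x, rfl⟩ := C.toBar_surj x
    rw [C.barD_toBar, C.barD_toBar, C.d_sq, map_zero]
  comul := C.barComul
  comul_mem := by
    rintro n _ ⟨x, hx, rfl⟩
    rw [C.barComul_toBar]
    exact tgr_map C.toBar C.toBar C.toBar_mem C.toBar_mem (C.comul_mem n x hx)
  coassoc := by
    intro x
    obtain ⟨x, rfl⟩ := C.toBar_surj x
    have h := congrArg (TensorProduct.map C.toBar (TensorProduct.map C.toBar C.toBar))
      (Coalgebra.coassoc_apply (R := k) x)
    rw [C.barComul_toBar]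
    have h1 : ∀ t : C.X ⊗[k] C.X,
        TensorProduct.assoc k _ _ _ (C.barComul.rTensor _ (TensorProduct.map C.toBar C.toBar t)) =
        TensorProduct.map C.toBar (TensorProduct.map C.toBar C.toBar)
          (TensorProduct.assoc k _ _ _ ((Coalgebra.comul (R := k)).rTensor _ t)) := by
      intro t
      induction t with
      | zero => simp
      | add s t hs ht => simp only [map_add, hs, ht]
      | tmul x y =>
        simp only [TensorProduct.map_tmul, LinearMap.rTensor_tmul, C.barComul_toBar]
        induction (Coalgebra.comul (R := k) x) with
        | zero => simp
        | add s t hs ht => simp only [map_add, TensorProduct.add_tmul, hs, ht]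
        | tmul a b => simp
    have h2 : ∀ t : C.X ⊗[k] C.X,
        C.barComul.lTensor _ (TensorProduct.map C.toBar C.toBar t) =
        TensorProduct.map C.toBar (TensorProduct.map C.toBar C.toBar)
          ((Coalgebra.comul (R := k)).lTensor _ t) := by
      intro t
      induction t with
      | zero => simp
      | add s t hs ht => simp only [map_add, hs, ht]
      | tmul x y => simp only [TensorProduct.map_tmul, LinearMap.lTensor_tmul, C.barComul_toBar]
    rw [h1, h2, h]
  cocomm := by
    intro x
    obtain ⟨x, rfl⟩ := C.toBar_surj x
    rw [C.barComul_toBar, swap_map C.internal C.bar_internal C.toBar C.toBar_mem, C.cocomm]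
  comul_d := by
    intro x
    obtain ⟨x, rfl⟩ := C.toBar_surj x
    rw [C.barD_toBar, C.barComul_toBar, C.barComul_toBar, C.comul_d, map_add]
    congr 1
    · induction (Coalgebra.comul (R := k) x) with
      | zero => simp
      | add s t hs ht => simp only [map_add, hs, ht]
      | tmul a b => simp [C.barD_toBar]
    · induction (Coalgebra.comul (R := k) x) with
      | zero => simp
      | add s t hs ht => simp only [map_add, hs, ht]
      | tmul a b =>
        simp [C.barD_toBar, tw_map_zero C.internal C.bar_internal C.toBar C.toBar_mem]

/-- The iterated coproducts `X → X^{⊗ (n + 1)}`, where the tensor powers of `X` are regarded as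
subspaces of the tensor algebra. -/
def NDGCC.iter (D : NDGCC k) : ℕ → D.X →ₗ[k] TensorAlgebra k D.X
  | 0 => TensorAlgebra.ι k
  | n + 1 => LinearMap.mul' k _ ∘ₗ TensorProduct.map (TensorAlgebra.ι k) (D.iter n) ∘ₗ D.comul

/-- Conilpotency: every element of `C̄` is killed by some iterated reduced coproduct. -/
def DGCC.Conilpotent (C : DGCC k) : Prop :=
  ∀ x, ∃ n, C.reduced.iter n x = 0

end Coalgebras

/-! ### Graded algebras given by generators -/

section Gen

variable {k : Type u} [Field k]
variable {V : Type u} [AddCommGroup V] [Module k V] {A : Type u} [Ring A] [Algebra k A]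

/-- `IsMono gV ι n a` says that `a` is a product of homogeneous generators, of total degree `n`. -/
inductive IsMono (gV : ℤ → Submodule k V) (ι : V →ₗ[k] A) : ℤ → A → Prop
  | one : IsMono gV ι 0 1
  | cons {i j n : ℤ} {v : V} {a : A} (hn : i + j = n) (hv : v ∈ gV i) (ha : IsMono gV ι j a) :
      IsMono gV ι n (ι v * a)

/-- The grading of an algebra generated by a graded vector space: the component of degree `n` is
spanned by the monomials of degree `n` in homogeneous generators. -/
def monoGr (gV : ℤ → Submodule k V) (ι : V →ₗ[k] A) (n : ℤ) : Submodule k A :=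
  Submodule.span k {a | IsMono gV ι n a}

variable {gV : ℤ → Submodule k V} {ι : V →ₗ[k] A}

lemma IsMono.mem {n : ℤ} {a : A} (h : IsMono gV ι n a) : a ∈ monoGr gV ι n :=
  Submodule.subset_span h

lemma IsMono.mul {i j : ℤ} {a b : A} (ha : IsMono gV ι i a) (hb : IsMono gV ι j b) :
    IsMono gV ι (i + j) (a * b) := by
  induction ha with
  | one => simpa using hb
  | cons hn hv _ ih =>
    rw [mul_assoc]
    exact IsMono.cons (by omega) hv ih

lemma monoGr_one : (1 : A) ∈ monoGr gV ι 0 := IsMono.one.mem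

lemma monoGr_ι {n : ℤ} {v : V} (hv : v ∈ gV n) : ι v ∈ monoGr gV ι n := by
  have := (IsMono.cons (ι := ι) (add_zero n) hv IsMono.one).mem
  rwa [mul_one] at this

/-- Bilinear statements about homogeneous elements may be checked on monomials. -/
lemma monoGr_induction {n : ℤ} {p : A → Prop} {a : A} (ha : a ∈ monoGr gV ι n)
    (mono : ∀ b, IsMono gV ι n b → p b) (zero : p 0) (add : ∀ b c, p b → p c → p (b + c))
    (smul : ∀ (r : k) b, p b → p (r • b)) : p a :=
  Submodule.span_induction (p := fun a _ => p a) (fun b hb => mono b hb) zero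
    (fun b c _ _ => add b c) (fun r b _ => smul r b) ha

lemma monoGr_mul {i j : ℤ} {a b : A} (ha : a ∈ monoGr gV ι i) (hb : b ∈ monoGr gV ι j) :
    a * b ∈ monoGr gV ι (i + j) := by
  refine monoGr_induction (p := fun a => a * b ∈ _) ha (fun a ha => ?_) (by simp)
    (fun a a' h h' => by rw [add_mul]; exact add_mem h h')
    (fun r a h => by rw [smul_mul_assoc]; exact Submodule.smul_mem _ _ h)
  exact monoGr_induction (p := fun b => a * b ∈ _) hb (fun b hb => (ha.mul hb).mem) (by simp)
    (fun a a' h h' => by rw [mul_add]; exact add_mem h h')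
    (fun r a h => by rw [mul_smul_comm]; exact Submodule.smul_mem _ _ h)

lemma gen_induction (hgen : Algebra.adjoin k (Set.range ι) = ⊤) {p : A → Prop} (a : A)
    (gen : ∀ v, p (ι v)) (scalar : ∀ r, p (algebraMap k A r))
    (add : ∀ a b, p a → p b → p (a + b)) (mul : ∀ a b, p a → p b → p (a * b)) : p a := by
  have ha : a ∈ Algebra.adjoin k (Set.range ι) := by rw [hgen]; trivial
  induction ha using Algebra.adjoin_induction with
  | mem x hx => obtain ⟨v, rfl⟩ := hx; exact gen v
  | algebraMap r => exact scalar r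
  | add x y _ _ hx hy => exact add x y hx hy
  | mul x y _ _ hx hy => exact mul x y hx hy

variable (gV ι) in
/-- The algebra `A` is generated by the graded vector space `V`, and carries the grading for which
`V` is homogeneous (expressed by an action of the multiplicative group). -/
structure IsGen : Prop where
  internal : DirectSum.IsInternal gV
  gen : Algebra.adjoin k (Set.range ι) = ⊤
  coact : ∃ ρ : A →ₐ[k] AddMonoidAlgebra A ℤ, ∀ i, ∀ v ∈ gV i,
    ρ (ι v) = AddMonoidAlgebra.single i (ι v)

lemma IsGen.grInternal (h : IsGen gV ι) : DirectSum.IsInternal (monoGr gV ι) := by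
  obtain ⟨ρ, hρ⟩ := h.coact
  have key : ∀ n, ∀ a ∈ monoGr gV ι n, ρ a = AddMonoidAlgebra.single n a := by
    intro n a hmem
    refine monoGr_induction (p := fun a => ρ a = AddMonoidAlgebra.single n a) hmem (fun a ha => ?_)
      (by simp) (fun a b ha hb => by rw [map_add, ha, hb, AddMonoidAlgebra.single_add])
      (fun r a ha => by rw [map_smul, ha, AddMonoidAlgebra.smul_single])
    clear hmem
    induction ha with
    | one => rw [map_one]; rfl
    | cons hn hv _ ih =>
      rw [map_mul, hρ _ _ hv, ih, AddMonoidAlgebra.single_mul_single, hn]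
  let c : ℤ → AddMonoidAlgebra A ℤ →ₗ[k] A := fun n =>
    { toFun := fun x => x.coeff n
      map_add' := fun x y => by simp
      map_smul' := fun r x => by simp }
  refine isInternal_of_proj (fun n => c n ∘ₗ ρ.toLinearMap) ?_ ?_ ?_
  · intro n a ha
    change (ρ a).coeff n = a
    rw [key n a ha, AddMonoidAlgebra.coeff_single, Finsupp.single_eq_same]
  · intro m n a ha hne
    change (ρ a).coeff m = 0
    rw [key n a ha, AddMonoidAlgebra.coeff_single, Finsupp.single_eq_of_ne' hne]
  · intro a
    refine gen_induction h.gen (p := fun a => a ∈ ⨆ n, monoGr gV ι n) a (fun v => ?_) (fun r => ?_)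
      (fun a b ha hb => add_mem ha hb) (fun a b ha hb => ?_)
    · exact hom_induction h.internal (p := fun v => ι v ∈ ⨆ n, monoGr gV ι n) v
        (fun n v hv => Submodule.mem_iSup_of_mem n (monoGr_ι hv))
        (fun v w hv hw => by rw [map_add]; exact add_mem hv hw)
    · rw [Algebra.algebraMap_eq_smul_one]
      exact Submodule.smul_mem _ _ (Submodule.mem_iSup_of_mem 0 monoGr_one)
    · refine Submodule.iSup_induction _ (motive := fun a => a * b ∈ ⨆ n, monoGr gV ι n) ha
        (fun i a ha => ?_) (by simp) (fun a a' h h' => by rw [add_mul]; exact add_mem h h')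
      refine Submodule.iSup_induction _ (motive := fun b => a * b ∈ ⨆ n, monoGr gV ι n) hb
        (fun j b hb => ?_) (by simp) (fun a a' h h' => by rw [mul_add]; exact add_mem h h')
      exact Submodule.mem_iSup_of_mem (i + j) (monoGr_mul ha hb)

lemma mono_comm (hc : ∀ i j, ∀ v ∈ gV i, ∀ w ∈ gV j, ι v * ι w = sgn k (i * j) • (ι w * ι v))
    {i j : ℤ} {a b : A} (ha : a ∈ monoGr gV ι i) (hb : b ∈ monoGr gV ι j) :
    a * b = sgn k (i * j) • (b * a) := by
  have h1 : ∀ {i j : ℤ} {v : V} {b : A}, v ∈ gV i → IsMono gV ι j b →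
      ι v * b = sgn k (i * j) • (b * ι v) := by
    intro i j v b hv hb
    induction hb with
    | one => simp [sgn_zero]
    | @cons p q n w b hn hw hb ih =>
      rw [← mul_assoc, hc _ _ v hv w hw, smul_mul_assoc, mul_assoc, ih, mul_smul_comm, smul_smul,
        ← sgn_add, ← mul_add, hn, mul_assoc]
  have h2 : ∀ {i j : ℤ} {a b : A}, IsMono gV ι i a → IsMono gV ι j b →
      a * b = sgn k (i * j) • (b * a) := by
    intro i j a b ha hb
    induction ha with
    | one => simp [sgn_zero]
    | @cons p q n w a hn hw ha ih =>
      rw [mul_assoc, ih, mul_smul_comm, ← mul_assoc, h1 hw hb, smul_mul_assoc, smul_smul, ← sgn_add,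
        ← add_mul, add_comm, hn, mul_assoc]
  refine monoGr_induction (p := fun a => a * b = sgn k (i * j) • (b * a)) ha (fun a ha => ?_)
    (by simp) (fun a a' h h' => by rw [add_mul, mul_add, smul_add, h, h'])
    (fun r a h => by rw [smul_mul_assoc, mul_smul_comm, h, smul_comm])
  exact monoGr_induction (p := fun b => a * b = sgn k (i * j) • (b * a)) hb (fun b hb => h2 ha hb)
    (by simp) (fun a a' h h' => by rw [add_mul, mul_add, smul_add, h, h'])
    (fun r a h => by rw [smul_mul_assoc, mul_smul_comm, h, smul_comm])

lemma tw_mul {gA : ℤ → Submodule k A} (hA : DirectSum.IsInternal gA)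
    (hm : ∀ i j, ∀ x ∈ gA i, ∀ y ∈ gA j, x * y ∈ gA (i + j)) (e : ℤ) (a b : A) :
    tw hA e (a * b) = tw hA e a * tw hA e b := by
  refine hom_induction hA (p := fun a => tw hA e (a * b) = tw hA e a * tw hA e b) a
    (fun i a ha => ?_) (fun a a' h h' => by rw [add_mul, map_add, h, h', map_add, add_mul])
  refine hom_induction hA (p := fun b => tw hA e (a * b) = tw hA e a * tw hA e b) b
    (fun j b hb => ?_) (fun a a' h h' => by rw [mul_add, map_add, h, h', map_add, mul_add])
  rw [tw_of_mem hA e ha, tw_of_mem hA e hb, tw_of_mem hA e (hm i j a ha b hb), smul_mul_smul_comm,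
    ← sgn_add, mul_add]

/-- `D` is a graded derivation; `e` is the parity of its degree. -/
def IsDer {gA : ℤ → Submodule k A} (hA : DirectSum.IsInternal gA) (e : ℤ) (D : A →ₗ[k] A) : Prop :=
  ∀ a b, D (a * b) = D a * b + tw hA e a * D b

lemma IsDer.map_one {gA : ℤ → Submodule k A} {hA : DirectSum.IsInternal gA} {e : ℤ} {D : A →ₗ[k] A}
    (hD : IsDer hA e D) (h1 : (1 : A) ∈ gA 0) : D 1 = 0 := by
  have := hD 1 1
  rw [tw_of_mem hA e h1, mul_zero, sgn_zero, one_smul, one_mul, mul_one] at this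
  simpa using this

/-- The matrix `(a₀₀, δ; 0, a)` from which a graded derivation is read off. -/
def derMat (a₀ b a : A) : Matrix (Fin 2) (Fin 2) A := !![a₀, b; 0, a]

/-- The upper right entry of an algebra homomorphism to two by two matrices. -/
def derOf (Φ : A →ₐ[k] Matrix (Fin 2) (Fin 2) A) : A →ₗ[k] A where
  toFun a := Φ a 0 1
  map_add' a b := by simp
  map_smul' r a := by simp

lemma derOf_apply (Φ : A →ₐ[k] Matrix (Fin 2) (Fin 2) A) (a : A) : derOf Φ a = Φ a 0 1 := rfl

lemma derOf_spec (h : IsGen gV ι) (e : ℤ) (δ : V →ₗ[k] A) (Φ : A →ₐ[k] Matrix (Fin 2) (Fin 2) A)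
    (hΦ : ∀ v, Φ (ι v) = derMat (tw h.grInternal e (ι v)) (δ v) (ι v)) :
    IsDer h.grInternal e (derOf Φ) ∧ ∀ v, derOf Φ (ι v) = δ v := by
  have key : ∀ a, Φ a 0 0 = tw h.grInternal e a ∧ Φ a 1 0 = 0 ∧ Φ a 1 1 = a := by
    intro a
    refine gen_induction h.gen (p := fun a => Φ a 0 0 = tw h.grInternal e a ∧ Φ a 1 0 = 0 ∧
      Φ a 1 1 = a) a (fun v => ?_) (fun r => ?_) (fun a b ha hb => ?_) (fun a b ha hb => ?_)
    · simp [hΦ, derMat]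
    · rw [AlgHomClass.commutes, Algebra.algebraMap_eq_smul_one, Algebra.algebraMap_eq_smul_one,
        map_smul, tw_of_mem h.grInternal e monoGr_one]
      simp [sgn_zero]
    · simp [ha, hb]
    · simp [ha, hb, Matrix.mul_apply, tw_mul h.grInternal fun i j x hx y hy => monoGr_mul hx hy]
  refine ⟨fun a b => ?_, fun v => ?_⟩
  · simp [derOf_apply, Matrix.mul_apply, key, add_comm]
  · simp [derOf_apply, hΦ, derMat]

variable {hA : DirectSum.IsInternal (monoGr gV ι)}

lemma IsDer.mem {e m : ℤ} {D : A →ₗ[k] A} (hD : IsDer hA e D)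
    (hδ : ∀ n, ∀ v ∈ gV n, D (ι v) ∈ monoGr gV ι (n + m)) :
    ∀ n, ∀ a ∈ monoGr gV ι n, D a ∈ monoGr gV ι (n + m) := by
  intro n a hmem
  refine monoGr_induction (p := fun a => D a ∈ monoGr gV ι (n + m)) hmem (fun a ha => ?_) (by simp)
    (fun b c hb hc => by rw [map_add]; exact add_mem hb hc)
    (fun r b hb => by rw [map_smul]; exact Submodule.smul_mem _ _ hb)
  clear hmem
  induction ha with
  | one => rw [hD.map_one monoGr_one]; exact zero_mem _
  | @cons i j n v a hn hv ha ih =>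
    rw [hD]
    refine add_mem ?_ ?_
    · have := monoGr_mul (hδ i v hv) ha.mem
      rwa [show i + m + j = n + m by omega] at this
    · have := monoGr_mul (tw_mem hA e (monoGr_ι hv)) ih
      rwa [show i + (j + m) = n + m by omega] at this

lemma IsDer.sq_zero {D : A →ₗ[k] A} (hgen : Algebra.adjoin k (Set.range ι) = ⊤) (hD : IsDer hA 1 D)
    (hm : ∀ n, ∀ a ∈ monoGr gV ι n, D a ∈ monoGr gV ι (n - 1)) (h0 : ∀ v, D (D (ι v)) = 0) (a : A) :
    D (D a) = 0 := by
  refine gen_induction hgen (p := fun a => D (D a) = 0) a h0 (fun r => ?_)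
    (fun a b ha hb => by simp [ha, hb]) (fun a b ha hb => ?_)
  · rw [Algebra.algebraMap_eq_smul_one, map_smul, hD.map_one monoGr_one, smul_zero, map_zero]
  · rw [hD, map_add, hD, hD, ha, hb, tw_d hA D hm]
    simp

lemma IsDer.comm {D E : A →ₗ[k] A} (hgen : Algebra.adjoin k (Set.range ι) = ⊤) (hD : IsDer hA 1 D)
    (hE : IsDer hA 0 E) (hm : ∀ n, ∀ a ∈ monoGr gV ι n, E a ∈ monoGr gV ι n)
    (h0 : ∀ v, D (E (ι v)) = E (D (ι v))) (a : A) : D (E a) = E (D a) := by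
  refine gen_induction hgen (p := fun a => D (E a) = E (D a)) a h0 (fun r => ?_)
    (fun a b ha hb => by simp [ha, hb]) (fun a b ha hb => ?_)
  · simp [Algebra.algebraMap_eq_smul_one, hD.map_one monoGr_one, hE.map_one monoGr_one]
  · have ht : ∀ x, tw hA 0 x = x := fun x => by rw [tw_zero]; rfl
    have hEt : ∀ x, tw hA 1 (E x) = E (tw hA 1 x) := tw_map_zero hA hA E hm 1
    simp only [hD _ _, hE _ _, ht, map_add, ha, hb, hEt]
    abel

/-- The augmented commutative differential graded algebra generated by `V`, with differential `D`
and with the augmentation `ε` vanishing on generators. -/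
def ADGCA.ofGen (h : IsGen gV ι)
    (hc : ∀ i j, ∀ v ∈ gV i, ∀ w ∈ gV j, ι v * ι w = sgn k (i * j) • (ι w * ι v))
    (D : A →ₗ[k] A) (hD : IsDer h.grInternal 1 D)
    (hδ : ∀ n, ∀ v ∈ gV n, D (ι v) ∈ monoGr gV ι (n - 1)) (h0 : ∀ v, D (D (ι v)) = 0)
    (ε : A →ₐ[k] k) (hε : ∀ v, ε (ι v) = 0) (hεd : ∀ v, ε (D (ι v)) = 0) : ADGCA k where
  X := A
  gr := monoGr gV ι
  internal := h.grInternal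
  one_mem := monoGr_one
  mul_mem _ _ _ hx _ hy := monoGr_mul hx hy
  mul_comm _ _ _ hx _ hy := mono_comm hc hx hy
  d := D
  d_mem := by
    simpa [sub_eq_add_neg] using hD.mem (m := -1) (by simpa [sub_eq_add_neg] using hδ)
  d_sq := hD.sq_zero h.gen (by
    simpa [sub_eq_add_neg] using hD.mem (m := -1) (by simpa [sub_eq_add_neg] using hδ)) h0
  d_leibniz i x hx y := by rw [hD, tw_one_of_mem h.grInternal hx, smul_mul_assoc]
  aug := ε
  aug_d x := by
    have : ∀ n, ∀ x ∈ monoGr gV ι n, ε (D x) = 0 := by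
      intro n x hx
      refine monoGr_induction (p := fun x => ε (D x) = 0) hx (fun x hx => ?_) (by simp)
        (fun b c hb hc => by simp [hb, hc]) (fun r b hb => by simp [hb])
      cases hx with
      | one => rw [hD.map_one monoGr_one, map_zero]
      | cons hn hv ha =>
        rw [hD, map_add, map_mul, map_mul, hεd, tw_one_of_mem h.grInternal (monoGr_ι hv), map_smul,
          hε]
        simp
    exact hom_induction h.grInternal (p := fun x => ε (D x) = 0) x this
      (fun y z hy hz => by simp [hy, hz])
  aug_gr n hn x hx := by
    refine monoGr_induction (p := fun x => ε x = 0) hx (fun x hx => ?_) (by simp)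
      (fun b c hb hc => by simp [hb, hc]) (fun r b hb => by simp [hb])
    cases hx with
    | one => exact absurd rfl hn
    | cons hn hv ha => rw [map_mul, hε, zero_mul]

end Gen

/-! ### Morphisms, quasi-isomorphisms, homotopy categories and homology -/

section Cat

variable {k : Type u} [Field k]

/-- Morphisms of differential graded Lie algebras. -/
@[ext] structure DGLA.Hom (L M : DGLA k) : Type u where
  f : L.X →ₗ[k] M.X
  map_gr : ∀ n, ∀ x ∈ L.gr n, f x ∈ M.gr n
  map_d : ∀ x, f (L.d x) = M.d (f x)
  map_br : ∀ x y, f (L.br x y) = M.br (f x) (f y)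

instance : Category (DGLA k) where
  Hom L M := DGLA.Hom L M
  id L := ⟨LinearMap.id, fun _ _ h => h, fun _ => rfl, fun _ _ => rfl⟩
  comp F G := ⟨G.f ∘ₗ F.f, fun n x h => G.map_gr n _ (F.map_gr n x h),
    fun x => by simp [F.map_d, G.map_d], fun x y => by simp [F.map_br, G.map_br]⟩

/-- Morphisms of augmented commutative differential graded algebras. -/
@[ext] structure ADGCA.Hom (A B : ADGCA k) : Type u where
  f : A.X →ₐ[k] B.X
  map_gr : ∀ n, ∀ x ∈ A.gr n, f x ∈ B.gr n
  map_d : ∀ x, f (A.d x) = B.d (f x)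
  map_aug : ∀ x, B.aug (f x) = A.aug x

instance : Category (ADGCA k) where
  Hom A B := ADGCA.Hom A B
  id A := ⟨AlgHom.id k A.X, fun _ _ h => h, fun _ => rfl, fun _ => rfl⟩
  comp F G := ⟨G.f.comp F.f, fun n x h => G.map_gr n _ (F.map_gr n x h),
    fun x => by simp [F.map_d, G.map_d], fun x => by simp [F.map_aug, G.map_aug]⟩

/-- The linear map underlying a morphism. -/
def DGLA.lin {L M : DGLA k} (F : L ⟶ M) : L.X →ₗ[k] M.X := DGLA.Hom.f F

/-- The linear map underlying a morphism. -/
def ADGCA.lin {A B : ADGCA k} (F : A ⟶ B) : A.X →ₗ[k] B.X := (ADGCA.Hom.f F).toLinearMap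

/-- A map `f` commuting with differentials induces a bijection on homology: it is injective
(first part) and surjective (second part) on homology classes. -/
def IsQIso {X Y : Type u} [AddCommGroup X] [Module k X] [AddCommGroup Y] [Module k Y]
    (dX : X →ₗ[k] X) (dY : Y →ₗ[k] Y) (f : X →ₗ[k] Y) : Prop :=
  (∀ x, dX x = 0 → (∃ y, f x = dY y) → ∃ x', x = dX x') ∧
    ∀ y, dY y = 0 → ∃ x y', dX x = 0 ∧ y = f x + dY y'

/-- Quasi-isomorphisms of differential graded Lie algebras. -/
def DGLA.QIso {L M : DGLA k} (F : L ⟶ M) : Prop := IsQIso L.d M.d (DGLA.lin F)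

/-- Cofibrant differential graded Lie algebras: those having the lifting property with respect to
all surjective quasi-isomorphisms (the acyclic fibrations). -/
def DGLA.Cofibrant (Q : DGLA k) : Prop :=
  ∀ (E B : DGLA k) (p : E ⟶ B) (f : Q ⟶ B), Function.Surjective (DGLA.lin p) → DGLA.QIso p →
    ∃ g : Q ⟶ E, g ≫ p = f

variable (k) in
/-- The class of quasi-isomorphisms of augmented commutative differential graded algebras. -/
def ADGCA.qis : MorphismProperty (ADGCA k) := fun A B F => IsQIso A.d B.d (ADGCA.lin F)

/-- Two augmented commutative differential graded algebras are isomorphic in the homotopy category,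
that is, in the localization at the quasi-isomorphisms. -/
def HoIso (A B : ADGCA k) : Prop :=
  Nonempty ((ADGCA.qis k).Q.obj A ≅ (ADGCA.qis k).Q.obj B)

lemma ADGCA.d_mul (A : ADGCA k) (x y : A.X) :
    A.d (x * y) = A.d x * y + tw A.internal 1 x * A.d y := by
  refine hom_induction A.internal (p := fun x => A.d (x * y) = A.d x * y +
    tw A.internal 1 x * A.d y) x (fun i x hx => ?_) (fun x x' h h' => ?_)
  · rw [A.d_leibniz i x hx, tw_one_of_mem A.internal hx, smul_mul_assoc]
  · simp only [add_mul, map_add, h, h']; abel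

lemma ADGCA.d_one (A : ADGCA k) : A.d 1 = 0 := by
  have := A.d_mul 1 1
  rw [tw_one_of_mem A.internal A.one_mem, sgn_zero, one_smul, one_mul, mul_one] at this
  simpa using this

/-- The algebra of cycles. -/
def ADGCA.cycles (A : ADGCA k) : Subalgebra k A.X where
  carrier := {x | A.d x = 0}
  mul_mem' := by
    intro x y hx hy
    simp only [Set.mem_ofPred_eq] at *
    rw [A.d_mul, hx, hy]; simp
  add_mem' := by
    intro x y hx hy
    simp only [Set.mem_ofPred_eq] at *
    rw [map_add, hx, hy, add_zero]
  algebraMap_mem' r := by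
    change A.d _ = 0
    rw [Algebra.algebraMap_eq_smul_one, map_smul, A.d_one, smul_zero]

lemma ADGCA.mem_cycles (A : ADGCA k) {x : A.X} : x ∈ A.cycles ↔ A.d x = 0 := Iff.rfl

/-- The ideal of boundaries in the algebra of cycles. -/
def ADGCA.boundaries (A : ADGCA k) : Ideal A.cycles where
  carrier := {x | ∃ y, A.d y = x}
  add_mem' := by
    rintro x y ⟨a, ha⟩ ⟨b, hb⟩
    exact ⟨a + b, by simp [ha, hb]⟩
  zero_mem' := ⟨0, by simp⟩
  smul_mem' := by
    rintro ⟨z, hz⟩ x ⟨a, ha⟩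
    refine ⟨tw A.internal 1 z * a, ?_⟩
    have h0 : A.d (tw A.internal 1 z) = 0 := by
      have := tw_d A.internal A.d A.d_mem z
      rw [A.mem_cycles.1 hz, map_zero] at this
      simpa using this.symm
    rw [A.d_mul, h0, zero_mul, zero_add, tw_tw, ha]
    rfl

instance (A : ADGCA k) : A.boundaries.IsTwoSided where
  mul_mem_of_left := by
    rintro x ⟨z, hz⟩ ⟨a, ha⟩
    refine ⟨a * z, ?_⟩
    rw [A.d_mul, A.mem_cycles.1 hz, mul_zero, add_zero, ha]
    rfl

/-- The homology algebra. -/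
abbrev ADGCA.H (A : ADGCA k) : Type u := A.cycles ⧸ A.boundaries

/-- The homology classes of degree `n`. -/
def ADGCA.Hgr (A : ADGCA k) (n : ℤ) : Submodule k A.H :=
  ((A.gr n).comap A.cycles.val.toLinearMap).map (Ideal.Quotient.mkₐ k A.boundaries).toLinearMap

/-- The homology algebras of `A` and `B` are isomorphic as graded algebras. -/
def HomologyIso (A B : ADGCA k) : Prop :=
  ∃ e : A.H ≃ₐ[k] B.H, ∀ n, (A.Hgr n).map e.toLinearMap = B.Hgr n

end Cat

/-! ### Graded symmetric algebras, and graded commutative algebras given by relations -/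

section Pres

variable {k : Type u} [Field k]
variable {V : Type u} [AddCommGroup V] [Module k V]

/-- The defining relations of the graded commutative algebra generated by the graded vector space
`V` subject to the relations `R`. -/
inductive PresRel (gV : ℤ → Submodule k V) (R : TensorAlgebra k V → TensorAlgebra k V → Prop) :
    TensorAlgebra k V → TensorAlgebra k V → Prop
  | comm {i j : ℤ} {v w : V} (hv : v ∈ gV i) (hw : w ∈ gV j) :
      PresRel gV R (TensorAlgebra.ι k v * TensorAlgebra.ι k w)
        (sgn k (i * j) • (TensorAlgebra.ι k w * TensorAlgebra.ι k v))
  | rel {a b : TensorAlgebra k V} (h : R a b) : PresRel gV R a b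

variable (gV : ℤ → Submodule k V) (R : TensorAlgebra k V → TensorAlgebra k V → Prop)

/-- The graded commutative algebra generated by the graded vector space `V` subject to the
relations `R`. -/
def Pres : Type u := RingQuot (PresRel gV R)

instance : Ring (Pres gV R) := inferInstanceAs (Ring (RingQuot (PresRel gV R)))

instance : Algebra k (Pres gV R) := inferInstanceAs (Algebra k (RingQuot (PresRel gV R)))

/-- The canonical map from the tensor algebra. -/
def Pres.mk : TensorAlgebra k V →ₐ[k] Pres gV R := RingQuot.mkAlgHom k _

/-- The generators. -/
def Pres.gen : V →ₗ[k] Pres gV R := (Pres.mk gV R).toLinearMap ∘ₗ TensorAlgebra.ι k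

variable {gV R}

lemma Pres.mk_surj : Function.Surjective (Pres.mk gV R) := RingQuot.mkAlgHom_surjective k _

lemma Pres.mk_ι (v : V) : Pres.mk gV R (TensorAlgebra.ι k v) = Pres.gen gV R v := rfl

lemma Pres.mk_rel {a b : TensorAlgebra k V} (h : R a b) : Pres.mk gV R a = Pres.mk gV R b :=
  RingQuot.mkAlgHom_rel k (PresRel.rel h)

lemma Pres.gen_comm : ∀ i j, ∀ v ∈ gV i, ∀ w ∈ gV j, Pres.gen gV R v * Pres.gen gV R w =
    sgn k (i * j) • (Pres.gen gV R w * Pres.gen gV R v) := by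
  intro i j v hv w hw
  have : Pres.mk gV R _ = Pres.mk gV R _ :=
    RingQuot.mkAlgHom_rel k (PresRel.comm (R := R) hv hw)
  rwa [map_mul, map_smul, map_mul] at this

/-- The universal property. -/
def Pres.lift {B : Type u} [Ring B] [Algebra k B] (φ : V →ₗ[k] B)
    (hc : ∀ i j, ∀ v ∈ gV i, ∀ w ∈ gV j, φ v * φ w = sgn k (i * j) • (φ w * φ v))
    (hR : ∀ a b, R a b → TensorAlgebra.lift k φ a = TensorAlgebra.lift k φ b) :
    Pres gV R →ₐ[k] B :=
  RingQuot.liftAlgHom k ⟨TensorAlgebra.lift k φ, by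
    intro a b h
    cases h with
    | comm hv hw => simpa using hc _ _ _ hv _ hw
    | rel h => exact hR a b h⟩

lemma Pres.lift_mk {B : Type u} [Ring B] [Algebra k B] (φ : V →ₗ[k] B)
    (hc : ∀ i j, ∀ v ∈ gV i, ∀ w ∈ gV j, φ v * φ w = sgn k (i * j) • (φ w * φ v))
    (hR : ∀ a b, R a b → TensorAlgebra.lift k φ a = TensorAlgebra.lift k φ b)
    (a : TensorAlgebra k V) : Pres.lift φ hc hR (Pres.mk gV R a) = TensorAlgebra.lift k φ a :=
  RingQuot.liftAlgHom_mkAlgHom_apply k _ _ a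

lemma Pres.lift_gen {B : Type u} [Ring B] [Algebra k B] (φ : V →ₗ[k] B)
    (hc : ∀ i j, ∀ v ∈ gV i, ∀ w ∈ gV j, φ v * φ w = sgn k (i * j) • (φ w * φ v))
    (hR : ∀ a b, R a b → TensorAlgebra.lift k φ a = TensorAlgebra.lift k φ b) (v : V) :
    Pres.lift φ hc hR (Pres.gen gV R v) = φ v := by
  rw [← Pres.mk_ι, Pres.lift_mk, TensorAlgebra.lift_ι_apply]

lemma tensor_adjoin : Algebra.adjoin k (Set.range (TensorAlgebra.ι k (M := V))) = ⊤ :=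
  TensorAlgebra.adjoin_range_ι

/-- The elements of the Laurent polynomial algebra over `A` which are concentrated in degree `i`. -/
def singleLin {A : Type u} [Ring A] [Algebra k A] (i : ℤ) : A →ₗ[k] AddMonoidAlgebra A ℤ where
  toFun a := AddMonoidAlgebra.single i a
  map_add' _ _ := AddMonoidAlgebra.single_add _ _ _
  map_smul' r a := (AddMonoidAlgebra.smul_single r i a).symm

lemma tensor_isGen (h : DirectSum.IsInternal gV) : IsGen gV (TensorAlgebra.ι k) where
  internal := h
  gen := tensor_adjoin
  coact := by
    let s : ℤ → V →ₗ[k] AddMonoidAlgebra (TensorAlgebra k V) ℤ := fun i =>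
      singleLin i ∘ₗ TensorAlgebra.ι k
    refine ⟨TensorAlgebra.lift k (byDeg h s), fun i v hv => ?_⟩
    rw [TensorAlgebra.lift_ι_apply, byDeg_of_mem h s hv]
    rfl

lemma monoGr_map {A B : Type u} [Ring A] [Algebra k A] [Ring B] [Algebra k B] {ι : V →ₗ[k] A}
    {ι' : V →ₗ[k] B} (f : A →ₐ[k] B) (hf : ∀ v, f (ι v) = ι' v) {n : ℤ} {a : A}
    (ha : a ∈ monoGr gV ι n) : f a ∈ monoGr gV ι' n := by
  refine monoGr_induction (p := fun a => f a ∈ monoGr gV ι' n) ha (fun a ha => ?_) (by simp)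
    (fun b c hb hc => by rw [map_add]; exact add_mem hb hc)
    (fun r b hb => by rw [map_smul]; exact Submodule.smul_mem _ _ hb)
  refine IsMono.mem ?_
  clear * - ha hf
  induction ha with
  | one => rw [map_one]; exact IsMono.one
  | cons hn hv _ ih => rw [map_mul, hf]; exact IsMono.cons hn hv ih

variable (gV R) in
/-- The relations are homogeneous. -/
def HomRel : Prop := ∀ a b, R a b → ∃ n, a ∈ monoGr gV (TensorAlgebra.ι k) n ∧
  b ∈ monoGr gV (TensorAlgebra.ι k) n

lemma Pres.isGen (h : DirectSum.IsInternal gV) (hR : HomRel gV R) :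
    IsGen gV (Pres.gen gV R) where
  internal := h
  gen := by
    rw [Pres.gen, LinearMap.coe_comp, Set.range_comp]
    have := AlgHom.map_adjoin (Pres.mk gV R) (Set.range (TensorAlgebra.ι k (M := V)))
    rw [tensor_adjoin, Algebra.map_top, (AlgHom.range_eq_top _).2 Pres.mk_surj] at this
    exact this.symm
  coact := by
    let s : ℤ → V →ₗ[k] AddMonoidAlgebra (Pres gV R) ℤ := fun i =>
      singleLin i ∘ₗ Pres.gen gV R
    have hs : ∀ i, ∀ v ∈ gV i, byDeg h s v = AddMonoidAlgebra.single i (Pres.gen gV R v) := by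
      intro i v hv
      rw [byDeg_of_mem h s hv]
      simp only [s, singleLin, LinearMap.comp_apply, LinearMap.coe_mk, AddHom.coe_mk]
    have key : ∀ n, ∀ a ∈ monoGr gV (TensorAlgebra.ι k) n,
        TensorAlgebra.lift k (byDeg h s) a = AddMonoidAlgebra.single n (Pres.mk gV R a) := by
      intro n a hmem
      refine monoGr_induction (p := fun a => TensorAlgebra.lift k (byDeg h s) a =
        AddMonoidAlgebra.single n (Pres.mk gV R a)) hmem (fun a ha => ?_)
        (by simp) (fun a b ha hb => by rw [map_add, ha, hb, map_add, AddMonoidAlgebra.single_add])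
        (fun r a ha => by rw [map_smul, ha, map_smul, AddMonoidAlgebra.smul_single])
      clear hmem
      induction ha with
      | one => rw [map_one, map_one]; rfl
      | cons hn hv _ ih =>
        rw [map_mul, TensorAlgebra.lift_ι_apply, hs _ _ hv, ih, AddMonoidAlgebra.single_mul_single,
          hn, map_mul, Pres.mk_ι]
    refine ⟨Pres.lift (byDeg h s) (fun i j v hv w hw => ?_) (fun a b hab => ?_), fun i v hv => ?_⟩
    · rw [hs i v hv, hs j w hw, AddMonoidAlgebra.single_mul_single,
        AddMonoidAlgebra.single_mul_single, Pres.gen_comm i j v hv w hw, add_comm,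
        AddMonoidAlgebra.smul_single]
    · obtain ⟨n, ha, hb⟩ := hR a b hab
      rw [key n a ha, key n b hb, Pres.mk_rel hab]
    · rw [Pres.lift_gen, hs i v hv]

section Der

variable (h : DirectSum.IsInternal gV) (hR : HomRel gV R)

/-- The linear map `v ↦ (± v, δ v; 0, v)`. -/
def Pres.derGen (e : ℤ) (δ : V →ₗ[k] Pres gV R) :
    V →ₗ[k] Matrix (Fin 2) (Fin 2) (Pres gV R) where
  toFun v := derMat (tw (Pres.isGen h hR).grInternal e (Pres.gen gV R v)) (δ v) (Pres.gen gV R v)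
  map_add' v w := by ext i j; fin_cases i <;> fin_cases j <;> simp [derMat]
  map_smul' r v := by ext i j; fin_cases i <;> fin_cases j <;> simp [derMat]

/-- The derivation of the tensor algebra with values in the quotient algebra which is given by `δ`
on generators. -/
def Pres.derT (e : ℤ) (δ : V →ₗ[k] Pres gV R) (a : TensorAlgebra k V) : Pres gV R :=
  TensorAlgebra.lift k (Pres.derGen h hR e δ) a 0 1

lemma Pres.derGen_entries (e : ℤ) (δ : V →ₗ[k] Pres gV R) (a : TensorAlgebra k V) :
    TensorAlgebra.lift k (Pres.derGen h hR e δ) a 0 0 =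
      tw (Pres.isGen h hR).grInternal e (Pres.mk gV R a) ∧
    TensorAlgebra.lift k (Pres.derGen h hR e δ) a 1 0 = 0 ∧
    TensorAlgebra.lift k (Pres.derGen h hR e δ) a 1 1 = Pres.mk gV R a := by
  refine gen_induction tensor_adjoin (p := fun a =>
    TensorAlgebra.lift k (Pres.derGen h hR e δ) a 0 0 =
      tw (Pres.isGen h hR).grInternal e (Pres.mk gV R a) ∧
    TensorAlgebra.lift k (Pres.derGen h hR e δ) a 1 0 = 0 ∧
    TensorAlgebra.lift k (Pres.derGen h hR e δ) a 1 1 = Pres.mk gV R a) a (fun v => ?_)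
    (fun r => ?_) (fun a b ha hb => ?_) (fun a b ha hb => ?_)
  · simp [Pres.derGen, derMat, Pres.mk_ι]
  · rw [Algebra.algebraMap_eq_smul_one, map_smul, map_smul, map_smul, map_one, map_one,
      tw_of_mem (Pres.isGen h hR).grInternal e monoGr_one]
    simp [sgn_zero]
  · simp [ha, hb]
  · simp [ha, hb, Matrix.mul_apply,
      tw_mul (Pres.isGen h hR).grInternal fun i j x hx y hy => monoGr_mul hx hy]

lemma Pres.derT_mul (e : ℤ) (δ : V →ₗ[k] Pres gV R) (a b : TensorAlgebra k V) :
    Pres.derT h hR e δ (a * b) = Pres.derT h hR e δ a * Pres.mk gV R b +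
      tw (Pres.isGen h hR).grInternal e (Pres.mk gV R a) * Pres.derT h hR e δ b := by
  simp [Pres.derT, Matrix.mul_apply, Pres.derGen_entries, add_comm]

lemma Pres.derT_ι (e : ℤ) (δ : V →ₗ[k] Pres gV R) (v : V) :
    Pres.derT h hR e δ (TensorAlgebra.ι k v) = δ v := by
  simp [Pres.derT, Pres.derGen, derMat]

lemma Pres.derT_add (e : ℤ) (δ : V →ₗ[k] Pres gV R) (a b : TensorAlgebra k V) :
    Pres.derT h hR e δ (a + b) = Pres.derT h hR e δ a + Pres.derT h hR e δ b := by
  simp [Pres.derT]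

lemma Pres.derT_zero (e : ℤ) (δ : V →ₗ[k] Pres gV R) : Pres.derT h hR e δ 0 = 0 := by
  simp [Pres.derT]

/-- A map `δ` on generators of degree `m`, where `m` has the parity of `e`, which is compatible with
the relations. -/
structure Pres.DerData (e m : ℤ) (δ : V →ₗ[k] Pres gV R) : Prop where
  even : Even (m - e)
  mem : ∀ n, ∀ v ∈ gV n, δ v ∈ monoGr gV (Pres.gen gV R) (n + m)
  rel : ∀ a b, R a b → Pres.derT h hR e δ a = Pres.derT h hR e δ b

lemma sgn_mul_even (i : ℤ) {n : ℤ} (hn : Even n) : sgn k (i * n) = 1 := by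
  simp [sgn, Int.negOnePow_even _ (hn.mul_left i)]

variable {h hR}

/-- The homomorphism to two by two matrices which defines a derivation. -/
def Pres.derHom {e m : ℤ} {δ : V →ₗ[k] Pres gV R} (H : Pres.DerData h hR e m δ) :
    Pres gV R →ₐ[k] Matrix (Fin 2) (Fin 2) (Pres gV R) :=
  Pres.lift (Pres.derGen h hR e δ)
    (by
      intro i j v hv w hw
      have e1 : Pres.gen gV R v * δ w = (sgn k (i * (j + m))) • (δ w * Pres.gen gV R v) :=
        mono_comm Pres.gen_comm (monoGr_ι hv) (H.mem j w hw)
      have e2 : Pres.gen gV R w * δ v = (sgn k (j * (i + m))) • (δ v * Pres.gen gV R w) :=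
        mono_comm Pres.gen_comm (monoGr_ι hw) (H.mem i v hv)
      have e3 := Pres.gen_comm (R := R) i j v hv w hw
      have s1 : sgn k (e * i) * sgn k (i * (j + m)) = sgn k (i * j) := by
        rw [← sgn_add, show e * i + i * (j + m) = i * j + (i * (m - e) + (e * i + e * i)) by ring,
          sgn_add, sgn_add, sgn_mul_even i H.even, sgn_add, sgn_sq]
        simp
      have s2 : sgn k (e * j) * sgn k (j * (i + m)) = sgn k (i * j) := by
        rw [← sgn_add, show e * j + j * (i + m) = i * j + (j * (m - e) + (e * j + e * j)) by ring,
          sgn_add, sgn_add, sgn_mul_even j H.even, sgn_add, sgn_sq]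
        simp
      have t1 := tw_of_mem (Pres.isGen h hR).grInternal e (monoGr_ι (ι := Pres.gen gV R) hv)
      have t2 := tw_of_mem (Pres.isGen h hR).grInternal e (monoGr_ι (ι := Pres.gen gV R) hw)
      ext a b
      fin_cases a <;> fin_cases b
      · simp only [Pres.derGen, derMat, LinearMap.coe_mk, AddHom.coe_mk, Matrix.mul_apply,
          Fin.sum_univ_two, Matrix.smul_apply, t1, t2]
        simp [smul_smul, e3, mul_comm, mul_left_comm, mul_assoc]
      · simp only [Pres.derGen, derMat, LinearMap.coe_mk, AddHom.coe_mk, Matrix.mul_apply,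
          Fin.sum_univ_two, Matrix.smul_apply, t1, t2]
        simp only [Fin.isValue, Fin.zero_eta, Matrix.of_apply, Matrix.cons_val', Matrix.cons_val_zero,
          Matrix.cons_val_fin_one, Fin.mk_one, Matrix.cons_val_one, smul_mul_assoc, smul_add, e1, e2,
          smul_smul, s1, s2, sgn_sq, one_smul]
        abel
      · simp [Pres.derGen, derMat, Matrix.mul_apply]
      · simp [Pres.derGen, derMat, Matrix.mul_apply, e3])
    (by
      intro a b hab
      have ha := Pres.derGen_entries h hR e δ a
      have hb := Pres.derGen_entries h hR e δ b
      have hab' := Pres.mk_rel (gV := gV) hab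
      ext i j
      fin_cases i <;> fin_cases j
      · exact ha.1.trans (by rw [hab']; exact hb.1.symm)
      · exact H.rel a b hab
      · exact ha.2.1.trans hb.2.1.symm
      · exact ha.2.2.trans (by rw [hab']; exact hb.2.2.symm))

/-- The graded derivation extending `δ`. -/
def Pres.der {e m : ℤ} {δ : V →ₗ[k] Pres gV R} (H : Pres.DerData h hR e m δ) :
    Pres gV R →ₗ[k] Pres gV R := derOf (Pres.derHom H)

lemma Pres.der_isDer {e m : ℤ} {δ : V →ₗ[k] Pres gV R} (H : Pres.DerData h hR e m δ) :
    IsDer (Pres.isGen h hR).grInternal e (Pres.der H) :=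
  (derOf_spec (Pres.isGen h hR) e δ (Pres.derHom H) fun v => by
    rw [Pres.derHom, Pres.lift_gen]; rfl).1

lemma Pres.der_gen {e m : ℤ} {δ : V →ₗ[k] Pres gV R} (H : Pres.DerData h hR e m δ) (v : V) :
    Pres.der H (Pres.gen gV R v) = δ v :=
  (derOf_spec (Pres.isGen h hR) e δ (Pres.derHom H) fun v => by
    rw [Pres.derHom, Pres.lift_gen]; rfl).2 v

lemma Pres.der_mem {e m : ℤ} {δ : V →ₗ[k] Pres gV R} (H : Pres.DerData h hR e m δ) :
    ∀ n, ∀ a ∈ monoGr gV (Pres.gen gV R) n, Pres.der H a ∈ monoGr gV (Pres.gen gV R) (n + m) :=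
  (Pres.der_isDer H).mem fun n v hv => by rw [Pres.der_gen]; exact H.mem n v hv

end Der

/-- The augmentation which vanishes on generators. -/
def Pres.aug (hR : ∀ a b, R a b →
    TensorAlgebra.lift k (0 : V →ₗ[k] k) a = TensorAlgebra.lift k (0 : V →ₗ[k] k) b) :
    Pres gV R →ₐ[k] k :=
  Pres.lift 0 (fun i j v _ w _ => by simp) hR

lemma Pres.aug_gen (hR : ∀ a b, R a b →
    TensorAlgebra.lift k (0 : V →ₗ[k] k) a = TensorAlgebra.lift k (0 : V →ₗ[k] k) b) (v : V) :
    Pres.aug (gV := gV) hR (Pres.gen gV R v) = 0 := by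
  rw [Pres.aug, Pres.lift_gen]; rfl

variable (gV) in
/-- The graded symmetric algebra of the graded vector space `V`. -/
abbrev GSym : Type u := Pres gV fun _ _ => False

lemma homRel_false : HomRel gV fun _ _ => False := fun _ _ h => h.elim

lemma GSym.derData (h : DirectSum.IsInternal gV) {e m : ℤ} (he : Even (m - e))
    (δ : V →ₗ[k] GSym gV) (hδ : ∀ n, ∀ v ∈ gV n, δ v ∈ monoGr gV (Pres.gen gV _) (n + m)) :
    Pres.DerData h homRel_false e m δ :=
  ⟨he, hδ, fun _ _ h => h.elim⟩

end Pres

/-! ### The cobar construction `Ω_Comm(C)` -/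

section Cobar

variable {k : Type u} [Field k]

/-- A graded subspace of a differential graded Lie algebra which is closed under the differential
and the bracket. -/
def DGLA.sub (L : DGLA k) (S : Submodule k L.X) (hp : ∀ n, ∀ x ∈ S, proj L.internal n x ∈ S)
    (hd : ∀ x ∈ S, L.d x ∈ S) (hb : ∀ x ∈ S, ∀ y ∈ S, L.br x y ∈ S) : DGLA k where
  X := S
  gr n := (L.gr n).comap S.subtype
  internal := sub_internal L.internal S hp
  d := L.d.restrict hd
  d_mem n x hx := L.d_mem n x hx
  d_sq x := Subtype.ext (L.d_sq x)
  br := LinearMap.mk₂ k (fun x y => ⟨L.br x y, hb x x.2 y y.2⟩)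
    (fun _ _ _ => Subtype.ext (by simp)) (fun _ _ _ => Subtype.ext (by simp))
    (fun _ _ _ => Subtype.ext (by simp)) (fun _ _ _ => Subtype.ext (by simp))
  br_mem i j x hx y hy := L.br_mem i j x hx y hy
  br_skew i j x hx y hy := Subtype.ext (L.br_skew i j x hx y hy)
  br_jacobi i j l x hx y hy z hz := Subtype.ext (L.br_jacobi i j l x hx y hy z hz)
  br_leibniz i j x hx y hy := Subtype.ext (L.br_leibniz i j x hx y hy)

/-- The graded commutator of an algebra. -/
def gbr {A : Type u} [Ring A] [Algebra k A] {gA : ℤ → Submodule k A}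
    (h : DirectSum.IsInternal gA) : A →ₗ[k] A →ₗ[k] A :=
  LinearMap.mul k A - TensorProduct.curry (LinearMap.mul' k A ∘ₗ swap h)

lemma gbr_apply {A : Type u} [Ring A] [Algebra k A] {gA : ℤ → Submodule k A}
    (h : DirectSum.IsInternal gA) {i j : ℤ} {a b : A} (ha : a ∈ gA i) (hb : b ∈ gA j) :
    gbr h a b = a * b - sgn k (i * j) • (b * a) := by
  simp [gbr, swap_tmul h ha hb]

/-- The differential graded Lie algebra of graded commutators in a differential graded algebra. -/
def commLie {A : Type u} [Ring A] [Algebra k A] {gA : ℤ → Submodule k A}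
    (h : DirectSum.IsInternal gA) (hm : ∀ i j, ∀ x ∈ gA i, ∀ y ∈ gA j, x * y ∈ gA (i + j))
    (D : A →ₗ[k] A) (hD : IsDer h 1 D) (hd : ∀ n, ∀ x ∈ gA n, D x ∈ gA (n - 1))
    (h0 : ∀ x, D (D x) = 0) : DGLA k where
  X := A
  gr := gA
  internal := h
  d := D
  d_mem := hd
  d_sq := h0
  br := gbr h
  br_mem i j x hx y hy := by
    rw [gbr_apply h hx hy]
    have := hm j i y hy x hx
    rw [add_comm] at this
    exact sub_mem (hm i j x hx y hy) (Submodule.smul_mem _ _ this)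
  br_skew i j x hx y hy := by
    rw [gbr_apply h hx hy, gbr_apply h hy hx, smul_sub, smul_smul, mul_comm j i, neg_mul, sgn_sq]
    simp only [neg_smul, one_smul]
    abel
  br_jacobi i j l x hx y hy z hz := by
    have hb : ∀ {i j : ℤ} {x y : A}, x ∈ gA i → y ∈ gA j → gbr h x y ∈ gA (i + j) := by
      intro i j x y hx hy
      rw [gbr_apply h hx hy]
      have := hm j i y hy x hx
      rw [add_comm] at this
      exact sub_mem (hm i j x hx y hy) (Submodule.smul_mem _ _ this)
    rw [gbr_apply h hx (hb hy hz), gbr_apply h (hb hx hy) hz, gbr_apply h hy (hb hx hz),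
      gbr_apply h hx hy, gbr_apply h hy hz, gbr_apply h hx hz, mul_add, add_mul, mul_add, sgn_add,
      sgn_add, sgn_add, mul_comm j i]
    rcases sgn_cases k (i * j) with e1 | e1 <;> rcases sgn_cases k (j * l) with e2 | e2 <;>
      rcases sgn_cases k (i * l) with e3 | e3 <;> simp only [e1, e2, e3, mul_sub, sub_mul, mul_one,
        one_smul, neg_smul, mul_neg, neg_neg, mul_assoc, neg_mul, smul_sub, one_mul, smul_neg,
        sub_neg_eq_add, mul_add, add_mul, smul_add] <;> abel
  br_leibniz i j x hx y hy := by
    rw [gbr_apply h hx hy, gbr_apply h (hd i x hx) hy, gbr_apply h hx (hd j y hy), map_sub, map_smul,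
      hD, hD, tw_one_of_mem h hx, tw_one_of_mem h hy, sub_mul, mul_sub, sgn_sub, sgn_sub, one_mul,
      mul_one]
    rcases sgn_cases k (i * j) with e1 | e1 <;> rcases sgn_cases k i with e2 | e2 <;>
      rcases sgn_cases k j with e3 | e3 <;> simp only [e1, e2, e3, mul_sub, sub_mul, mul_one,
        one_smul, neg_smul, mul_neg, neg_neg, mul_assoc, neg_mul, smul_sub, one_mul, smul_neg,
        sub_neg_eq_add, mul_add, add_mul, smul_add] <;> abel

section TensorDer

variable {V : Type u} [AddCommGroup V] [Module k V] {gV : ℤ → Submodule k V}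
  (h : DirectSum.IsInternal gV)

/-- The linear map `v ↦ (± v, δ v; 0, v)`. -/
def tensorDerGen (e : ℤ) (δ : V →ₗ[k] TensorAlgebra k V) :
    V →ₗ[k] Matrix (Fin 2) (Fin 2) (TensorAlgebra k V) where
  toFun v := derMat (tw (tensor_isGen h).grInternal e (TensorAlgebra.ι k v)) (δ v)
    (TensorAlgebra.ι k v)
  map_add' v w := by ext i j; fin_cases i <;> fin_cases j <;> simp [derMat]
  map_smul' r v := by ext i j; fin_cases i <;> fin_cases j <;> simp [derMat]

/-- The graded derivation of the tensor algebra extending `δ`. -/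
def tensorDer (e : ℤ) (δ : V →ₗ[k] TensorAlgebra k V) : TensorAlgebra k V →ₗ[k] TensorAlgebra k V :=
  derOf (TensorAlgebra.lift k (tensorDerGen h e δ))

lemma tensorDer_isDer (e : ℤ) (δ : V →ₗ[k] TensorAlgebra k V) :
    IsDer (tensor_isGen h).grInternal e (tensorDer h e δ) :=
  (derOf_spec (tensor_isGen h) e δ _ fun v => by rw [TensorAlgebra.lift_ι_apply]; rfl).1

lemma tensorDer_ι (e : ℤ) (δ : V →ₗ[k] TensorAlgebra k V) (v : V) :
    tensorDer h e δ (TensorAlgebra.ι k v) = δ v :=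
  (derOf_spec (tensor_isGen h) e δ _ fun v => by rw [TensorAlgebra.lift_ι_apply]; rfl).2 v

variable (gV) in
/-- `IsLie gV n a` says that `a` is an iterated graded commutator, of degree `n`, of homogeneous
elements of `V`. -/
inductive IsLie : ℤ → TensorAlgebra k V → Prop
  | gen {n : ℤ} {v : V} (hv : v ∈ gV n) : IsLie n (TensorAlgebra.ι k v)
  | br {i j : ℤ} {a b : TensorAlgebra k V} (ha : IsLie i a) (hb : IsLie j b) :
      IsLie (i + j) (a * b - sgn k (i * j) • (b * a))

variable (gV) in
/-- The free graded Lie algebra on `V` (over a field of characteristic zero), realized as the graded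
Lie subalgebra of the tensor algebra which is generated by `V`. -/
def freeLie : Submodule k (TensorAlgebra k V) :=
  Submodule.span k {a | ∃ n, IsLie gV n a}

lemma IsLie.mem_gr {n : ℤ} {a : TensorAlgebra k V} (ha : IsLie gV n a) :
    a ∈ monoGr gV (TensorAlgebra.ι k) n := by
  induction ha with
  | gen hv => exact monoGr_ι hv
  | br _ _ ha hb =>
    refine sub_mem (monoGr_mul ha hb) (Submodule.smul_mem _ _ ?_)
    rw [add_comm]
    exact monoGr_mul hb ha

lemma IsLie.mem {n : ℤ} {a : TensorAlgebra k V} (ha : IsLie gV n a) : a ∈ freeLie gV :=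
  Submodule.subset_span ⟨n, ha⟩

lemma freeLie_induction {p : TensorAlgebra k V → Prop} {a : TensorAlgebra k V}
    (ha : a ∈ freeLie gV) (lie : ∀ n b, IsLie gV n b → p b) (zero : p 0)
    (add : ∀ b c, p b → p c → p (b + c)) (smul : ∀ (r : k) b, p b → p (r • b)) : p a :=
  Submodule.span_induction (p := fun a _ => p a) (fun b hb => hb.elim fun n hb => lie n b hb) zero
    (fun b c _ _ => add b c) (fun r b _ => smul r b) ha

lemma ι_mem_freeLie (h : DirectSum.IsInternal gV) (v : V) : TensorAlgebra.ι k v ∈ freeLie gV :=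
  hom_induction h (p := fun v => TensorAlgebra.ι k v ∈ freeLie gV) v
    (fun _ _ hv => (IsLie.gen hv).mem) (fun v w hv hw => by rw [map_add]; exact add_mem hv hw)

lemma freeLie_gbr {a b : TensorAlgebra k V} (ha : a ∈ freeLie gV) (hb : b ∈ freeLie gV) :
    gbr (tensor_isGen h).grInternal a b ∈ freeLie gV := by
  refine freeLie_induction (p := fun a => gbr (tensor_isGen h).grInternal a b ∈ freeLie gV) ha
    (fun i a ha => ?_) (by simp) (fun a a' h h' => by simpa using add_mem h h')
    (fun r a h => by simpa using Submodule.smul_mem _ _ h)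
  refine freeLie_induction (p := fun b => gbr (tensor_isGen h).grInternal a b ∈ freeLie gV) hb
    (fun j b hb => ?_) (by simp) (fun a a' h h' => by simpa using add_mem h h')
    (fun r a h => by simpa using Submodule.smul_mem _ _ h)
  rw [gbr_apply _ ha.mem_gr hb.mem_gr]
  exact (IsLie.br ha hb).mem

lemma freeLie_proj (n : ℤ) (a : TensorAlgebra k V) (ha : a ∈ freeLie gV) :
    proj (tensor_isGen h).grInternal n a ∈ freeLie gV := by
  refine freeLie_induction (p := fun a => proj (tensor_isGen h).grInternal n a ∈ freeLie gV) ha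
    (fun i a ha => ?_) (by simp) (fun a a' h h' => by rw [map_add]; exact add_mem h h')
    (fun r a h => by rw [map_smul]; exact Submodule.smul_mem _ _ h)
  by_cases e : i = n
  · subst e; rw [proj_of_mem _ ha.mem_gr]; exact ha.mem
  · rw [proj_of_ne _ ha.mem_gr e]; exact zero_mem _

lemma freeLie_der {D : TensorAlgebra k V →ₗ[k] TensorAlgebra k V}
    (hD : IsDer (tensor_isGen h).grInternal 1 D)
    (hd : ∀ n, ∀ x ∈ monoGr gV (TensorAlgebra.ι k) n, D x ∈ monoGr gV (TensorAlgebra.ι k) (n - 1))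
    (hδ : ∀ v, D (TensorAlgebra.ι k v) ∈ freeLie gV) (a : TensorAlgebra k V) (ha : a ∈ freeLie gV) :
    D a ∈ freeLie gV := by
  refine freeLie_induction (p := fun a => D a ∈ freeLie gV) ha
    (fun i a ha => ?_) (by simp) (fun a a' h h' => by rw [map_add]; exact add_mem h h')
    (fun r a h => by rw [map_smul]; exact Submodule.smul_mem _ _ h)
  clear * - ha hD hd hδ
  induction ha with
  | gen hv => exact hδ _
  | @br i j a b ha hb iha ihb =>
    have hI := (tensor_isGen h).grInternal
    have : D (a * b - sgn k (i * j) • (b * a)) =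
        gbr hI (D a) b + sgn k i • gbr hI a (D b) := by
      rw [gbr_apply hI (hd i a ha.mem_gr) hb.mem_gr, gbr_apply hI ha.mem_gr (hd j b hb.mem_gr),
        map_sub, map_smul, hD, hD, tw_one_of_mem hI ha.mem_gr, tw_one_of_mem hI hb.mem_gr, sub_mul,
        mul_sub, sgn_sub, sgn_sub, one_mul, mul_one]
      rcases sgn_cases k (i * j) with e1 | e1 <;> rcases sgn_cases k i with e2 | e2 <;>
        rcases sgn_cases k j with e3 | e3 <;> simp only [e1, e2, e3, mul_sub, sub_mul, mul_one,
          one_smul, neg_smul, mul_neg, neg_neg, mul_assoc, neg_mul, smul_sub, one_mul, smul_neg,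
          sub_neg_eq_add, mul_add, add_mul, smul_add] <;> abel
    rw [this]
    exact add_mem (freeLie_gbr h iha hb.mem) (Submodule.smul_mem _ _ (freeLie_gbr h ha.mem ihb))

end TensorDer

lemma map_tw_tgr {X : Type u} [AddCommGroup X] [Module k X] {gX : ℤ → Submodule k X}
    (hX : DirectSum.IsInternal gX) {n : ℤ} {t : X ⊗[k] X} (ht : t ∈ tgr gX gX n) :
    TensorProduct.map (tw hX 1) (tw hX 1) t = sgn k n • t := by
  refine Submodule.span_induction (p := fun t _ => TensorProduct.map (tw hX 1) (tw hX 1) t =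
    sgn k n • t) ?_ (by simp) (fun s t _ _ hs ht => by simp [hs, ht])
    (fun r t _ ht => by rw [map_smul, ht, smul_comm]) ht
  rintro _ ⟨i, j, hij, x, hx, y, hy, rfl⟩
  rw [TensorProduct.map_tmul, tw_one_of_mem hX hx, tw_one_of_mem hX hy, ← hij, sgn_add,
    TensorProduct.smul_tmul_smul]

lemma comul_tw {X : Type u} [AddCommGroup X] [Module k X] {gX : ℤ → Submodule k X}
    (hX : DirectSum.IsInternal gX) (Δ : X →ₗ[k] X ⊗[k] X)
    (hΔ : ∀ n, ∀ x ∈ gX n, Δ x ∈ tgr gX gX n) (x : X) :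
    Δ (tw hX 1 x) = TensorProduct.map (tw hX 1) (tw hX 1) (Δ x) := by
  refine hom_induction hX (p := fun x => Δ (tw hX 1 x) = TensorProduct.map (tw hX 1) (tw hX 1) (Δ x))
    x (fun n x hx => ?_) (fun y z hy hz => by simp [hy, hz])
  rw [tw_one_of_mem hX hx, map_smul, map_tw_tgr hX (hΔ n x hx)]

section

variable (D : NDGCC k)

/-- The grading of the desuspension of `D`: an element of degree `n + 1` of `D` has degree `n`. -/
abbrev NDGCC.sgr (n : ℤ) : Submodule k D.X := D.gr (n + 1)

lemma NDGCC.s_internal : DirectSum.IsInternal D.sgr := shift_internal D.internal 1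

/-- The map `x ⊗ y ↦ (-1) ^ |x| x y` to the tensor algebra. -/
def NDGCC.quad : D.X ⊗[k] D.X →ₗ[k] TensorAlgebra k D.X :=
  LinearMap.mul' k _ ∘ₗ
    TensorProduct.map (TensorAlgebra.ι k ∘ₗ tw D.internal 1) (TensorAlgebra.ι k)

lemma NDGCC.quad_tmul (x y : D.X) : D.quad (x ⊗ₜ y) =
    TensorAlgebra.ι k (tw D.internal 1 x) * TensorAlgebra.ι k y := rfl

/-- The cobar differential on generators: `c ↦ -dc - ∑ (-1) ^ |c'| c' c''`. -/
def NDGCC.cobarδ : D.X →ₗ[k] TensorAlgebra k D.X :=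
  -(TensorAlgebra.ι k ∘ₗ D.d) - D.quad ∘ₗ D.comul

/-- The cobar differential. -/
def NDGCC.cobarD : TensorAlgebra k D.X →ₗ[k] TensorAlgebra k D.X :=
  tensorDer D.s_internal 1 D.cobarδ

lemma NDGCC.cobarD_isDer : IsDer (tensor_isGen D.s_internal).grInternal 1 D.cobarD :=
  tensorDer_isDer _ _ _

lemma NDGCC.cobarD_ι (x : D.X) : D.cobarD (TensorAlgebra.ι k x) =
    -TensorAlgebra.ι k (D.d x) - D.quad (D.comul x) := tensorDer_ι _ _ _ x

lemma NDGCC.quad_mem {n : ℤ} {t : D.X ⊗[k] D.X} (ht : t ∈ tgr D.gr D.gr n) :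
    D.quad t ∈ monoGr D.sgr (TensorAlgebra.ι k) (n - 2) := by
  suffices h : tgr D.gr D.gr n ≤ (monoGr D.sgr (TensorAlgebra.ι k) (n - 2)).comap D.quad from h ht
  refine Submodule.span_le.2 ?_
  rintro _ ⟨i, j, hij, x, hx, y, hy, rfl⟩
  have h1 : TensorAlgebra.ι k (tw D.internal 1 x) ∈ monoGr D.sgr (TensorAlgebra.ι k) (i - 1) :=
    monoGr_ι (by simpa [NDGCC.sgr] using tw_mem D.internal 1 hx)
  have h2 : TensorAlgebra.ι k y ∈ monoGr D.sgr (TensorAlgebra.ι k) (j - 1) :=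
    monoGr_ι (by simpa [NDGCC.sgr] using hy)
  have := monoGr_mul h1 h2
  rwa [show i - 1 + (j - 1) = n - 2 by omega] at this

lemma NDGCC.cobarD_mem : ∀ n, ∀ a ∈ monoGr D.sgr (TensorAlgebra.ι k) n,
    D.cobarD a ∈ monoGr D.sgr (TensorAlgebra.ι k) (n - 1) := by
  have := D.cobarD_isDer.mem (m := -1) (fun n x hx => by
    rw [D.cobarD_ι]
    refine sub_mem (neg_mem (monoGr_ι ?_)) ?_
    · have := D.d_mem _ x hx
      rwa [show n + 1 - 1 = n + -1 + 1 by ring] at this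
    · have := D.quad_mem (D.comul_mem _ x hx)
      rwa [show n + 1 - 2 = n + -1 by ring] at this)
  simpa [sub_eq_add_neg] using this

lemma NDGCC.tw_ι (x : D.X) : tw (tensor_isGen D.s_internal).grInternal 1 (TensorAlgebra.ι k x) =
    -TensorAlgebra.ι k (tw D.internal 1 x) := by
  refine hom_induction D.internal (p := fun x => tw (tensor_isGen D.s_internal).grInternal 1
    (TensorAlgebra.ι k x) = -TensorAlgebra.ι k (tw D.internal 1 x)) x (fun n x hx => ?_)
    (fun y z hy hz => by simp only [map_add, hy, hz, neg_add])
  have h1 : TensorAlgebra.ι k x ∈ monoGr D.sgr (TensorAlgebra.ι k) (n - 1) :=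
    monoGr_ι (by simpa [NDGCC.sgr] using hx)
  rw [tw_one_of_mem _ h1, tw_one_of_mem _ hx, sgn_sub, sgn_one, map_smul]
  simp

/-- The map `x ⊗ y ⊗ z ↦ (-1) ^ |y| x y z`. -/
def NDGCC.cubic : D.X ⊗[k] (D.X ⊗[k] D.X) →ₗ[k] TensorAlgebra k D.X :=
  LinearMap.mul' k _ ∘ₗ TensorProduct.map (TensorAlgebra.ι k) D.quad

lemma NDGCC.cobar_aux1 (t : D.X ⊗[k] D.X) :
    LinearMap.mul' k _ (TensorProduct.map (D.quad ∘ₗ D.comul ∘ₗ tw D.internal 1) (TensorAlgebra.ι k) t) =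
      D.cubic (TensorProduct.assoc k _ _ _ (D.comul.rTensor _ t)) := by
  induction t with
  | zero => simp
  | add s t hs ht => simp only [map_add, hs, ht]
  | tmul x y =>
    simp only [TensorProduct.map_tmul, LinearMap.comp_apply, LinearMap.rTensor_tmul,
      comul_tw D.internal D.comul D.comul_mem]
    induction (D.comul x) with
    | zero => simp
    | add s t hs ht => simp only [map_add, TensorProduct.add_tmul, hs, ht]
    | tmul a b => simp [NDGCC.cubic, NDGCC.quad_tmul, tw_tw, mul_assoc]

lemma NDGCC.cobar_aux2 (t : D.X ⊗[k] D.X) :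
    LinearMap.mul' k _ (TensorProduct.map (TensorAlgebra.ι k) (D.quad ∘ₗ D.comul) t) =
      D.cubic (D.comul.lTensor _ t) := by
  induction t with
  | zero => simp
  | add s t hs ht => simp only [map_add, hs, ht]
  | tmul x y => simp [NDGCC.cubic]

lemma NDGCC.cobarD_quad (t : D.X ⊗[k] D.X) : D.cobarD (D.quad t) =
    D.quad (TensorProduct.map D.d LinearMap.id t + TensorProduct.map (tw D.internal 1) D.d t) -
      D.cubic (TensorProduct.assoc k _ _ _ (D.comul.rTensor _ t)) +
      D.cubic (D.comul.lTensor _ t) := by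
  rw [← D.cobar_aux1, ← D.cobar_aux2]
  induction t with
  | zero => simp
  | add s t hs ht => simp only [map_add, hs, ht]; noncomm_ring
  | tmul x y =>
    simp only [NDGCC.quad_tmul, D.cobarD_isDer _ _, D.cobarD_ι, D.tw_ι, TensorProduct.map_tmul,
      map_add, LinearMap.comp_apply, tw_tw, tw_d D.internal D.d D.d_mem, LinearMap.id_apply,
      LinearMap.mul'_apply, map_neg]
    noncomm_ring

lemma NDGCC.cobarD_sq_ι (x : D.X) : D.cobarD (D.cobarD (TensorAlgebra.ι k x)) = 0 := by
  rw [D.cobarD_ι, map_sub, map_neg, D.cobarD_ι, D.cobarD_quad, D.d_sq, D.comul_d, D.coassoc]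
  simp only [map_zero]
  noncomm_ring

/-- The cobar differential is `-dc - (1 / 2) ∑ (-1) ^ |c'| [c', c'']` on generators. -/
lemma NDGCC.cobarD_ι_mem [CharZero k] (x : D.X) :
    D.cobarD (TensorAlgebra.ι k x) ∈ freeLie D.sgr := by
  rw [D.cobarD_ι]
  refine sub_mem (neg_mem (ι_mem_freeLie D.s_internal _)) ?_
  have h2 : ∀ t, D.quad (t + swap D.internal t) ∈ freeLie D.sgr := by
    intro t
    have h : D.quad ∘ₗ (LinearMap.id + swap D.internal) =
        TensorProduct.lift (gbr (tensor_isGen D.s_internal).grInternal) ∘ₗ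
          TensorProduct.map (TensorAlgebra.ι k ∘ₗ tw D.internal 1) (TensorAlgebra.ι k) := by
      refine tensor_ext_gr D.internal D.internal fun i j x hx y hy => ?_
      have hx1 : TensorAlgebra.ι k (tw D.internal 1 x) ∈ monoGr D.sgr (TensorAlgebra.ι k) (i - 1) :=
        monoGr_ι (by simpa [NDGCC.sgr] using tw_mem D.internal 1 hx)
      have hy1 : TensorAlgebra.ι k y ∈ monoGr D.sgr (TensorAlgebra.ι k) (j - 1) :=
        monoGr_ι (by simpa [NDGCC.sgr] using hy)
      simp only [LinearMap.comp_apply, LinearMap.add_apply, LinearMap.id_apply, map_add,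
        swap_tmul D.internal hx hy, TensorProduct.map_tmul, TensorProduct.lift.tmul, map_smul,
        NDGCC.quad_tmul]
      rw [gbr_apply _ hx1 hy1, show (i - 1) * (j - 1) = i * j - i - j + 1 by ring, sgn_add, sgn_sub,
        sgn_sub, sgn_one, tw_one_of_mem D.internal hx, tw_one_of_mem D.internal hy]
      rcases sgn_cases k (i * j) with e1 | e1 <;> rcases sgn_cases k i with e2 | e2 <;>
        rcases sgn_cases k j with e3 | e3 <;> simp [e1, e2, e3, sub_eq_add_neg]
    have h' : D.quad (t + swap D.internal t) = _ := LinearMap.congr_fun h t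
    rw [h']
    clear h' h
    induction t with
    | zero => simp
    | add s t hs ht => rw [map_add]; exact add_mem hs ht
    | tmul a b =>
      simp only [LinearMap.comp_apply, TensorProduct.map_tmul, TensorProduct.lift.tmul]
      exact freeLie_gbr D.s_internal (ι_mem_freeLie D.s_internal _) (ι_mem_freeLie D.s_internal _)
  have h3 := h2 (D.comul x)
  rw [D.cocomm, ← two_smul k, map_smul] at h3
  have h4 := Submodule.smul_mem _ (2⁻¹ : k) h3
  rwa [smul_smul, inv_mul_cancel₀ two_ne_zero, one_smul] at h4

/-- The cobar construction `Ω_Comm`: the free graded Lie algebra on the desuspension of `D`, with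
the differential `c ↦ -dc - (1 / 2) ∑ (-1) ^ |c'| [c', c'']`. -/
def NDGCC.omegaComm [CharZero k] : DGLA k :=
  (commLie (tensor_isGen D.s_internal).grInternal (fun _ _ _ hx _ hy => monoGr_mul hx hy) D.cobarD
    D.cobarD_isDer D.cobarD_mem
    (D.cobarD_isDer.sq_zero tensor_adjoin D.cobarD_mem D.cobarD_sq_ι)).sub (freeLie D.sgr)
    (freeLie_proj D.s_internal) (freeLie_der D.s_internal D.cobarD_isDer D.cobarD_mem
      D.cobarD_ι_mem) (fun _ hx _ hy => freeLie_gbr D.s_internal hx hy)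

/-- The cobar construction `Ω_Comm(C)` of a coaugmented cocommutative coalgebra. -/
def DGCC.omegaComm [CharZero k] (C : DGCC k) : DGLA k := C.reduced.omegaComm

end

end Cobar

/-! ### Representation algebras -/

section Rep

variable {k : Type u} [Field k]

lemma proj_map {X Y : Type u} [AddCommGroup X] [Module k X] [AddCommGroup Y] [Module k Y]
    {gX : ℤ → Submodule k X} {gY : ℤ → Submodule k Y} (hX : DirectSum.IsInternal gX)
    (hY : DirectSum.IsInternal gY) (m : ℤ) (f : X →ₗ[k] Y)
    (hf : ∀ n, ∀ x ∈ gX n, f x ∈ gY (n + m)) (n : ℤ) (x : X) :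
    f (proj hX n x) = proj hY (n + m) (f x) := by
  refine hom_induction hX (p := fun x => f (proj hX n x) = proj hY (n + m) (f x)) x
    (fun i x hx => ?_) (fun y z hy hz => by simp [hy, hz])
  by_cases e : i = n
  · subst e; rw [proj_of_mem hX hx, proj_of_mem hY (hf i x hx)]
  · rw [proj_of_ne hX hx e, proj_of_ne hY (hf i x hx) (by omega), map_zero]

/-- A graded subalgebra closed under the differential. -/
def ADGCA.sub (A : ADGCA k) (S : Subalgebra k A.X) (hp : ∀ n, ∀ x ∈ S, proj A.internal n x ∈ S)
    (hd : ∀ x ∈ S, A.d x ∈ S) : ADGCA k where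
  X := S
  gr n := (A.gr n).comap S.val.toLinearMap
  internal := sub_internal A.internal (Subalgebra.toSubmodule S) hp
  one_mem := A.one_mem
  mul_mem i j x hx y hy := A.mul_mem i j x hx y hy
  mul_comm i j x hx y hy := Subtype.ext (A.mul_comm i j x hx y hy)
  d := A.d.restrict (p := Subalgebra.toSubmodule S) (q := Subalgebra.toSubmodule S) hd
  d_mem n x hx := A.d_mem n x hx
  d_sq x := Subtype.ext (A.d_sq x)
  d_leibniz i x hx y := Subtype.ext (A.d_leibniz i x hx y)
  aug := A.aug.comp S.val
  aug_d x := A.aug_d x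
  aug_gr n hn x hx := A.aug_gr n hn x hx

lemma IsDer.map_algebraMap {A : Type u} [Ring A] [Algebra k A] {gA : ℤ → Submodule k A}
    {hA : DirectSum.IsInternal gA} {e : ℤ} {D : A →ₗ[k] A} (hD : IsDer hA e D)
    (h1 : (1 : A) ∈ gA 0) (r : k) : D (algebraMap k A r) = 0 := by
  rw [Algebra.algebraMap_eq_smul_one, map_smul, hD.map_one h1, smul_zero]

/-- The algebra of invariants of a family of derivations of degree zero commuting with the
differential. -/
def ADGCA.invariants (A : ADGCA k) {Y : Type u} (θ : Y → A.X →ₗ[k] A.X)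
    (hθ : ∀ y, IsDer A.internal 0 (θ y)) (hm : ∀ y n, ∀ x ∈ A.gr n, θ y x ∈ A.gr n)
    (hc : ∀ y x, A.d (θ y x) = θ y (A.d x)) : ADGCA k :=
  A.sub
    { carrier := {a | ∀ y, θ y a = 0}
      mul_mem' := fun {a b} ha hb y => by rw [hθ y a b, ha y, hb y, zero_mul, mul_zero, add_zero]
      add_mem' := fun {a b} ha hb y => by rw [map_add, ha y, hb y, add_zero]
      algebraMap_mem' := fun r y => (hθ y).map_algebraMap A.one_mem r }
    (fun n a ha y => by
      rw [proj_map A.internal A.internal 0 (θ y) (by simpa using hm y) n a, ha y, map_zero])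
    (fun a ha y => by rw [← hc, ha y, map_zero])

/-- The algebra of the elements which are annihilated, together with their differentials, by a
family of derivations of odd degree `m`. -/
def ADGCA.basic (A : ADGCA k) {Y : Type u} (θ : Y → A.X →ₗ[k] A.X) (m : ℤ)
    (hθ : ∀ y, IsDer A.internal 1 (θ y)) (hm : ∀ y n, ∀ x ∈ A.gr n, θ y x ∈ A.gr (n + m)) :
    ADGCA k :=
  A.sub
    { carrier := {a | ∀ y, θ y a = 0 ∧ θ y (A.d a) = 0}
      mul_mem' := fun {a b} ha hb y => by
        have h1 : ∀ x, θ y x = 0 → θ y (tw A.internal 1 x) = 0 := fun x hx => by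
          have := tw_map A.internal A.internal m (θ y) (hm y) 1 x
          rw [hx, map_zero] at this
          rcases sgn_cases k (1 * m) with e | e <;> rw [e] at this
          · rw [one_smul] at this; exact this.symm
          · rw [neg_smul, one_smul, eq_comm, neg_eq_zero] at this; exact this
        have h2 : θ y (A.d (tw A.internal 1 a)) = 0 := by
          have := tw_d A.internal A.d A.d_mem a
          rw [← neg_eq_iff_eq_neg] at this
          rw [← this, map_neg, h1 _ (ha y).2, neg_zero]
        refine ⟨by rw [hθ y a b, (ha y).1, (hb y).1, zero_mul, mul_zero, add_zero], ?_⟩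
        rw [A.d_mul, map_add, hθ y, hθ y, (ha y).2, (hb y).1, (hb y).2, h1 a (ha y).1]
        simp
      add_mem' := fun {a b} ha hb y =>
        ⟨by rw [map_add, (ha y).1, (hb y).1, add_zero],
          by rw [map_add, map_add, (ha y).2, (hb y).2, add_zero]⟩
      algebraMap_mem' := fun r y => ⟨(hθ y).map_algebraMap A.one_mem r, by
        rw [Algebra.algebraMap_eq_smul_one, map_smul, A.d_one, smul_zero, map_zero]⟩ }
    (fun n a ha y => by
      refine ⟨by rw [proj_map A.internal A.internal m (θ y) (hm y) n a, (ha y).1, map_zero], ?_⟩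
      rw [proj_map A.internal A.internal (-1) A.d (by simpa [sub_eq_add_neg] using A.d_mem) n a,
        proj_map A.internal A.internal m (θ y) (hm y), (ha y).2, map_zero])
    (fun a ha y => ⟨(ha y).2, by rw [A.d_sq, map_zero]⟩)

section TGen

variable (M X Y : Type u) [AddCommGroup M] [Module k M] [AddCommGroup X] [Module k X]
  [AddCommGroup Y] [Module k Y]

variable (k) in
/-- The tensor product `M ⊗ X` of a vector space `M` and a graded vector space `X`, where `M` is
in degree zero. -/
def TGen : Type u := M ⊗[k] X

instance : AddCommGroup (TGen k M X) := inferInstanceAs (AddCommGroup (M ⊗[k] X))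

instance : Module k (TGen k M X) := inferInstanceAs (Module k (M ⊗[k] X))

variable (k) in
/-- The element `m ⊗ x`. -/
def TGen.mk : M →ₗ[k] X →ₗ[k] TGen k M X := TensorProduct.mk k M X

variable {X Y}

/-- The grading of `M ⊗ X`. -/
def TGen.gr (gr : ℤ → Submodule k X) (n : ℤ) : Submodule k (TGen k M X) := lgr M gr n

variable {M}

/-- Linear maps out of `M ⊗ X`. -/
def TGen.lift (f : M →ₗ[k] X →ₗ[k] Y) : TGen k M X →ₗ[k] Y := TensorProduct.lift f

lemma TGen.lift_mk (f : M →ₗ[k] X →ₗ[k] Y) (m : M) (x : X) :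
    TGen.lift f (TGen.mk k M X m x) = f m x := TensorProduct.lift.tmul m x

lemma TGen.induction {p : TGen k M X → Prop} (t : TGen k M X) (zero : p 0)
    (mk : ∀ m x, p (TGen.mk k M X m x)) (add : ∀ s t, p s → p t → p (s + t)) : p t :=
  TensorProduct.induction_on t zero mk add

variable {M' X' : Type u} [AddCommGroup M'] [Module k M'] [AddCommGroup X'] [Module k X']

/-- The tensor product of linear maps. -/
def TGen.map (f : M →ₗ[k] M') (h : X →ₗ[k] X') : TGen k M X →ₗ[k] TGen k M' X' :=
  TensorProduct.map f h

lemma TGen.map_mk (f : M →ₗ[k] M') (h : X →ₗ[k] X') (m : M) (x : X) :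
    TGen.map f h (TGen.mk k M X m x) = TGen.mk k M' X' (f m) (h x) := TensorProduct.map_tmul f h m x

lemma TGen.ext {f h : TGen k M X →ₗ[k] Y}
    (H : ∀ m x, f (TGen.mk k M X m x) = h (TGen.mk k M X m x)) : f = h := TensorProduct.ext' H

lemma TGen.map_map {M'' X'' : Type u} [AddCommGroup M''] [Module k M''] [AddCommGroup X'']
    [Module k X''] (f : M →ₗ[k] M') (h : X →ₗ[k] X') (f' : M' →ₗ[k] M'') (h' : X' →ₗ[k] X'')
    (t : TGen k M X) : TGen.map f' h' (TGen.map f h t) = TGen.map (f' ∘ₗ f) (h' ∘ₗ h) t :=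
  LinearMap.congr_fun (TensorProduct.map_comp f' h' f h).symm t

lemma TGen.map_zero_right (f : M →ₗ[k] M') (t : TGen k M X) :
    TGen.map f (0 : X →ₗ[k] X') t = 0 :=
  LinearMap.congr_fun (TensorProduct.map_zero_right f) t

variable {gr : ℤ → Submodule k X}

lemma TGen.internal (h : DirectSum.IsInternal gr) (M : Type u) [AddCommGroup M] [Module k M] :
    DirectSum.IsInternal (TGen.gr M gr) := lgr_internal h M

lemma TGen.mk_mem (m : M) {n : ℤ} {x : X} (hx : x ∈ gr n) : TGen.mk k M X m x ∈ TGen.gr M gr n :=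
  tmul_mem_lgr m hx

lemma TGen.gr_induction {n : ℤ} {p : TGen k M X → Prop} {t : TGen k M X} (ht : t ∈ TGen.gr M gr n)
    (zero : p 0) (mk : ∀ m, ∀ x ∈ gr n, p (TGen.mk k M X m x))
    (add : ∀ s t, p s → p t → p (s + t)) : p t := lgr_induction ht zero mk add

lemma TGen.map_mem {gr' : ℤ → Submodule k X'} (f : M →ₗ[k] M') (h : X →ₗ[k] X') (m : ℤ)
    (hh : ∀ n, ∀ x ∈ gr n, h x ∈ gr' (n + m)) {n : ℤ} {t : TGen k M X} (ht : t ∈ TGen.gr M gr n) :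
    TGen.map f h t ∈ TGen.gr M' gr' (n + m) :=
  TGen.gr_induction (p := fun t => TGen.map f h t ∈ TGen.gr M' gr' (n + m)) ht (by simp)
    (fun a x hx => by rw [TGen.map_mk]; exact TGen.mk_mem _ (hh n x hx))
    (fun s t hs ht => by rw [map_add]; exact add_mem hs ht)

lemma TGen.tw_mk (h : DirectSum.IsInternal gr) (i : ℤ) (m : M) (x : X) :
    tw (TGen.internal h M) i (TGen.mk k M X m x) = TGen.mk k M X m (tw h i x) := by
  refine hom_induction h (p := fun x => tw (TGen.internal h M) i (TGen.mk k M X m x) =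
    TGen.mk k M X m (tw h i x)) x (fun n x hx => ?_) (fun y z hy hz => by simp only [map_add, hy, hz])
  rw [tw_of_mem h i hx, tw_of_mem _ i (TGen.mk_mem m hx), map_smul]

end TGen

variable {g : Type u} [LieRing g] [LieAlgebra k g] [Module.Finite k g]

variable (k g) in
/-- The bracket of a Lie algebra as a bilinear map. -/
def brLin : g →ₗ[k] g →ₗ[k] g :=
  LinearMap.mk₂ k (fun x y => ⁅x, y⁆) add_lie smul_lie lie_add lie_smul

/-- The cobracket of the dual Lie coalgebra `g^*`, dual to the bracket: under the isomorphism
`g^* ⊗ g^* ≅ (g ⊗ g)^*`, it is `φ ↦ (x ⊗ y ↦ φ [x, y])`. -/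
def coLie : Module.Dual k g →ₗ[k] Module.Dual k g ⊗[k] Module.Dual k g :=
  (TensorProduct.dualDistribEquiv k g g).symm.toLinearMap ∘ₗ (TensorProduct.lift (brLin k g)).dualMap

lemma dualDistribEquiv_eq {V W : Type u} [AddCommGroup V] [Module k V] [Module.Finite k V]
    [AddCommGroup W] [Module k W] [Module.Finite k W] (t : Module.Dual k V ⊗[k] Module.Dual k W) :
    TensorProduct.dualDistribEquiv k V W t = TensorProduct.dualDistrib k V W t := rfl

lemma dualDistrib_inj {s t : Module.Dual k g ⊗[k] Module.Dual k g}
    (h : ∀ x y, TensorProduct.dualDistrib k g g s (x ⊗ₜ y) =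
      TensorProduct.dualDistrib k g g t (x ⊗ₜ y)) : s = t := by
  refine (TensorProduct.dualDistribEquiv k g g).injective ?_
  rw [dualDistribEquiv_eq, dualDistribEquiv_eq]
  exact TensorProduct.ext' h

lemma coLie_spec (φ : Module.Dual k g) (x y : g) :
    TensorProduct.dualDistrib k g g (coLie φ) (x ⊗ₜ y) = φ ⁅x, y⁆ := by
  rw [← dualDistribEquiv_eq, coLie, LinearMap.comp_apply, LinearEquiv.coe_coe,
    LinearEquiv.apply_symm_apply]
  rfl

/-- The operator `φ ↦ φ ∘ ad y` on `g^*`. -/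
def coad (y : g) : Module.Dual k g →ₗ[k] Module.Dual k g := (brLin k g y).dualMap

lemma coad_apply (y : g) (φ : Module.Dual k g) (x : g) : coad y φ x = φ ⁅y, x⁆ := rfl

lemma coLie_coad (y : g) (φ : Module.Dual k g) : coLie (coad y φ) =
    (coad y).rTensor _ (coLie φ) + (coad y).lTensor _ (coLie φ) := by
  refine dualDistrib_inj fun a b => ?_
  have h1 : ∀ t : Module.Dual k g ⊗[k] Module.Dual k g,
      TensorProduct.dualDistrib k g g ((coad y).rTensor _ t) (a ⊗ₜ b) =
        TensorProduct.dualDistrib k g g t (⁅y, a⁆ ⊗ₜ b) := by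
    intro t
    induction t with
    | zero => simp
    | add s t hs ht => simp only [map_add, LinearMap.add_apply, hs, ht]
    | tmul p q => simp [coad_apply]
  have h2 : ∀ t : Module.Dual k g ⊗[k] Module.Dual k g,
      TensorProduct.dualDistrib k g g ((coad y).lTensor _ t) (a ⊗ₜ b) =
        TensorProduct.dualDistrib k g g t (a ⊗ₜ ⁅y, b⁆) := by
    intro t
    induction t with
    | zero => simp
    | add s t hs ht => simp only [map_add, LinearMap.add_apply, hs, ht]
    | tmul p q => simp [coad_apply]
  rw [map_add, LinearMap.add_apply, h1, h2, coLie_spec, coLie_spec, coLie_spec, coad_apply,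
    leibniz_lie, map_add]

section

variable (g) (L : DGLA k)

/-- The map `φ ⊗ ψ ↦ (φ ⊗ ξ) (ψ ⊗ η)`. -/
def repProd (ξ η : L.X) : Module.Dual k g ⊗[k] Module.Dual k g →ₗ[k]
    TensorAlgebra k (TGen k (Module.Dual k g) L.X) :=
  LinearMap.mul' k _ ∘ₗ TensorProduct.map
    (TensorAlgebra.ι k ∘ₗ (TGen.mk k (Module.Dual k g) L.X).flip ξ)
    (TensorAlgebra.ι k ∘ₗ (TGen.mk k (Module.Dual k g) L.X).flip η)

/-- The relations `φ ⊗ [ξ, η] = ∑ (φ' ⊗ ξ) (φ'' ⊗ η)`, where `∑ φ' ⊗ φ''` is the cobracket of `φ`. -/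
inductive RepRel : TensorAlgebra k (TGen k (Module.Dual k g) L.X) → TensorAlgebra k (TGen k (Module.Dual k g) L.X) → Prop
  | mk {i j : ℤ} {ξ η : L.X} (hξ : ξ ∈ L.gr i) (hη : η ∈ L.gr j) (φ : Module.Dual k g) :
      RepRel (TensorAlgebra.ι k (TGen.mk k _ L.X φ (L.br ξ η))) (repProd g L ξ η (coLie φ))

/-- The grading of the generators `g^* ⊗ 𝔞`. -/
abbrev repGr : ℤ → Submodule k (TGen k (Module.Dual k g) L.X) := TGen.gr (Module.Dual k g) L.gr

lemma repGr_internal : DirectSum.IsInternal (repGr g L) := TGen.internal L.internal _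

variable {g}

lemma repProd_mem {i j : ℤ} {ξ η : L.X} (hξ : ξ ∈ L.gr i) (hη : η ∈ L.gr j)
    (t : Module.Dual k g ⊗[k] Module.Dual k g) :
    repProd g L ξ η t ∈ monoGr (repGr g L) (TensorAlgebra.ι k) (i + j) := by
  induction t with
  | zero => simp
  | add s t hs ht => rw [map_add]; exact add_mem hs ht
  | tmul φ ψ => exact monoGr_mul (monoGr_ι (TGen.mk_mem φ hξ)) (monoGr_ι (TGen.mk_mem ψ hη))

lemma repRel_hom : HomRel (repGr g L) (RepRel g L) := by
  rintro _ _ ⟨hξ, hη, φ⟩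
  exact ⟨_, monoGr_ι (TGen.mk_mem φ (L.br_mem _ _ _ hξ _ hη)), repProd_mem L hξ hη _⟩

variable (g)

/-- The underlying graded algebra of the representation algebra. -/
abbrev RepAlg : Type u := Pres (repGr g L) (RepRel g L)

variable {g}

lemma rep_rel {i j : ℤ} {ξ η : L.X} (hξ : ξ ∈ L.gr i) (hη : η ∈ L.gr j) (φ : Module.Dual k g) :
    Pres.gen (repGr g L) (RepRel g L) (TGen.mk k _ L.X φ (L.br ξ η)) =
      Pres.mk (repGr g L) (RepRel g L) (repProd g L ξ η (coLie φ)) :=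
  Pres.mk_rel (RepRel.mk hξ hη φ)

lemma rep_dData : Pres.DerData (repGr_internal g L) (repRel_hom L) 1 (-1)
    (Pres.gen (repGr g L) (RepRel g L) ∘ₗ TGen.map (LinearMap.id : Module.Dual k g →ₗ[k] _) L.d) where
  even := by decide
  mem n v hv := by
    refine monoGr_ι (TGen.gr_induction (p := fun v => TGen.map (LinearMap.id : Module.Dual k g →ₗ[k] _) L.d v ∈
      TGen.gr (Module.Dual k g) L.gr (n + -1)) hv (by simp) (fun m x hx => ?_)
      (fun s t hs ht => by rw [map_add]; exact add_mem hs ht))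
    rw [TGen.map_mk]
    exact TGen.mk_mem m (L.d_mem n x hx)
  rel := by
    rintro _ _ ⟨hξ, hη, φ⟩
    rename_i i j ξ η
    rw [Pres.derT_ι, LinearMap.comp_apply, TGen.map_mk, LinearMap.id_apply, L.br_leibniz i j ξ hξ η hη,
      map_add, map_smul, map_add, map_smul,
      rep_rel L (L.d_mem _ _ hξ) hη, rep_rel L hξ (L.d_mem _ _ hη)]
    induction (coLie φ) with
    | zero => simp [Pres.derT_zero]
    | add s t hs ht =>
      rw [map_add (repProd g L ξ η), Pres.derT_add, ← hs, ← ht]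
      simp only [map_add, smul_add]
      abel
    | tmul p q =>
      have e : tw (Pres.isGen (repGr_internal g L) (repRel_hom L)).grInternal 1
          (Pres.gen (repGr g L) (RepRel g L) (TGen.mk k _ L.X p ξ)) =
          sgn k i • Pres.gen (repGr g L) (RepRel g L) (TGen.mk k _ L.X p ξ) :=
        tw_one_of_mem _ (monoGr_ι (TGen.mk_mem p hξ))
      simp [repProd, Pres.derT_mul, Pres.derT_ι, Pres.mk_ι, e, TGen.map_mk]

variable (g) in
/-- The representation algebra `𝔞_g`: the graded commutative algebra generated by `g^* ⊗ 𝔞` with the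
relations `φ ⊗ [ξ, η] = ∑ (φ' ⊗ ξ) (φ'' ⊗ η)`, with the differential induced by that of `𝔞`, and with
the augmentation corresponding to the zero representation. -/
def rep : ADGCA k :=
  ADGCA.ofGen (Pres.isGen (repGr_internal g L) (repRel_hom L)) Pres.gen_comm
    (Pres.der (rep_dData L)) (Pres.der_isDer _)
    (fun n v hv => by
      rw [Pres.der_gen]
      exact (rep_dData L).mem n v hv)
    (fun v => by
      rw [Pres.der_gen, LinearMap.comp_apply, Pres.der_gen, LinearMap.comp_apply,
        TGen.map_map, show L.d ∘ₗ L.d = 0 from LinearMap.ext L.d_sq, TGen.map_zero_right, map_zero])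
    (Pres.aug (by
      rintro _ _ ⟨hξ, hη, φ⟩
      rw [TensorAlgebra.lift_ι_apply]
      induction (coLie φ) with
      | zero => simp
      | add s t hs ht => rw [map_add, map_add, ← hs, ← ht]; simp
      | tmul p q => simp [repProd]))
    (fun v => Pres.aug_gen _ v)
    (fun v => by rw [Pres.der_gen]; exact Pres.aug_gen _ _)

lemma rep_actData (y : g) : Pres.DerData (repGr_internal g L) (repRel_hom L) 0 0
    (Pres.gen (repGr g L) (RepRel g L) ∘ₗ TGen.map (coad y) (LinearMap.id : L.X →ₗ[k] _)) where
  even := by decide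
  mem n v hv := by
    refine monoGr_ι (TGen.gr_induction (p := fun v => TGen.map (coad y) (LinearMap.id : L.X →ₗ[k] _) v ∈
      TGen.gr (Module.Dual k g) L.gr (n + 0)) hv (by simp) (fun m x hx => ?_)
      (fun s t hs ht => by rw [map_add]; exact add_mem hs ht))
    rw [TGen.map_mk, LinearMap.id_apply, add_zero]
    exact TGen.mk_mem _ hx
  rel := by
    rintro _ _ ⟨hξ, hη, φ⟩
    rename_i i j ξ η
    rw [Pres.derT_ι, LinearMap.comp_apply, TGen.map_mk, LinearMap.id_apply, rep_rel L hξ hη, coLie_coad]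
    induction (coLie φ) with
    | zero => simp [Pres.derT_zero]
    | add s t hs ht =>
      rw [map_add (repProd g L ξ η) s t, Pres.derT_add, ← hs, ← ht]
      simp only [map_add]
      abel
    | tmul p q => simp [repProd, Pres.derT_mul, Pres.derT_ι, Pres.mk_ι, tw_zero, TGen.map_mk]

/-- The derivation of the representation algebra by which `y ∈ g` acts: on generators, it is
`φ ⊗ ξ ↦ (φ ∘ ad y) ⊗ ξ`. -/
def repAct (y : g) : RepAlg g L →ₗ[k] RepAlg g L := Pres.der (rep_actData L y)

lemma repAct_mem (y : g) : ∀ n, ∀ a ∈ (rep g L).gr n, repAct L y a ∈ (rep g L).gr n := by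
  intro n a ha
  have := Pres.der_mem (rep_actData L y) n a ha
  rwa [add_zero] at this

lemma repAct_d (y : g) (a : RepAlg g L) :
    (rep g L).d (repAct L y a) = repAct L y ((rep g L).d a) := by
  refine IsDer.comm (Pres.isGen (repGr_internal g L) (repRel_hom L)).gen
    (Pres.der_isDer (rep_dData L)) (Pres.der_isDer (rep_actData L y))
    (by simpa using Pres.der_mem (rep_actData L y)) (fun v => ?_) a
  rw [Pres.der_gen, Pres.der_gen, LinearMap.comp_apply, LinearMap.comp_apply, Pres.der_gen,
    Pres.der_gen, LinearMap.comp_apply, LinearMap.comp_apply, TGen.map_map, TGen.map_map]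
  rfl

variable (g) in
/-- The algebra of invariants `𝔞_g^{ad g}`. -/
def repInv : ADGCA k :=
  (rep g L).invariants (repAct L (g := g)) (fun y => Pres.der_isDer (rep_actData L y))
    (repAct_mem L) (repAct_d L)

end

end Rep

/-! ### The Lie coalgebras `g^*(C)` and their Chevalley-Eilenberg algebras -/

section LieCoalg

variable {k : Type u} [Field k]

section Cyc

variable {X : Type u} [AddCommGroup X] [Module k X] {gX : ℤ → Submodule k X}
  (hX : DirectSum.IsInternal gX)

lemma cyc_tmul {i j l : ℤ} {x y z : X} (hx : x ∈ gX i) (hy : y ∈ gX j) (hz : z ∈ gX l) :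
    cyc hX ((x ⊗ₜ y) ⊗ₜ z) = sgn k ((i + j) * l) • ((z ⊗ₜ[k] x) ⊗ₜ[k] y) := by
  simp only [cyc, LinearMap.comp_apply, LinearEquiv.coe_coe, TensorProduct.assoc_tmul,
    LinearMap.lTensor_tmul, swap_tmul hX hy hz, TensorProduct.tmul_smul, map_smul,
    TensorProduct.assoc_symm_tmul, LinearMap.rTensor_tmul, swap_tmul hX hx hz,
    ← TensorProduct.smul_tmul', smul_smul, ← sgn_add]
  rw [show j * l + i * l = (i + j) * l by ring]

lemma tensor3_ext_gr (hX : DirectSum.IsInternal gX) {Z : Type u} [AddCommGroup Z] [Module k Z] {f h : (X ⊗[k] X) ⊗[k] X →ₗ[k] Z}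
    (H : ∀ i j l, ∀ x ∈ gX i, ∀ y ∈ gX j, ∀ z ∈ gX l, f ((x ⊗ₜ y) ⊗ₜ z) = h ((x ⊗ₜ y) ⊗ₜ z)) :
    f = h := by
  refine TensorProduct.ext (tensor_ext_gr hX hX fun i j x hx y hy => ext_gr hX fun l z hz => ?_)
  exact H i j l x hx y hy z hz

lemma cyc_coassoc (Δ : X →ₗ[k] X ⊗[k] X)
    (ha : ∀ x, TensorProduct.assoc k X X X (Δ.rTensor X (Δ x)) = Δ.lTensor X (Δ x))
    (hc : ∀ x, swap hX (Δ x) = Δ x) (x : X) : cyc hX (Δ.rTensor X (Δ x)) = Δ.rTensor X (Δ x) := by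
  have h1 : (swap hX).lTensor X (Δ.lTensor X (Δ x)) = Δ.lTensor X (Δ x) := by
    rw [← LinearMap.comp_apply, ← LinearMap.lTensor_comp,
      show swap hX ∘ₗ Δ = Δ from LinearMap.ext hc]
  have h2 : (swap hX).rTensor X (Δ.rTensor X (Δ x)) = Δ.rTensor X (Δ x) := by
    rw [← LinearMap.comp_apply, ← LinearMap.rTensor_comp,
      show swap hX ∘ₗ Δ = Δ from LinearMap.ext hc]
  simp only [cyc, LinearMap.comp_apply, LinearEquiv.coe_coe]
  rw [ha, h1, ← ha, LinearEquiv.symm_apply_apply, h2]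

end Cyc

section GStar

variable (k) in
/-- The map `(φ ⊗ ψ), (c ⊗ c') ↦ (φ ⊗ c) ⊗ (ψ ⊗ c')`. -/
def pair (M X : Type u) [AddCommGroup M] [Module k M] [AddCommGroup X] [Module k X] :
    M ⊗[k] M →ₗ[k] X ⊗[k] X →ₗ[k] TGen k M X ⊗[k] TGen k M X :=
  TensorProduct.map₂ (TGen.mk k M X) (TGen.mk k M X)

variable (k) in
/-- The map `(φ ⊗ ψ ⊗ χ), (c ⊗ c' ⊗ c'') ↦ (φ ⊗ c) ⊗ (ψ ⊗ c') ⊗ (χ ⊗ c'')`. -/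
def triple (M X : Type u) [AddCommGroup M] [Module k M] [AddCommGroup X] [Module k X] :
    (M ⊗[k] M) ⊗[k] M →ₗ[k] (X ⊗[k] X) ⊗[k] X →ₗ[k] (TGen k M X ⊗[k] TGen k M X) ⊗[k] TGen k M X :=
  TensorProduct.map₂ (pair k M X) (TGen.mk k M X)

variable {M X : Type u} [AddCommGroup M] [Module k M] [AddCommGroup X] [Module k X]
  {gX : ℤ → Submodule k X}

lemma pair_tmul (p q : M) (a b : X) : pair k M X (p ⊗ₜ q) (a ⊗ₜ b) =
    TGen.mk k M X p a ⊗ₜ TGen.mk k M X q b := by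
  simp [pair]

lemma triple_tmul (u : M ⊗[k] M) (q : M) (w : X ⊗[k] X) (b : X) :
    triple k M X (u ⊗ₜ q) (w ⊗ₜ b) = pair k M X u w ⊗ₜ TGen.mk k M X q b := by
  simp [triple]

lemma swap_pair (hX : DirectSum.IsInternal gX) (u : M ⊗[k] M) (w : X ⊗[k] X) :
    swap (TGen.internal hX M) (pair k M X u w) =
      pair k M X (TensorProduct.comm k M M u) (swap hX w) := by
  induction u with
  | zero => simp
  | add s t hs ht => simp only [map_add, LinearMap.add_apply, hs, ht]
  | tmul p q =>
    have : swap (TGen.internal hX M) ∘ₗ pair k M X (p ⊗ₜ q) = pair k M X (q ⊗ₜ p) ∘ₗ swap hX := by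
      refine tensor_ext_gr hX hX fun i j x hx y hy => ?_
      rw [LinearMap.comp_apply, LinearMap.comp_apply, pair_tmul,
        swap_tmul _ (TGen.mk_mem p hx) (TGen.mk_mem q hy), swap_tmul hX hx hy, map_smul, pair_tmul]
    exact LinearMap.congr_fun this w

variable (k) in
/-- The cyclic permutation `φ ⊗ ψ ⊗ χ ↦ χ ⊗ φ ⊗ ψ`. -/
def cyc₀ (M : Type u) [AddCommGroup M] [Module k M] :
    (M ⊗[k] M) ⊗[k] M →ₗ[k] (M ⊗[k] M) ⊗[k] M :=
  (TensorProduct.assoc k M M M).symm.toLinearMap ∘ₗ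
    (TensorProduct.comm k (M ⊗[k] M) M).toLinearMap

lemma cyc₀_tmul (p q r : M) : cyc₀ k M ((p ⊗ₜ q) ⊗ₜ r) = (r ⊗ₜ p) ⊗ₜ q := rfl

lemma cyc_triple (hX : DirectSum.IsInternal gX) (u : (M ⊗[k] M) ⊗[k] M) (w : (X ⊗[k] X) ⊗[k] X) :
    cyc (TGen.internal hX M) (triple k M X u w) = triple k M X (cyc₀ k M u) (cyc hX w) := by
  have : ∀ p q r : M, cyc (TGen.internal hX M) ∘ₗ triple k M X ((p ⊗ₜ q) ⊗ₜ r) =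
      triple k M X ((r ⊗ₜ p) ⊗ₜ q) ∘ₗ cyc hX := by
    intro p q r
    refine tensor3_ext_gr hX fun i j l x hx y hy z hz => ?_
    rw [LinearMap.comp_apply, LinearMap.comp_apply, triple_tmul, pair_tmul,
      cyc_tmul _ (TGen.mk_mem p hx) (TGen.mk_mem q hy) (TGen.mk_mem r hz), cyc_tmul hX hx hy hz,
      map_smul, triple_tmul, pair_tmul]
  induction u with
  | zero => simp
  | add s t hs ht => simp only [map_add, LinearMap.add_apply, hs, ht]
  | tmul u r =>
    induction u with
    | zero => simp
    | add s t hs ht => simp only [TensorProduct.add_tmul, map_add, LinearMap.add_apply, hs, ht]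
    | tmul p q => exact LinearMap.congr_fun (this p q r) w

variable {g : Type u} [LieRing g] [LieAlgebra k g] [Module.Finite k g]

lemma coLie_skew (φ : Module.Dual k g) :
    TensorProduct.comm k _ _ (coLie φ) = (-1 : k) • coLie φ := by
  refine dualDistrib_inj fun x y => ?_
  have h : ∀ t : Module.Dual k g ⊗[k] Module.Dual k g,
      TensorProduct.dualDistrib k g g (TensorProduct.comm k _ _ t) (x ⊗ₜ y) =
        TensorProduct.dualDistrib k g g t (y ⊗ₜ x) := by
    intro t
    induction t with
    | zero => simp
    | add s t hs ht => simp only [map_add, LinearMap.add_apply, hs, ht]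
    | tmul p q => simp [mul_comm]
  rw [h, map_smul, LinearMap.smul_apply, coLie_spec, coLie_spec, ← lie_skew, map_neg, neg_smul,
    one_smul]

variable (k g) in
/-- The pairing between threefold tensor products. -/
def ev3 : (Module.Dual k g ⊗[k] Module.Dual k g) ⊗[k] Module.Dual k g ≃ₗ[k]
    Module.Dual k ((g ⊗[k] g) ⊗[k] g) :=
  (TensorProduct.congr (TensorProduct.dualDistribEquiv k g g) (LinearEquiv.refl k _)).trans
    (TensorProduct.dualDistribEquiv k (g ⊗[k] g) g)

lemma ev3_tmul (u : Module.Dual k g ⊗[k] Module.Dual k g) (r : Module.Dual k g) (x y z : g) :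
    ev3 k g (u ⊗ₜ r) ((x ⊗ₜ y) ⊗ₜ z) =
      TensorProduct.dualDistrib k g g u (x ⊗ₜ y) * r z := by
  simp only [ev3, LinearEquiv.trans_apply, TensorProduct.congr_tmul, dualDistribEquiv_eq,
    TensorProduct.dualDistrib_apply, LinearEquiv.refl_apply]

lemma ev3_cyc₀ (t : (Module.Dual k g ⊗[k] Module.Dual k g) ⊗[k] Module.Dual k g) (x y z : g) :
    ev3 k g (cyc₀ k _ t) ((x ⊗ₜ y) ⊗ₜ z) = ev3 k g t ((y ⊗ₜ z) ⊗ₜ x) := by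
  induction t with
  | zero => simp
  | add s t hs ht => simp only [map_add, LinearMap.add_apply, hs, ht]
  | tmul u r =>
    induction u with
    | zero => simp
    | add s t hs ht => simp only [TensorProduct.add_tmul, map_add, LinearMap.add_apply, hs, ht]
    | tmul p q =>
      rw [cyc₀_tmul, ev3_tmul, ev3_tmul, TensorProduct.dualDistrib_apply,
        TensorProduct.dualDistrib_apply]
      ring

lemma ev3_coLie (φ : Module.Dual k g) (x y z : g) :
    ev3 k g ((coLie (k := k) (g := g)).rTensor _ (coLie φ)) ((x ⊗ₜ y) ⊗ₜ z) = φ ⁅⁅x, y⁆, z⁆ := by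
  rw [← coLie_spec]
  induction (coLie φ) with
  | zero => simp
  | add s t hs ht => simp only [map_add, LinearMap.add_apply, hs, ht]
  | tmul p q =>
    rw [LinearMap.rTensor_tmul, ev3_tmul, coLie_spec, TensorProduct.dualDistrib_apply]

lemma coLie_jacobi (φ : Module.Dual k g) :
    (coLie (k := k) (g := g)).rTensor _ (coLie φ) + cyc₀ k _ (coLie.rTensor _ (coLie φ)) +
      cyc₀ k _ (cyc₀ k _ (coLie.rTensor _ (coLie φ))) = 0 := by
  refine (ev3 k g).injective ?_
  rw [map_zero]
  refine TensorProduct.ext_threefold fun x y z => ?_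
  rw [map_add, map_add, LinearMap.add_apply, LinearMap.add_apply, ev3_cyc₀, ev3_cyc₀, ev3_cyc₀,
    ev3_coLie, ev3_coLie, ev3_coLie, ← map_add, ← map_add, LinearMap.zero_apply]
  have := lie_jacobi x y z
  rw [← lie_skew x ⁅y, z⁆, ← lie_skew y ⁅z, x⁆, ← lie_skew z ⁅x, y⁆] at this
  have h2 : ⁅⁅x, y⁆, z⁆ + ⁅⁅y, z⁆, x⁆ + ⁅⁅z, x⁆, y⁆ = 0 := by
    rw [← neg_eq_zero, ← this]; abel
  rw [h2, map_zero]

variable (g) (D : NDGCC k)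

/-- The cobracket of `g^*(D)`: `φ ⊗ c ↦ ∑ (φ' ⊗ c') ⊗ (φ'' ⊗ c'')`. -/
def gStarCobr : TGen k (Module.Dual k g) D.X →ₗ[k]
    TGen k (Module.Dual k g) D.X ⊗[k] TGen k (Module.Dual k g) D.X :=
  TGen.lift ((pair k (Module.Dual k g) D.X).compl₁₂ coLie D.comul)

variable {g}

lemma gStarCobr_mk (φ : Module.Dual k g) (c : D.X) :
    gStarCobr g D (TGen.mk k _ _ φ c) = pair k _ _ (coLie φ) (D.comul c) := TGen.lift_mk _ _ _

lemma gStarCobr_pair (u : Module.Dual k g ⊗[k] Module.Dual k g) (w : D.X ⊗[k] D.X) :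
    (gStarCobr g D).rTensor _ (pair k _ _ u w) =
      triple k _ _ (coLie.rTensor _ u) (D.comul.rTensor _ w) := by
  induction u with
  | zero => simp
  | add s t hs ht => simp only [map_add, LinearMap.add_apply, hs, ht]
  | tmul p q =>
    induction w with
    | zero => simp
    | add s t hs ht => simp only [map_add, hs, ht]
    | tmul a b =>
      rw [pair_tmul, LinearMap.rTensor_tmul, gStarCobr_mk, LinearMap.rTensor_tmul,
        LinearMap.rTensor_tmul, triple_tmul]

lemma pair_map (u : M ⊗[k] M) (f h : X →ₗ[k] X) (w : X ⊗[k] X) :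
    TensorProduct.map (TGen.map LinearMap.id f) (TGen.map LinearMap.id h) (pair k M X u w) =
      pair k M X u (TensorProduct.map f h w) := by
  induction u with
  | zero => simp
  | add s t hs ht => simp only [map_add, LinearMap.add_apply, hs, ht]
  | tmul p q =>
    induction w with
    | zero => simp
    | add s t hs ht => simp only [map_add, hs, ht]
    | tmul a b => simp [pair_tmul, TGen.map_mk]

lemma pair_mem {u : M ⊗[k] M} {n : ℤ} {w : X ⊗[k] X} (hw : w ∈ tgr gX gX n) :
    pair k M X u w ∈ tgr (TGen.gr M gX) (TGen.gr M gX) n := by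
  induction u with
  | zero => simp
  | add s t hs ht => rw [map_add, LinearMap.add_apply]; exact add_mem hs ht
  | tmul p q =>
    suffices h : tgr gX gX n ≤ (tgr (TGen.gr M gX) (TGen.gr M gX) n).comap (pair k M X (p ⊗ₜ q))
      from h hw
    refine Submodule.span_le.2 ?_
    rintro _ ⟨i, j, hij, x, hx, y, hy, rfl⟩
    rw [SetLike.mem_coe, Submodule.mem_comap, pair_tmul]
    exact tmul_mem_tgr hij (TGen.mk_mem p hx) (TGen.mk_mem q hy)

variable (g) in
/-- The Lie coalgebra `g^*(D) = g^* ⊗ D` of a cocommutative coalgebra `D`. -/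
def gStar : DGLC k where
  X := TGen k (Module.Dual k g) D.X
  gr := TGen.gr _ D.gr
  internal := TGen.internal D.internal _
  d := TGen.map LinearMap.id D.d
  d_mem n x hx := by
    have := TGen.map_mem (gr' := D.gr) (LinearMap.id : Module.Dual k g →ₗ[k] _) D.d (-1)
      (by simpa [sub_eq_add_neg] using D.d_mem) hx
    rwa [← sub_eq_add_neg] at this
  d_sq x := by
    rw [TGen.map_map, show D.d ∘ₗ D.d = 0 from LinearMap.ext D.d_sq, TGen.map_zero_right]
  cobr := gStarCobr g D
  cobr_mem n x hx := by
    refine TGen.gr_induction (p := fun x => gStarCobr g D x ∈ tgr (TGen.gr _ D.gr)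
      (TGen.gr _ D.gr) n) hx (by simp) (fun φ c hc => ?_)
      (fun s t hs ht => by rw [map_add]; exact add_mem hs ht)
    rw [gStarCobr_mk]
    exact pair_mem (D.comul_mem n c hc)
  cobr_skew x := by
    induction x using TGen.induction with
    | zero => simp
    | add s t hs ht => simp only [map_add, hs, ht, neg_add]
    | mk φ c =>
      rw [gStarCobr_mk, swap_pair D.internal, coLie_skew, D.cocomm, map_smul, LinearMap.smul_apply,
        neg_smul, one_smul]
  cobr_jacobi x := by
    induction x using TGen.induction with
    | zero => simp
    | add s t hs ht =>
      simp only [map_add]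
      rw [← add_zero (0 : _ ⊗[k] _)]
      nth_rewrite 1 [← hs]
      rw [← ht]
      abel
    | mk φ c =>
      rw [gStarCobr_mk, gStarCobr_pair, cyc_triple D.internal, cyc_triple D.internal,
        cyc_coassoc D.internal D.comul D.coassoc D.cocomm,
        cyc_coassoc D.internal D.comul D.coassoc D.cocomm, ← LinearMap.add_apply,
        ← LinearMap.add_apply, ← map_add, ← map_add, coLie_jacobi, map_zero, LinearMap.zero_apply]
  cobr_d x := by
    have htw : tw (TGen.internal D.internal (Module.Dual k g)) 1 =
        TGen.map LinearMap.id (tw D.internal 1) :=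
      TGen.ext fun m x => by rw [TGen.tw_mk, TGen.map_mk]; rfl
    have hid : (LinearMap.id : TGen k (Module.Dual k g) D.X →ₗ[k] _) =
        TGen.map LinearMap.id LinearMap.id := TGen.ext fun m x => by rw [TGen.map_mk]; rfl
    rw [htw, hid]
    induction x using TGen.induction with
    | zero => simp
    | add s t hs ht => simp only [map_add, hs, ht]; abel
    | mk φ c =>
      rw [TGen.map_mk, gStarCobr_mk, gStarCobr_mk, pair_map, pair_map, D.comul_d, map_add]
      rfl

end GStar

section CEc

variable (G : DGLC k)

/-- The grading of the desuspension of `G`: an element of degree `n + 1` of `G` has degree `n`. -/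
abbrev DGLC.sgr (n : ℤ) : Submodule k G.X := G.gr (n + 1)

lemma DGLC.s_internal : DirectSum.IsInternal G.sgr := shift_internal G.internal 1

/-- The graded symmetric algebra on the desuspension of `G`. -/
abbrev DGLC.S : Type u := GSym G.sgr

/-- The generators. -/
abbrev DGLC.s : G.X →ₗ[k] G.S := Pres.gen G.sgr fun _ _ => False

/-- The map `x ⊗ y ↦ (-1) ^ |x| x y`. -/
def DGLC.quad : G.X ⊗[k] G.X →ₗ[k] G.S :=
  LinearMap.mul' k _ ∘ₗ TensorProduct.map (G.s ∘ₗ tw G.internal 1) G.s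

lemma DGLC.quad_tmul (x y : G.X) : G.quad (x ⊗ₜ y) = G.s (tw G.internal 1 x) * G.s y := rfl

/-- The differential on generators, `x ↦ -dx - (1 / 2) ∑ (-1) ^ |x'| x' x''`. -/
def DGLC.ceδ : G.X →ₗ[k] G.S := -(G.s ∘ₗ G.d) - (2⁻¹ : k) • (G.quad ∘ₗ G.cobr)

lemma DGLC.s_mem {i : ℤ} {x : G.X} (hx : x ∈ G.gr i) : G.s x ∈ monoGr G.sgr G.s (i - 1) :=
  monoGr_ι (by simpa [DGLC.sgr] using hx)

lemma DGLC.quad_mem {n : ℤ} {t : G.X ⊗[k] G.X} (ht : t ∈ tgr G.gr G.gr n) :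
    G.quad t ∈ monoGr G.sgr G.s (n - 2) := by
  suffices h : tgr G.gr G.gr n ≤ (monoGr G.sgr G.s (n - 2)).comap G.quad from h ht
  refine Submodule.span_le.2 ?_
  rintro _ ⟨i, j, hij, x, hx, y, hy, rfl⟩
  have := monoGr_mul (G.s_mem (tw_mem G.internal 1 hx)) (G.s_mem hy)
  rwa [show i - 1 + (j - 1) = n - 2 by omega] at this

lemma DGLC.ceData : Pres.DerData G.s_internal homRel_false 1 (-1) G.ceδ :=
  GSym.derData _ (by decide) _ fun n x hx => by
    refine sub_mem (neg_mem (monoGr_ι ?_)) (Submodule.smul_mem _ _ ?_)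
    · have := G.d_mem _ x hx
      rwa [show n + 1 - 1 = n + -1 + 1 by ring] at this
    · have := G.quad_mem (G.cobr_mem _ x hx)
      rwa [show n + 1 - 2 = n + -1 by ring] at this

/-- The differential of the Chevalley-Eilenberg algebra. -/
def DGLC.ceD : G.S →ₗ[k] G.S := Pres.der G.ceData

lemma DGLC.ceD_isDer : IsDer (Pres.isGen G.s_internal homRel_false).grInternal 1 G.ceD :=
  Pres.der_isDer _

lemma DGLC.ceD_s (x : G.X) :
    G.ceD (G.s x) = -G.s (G.d x) - (2⁻¹ : k) • G.quad (G.cobr x) := Pres.der_gen _ x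

lemma DGLC.tw_s (x : G.X) : tw (Pres.isGen G.s_internal homRel_false).grInternal 1 (G.s x) =
    -G.s (tw G.internal 1 x) := by
  refine hom_induction G.internal (p := fun x =>
    tw (Pres.isGen G.s_internal homRel_false).grInternal 1 (G.s x) = -G.s (tw G.internal 1 x)) x
    (fun n x hx => ?_) (fun y z hy hz => by simp only [map_add, hy, hz, neg_add])
  rw [tw_one_of_mem _ (G.s_mem hx), tw_one_of_mem _ hx, sgn_sub, sgn_one, map_smul]
  simp

/-- The map `x ⊗ y ⊗ z ↦ (-1) ^ |y| x y z`. -/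
def DGLC.cubic : (G.X ⊗[k] G.X) ⊗[k] G.X →ₗ[k] G.S :=
  LinearMap.mul' k _ ∘ₗ TensorProduct.map (LinearMap.mul' k _ ∘ₗ
    TensorProduct.map G.s (G.s ∘ₗ tw G.internal 1)) G.s

lemma DGLC.cubic_tmul (x y z : G.X) : G.cubic ((x ⊗ₜ y) ⊗ₜ z) =
    G.s x * G.s (tw G.internal 1 y) * G.s z := rfl

lemma DGLC.cubic_cyc (t : (G.X ⊗[k] G.X) ⊗[k] G.X) : G.cubic (cyc G.internal t) = G.cubic t := by
  have : G.cubic ∘ₗ cyc G.internal = G.cubic := by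
    refine tensor3_ext_gr G.internal fun i j l x hx y hy z hz => ?_
    have e := mono_comm (A := G.S) Pres.gen_comm (G.s_mem hz)
      (monoGr_mul (G.s_mem hx) (G.s_mem hy))
    rw [LinearMap.comp_apply, cyc_tmul G.internal hx hy hz, map_smul, G.cubic_tmul, G.cubic_tmul,
      tw_one_of_mem G.internal hx, tw_one_of_mem G.internal hy, map_smul, map_smul, mul_smul_comm,
      mul_smul_comm, smul_mul_assoc, smul_mul_assoc, mul_assoc (G.s z), e, smul_smul, smul_smul,
      show (l - 1) * (i - 1 + (j - 1)) = (i + j) * l + (i + j) + -(2 * (l - 1)) - 2 * (i + j) by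
        ring, sgn_sub, sgn_add, sgn_add, sgn_neg, sgn_add]
    have h2 : ∀ n : ℤ, sgn k (2 * n) = 1 := fun n => by rw [two_mul, sgn_add, sgn_sq]
    rw [h2, h2]
    congr 1
    rcases sgn_cases k ((i + j) * l) with e1 | e1 <;> rcases sgn_cases k i with e2 | e2 <;>
      rcases sgn_cases k j with e3 | e3 <;> simp [e1, e2, e3]
  exact LinearMap.congr_fun this t

lemma DGLC.ce_aux1 (t : G.X ⊗[k] G.X) :
    LinearMap.mul' k _ (TensorProduct.map (G.quad ∘ₗ G.cobr ∘ₗ tw G.internal 1) G.s t) =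
      G.cubic (G.cobr.rTensor _ t) := by
  induction t with
  | zero => simp
  | add s t hs ht => simp only [map_add, hs, ht]
  | tmul x y =>
    simp only [TensorProduct.map_tmul, LinearMap.comp_apply, LinearMap.rTensor_tmul,
      comul_tw G.internal G.cobr G.cobr_mem]
    induction (G.cobr x) with
    | zero => simp
    | add s t hs ht => simp only [map_add, TensorProduct.add_tmul, hs, ht]
    | tmul a b => simp [G.cubic_tmul, G.quad_tmul, tw_tw]

lemma DGLC.ce_aux2 (t : G.X ⊗[k] G.X) :
    LinearMap.mul' k _ (TensorProduct.map G.s (G.quad ∘ₗ G.cobr) (swap G.internal t)) =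
      G.cubic (cyc G.internal (G.cobr.rTensor _ t)) := by
  suffices h : LinearMap.mul' k _ ∘ₗ TensorProduct.map G.s (G.quad ∘ₗ G.cobr) ∘ₗ swap G.internal =
      G.cubic ∘ₗ cyc G.internal ∘ₗ G.cobr.rTensor _ from LinearMap.congr_fun h t
  refine tensor_ext_gr G.internal G.internal fun i j x hx y hy => ?_
  simp only [LinearMap.comp_apply, swap_tmul G.internal hx hy, map_smul, TensorProduct.map_tmul,
    LinearMap.rTensor_tmul, LinearMap.mul'_apply]
  have := G.cobr_mem i x hx
  refine Submodule.span_induction (p := fun t _ => sgn k (i * j) • (G.s y * G.quad t) =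
    G.cubic (cyc G.internal (t ⊗ₜ y))) ?_ (by simp) (fun s t _ _ hs ht => ?_)
    (fun r t _ ht => ?_) this
  · rintro _ ⟨a, b, hab, v, hv, w, hw, rfl⟩
    rw [cyc_tmul G.internal hv hw hy, map_smul, G.cubic_tmul, G.quad_tmul, hab, mul_assoc]
  · rw [map_add, mul_add, smul_add, hs, ht, TensorProduct.add_tmul, map_add, map_add]
  · rw [map_smul, mul_smul_comm, smul_comm, ht, ← TensorProduct.smul_tmul', map_smul, map_smul]

lemma DGLC.ceD_quad (t : G.X ⊗[k] G.X) : G.ceD (G.quad t) =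
    G.quad (TensorProduct.map G.d LinearMap.id t + TensorProduct.map (tw G.internal 1) G.d t) -
      (2⁻¹ : k) • LinearMap.mul' k _
        (TensorProduct.map (G.quad ∘ₗ G.cobr ∘ₗ tw G.internal 1) G.s t) +
      (2⁻¹ : k) • LinearMap.mul' k _ (TensorProduct.map G.s (G.quad ∘ₗ G.cobr) t) := by
  induction t with
  | zero => simp
  | add s t hs ht => simp only [map_add, hs, ht, smul_add]; abel
  | tmul x y =>
    simp only [G.quad_tmul, G.ceD_isDer _ _, G.ceD_s, G.tw_s, TensorProduct.map_tmul,
      map_add, LinearMap.comp_apply, tw_tw, tw_d G.internal G.d G.d_mem, LinearMap.id_apply,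
      LinearMap.mul'_apply, map_neg, sub_mul, mul_sub, neg_mul, mul_neg, neg_neg, smul_mul_assoc,
      mul_smul_comm, smul_neg]
    abel

lemma DGLC.ceD_sq_s [CharZero k] (x : G.X) : G.ceD (G.ceD (G.s x)) = 0 := by
  have hskew : G.cobr x = -swap G.internal (G.cobr x) := by rw [G.cobr_skew, neg_neg]
  have h2 : LinearMap.mul' k _ (TensorProduct.map G.s (G.quad ∘ₗ G.cobr) (G.cobr x)) =
      -G.cubic (G.cobr.rTensor _ (G.cobr x)) := by
    conv_lhs => rw [hskew]
    rw [map_neg, map_neg, G.ce_aux2, G.cubic_cyc]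
  have h3 : G.cubic (G.cobr.rTensor _ (G.cobr x)) = 0 := by
    have := congrArg G.cubic (G.cobr_jacobi x)
    rw [map_add, map_add, G.cubic_cyc, G.cubic_cyc, G.cubic_cyc, map_zero] at this
    have h : (3 : k) • G.cubic (G.cobr.rTensor _ (G.cobr x)) = 0 := by
      rw [← this]; module
    exact (smul_eq_zero.1 h).resolve_left (by norm_num)
  rw [G.ceD_s, map_sub, map_neg, map_smul, G.ceD_s, G.ceD_quad, G.ce_aux1, h2, h3, G.d_sq, G.cobr_d]
  simp

/-- The Chevalley-Eilenberg algebra of a Lie coalgebra: the graded symmetric algebra on the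
desuspension of `G`, with the differential `x ↦ -dx - (1 / 2) ∑ (-1) ^ |x'| x' x''`. -/
def DGLC.cec [CharZero k] : ADGCA k :=
  ADGCA.ofGen (Pres.isGen G.s_internal homRel_false) Pres.gen_comm G.ceD G.ceD_isDer
    (fun n v hv => by
      rw [DGLC.ceD, Pres.der_gen]
      exact G.ceData.mem n v hv)
    G.ceD_sq_s (Pres.aug fun _ _ h => h.elim) (fun v => Pres.aug_gen _ v)
    (fun v => by
      rw [G.ceD_s, map_sub, map_neg, map_smul, Pres.aug_gen]
      suffices h : ∀ t, Pres.aug (gV := G.sgr) (R := fun _ _ => False) (fun _ _ h => h.elim)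
        (G.quad t) = 0 by rw [h]; simp
      intro t
      induction t with
      | zero => simp
      | add s t hs ht => rw [map_add, map_add, hs, ht, add_zero]
      | tmul a b => rw [G.quad_tmul, map_mul, Pres.aug_gen, zero_mul])

lemma DGLC.contrData (p : Module.Dual k G.X) (hp : ∀ n, n ≠ 0 → ∀ x ∈ G.gr n, p x = 0) :
    Pres.DerData G.s_internal homRel_false 1 1 (p.smulRight (1 : G.S)) :=
  GSym.derData _ (by decide) _ fun n x hx => by
    rw [LinearMap.smulRight_apply]
    by_cases hn : n + 1 = 0
    · rw [hn]
      exact Submodule.smul_mem _ _ monoGr_one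
    · rw [hp (n + 1) hn x hx, zero_smul]
      exact zero_mem _

/-- The contraction with a functional `p`: the derivation of degree `1` with `x ↦ p x` on
generators. -/
def DGLC.contr (p : Module.Dual k G.X) (hp : ∀ n, n ≠ 0 → ∀ x ∈ G.gr n, p x = 0) :
    G.S →ₗ[k] G.S := Pres.der (G.contrData p hp)

/-- The relative Chevalley-Eilenberg algebra of the pair `(G, h^*)`, for a map of Lie coalgebras
`G → h^*` where `h` is a finite-dimensional Lie algebra (in degree zero); `p y` is the composite of
`G → h^*` and the evaluation at `y ∈ h`. It consists of the elements `ω` which belong to the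
symmetric algebra of the desuspension of the kernel of `G → h^*` (that is, all the contractions
`i_y ω` vanish) and are invariant under `h` (that is, moreover `L_y ω = i_y (dω) + d (i_y ω)`
vanishes). -/
def DGLC.cecRel [CharZero k] {h : Type u} (p : h → Module.Dual k G.X)
    (hp : ∀ y n, n ≠ 0 → ∀ x ∈ G.gr n, p y x = 0) : ADGCA k :=
  G.cec.basic (fun y => G.contr (p y) (hp y)) 1 (fun _ => Pres.der_isDer _)
    (fun _ => Pres.der_mem _)

end CEc

section Main

variable (g : Type u) [LieRing g] [LieAlgebra k g] [Module.Finite k g] (C : DGCC k)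

/-- The composite of the map `g^*(C) → g^*`, `φ ⊗ c ↦ ε(c) φ`, with the evaluation at `y`. -/
def gStarEv (y : g) : Module.Dual k (gStar g C.toN).X :=
  TGen.lift (X := C.X)
    ((LinearMap.mul k k).compl₁₂ (Module.Dual.eval k g y) (Coalgebra.counit : C.X →ₗ[k] k))

variable {g} in
lemma gStarEv_gr (y : g) (n : ℤ) (hn : n ≠ 0) (x : (gStar g C.toN).X)
    (hx : x ∈ (gStar g C.toN).gr n) : gStarEv g C y x = 0 := by
  refine TGen.gr_induction (X := C.X) (p := fun x => gStarEv g C y x = 0) hx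
    (LinearMap.map_zero _) (fun φ c hc => ?_) (fun s t hs ht => ?_)
  · have : gStarEv g C y (TGen.mk k _ C.X φ c) = φ y * Coalgebra.counit (R := k) c :=
      TGen.lift_mk _ _ _
    exact this.trans (by rw [C.counit_gr n hn c hc, mul_zero])
  · exact ((gStarEv g C y).map_add s t).trans (by rw [hs, ht, add_zero])

/-- The Chevalley-Eilenberg algebra of the Lie coalgebra `g^*(C̄)`. -/
def cecBar [CharZero k] : ADGCA k := (gStar g C.reduced).cec

/-- The relative Chevalley-Eilenberg algebra of the pair `(g^*(C), g^*)`. -/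
def cecPair [CharZero k] : ADGCA k :=
  (gStar g C.toN).cecRel (gStarEv g C) (gStarEv_gr C)

end Main

end LieCoalg

/-! ### Duals of coalgebras -/

section Dual

variable {k : Type u} [Field k]

/-- The functional `f` vanishes on `gr n` for all but finitely many `n`. -/
def FinSupp {X : Type u} [AddCommGroup X] [Module k X] (gr : ℤ → Submodule k X) (f : X →ₗ[k] k) :
    Prop :=
  ∃ N : ℕ, ∀ n : ℤ, (N : ℤ) ≤ |n| → ∀ x ∈ gr n, f x = 0

section FinSupp

variable {X : Type u} [AddCommGroup X] [Module k X] {gr : ℤ → Submodule k X}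

lemma FinSupp.add {f h : X →ₗ[k] k} (hf : FinSupp gr f) (hh : FinSupp gr h) :
    FinSupp gr (f + h) := by
  obtain ⟨N, hN⟩ := hf
  obtain ⟨M, hM⟩ := hh
  refine ⟨N + M, fun n hn x hx => ?_⟩
  push_cast at hn
  rw [LinearMap.add_apply, hN n (by omega) x hx, hM n (by omega) x hx, add_zero]

lemma FinSupp.smul {f : X →ₗ[k] k} (hf : FinSupp gr f) (r : k) : FinSupp gr (r • f) := by
  obtain ⟨N, hN⟩ := hf
  exact ⟨N, fun n hn x hx => by rw [LinearMap.smul_apply, hN n hn x hx, smul_zero]⟩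

lemma FinSupp.comp {f : X →ₗ[k] k} (hf : FinSupp gr f) (m : ℤ) (T : X →ₗ[k] X)
    (hT : ∀ n, ∀ x ∈ gr n, T x ∈ gr (n + m) ⊔ gr (n + m - 1)) : FinSupp gr (f ∘ₗ T) := by
  obtain ⟨N, hN⟩ := hf
  refine ⟨N + m.natAbs + 1, fun n hn x hx => ?_⟩
  push_cast at hn
  obtain ⟨y, hy, z, hz, e⟩ := Submodule.mem_sup.1 (hT n x hx)
  have h1 : |n| ≤ |n + m| + |m| := by
    have := abs_sub (n + m) m
    rwa [add_sub_cancel_right] at this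
  have h2 : |n + m| ≤ |n + m - 1| + 1 := by
    have := abs_add_le (n + m - 1) 1
    rwa [sub_add_cancel, abs_one] at this
  rw [LinearMap.comp_apply, ← e, map_add, hN _ (by omega) y hy, hN _ (by omega) z hz, add_zero]

lemma FinSupp.conv [Coalgebra k X]
    (hΔ : ∀ n, ∀ x ∈ gr n, Coalgebra.comul (R := k) x ∈ tgr gr gr n)
    {f h : WithConv (X →ₗ[k] k)} (hf : FinSupp gr f.ofConv) (hh : FinSupp gr h.ofConv) :
    FinSupp gr (f * h).ofConv := by
  obtain ⟨N, hN⟩ := hf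
  obtain ⟨M, hM⟩ := hh
  refine ⟨N + M, fun n hn x hx => ?_⟩
  push_cast at hn
  rw [LinearMap.convMul_apply]
  refine Submodule.span_induction (p := fun t _ => LinearMap.mul' k k
    (TensorProduct.map f.ofConv h.ofConv t) = 0) ?_ (by simp)
    (fun s t _ _ hs ht => by simp only [map_add, hs, ht, add_zero])
    (fun r t _ ht => by simp only [map_smul, ht, smul_zero]) (hΔ n x hx)
  rintro _ ⟨i, j, hij, y, hy, z, hz, rfl⟩
  rw [TensorProduct.map_tmul, LinearMap.mul'_apply]
  have h1 := abs_add_le i j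
  rw [hij] at h1
  by_cases hi : (N : ℤ) ≤ |i|
  · rw [hN i hi y hy, zero_mul]
  · rw [hM j (by omega) z hz, mul_zero]

end FinSupp

/-- A family of subspaces of weight `n` of a coalgebra, where the differential may lower the weight
by one. -/
structure DGCC.WeightFamily (X : DGCC k) (wt : ℤ → Submodule k X.X) : Prop where
  proj_mem : ∀ n w, ∀ x ∈ wt w, proj X.internal n x ∈ wt w
  comul_mem : ∀ w, ∀ x ∈ wt w, Coalgebra.comul (R := k) x ∈ tgr wt wt w
  d_mem : ∀ w, ∀ x ∈ wt w, X.d x ∈ wt w ⊔ wt (w - 1)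
  counit : ∀ w, w ≠ 0 → ∀ x ∈ wt w, Coalgebra.counit (R := k) x = 0

variable (X : DGCC k) {wt : ℤ → Submodule k X.X} (h : X.WeightFamily wt)

/-- The functionals on `X` supported in finitely many degrees and finitely many weights, with the
convolution product `(f * g) x = ∑ f x' * g x''`. -/
def DGCC.dualAlg : Subalgebra k (WithConv (X.X →ₗ[k] k)) where
  carrier := {f | FinSupp X.gr f.ofConv ∧ FinSupp wt f.ofConv}
  mul_mem' hf hg := ⟨hf.1.conv X.comul_mem hg.1, hf.2.conv h.comul_mem hg.2⟩
  add_mem' hf hg := ⟨hf.1.add hg.1, hf.2.add hg.2⟩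
  algebraMap_mem' r := by
    have key : ∀ gr : ℤ → Submodule k X.X,
        (∀ w, w ≠ 0 → ∀ x ∈ gr w, Coalgebra.counit (R := k) x = 0) →
        FinSupp gr (algebraMap k (WithConv (X.X →ₗ[k] k)) r).ofConv := by
      intro gr hgr
      refine ⟨1, fun n hn x hx => ?_⟩
      rw [LinearMap.convAlgebraMap_apply, hgr n (by rintro rfl; simp at hn) x hx, map_zero,
        smul_zero]
    exact ⟨key _ X.counit_gr, key _ h.counit⟩

/-- The underlying algebra of the dual of `X`. -/
def DGCC.Dual : Type u := X.dualAlg h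

instance : Ring (X.Dual h) := inferInstanceAs (Ring (X.dualAlg h))

instance : Algebra k (X.Dual h) := inferInstanceAs (Algebra k (X.dualAlg h))

/-- The functional underlying an element of the dual. -/
def DGCC.ev : X.Dual h →ₗ[k] X.X →ₗ[k] k where
  toFun f := f.1.ofConv
  map_add' _ _ := rfl
  map_smul' _ _ := rfl

/-- An element of the dual is a functional with finite support. -/
def DGCC.mkDual (f : X.X →ₗ[k] k) (h1 : FinSupp X.gr f) (h2 : FinSupp wt f) : X.Dual h :=
  ⟨WithConv.toConv f, h1, h2⟩

variable {h}

lemma DGCC.ev_mkDual (f : X.X →ₗ[k] k) (h1 : FinSupp X.gr f) (h2 : FinSupp wt f) (x : X.X) :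
    X.ev h (X.mkDual h f h1 h2) x = f x := rfl

lemma DGCC.ev_finSupp (f : X.Dual h) : FinSupp X.gr (X.ev h f) := f.2.1

lemma DGCC.ev_finSupp' (f : X.Dual h) : FinSupp wt (X.ev h f) := f.2.2

lemma DGCC.dual_ext {f f' : X.Dual h} (H : ∀ x, X.ev h f x = X.ev h f' x) : f = f' :=
  Subtype.ext (WithConv.ext (LinearMap.ext H))

lemma DGCC.ev_mul (f f' : X.Dual h) (x : X.X) : X.ev h (f * f') x =
    LinearMap.mul' k k (TensorProduct.map (X.ev h f) (X.ev h f') (Coalgebra.comul x)) := rfl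

lemma DGCC.ev_one (x : X.X) : X.ev h (1 : X.Dual h) x = Coalgebra.counit (R := k) x := rfl

variable (h)

/-- The conditions for precomposition with an operator `T` to preserve the dual. -/
def DGCC.Pre (T : X.X →ₗ[k] X.X) : Prop :=
  ∀ f, FinSupp X.gr f → FinSupp wt f → FinSupp X.gr (f ∘ₗ T) ∧ FinSupp wt (f ∘ₗ T)

variable {X h}

/-- Precomposition with an operator on `X`. -/
def DGCC.precomp {T : X.X →ₗ[k] X.X} (hT : X.Pre (wt := wt) T) : X.Dual h →ₗ[k] X.Dual h where
  toFun f := X.mkDual h (X.ev h f ∘ₗ T) (hT _ (X.ev_finSupp f) (X.ev_finSupp' f)).1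
    (hT _ (X.ev_finSupp f) (X.ev_finSupp' f)).2
  map_add' _ _ := rfl
  map_smul' _ _ := rfl

lemma DGCC.ev_precomp {T : X.X →ₗ[k] X.X} (hT : X.Pre (wt := wt) T) (f : X.Dual h) (x : X.X) :
    X.ev h (DGCC.precomp hT f) x = X.ev h f (T x) := rfl

variable (X h)

/-- The functionals of degree `n` are those vanishing outside degree `-n`. -/
def DGCC.dualGr (n : ℤ) : Submodule k (X.Dual h) where
  carrier := {f | ∀ m, m ≠ -n → ∀ x ∈ X.gr m, X.ev h f x = 0}
  add_mem' hf hg m hm x hx := by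
    rw [map_add, LinearMap.add_apply, hf m hm x hx, hg m hm x hx, add_zero]
  zero_mem' _ _ _ _ := by rw [map_zero, LinearMap.zero_apply]
  smul_mem' r f hf m hm x hx := by
    rw [map_smul, LinearMap.smul_apply, hf m hm x hx, smul_zero]

lemma proj_mem_gr {X : Type u} [AddCommGroup X] [Module k X] {gr : ℤ → Submodule k X}
    (h : DirectSum.IsInternal gr) (n m : ℤ) {x : X} (hx : x ∈ gr m) : proj h n x ∈ gr m := by
  by_cases e : m = n
  · subst e; rwa [proj_of_mem h hx]
  · rw [proj_of_ne h hx e]; exact zero_mem _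

variable {X h}

lemma DGCC.pre_of {T : X.X →ₗ[k] X.X} (m m' : ℤ)
    (h1 : ∀ n, ∀ x ∈ X.gr n, T x ∈ X.gr (n + m))
    (h2 : ∀ n, ∀ x ∈ wt n, T x ∈ wt (n + m') ⊔ wt (n + m' - 1)) : X.Pre (wt := wt) T :=
  fun _ hf hf' => ⟨hf.comp m T fun n x hx => Submodule.mem_sup_left (h1 n x hx), hf'.comp m' T h2⟩

variable (X h)

lemma DGCC.pre_proj (h : X.WeightFamily wt) (n : ℤ) : X.Pre (wt := wt) (proj X.internal n) :=
  DGCC.pre_of 0 0 (fun m x hx => by rw [add_zero]; exact proj_mem_gr X.internal n m hx)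
    fun m x hx => by rw [add_zero]; exact Submodule.mem_sup_left (h.proj_mem n m x hx)

lemma DGCC.pre_d (h : X.WeightFamily wt) : X.Pre (wt := wt) X.d :=
  DGCC.pre_of (-1) 0 (fun m x hx => X.d_mem m x hx)
    fun m x hx => by rw [add_zero]; exact h.d_mem m x hx

lemma DGCC.dual_internal : DirectSum.IsInternal (X.dualGr h) := by
  refine isInternal_of_proj (fun n => DGCC.precomp (h := h) (X.pre_proj h (-n)))
    (fun n f hf => ?_) (fun m n f hf hne => ?_) (fun f => ?_)
  · refine X.dual_ext fun x => ?_
    rw [DGCC.ev_precomp]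
    refine hom_induction X.internal (p := fun x =>
      X.ev h f (proj X.internal (-n) x) = X.ev h f x) x (fun i x hx => ?_)
      (fun y z hy hz => by simp only [map_add, hy, hz])
    by_cases e : i = -n
    · subst e; rw [proj_of_mem X.internal hx]
    · rw [proj_of_ne X.internal hx e, map_zero, hf i e x hx]
  · refine X.dual_ext fun x => ?_
    rw [DGCC.ev_precomp, map_zero, LinearMap.zero_apply]
    refine hom_induction X.internal (p := fun x =>
      X.ev h f (proj X.internal (-m) x) = 0) x (fun i x hx => ?_)
      (fun y z hy hz => by simp only [map_add, hy, hz, add_zero])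
    by_cases e : i = -m
    · subst e; rw [proj_of_mem X.internal hx, hf (-m) (by omega) x hx]
    · rw [proj_of_ne X.internal hx e, map_zero]
  · obtain ⟨N, hN⟩ := X.ev_finSupp f
    have key : f = ∑ n ∈ Finset.Icc (-N : ℤ) N,
        DGCC.precomp (h := h) (X.pre_proj h (-n)) f := by
      refine X.dual_ext fun x => ?_
      rw [map_sum, LinearMap.sum_apply]
      simp only [DGCC.ev_precomp]
      refine hom_induction X.internal (p := fun x => X.ev h f x = ∑ n ∈ Finset.Icc (-N : ℤ) N,
        X.ev h f (proj X.internal (-n) x)) x (fun i x hx => ?_)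
        (fun y z hy hz => by simp only [map_add, Finset.sum_add_distrib]; rw [← hy, ← hz])
      by_cases hi : -i ∈ Finset.Icc (-N : ℤ) N
      · rw [Finset.sum_eq_single_of_mem (-i) hi, neg_neg, proj_of_mem X.internal hx]
        intro b _ hb
        rw [proj_of_ne X.internal hx (by omega), map_zero]
      · rw [Finset.sum_eq_zero, hN i _ x hx]
        · simp only [Finset.mem_Icc, not_and_or, not_le] at hi
          rcases hi with hi | hi
          · have := le_abs_self i; omega
          · have := neg_le_abs i; omega
        · intro b hb
          rw [proj_of_ne X.internal hx (by rintro rfl; rw [neg_neg] at hi; exact hi hb), map_zero]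
    rw [key]
    refine Submodule.sum_mem _ fun n _ => Submodule.mem_iSup_of_mem n fun m hm x hx => ?_
    rw [DGCC.ev_precomp, proj_of_ne X.internal hx hm, map_zero]

lemma DGCC.dual_tw (e : ℤ) (f : X.Dual h) (x : X.X) :
    X.ev h (tw (X.dual_internal h) e f) x = X.ev h f (tw X.internal e x) := by
  refine hom_induction (X.dual_internal h) (p := fun f => X.ev h (tw (X.dual_internal h) e f) x =
    X.ev h f (tw X.internal e x)) f (fun n f hf => ?_) (fun f f' hf hf' => by
      simp only [map_add, LinearMap.add_apply, hf, hf'])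
  rw [tw_of_mem _ e hf, map_smul, LinearMap.smul_apply]
  refine hom_induction X.internal (p := fun x => sgn k (e * n) • X.ev h f x =
    X.ev h f (tw X.internal e x)) x (fun i x hx => ?_) (fun y z hy hz => by
      simp only [map_add, smul_add, hy, hz])
  rw [tw_of_mem X.internal e hx, map_smul]
  by_cases hi : i = -n
  · subst hi; rw [mul_neg, sgn_neg]
  · rw [hf i hi x hx, smul_zero, smul_zero]

/-- Coderivations of `X` induce derivations of the dual. -/
lemma DGCC.precomp_isDer (e : ℤ) (T : X.X →ₗ[k] X.X) (hT : X.Pre (wt := wt) T)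
    (hΔ : ∀ x, Coalgebra.comul (T x) = TensorProduct.map T LinearMap.id (Coalgebra.comul x) +
      TensorProduct.map (tw X.internal e) T (Coalgebra.comul (R := k) x)) :
    IsDer (X.dual_internal h) e (DGCC.precomp hT) := by
  intro f f'
  refine X.dual_ext fun x => ?_
  rw [DGCC.ev_precomp, map_add, LinearMap.add_apply, X.ev_mul, X.ev_mul, X.ev_mul, hΔ, map_add,
    map_add]
  congr 1
  · induction Coalgebra.comul (R := k) x with
    | zero => simp
    | add s t hs ht => simp only [map_add, hs, ht]
    | tmul a b =>
      simp only [TensorProduct.map_tmul, LinearMap.mul'_apply, DGCC.ev_precomp, LinearMap.id_apply]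
  · induction Coalgebra.comul (R := k) x with
    | zero => simp
    | add s t hs ht => simp only [map_add, hs, ht]
    | tmul a b =>
      simp only [TensorProduct.map_tmul, LinearMap.mul'_apply, X.dual_tw, DGCC.ev_precomp]

/-- The dual algebra of a coaugmented cocommutative coalgebra `X` equipped with weights: the
functionals of finite support, with the convolution product, and with the differential
`f ↦ f ∘ d`. -/
def DGCC.dual : ADGCA k where
  X := X.Dual h
  gr := X.dualGr h
  internal := X.dual_internal h
  one_mem m hm x hx := by
    rw [X.ev_one]
    exact X.counit_gr m (by simpa using hm) x hx
  mul_mem i j f hf f' hf' m hm x hx := by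
    rw [X.ev_mul]
    refine Submodule.span_induction (p := fun t _ => LinearMap.mul' k k
      (TensorProduct.map (X.ev h f) (X.ev h f') t) = 0) ?_ (by simp)
      (fun s t _ _ hs ht => by simp only [map_add, hs, ht, add_zero])
      (fun r t _ ht => by simp only [map_smul, ht, smul_zero]) (X.comul_mem m x hx)
    rintro _ ⟨a, b, hab, y, hy, z, hz, rfl⟩
    rw [TensorProduct.map_tmul, LinearMap.mul'_apply]
    by_cases ha : a = -i
    · rw [hf' b (by omega) z hz, mul_zero]
    · rw [hf a ha y hy, zero_mul]
  mul_comm i j f hf f' hf' := by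
    refine X.dual_ext fun x => ?_
    rw [map_smul, LinearMap.smul_apply, X.ev_mul, X.ev_mul, ← X.cocomm x]
    have : LinearMap.mul' k k ∘ₗ TensorProduct.map (X.ev h f) (X.ev h f') ∘ₗ swap X.internal =
        sgn k (i * j) • (LinearMap.mul' k k ∘ₗ TensorProduct.map (X.ev h f') (X.ev h f)) := by
      refine tensor_ext_gr X.internal X.internal fun a b y hy z hz => ?_
      simp only [LinearMap.comp_apply, LinearMap.smul_apply, swap_tmul X.internal hy hz, map_smul,
        TensorProduct.map_tmul, LinearMap.mul'_apply]
      by_cases hb : b = -i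
      · by_cases ha : a = -j
        · subst ha hb
          rw [neg_mul_neg, mul_comm j i, mul_comm (X.ev h f z)]
        · rw [hf' a ha y hy]; simp
      · rw [hf b hb z hz]; simp
    have h2 := LinearMap.congr_fun this (Coalgebra.comul x)
    have h3 := X.cocomm x
    simp only [LinearMap.comp_apply, LinearMap.smul_apply] at h2
    rw [h2, h3]
  d := DGCC.precomp (X.pre_d h)
  d_mem n f hf m hm x hx := by
    rw [DGCC.ev_precomp]
    exact hf (m - 1) (by omega) (X.d x) (X.d_mem m x hx)
  d_sq f := X.dual_ext fun x => by
    rw [DGCC.ev_precomp, DGCC.ev_precomp, X.d_sq, map_zero, map_zero, LinearMap.zero_apply]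
  d_leibniz i f hf f' := by
    rw [X.precomp_isDer h 1 X.d (X.pre_d h) X.comul_d, tw_one_of_mem _ hf, smul_mul_assoc]
  aug := AlgHom.ofLinearMap ((X.ev h).flip X.one)
    (by rw [LinearMap.flip_apply, X.ev_one, X.counit_one])
    (fun f f' => by
      simp only [LinearMap.flip_apply]
      rw [X.ev_mul, X.comul_one, TensorProduct.map_tmul, LinearMap.mul'_apply])
  aug_d f := by
    change X.ev h f (X.d X.one) = 0
    rw [X.d_one, map_zero]
  aug_gr n hn f hf := hf 0 (by omega) X.one X.one_mem

/-- The functionals of weight `w` are those vanishing outside weight `w`. -/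
def DGCC.dualWt (w : ℤ) : Submodule k (X.Dual h) where
  carrier := {f | ∀ m, m ≠ w → ∀ x ∈ wt m, X.ev h f x = 0}
  add_mem' hf hg m hm x hx := by
    rw [map_add, LinearMap.add_apply, hf m hm x hx, hg m hm x hx, add_zero]
  zero_mem' _ _ _ _ := by rw [map_zero, LinearMap.zero_apply]
  smul_mem' r f hf m hm x hx := by
    rw [map_smul, LinearMap.smul_apply, hf m hm x hx, smul_zero]

lemma DGCC.ev_proj (n : ℤ) (f : X.Dual h) (x : X.X) :
    X.ev h (proj (X.dual_internal h) n f) x = X.ev h f (proj X.internal (-n) x) := by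
  refine hom_induction (X.dual_internal h) (p := fun f =>
    X.ev h (proj (X.dual_internal h) n f) x = X.ev h f (proj X.internal (-n) x)) f
    (fun i f hf => ?_) (fun f f' hf hf' => by simp only [map_add, LinearMap.add_apply, hf, hf'])
  refine hom_induction X.internal (p := fun x => X.ev h (proj (X.dual_internal h) n f) x =
    X.ev h f (proj X.internal (-n) x)) x (fun j x hx => ?_)
    (fun y z hy hz => by rw [map_add, hy, hz, map_add, map_add])
  by_cases hi : i = n
  · subst hi
    rw [proj_of_mem _ hf]
    by_cases hj : j = -i
    · subst hj; rw [proj_of_mem X.internal hx]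
    · rw [proj_of_ne X.internal hx hj, map_zero, hf j hj x hx]
  · rw [proj_of_ne _ hf hi, map_zero, LinearMap.zero_apply]
    by_cases hj : j = -n
    · subst hj; rw [proj_of_mem X.internal hx, hf (-n) (by omega) x hx]
    · rw [proj_of_ne X.internal hx hj, map_zero]

lemma DGCC.dualWt_proj (n w : ℤ) (f) (hf : f ∈ X.dualWt h w) :
    proj (X.dual_internal h) n f ∈ X.dualWt h w := by
  intro m hm x hx
  rw [X.ev_proj]
  exact hf m hm _ (h.proj_mem (-n) m x hx)

lemma DGCC.dualWt_mul (i j : ℤ) (f) (hf : f ∈ X.dualWt h i) (f') (hf' : f' ∈ X.dualWt h j) :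
    f * f' ∈ X.dualWt h (i + j) := by
  intro m hm x hx
  rw [X.ev_mul]
  refine Submodule.span_induction (p := fun t _ => LinearMap.mul' k k
    (TensorProduct.map (X.ev h f) (X.ev h f') t) = 0) ?_ (by simp)
    (fun s t _ _ hs ht => by simp only [map_add, hs, ht, add_zero])
    (fun r t _ ht => by simp only [map_smul, ht, smul_zero]) (h.comul_mem m x hx)
  rintro _ ⟨a, b, hab, y, hy, z, hz, rfl⟩
  rw [TensorProduct.map_tmul, LinearMap.mul'_apply]
  by_cases ha : a = i
  · rw [hf' b (by omega) z hz, mul_zero]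
  · rw [hf a ha y hy, zero_mul]

end Dual

section Weighting

variable {k : Type u} [Field k]

/-- A weight grading of a coaugmented coalgebra, compatible with all the structure. -/
structure DGCC.Weighting (C : DGCC k) where
  wt : ℤ → Submodule k C.X
  internal : DirectSum.IsInternal wt
  proj_mem : ∀ n w, ∀ x ∈ wt w, proj C.internal n x ∈ wt w
  d_mem : ∀ w, ∀ x ∈ wt w, C.d x ∈ wt w
  comul_mem : ∀ w, ∀ x ∈ wt w, Coalgebra.comul (R := k) x ∈ tgr wt wt w
  counit : ∀ w, w ≠ 0 → ∀ x ∈ wt w, Coalgebra.counit (R := k) x = 0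
  one_mem : C.one ∈ wt 0

/-- The weight grading makes `C` a bigraded coalgebra: `C̄` is concentrated in positive weights, and
is finite-dimensional in each weight. -/
structure DGCC.Weighting.IsBigraded {C : DGCC k} (W : C.Weighting) : Prop where
  neg : ∀ w, w < 0 → W.wt w = ⊥
  zero : W.wt 0 = k ∙ C.one
  finite : ∀ w, Module.Finite k (W.wt w)

/-- The weight grading is trivial: everything has weight zero. -/
def DGCC.Weighting.IsTrivial {C : DGCC k} (W : C.Weighting) : Prop := W.wt 0 = ⊤

variable {C : DGCC k} (W : C.Weighting)

lemma DGCC.Weighting.family : C.WeightFamily W.wt :=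
  ⟨W.proj_mem, W.comul_mem, fun w x hx => Submodule.mem_sup_left (W.d_mem w x hx), W.counit⟩

/-- The dual algebra `A = C^*` (the restricted dual with respect to the weights). -/
def DGCC.Weighting.A : ADGCA k := C.dual W.family

/-- The weight grading of `A = C^*`. -/
def DGCC.Weighting.Awt (w : ℤ) : Submodule k W.A.X := C.dualWt W.family w

lemma DGCC.Weighting.Awt_d (w : ℤ) (f) (hf : f ∈ W.Awt w) : W.A.d f ∈ W.Awt w :=
  fun m hm x hx => hf m hm _ (W.d_mem m x hx)

/-- The commutative algebra underlying an augmented commutative algebra. -/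
def ADGCA.toN (A : ADGCA k) : NDGCA k where
  X := A.X
  gr := A.gr
  internal := A.internal
  mul := LinearMap.mul k A.X
  mul_assoc := mul_assoc
  mul_mem := A.mul_mem
  mul_comm := A.mul_comm
  d := A.d
  d_mem := A.d_mem
  d_sq := A.d_sq
  d_leibniz := A.d_leibniz

lemma ADGCA.aug_proj (A : ADGCA k) (n : ℤ) (x : A.X) (hx : A.aug x = 0) :
    A.aug (proj A.internal n x) = 0 := by
  by_cases hn : n = 0
  · subst hn
    rw [← hx]
    refine hom_induction A.internal (p := fun x => A.aug (proj A.internal 0 x) = A.aug x) x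
      (fun i x hx => ?_) (fun y z hy hz => by simp only [map_add, hy, hz])
    by_cases hi : i = 0
    · subst hi; rw [proj_of_mem A.internal hx]
    · rw [proj_of_ne A.internal hx hi, map_zero, A.aug_gr i hi x hx]
  · exact A.aug_gr n hn _ (proj_mem A.internal n x)

/-- The augmentation ideal `Ā` of `A`. -/
def ADGCA.bar (A : ADGCA k) : NDGCA k where
  X := LinearMap.ker A.aug.toLinearMap
  gr n := (A.gr n).comap (LinearMap.ker A.aug.toLinearMap).subtype
  internal := sub_internal A.internal _ A.aug_proj
  mul := LinearMap.mk₂ k (fun x y => ⟨x.1 * y.1, by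
      have : A.aug x.1 = 0 := x.2
      simp [this]⟩)
    (fun _ _ _ => Subtype.ext (add_mul _ _ _)) (fun _ _ _ => Subtype.ext (smul_mul_assoc _ _ _))
    (fun _ _ _ => Subtype.ext (mul_add _ _ _)) (fun _ _ _ => Subtype.ext (mul_smul_comm _ _ _))
  mul_assoc x y z := Subtype.ext (mul_assoc x.1 y.1 z.1)
  mul_mem i j x hx y hy := A.mul_mem i j x.1 hx y.1 hy
  mul_comm i j x hx y hy := Subtype.ext (A.mul_comm i j x.1 hx y.1 hy)
  d := A.d.restrict fun x _ => A.aug_d x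
  d_mem n x hx := A.d_mem n x.1 hx
  d_sq x := Subtype.ext (A.d_sq x.1)
  d_leibniz i x hx y := Subtype.ext (A.d_leibniz i x.1 hx y.1)

variable (g : Type u) [LieRing g] [LieAlgebra k g]

variable (B : NDGCA k)

/-- The bracket of `g(B)`. -/
def gLieBr : TGen k g B.X →ₗ[k] TGen k g B.X →ₗ[k] TGen k g B.X :=
  TGen.lift (LinearMap.mk₂ k (fun x a => TGen.map (brLin k g x) (B.mul a))
    (fun x y a => TGen.ext fun z b => by
      simp only [TGen.map_mk, map_add, LinearMap.add_apply])
    (fun r x a => TGen.ext fun z b => by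
      simp only [TGen.map_mk, map_smul, LinearMap.smul_apply])
    (fun x a b => TGen.ext fun z c => by
      simp only [TGen.map_mk, map_add, LinearMap.add_apply])
    (fun r x a => TGen.ext fun z b => by
      simp only [TGen.map_mk, map_smul, LinearMap.smul_apply]))

variable {g}

lemma gLieBr_mk (x y : g) (a b : B.X) : gLieBr g B (TGen.mk k g B.X x a) (TGen.mk k g B.X y b) =
    TGen.mk k g B.X ⁅x, y⁆ (B.mul a b) := by
  rw [gLieBr, TGen.lift_mk, LinearMap.mk₂_apply, TGen.map_mk]
  rfl

variable (g)

/-- The Lie algebra `g(B) = g ⊗ B` over a commutative algebra `B`, with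
`[x ⊗ a, y ⊗ b] = [x, y] ⊗ ab`. -/
def gLie : DGLA k where
  X := TGen k g B.X
  gr := TGen.gr g B.gr
  internal := TGen.internal B.internal g
  d := TGen.map LinearMap.id B.d
  d_mem n x hx := by
    have := TGen.map_mem (gr' := B.gr) (LinearMap.id : g →ₗ[k] g) B.d (-1)
      (by simpa [sub_eq_add_neg] using B.d_mem) hx
    rwa [← sub_eq_add_neg] at this
  d_sq x := by
    rw [TGen.map_map, show B.d ∘ₗ B.d = 0 from LinearMap.ext B.d_sq, TGen.map_zero_right]
  br := gLieBr g B
  br_mem i j s hs t ht := by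
    refine TGen.gr_induction (p := fun s => gLieBr g B s t ∈ TGen.gr g B.gr (i + j)) hs (by simp)
      (fun x a ha => ?_) (fun s s' h h' => by
        rw [map_add, LinearMap.add_apply]; exact add_mem h h')
    refine TGen.gr_induction (p := fun t => gLieBr g B (TGen.mk k g B.X x a) t ∈
      TGen.gr g B.gr (i + j)) ht (by simp)
      (fun y b hb => ?_) (fun s s' h h' => by rw [map_add]; exact add_mem h h')
    rw [gLieBr_mk]
    exact TGen.mk_mem _ (B.mul_mem i j a ha b hb)
  br_skew i j s hs t ht := by
    refine TGen.gr_induction (p := fun s => gLieBr g B s t = -sgn k (i * j) • gLieBr g B t s) hs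
      (by simp) (fun x a ha => ?_) (fun s s' h h' => by
        rw [map_add, LinearMap.add_apply, map_add, smul_add, h, h'])
    refine TGen.gr_induction (p := fun t => gLieBr g B (TGen.mk k g B.X x a) t =
      -sgn k (i * j) • gLieBr g B t (TGen.mk k g B.X x a)) ht (by simp) (fun y b hb => ?_)
      (fun s s' h h' => by rw [map_add, map_add, LinearMap.add_apply, smul_add, h, h'])
    rw [gLieBr_mk, gLieBr_mk, B.mul_comm i j a ha b hb, ← lie_skew, map_smul, map_neg,
      LinearMap.neg_apply, neg_smul, smul_neg]
  br_jacobi i j l s hs t ht w hw := by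
    refine TGen.gr_induction (p := fun s => gLieBr g B s (gLieBr g B t w) =
      gLieBr g B (gLieBr g B s t) w + sgn k (i * j) • gLieBr g B t (gLieBr g B s w)) hs
      (by simp) (fun x a ha => ?_) (fun s s' h h' => by
        simp only [map_add, LinearMap.add_apply, smul_add, h, h']; abel)
    refine TGen.gr_induction (p := fun t => gLieBr g B (TGen.mk k g B.X x a) (gLieBr g B t w) =
      gLieBr g B (gLieBr g B (TGen.mk k g B.X x a) t) w +
        sgn k (i * j) • gLieBr g B t (gLieBr g B (TGen.mk k g B.X x a) w)) ht
      (by simp) (fun y b hb => ?_) (fun s s' h h' => by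
        simp only [map_add, LinearMap.add_apply, smul_add, h, h']; abel)
    refine TGen.gr_induction (p := fun w => gLieBr g B (TGen.mk k g B.X x a)
      (gLieBr g B (TGen.mk k g B.X y b) w) =
      gLieBr g B (gLieBr g B (TGen.mk k g B.X x a) (TGen.mk k g B.X y b)) w +
        sgn k (i * j) • gLieBr g B (TGen.mk k g B.X y b) (gLieBr g B (TGen.mk k g B.X x a) w)) hw
      (by simp) (fun z c hc => ?_) (fun s s' h h' => by
        simp only [map_add, LinearMap.add_apply, smul_add, h, h']; abel)
    simp only [gLieBr_mk]
    rw [← B.mul_assoc b a c, B.mul_comm j i b hb a ha, map_smul, LinearMap.smul_apply, map_smul,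
      smul_smul, mul_comm j i, sgn_sq, one_smul, B.mul_assoc, leibniz_lie, map_add,
      LinearMap.add_apply]
  br_leibniz i j s hs t ht := by
    refine TGen.gr_induction (p := fun s => TGen.map LinearMap.id B.d (gLieBr g B s t) =
      gLieBr g B (TGen.map LinearMap.id B.d s) t +
        sgn k i • gLieBr g B s (TGen.map LinearMap.id B.d t)) hs (by simp) (fun x a ha => ?_)
      (fun s s' h h' => by simp only [map_add, LinearMap.add_apply, smul_add, h, h']; abel)
    refine TGen.gr_induction (p := fun t => TGen.map LinearMap.id B.d
      (gLieBr g B (TGen.mk k g B.X x a) t) =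
      gLieBr g B (TGen.map LinearMap.id B.d (TGen.mk k g B.X x a)) t + sgn k i •
        gLieBr g B (TGen.mk k g B.X x a) (TGen.map LinearMap.id B.d t)) ht (by simp)
      (fun y b hb => ?_)
      (fun s s' h h' => by simp only [map_add, LinearMap.add_apply, smul_add, h, h']; abel)
    simp only [gLieBr_mk, TGen.map_mk, LinearMap.id_apply]
    rw [B.d_leibniz i a ha b, map_add, map_smul]

end Weighting

/-! ### Graded symmetric coalgebras -/

section Sym

variable {k : Type u} [Field k]
variable {V : Type u} [AddCommGroup V] [Module k V] {gV : ℤ → Submodule k V}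

variable (gV) in
/-- The generators of the graded symmetric algebra. -/
abbrev GSym.ι : V →ₗ[k] GSym gV := Pres.gen gV fun _ _ => False

variable (gV) in
/-- The grading of the graded symmetric algebra. -/
abbrev GSym.gr (n : ℤ) : Submodule k (GSym gV) := monoGr gV (GSym.ι gV) n

lemma GSym.internal (h : DirectSum.IsInternal gV) : DirectSum.IsInternal (GSym.gr gV) :=
  (Pres.isGen h homRel_false).grInternal

lemma GSym.induction (h : DirectSum.IsInternal gV) {p : GSym gV → Prop} (a : GSym gV) (one : p 1)
    (cons : ∀ n, ∀ v ∈ gV n, ∀ a, p a → p (GSym.ι gV v * a))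
    (add : ∀ a b, p a → p b → p (a + b)) (smul : ∀ (r : k) a, p a → p (r • a)) : p a := by
  have zero : p 0 := by simpa using smul 0 1 one
  refine hom_induction (GSym.internal h) a (fun n a ha => ?_) add
  refine monoGr_induction ha (fun a ha => ?_) zero add smul
  clear * - ha one cons
  induction ha with
  | one => exact one
  | cons hn hv _ ih => exact cons _ _ hv _ ih

lemma GSym.comm {i j : ℤ} {a b : GSym gV} (ha : a ∈ GSym.gr gV i) (hb : b ∈ GSym.gr gV j) :
    a * b = sgn k (i * j) • (b * a) := mono_comm Pres.gen_comm ha hb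

/-- An endomorphism of the underlying vector space of the symmetric algebra commuting with the left
multiplications is determined by the value at `1`; more generally for maps intertwining left
multiplications with given operators. -/
lemma GSym.ext_of_intertwine (h : DirectSum.IsInternal gV) {Z : Type u} [AddCommGroup Z]
    [Module k Z] {F G : GSym gV →ₗ[k] Z} (one : F 1 = G 1)
    (cons : ∀ n, ∀ v ∈ gV n, ∀ a, F a = G a → F (GSym.ι gV v * a) = G (GSym.ι gV v * a)) : F = G :=
  LinearMap.ext fun a => GSym.induction h (p := fun a => F a = G a) a one cons
    (fun a b ha hb => by rw [map_add, map_add, ha, hb])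
    (fun r a ha => by rw [map_smul, map_smul, ha])

section Comul

variable (h : DirectSum.IsInternal gV)

/-- Multiplication on the left by `v ⊗ 1 + 1 ⊗ v`, for a generator `v`. -/
def GSym.Lam : V →ₗ[k] Module.End k (GSym gV ⊗[k] GSym gV) :=
  byDeg h fun n =>
    ((TensorProduct.mapBilinear (RingHom.id k) (GSym gV) (GSym gV) (GSym gV) (GSym gV)).flip LinearMap.id +
      TensorProduct.mapBilinear (RingHom.id k) (GSym gV) (GSym gV) (GSym gV) (GSym gV)
        (tw (GSym.internal h) n)) ∘ₗ LinearMap.mul k (GSym gV) ∘ₗ GSym.ι gV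

lemma GSym.Lam_tmul' {n : ℤ} {v : V} (hv : v ∈ gV n) (x y : GSym gV) :
    GSym.Lam h v (x ⊗ₜ y) = (GSym.ι gV v * x) ⊗ₜ y +
      tw (GSym.internal h) n x ⊗ₜ (GSym.ι gV v * y) := by
  rw [GSym.Lam, byDeg_of_mem h _ hv]
  rfl

lemma GSym.Lam_tmul {n a : ℤ} {v : V} (hv : v ∈ gV n) {x : GSym gV} (hx : x ∈ GSym.gr gV a)
    (y : GSym gV) : GSym.Lam h v (x ⊗ₜ y) = (GSym.ι gV v * x) ⊗ₜ y +
      sgn k (n * a) • (x ⊗ₜ[k] (GSym.ι gV v * y)) := by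
  rw [GSym.Lam_tmul' h hv, tw_of_mem _ n hx, TensorProduct.smul_tmul']

lemma GSym.ι_mul_mem {n a : ℤ} {v : V} (hv : v ∈ gV n) {x : GSym gV} (hx : x ∈ GSym.gr gV a) :
    GSym.ι gV v * x ∈ GSym.gr gV (n + a) := monoGr_mul (monoGr_ι hv) hx

lemma GSym.Lam_comm : ∀ i j, ∀ v ∈ gV i, ∀ w ∈ gV j,
    GSym.Lam h v * GSym.Lam h w = sgn k (i * j) • (GSym.Lam h w * GSym.Lam h v) := by
  intro i j v hv w hw
  refine tensor_ext_gr (GSym.internal h) (GSym.internal h) fun a b x hx y hy => ?_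
  have e := Pres.gen_comm (R := fun _ _ => False) i j v hv w hw
  rw [Module.End.mul_apply, LinearMap.smul_apply, Module.End.mul_apply, GSym.Lam_tmul h hw hx,
    GSym.Lam_tmul h hv hx, map_add, map_add, map_smul, map_smul,
    GSym.Lam_tmul h hv (GSym.ι_mul_mem hw hx), GSym.Lam_tmul h hv hx,
    GSym.Lam_tmul h hw (GSym.ι_mul_mem hv hx), GSym.Lam_tmul h hw hx, ← mul_assoc, ← mul_assoc,
    ← mul_assoc, ← mul_assoc, e, mul_add, mul_add, sgn_add, sgn_add, mul_comm j i, smul_mul_assoc,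
    smul_mul_assoc, ← TensorProduct.smul_tmul', TensorProduct.tmul_smul]
  rcases sgn_cases k (i * j) with e1 | e1 <;> rcases sgn_cases k (i * a) with e2 | e2 <;>
    rcases sgn_cases k (j * a) with e3 | e3 <;> simp only [e1, e2, e3] <;> module

/-- The coproduct of the symmetric algebra: the algebra homomorphism with `v ↦ v ⊗ 1 + 1 ⊗ v` on
generators. -/
def GSym.comul : GSym gV →ₗ[k] GSym gV ⊗[k] GSym gV :=
  (Pres.lift (GSym.Lam h) (GSym.Lam_comm h) fun _ _ h => h.elim).toLinearMap.flip (1 ⊗ₜ 1)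

lemma GSym.comul_one : GSym.comul h 1 = 1 ⊗ₜ[k] 1 := by
  rw [GSym.comul, LinearMap.flip_apply, AlgHom.toLinearMap_apply, map_one]
  rfl

lemma GSym.comul_cons (v : V) (a : GSym gV) :
    GSym.comul h (GSym.ι gV v * a) = GSym.Lam h v (GSym.comul h a) := by
  rw [GSym.comul, LinearMap.flip_apply, LinearMap.flip_apply, AlgHom.toLinearMap_apply,
    AlgHom.toLinearMap_apply, map_mul, Pres.lift_gen]
  rfl

variable (gV) in
/-- The counit of the symmetric algebra. -/
def GSym.counit : GSym gV →ₐ[k] k := Pres.aug fun _ _ h => h.elim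

lemma GSym.counit_cons (v : V) (a : GSym gV) : GSym.counit gV (GSym.ι gV v * a) = 0 := by
  rw [map_mul, GSym.counit, Pres.aug_gen, zero_mul]

lemma GSym.counit_gr (n : ℤ) (hn : n ≠ 0) (x) (hx : x ∈ GSym.gr gV n) :
    GSym.counit gV x = 0 := by
  refine monoGr_induction (p := fun x => GSym.counit gV x = 0) hx (fun x hx => ?_) (by simp)
    (fun b c hb hc => by simp [hb, hc]) (fun r b hb => by simp [hb])
  cases hx with
  | one => exact absurd rfl hn
  | cons hn hv ha => exact GSym.counit_cons _ _

lemma GSym.counit_tw (e : ℤ) (a : GSym gV) :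
    GSym.counit gV (tw (GSym.internal h) e a) = GSym.counit gV a := by
  refine hom_induction (GSym.internal h) (p := fun a => GSym.counit gV (tw (GSym.internal h) e a) =
    GSym.counit gV a) a (fun n a ha => ?_) (fun a b ha hb => by simp only [map_add, ha, hb])
  rw [tw_of_mem _ e ha, map_smul]
  by_cases hn : n = 0
  · rw [hn, mul_zero, sgn_zero, one_smul]
  · rw [GSym.counit_gr n hn a ha, smul_zero]

lemma map_tw_tgr' {X : Type u} [AddCommGroup X] [Module k X] {gX : ℤ → Submodule k X}
    (hX : DirectSum.IsInternal gX) (e : ℤ) {n : ℤ} {t : X ⊗[k] X} (ht : t ∈ tgr gX gX n) :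
    TensorProduct.map (tw hX e) (tw hX e) t = sgn k (e * n) • t := by
  refine Submodule.span_induction (p := fun t _ => TensorProduct.map (tw hX e) (tw hX e) t =
    sgn k (e * n) • t) ?_ (by simp) (fun s t _ _ hs ht => by simp [hs, ht])
    (fun r t _ ht => by rw [map_smul, ht, smul_comm]) ht
  rintro _ ⟨i, j, hij, x, hx, y, hy, rfl⟩
  rw [TensorProduct.map_tmul, tw_of_mem hX e hx, tw_of_mem hX e hy, ← hij, mul_add, sgn_add,
    TensorProduct.smul_tmul_smul]

lemma comul_tw' {X : Type u} [AddCommGroup X] [Module k X] {gX : ℤ → Submodule k X}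
    (hX : DirectSum.IsInternal gX) (Δ : X →ₗ[k] X ⊗[k] X)
    (hΔ : ∀ n, ∀ x ∈ gX n, Δ x ∈ tgr gX gX n) (e : ℤ) (x : X) :
    Δ (tw hX e x) = TensorProduct.map (tw hX e) (tw hX e) (Δ x) := by
  refine hom_induction hX (p := fun x => Δ (tw hX e x) = TensorProduct.map (tw hX e) (tw hX e) (Δ x))
    x (fun n x hx => ?_) (fun y z hy hz => by simp [hy, hz])
  rw [tw_of_mem hX e hx, map_smul, map_tw_tgr' hX e (hΔ n x hx)]

lemma tgr_le {X : Type u} [AddCommGroup X] [Module k X] {Y : Type u} [AddCommGroup Y] [Module k Y]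
    {gX : ℤ → Submodule k X} {gY : ℤ → Submodule k Y} {Z : Type u} [AddCommGroup Z] [Module k Z]
    {P : Submodule k Z} {n : ℤ} (f : X ⊗[k] Y →ₗ[k] Z)
    (hf : ∀ i j, i + j = n → ∀ x ∈ gX i, ∀ y ∈ gY j, f (x ⊗ₜ y) ∈ P) {t : X ⊗[k] Y}
    (ht : t ∈ tgr gX gY n) : f t ∈ P := by
  suffices h : tgr gX gY n ≤ P.comap f from h ht
  refine Submodule.span_le.2 ?_
  rintro _ ⟨i, j, hij, x, hx, y, hy, rfl⟩
  exact hf i j hij x hx y hy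

lemma GSym.Lam_mem {n m : ℤ} {v : V} (hv : v ∈ gV n) {t : GSym gV ⊗[k] GSym gV}
    (ht : t ∈ tgr (GSym.gr gV) (GSym.gr gV) m) :
    GSym.Lam h v t ∈ tgr (GSym.gr gV) (GSym.gr gV) (n + m) := by
  refine tgr_le (GSym.Lam h v) (fun i j hij x hx y hy => ?_) ht
  rw [GSym.Lam_tmul h hv hx]
  exact add_mem (tmul_mem_tgr (by omega) (GSym.ι_mul_mem hv hx) hy)
    (Submodule.smul_mem _ _ (tmul_mem_tgr (by omega) hx (GSym.ι_mul_mem hv hy)))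

lemma GSym.comul_mem : ∀ n, ∀ a ∈ GSym.gr gV n,
    GSym.comul h a ∈ tgr (GSym.gr gV) (GSym.gr gV) n := by
  intro n a ha
  refine monoGr_induction (p := fun a => GSym.comul h a ∈ tgr (GSym.gr gV) (GSym.gr gV) n) ha
    (fun a ha => ?_) (by simp) (fun b c hb hc => by rw [map_add]; exact add_mem hb hc)
    (fun r b hb => by rw [map_smul]; exact Submodule.smul_mem _ _ hb)
  clear * - ha
  induction ha with
  | one => rw [GSym.comul_one]; exact tmul_mem_tgr (add_zero 0) monoGr_one monoGr_one
  | cons hn hv _ ih => rw [GSym.comul_cons, ← hn]; exact GSym.Lam_mem h hv ih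

/-- Multiplication on the left by `v ⊗ 1 ⊗ 1 + 1 ⊗ v ⊗ 1 + 1 ⊗ 1 ⊗ v`, for `v` of degree `n`. -/
def GSym.Lam3 (n : ℤ) (v : V) : Module.End k (GSym gV ⊗[k] (GSym gV ⊗[k] GSym gV)) :=
  TensorProduct.map (LinearMap.mulLeft k (GSym.ι gV v)) LinearMap.id +
    TensorProduct.map (tw (GSym.internal h) n) (GSym.Lam h v)

lemma GSym.coassoc (a : GSym gV) :
    TensorProduct.assoc k _ _ _ ((GSym.comul h).rTensor _ (GSym.comul h a)) =
      (GSym.comul h).lTensor _ (GSym.comul h a) := by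
  suffices H : (TensorProduct.assoc k _ _ _).toLinearMap ∘ₗ (GSym.comul h).rTensor (GSym gV) ∘ₗ
      GSym.comul h = (GSym.comul h).lTensor (GSym gV) ∘ₗ GSym.comul h from LinearMap.congr_fun H a
  refine GSym.ext_of_intertwine h ?_ fun n v hv a ha => ?_
  · simp [GSym.comul_one]
  · simp only [LinearMap.comp_apply, LinearEquiv.coe_coe, GSym.comul_cons] at ha ⊢
    have h1 : ∀ t, TensorProduct.assoc k _ _ _ ((GSym.comul h).rTensor _ (GSym.Lam h v t)) =
        GSym.Lam3 h n v (TensorProduct.assoc k _ _ _ ((GSym.comul h).rTensor _ t)) := by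
      intro t
      induction t with
      | zero => simp
      | add s t hs ht => simp only [map_add, hs, ht]
      | tmul x y =>
        rw [GSym.Lam_tmul' h hv, map_add, LinearMap.rTensor_tmul, LinearMap.rTensor_tmul,
          LinearMap.rTensor_tmul, GSym.comul_cons,
          comul_tw' (GSym.internal h) (GSym.comul h) (GSym.comul_mem h)]
        generalize GSym.comul h x = u
        induction u with
        | zero => simp
        | add s t hs ht =>
          simp only [map_add, TensorProduct.add_tmul] at hs ht ⊢
          rw [← hs, ← ht]
          abel
        | tmul p q =>
          simp only [GSym.Lam3, GSym.Lam_tmul' h hv, TensorProduct.add_tmul, map_add,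
            TensorProduct.assoc_tmul, TensorProduct.map_tmul, LinearMap.add_apply,
            TensorProduct.tmul_add, LinearMap.mulLeft_apply, LinearMap.id_apply]
          abel
    have h2 : ∀ t, (GSym.comul h).lTensor _ (GSym.Lam h v t) =
        GSym.Lam3 h n v ((GSym.comul h).lTensor _ t) := by
      intro t
      induction t with
      | zero => simp
      | add s t hs ht => simp only [map_add, hs, ht]
      | tmul x y =>
        simp only [GSym.Lam3, GSym.Lam_tmul' h hv, map_add, LinearMap.lTensor_tmul,
          GSym.comul_cons, LinearMap.add_apply, TensorProduct.map_tmul, LinearMap.mulLeft_apply,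
          LinearMap.id_apply]
    rw [h1, h2, ha]

lemma GSym.rTensor_counit (a : GSym gV) :
    (GSym.counit gV).toLinearMap.rTensor _ (GSym.comul h a) = 1 ⊗ₜ[k] a := by
  suffices H : (GSym.counit gV).toLinearMap.rTensor (GSym gV) ∘ₗ GSym.comul h =
      TensorProduct.mk k k (GSym gV) 1 from LinearMap.congr_fun H a
  refine GSym.ext_of_intertwine h ?_ fun n v hv a ha => ?_
  · simp [GSym.comul_one]
  · rw [LinearMap.comp_apply, GSym.comul_cons]
    rw [LinearMap.comp_apply] at ha
    have h1 : ∀ t, (GSym.counit gV).toLinearMap.rTensor (GSym gV) (GSym.Lam h v t) =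
        (LinearMap.mulLeft k (GSym.ι gV v)).lTensor k
          ((GSym.counit gV).toLinearMap.rTensor (GSym gV) t) := by
      intro t
      induction t with
      | zero => simp
      | add s t hs ht => simp only [map_add, hs, ht]
      | tmul x y =>
        rw [GSym.Lam_tmul' h hv, map_add, LinearMap.rTensor_tmul, LinearMap.rTensor_tmul,
          LinearMap.rTensor_tmul, AlgHom.toLinearMap_apply, AlgHom.toLinearMap_apply,
          AlgHom.toLinearMap_apply, GSym.counit_cons, GSym.counit_tw h, TensorProduct.zero_tmul,
          zero_add, LinearMap.lTensor_tmul, LinearMap.mulLeft_apply]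
    rw [h1, ha]
    rfl

lemma GSym.lTensor_counit (a : GSym gV) :
    (GSym.counit gV).toLinearMap.lTensor _ (GSym.comul h a) = a ⊗ₜ[k] 1 := by
  suffices H : (GSym.counit gV).toLinearMap.lTensor (GSym gV) ∘ₗ GSym.comul h =
      (TensorProduct.mk k (GSym gV) k).flip 1 from LinearMap.congr_fun H a
  refine GSym.ext_of_intertwine h ?_ fun n v hv a ha => ?_
  · simp [GSym.comul_one]
  · rw [LinearMap.comp_apply, GSym.comul_cons]
    rw [LinearMap.comp_apply] at ha
    have h1 : ∀ t, (GSym.counit gV).toLinearMap.lTensor (GSym gV) (GSym.Lam h v t) =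
        (LinearMap.mulLeft k (GSym.ι gV v)).rTensor k
          ((GSym.counit gV).toLinearMap.lTensor (GSym gV) t) := by
      intro t
      induction t with
      | zero => simp
      | add s t hs ht => simp only [map_add, hs, ht]
      | tmul x y =>
        rw [GSym.Lam_tmul' h hv, map_add, LinearMap.lTensor_tmul, LinearMap.lTensor_tmul,
          LinearMap.lTensor_tmul, AlgHom.toLinearMap_apply, AlgHom.toLinearMap_apply,
          GSym.counit_cons, TensorProduct.tmul_zero, add_zero, LinearMap.rTensor_tmul,
          LinearMap.mulLeft_apply]
    rw [h1, ha]
    rfl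

lemma GSym.cocomm (a : GSym gV) : swap (GSym.internal h) (GSym.comul h a) = GSym.comul h a := by
  suffices H : swap (GSym.internal h) ∘ₗ GSym.comul h = GSym.comul h from LinearMap.congr_fun H a
  refine GSym.ext_of_intertwine h ?_ fun n v hv a ha => ?_
  · rw [LinearMap.comp_apply, GSym.comul_one, swap_tmul (GSym.internal h) monoGr_one monoGr_one,
      mul_zero, sgn_zero, one_smul]
  · rw [LinearMap.comp_apply, GSym.comul_cons]
    rw [LinearMap.comp_apply] at ha
    have h1 : swap (GSym.internal h) ∘ₗ GSym.Lam h v = GSym.Lam h v ∘ₗ swap (GSym.internal h) := by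
      refine tensor_ext_gr (GSym.internal h) (GSym.internal h) fun a b x hx y hy => ?_
      rw [LinearMap.comp_apply, LinearMap.comp_apply, GSym.Lam_tmul h hv hx,
        swap_tmul (GSym.internal h) hx hy, map_smul, map_add, map_smul,
        GSym.Lam_tmul h hv hy, swap_tmul (GSym.internal h) (GSym.ι_mul_mem hv hx) hy,
        swap_tmul (GSym.internal h) hx (GSym.ι_mul_mem hv hy), add_mul, mul_add, sgn_add, sgn_add,
        mul_comm a n]
      rcases sgn_cases k (n * b) with e1 | e1 <;> rcases sgn_cases k (n * a) with e2 | e2 <;>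
        rcases sgn_cases k (a * b) with e3 | e3 <;> simp only [e1, e2, e3] <;> module
    have h2 := LinearMap.congr_fun h1 (GSym.comul h a)
    simp only [LinearMap.comp_apply] at h2
    rw [h2, ha]

/-- The graded symmetric coalgebra. -/
@[reducible] def GSym.coalgebra : Coalgebra k (GSym gV) where
  comul := GSym.comul h
  counit := (GSym.counit gV).toLinearMap
  coassoc := LinearMap.ext (GSym.coassoc h)
  rTensor_counit_comp_comul := LinearMap.ext (GSym.rTensor_counit h)
  lTensor_counit_comp_comul := LinearMap.ext (GSym.lTensor_counit h)

end Comul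

end Sym

/-! ### The Chevalley-Eilenberg chains of a Lie algebra -/

section Chains

variable {k : Type u} [Field k] (L : DGLA k)

/-- The grading of the suspension of `L`: an element of degree `n - 1` of `L` has degree `n`. -/
abbrev DGLA.cgr (n : ℤ) : Submodule k L.X := L.gr (n - 1)

lemma DGLA.c_internal : DirectSum.IsInternal L.cgr :=
  shift_internal L.internal (-1)

/-- The bracket on the suspension of `L`: `b (s x) (s y) = (-1) ^ |x| s [x, y]`. -/
def DGLA.b : L.X →ₗ[k] L.X →ₗ[k] L.X := L.br ∘ₗ tw L.internal 1

variable {L}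

lemma DGLA.b_apply {n : ℤ} {v : L.X} (hv : v ∈ L.cgr n) (w : L.X) :
    L.b v w = sgn k (n - 1) • L.br v w := by
  rw [DGLA.b, LinearMap.comp_apply, tw_one_of_mem L.internal hv, map_smul, LinearMap.smul_apply]

lemma DGLA.b_mem {n j : ℤ} {v w : L.X} (hv : v ∈ L.cgr n) (hw : w ∈ L.cgr j) :
    L.b v w ∈ L.cgr (n - 1 + j) := by
  rw [DGLA.b_apply hv]
  have := L.br_mem _ _ v hv w hw
  rw [show n - 1 + (j - 1) = n - 1 + j - 1 by ring] at this
  exact Submodule.smul_mem _ _ this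

lemma DGLA.b_comm {n j : ℤ} {v w : L.X} (hv : v ∈ L.cgr n) (hw : w ∈ L.cgr j) :
    L.b v w = sgn k (n * j) • L.b w v := by
  rw [DGLA.b_apply hv, DGLA.b_apply hw, L.br_skew _ _ v hv w hw,
    show (n - 1) * (j - 1) = n * j - n - (j - 1) by ring, sgn_sub, sgn_sub, sgn_sub, sgn_sub,
    sgn_one]
  rcases sgn_cases k (n * j) with e1 | e1 <;> rcases sgn_cases k n with e2 | e2 <;>
    rcases sgn_cases k j with e3 | e3 <;> simp only [e1, e2, e3] <;> module

lemma DGLA.b_d {n j : ℤ} {v w : L.X} (hv : v ∈ L.cgr n) (hw : w ∈ L.cgr j) :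
    L.d (L.b v w) = -(sgn k n • L.b v (L.d w)) - L.b (L.d v) w := by
  have hd : L.d v ∈ L.cgr (n - 1) := L.d_mem _ v hv
  rw [DGLA.b_apply hv, DGLA.b_apply hv, DGLA.b_apply hd, map_smul, L.br_leibniz _ _ v hv w hw,
    sgn_sub, sgn_sub, sgn_one]
  simp only [sgn_sub, sgn_one]
  rcases sgn_cases k n with e2 | e2 <;> simp only [e2] <;> module

lemma DGLA.b_jacobi {n j l : ℤ} {v w u : L.X} (hv : v ∈ L.cgr n) (hw : w ∈ L.cgr j)
    (hu : u ∈ L.cgr l) : L.b v (L.b w u) =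
      sgn k ((n - 1) * (j - 1)) • L.b w (L.b v u) - sgn k n • L.b (L.b v w) u := by
  rw [DGLA.b_apply hv, DGLA.b_apply hw, DGLA.b_apply hw, DGLA.b_apply hv,
    DGLA.b_apply (DGLA.b_mem hv hw), DGLA.b_apply hv, map_smul, map_smul, map_smul,
    L.br_jacobi _ _ _ v hv w hw u hu, LinearMap.smul_apply, sgn_sub k (n - 1 + j), sgn_add]
  simp only [sgn_sub, sgn_one]
  rcases sgn_cases k ((n - 1) * (j - 1)) with e1 | e1 <;> rcases sgn_cases k n with e2 | e2 <;>
    rcases sgn_cases k j with e3 | e3 <;> simp only [e1, e2, e3] <;> module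

variable (L)

/-- The graded symmetric algebra of the suspension of `L`. -/
abbrev DGLA.S : Type u := GSym L.cgr

/-- The generators. -/
abbrev DGLA.ι : L.X →ₗ[k] L.S := GSym.ι L.cgr

lemma DGLA.S_internal : DirectSum.IsInternal (GSym.gr L.cgr) := GSym.internal L.c_internal

variable {L} in
lemma DGLA.ι_comm {i j : ℤ} {v w : L.X} (hv : v ∈ L.cgr i) (hw : w ∈ L.cgr j) :
    L.ι v * L.ι w = sgn k (i * j) • (L.ι w * L.ι v) := Pres.gen_comm i j v hv w hw

/-- The operators from which the action of `L` on the symmetric algebra is defined by recursion. -/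
def DGLA.Psi (j : ℤ) : L.X →ₗ[k] Module.End k ((L.X →ₗ[k] L.S) × L.S) :=
  LinearMap.mk₂ k (fun w m => ((LinearMap.mul k L.S).flip m.2 ∘ₗ L.ι ∘ₗ L.b.flip w +
      LinearMap.mulLeft k (L.ι w) ∘ₗ m.1 ∘ₗ tw L.internal j, L.ι w * m.2))
    (fun w w' m => Prod.ext (LinearMap.ext fun v => by
      simp only [LinearMap.add_apply, LinearMap.comp_apply, LinearMap.flip_apply, map_add,
        LinearMap.mul_apply', LinearMap.mulLeft_apply, add_mul, Prod.fst_add]; abel)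
      (by simp only [map_add, add_mul, Prod.snd_add]))
    (fun r w m => Prod.ext (LinearMap.ext fun v => by
      simp only [LinearMap.add_apply, LinearMap.comp_apply, LinearMap.flip_apply, map_smul,
        LinearMap.mul_apply', LinearMap.mulLeft_apply, smul_mul_assoc, Prod.smul_fst, smul_add,
        LinearMap.smul_apply])
      (by simp only [map_smul, smul_mul_assoc, Prod.smul_snd]))
    (fun w m m' => Prod.ext (LinearMap.ext fun v => by
      simp only [LinearMap.add_apply, LinearMap.comp_apply, LinearMap.flip_apply, map_add,
        LinearMap.mul_apply', LinearMap.mulLeft_apply, mul_add, Prod.fst_add, Prod.snd_add]; abel)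
      (by simp only [mul_add, Prod.snd_add]))
    (fun r w m => Prod.ext (LinearMap.ext fun v => by
      simp only [LinearMap.add_apply, LinearMap.comp_apply, LinearMap.flip_apply,
        LinearMap.mul_apply', LinearMap.mulLeft_apply, mul_smul_comm, Prod.smul_fst, smul_add,
        LinearMap.smul_apply, Prod.smul_snd])
      (by simp only [mul_smul_comm, Prod.smul_snd]))

lemma DGLA.Psi_fst (j : ℤ) (w : L.X) (m : (L.X →ₗ[k] L.S) × L.S) (v : L.X) :
    (L.Psi j w m).1 v = L.ι (L.b v w) * m.2 + L.ι w * m.1 (tw L.internal j v) := rfl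

lemma DGLA.Psi_snd (j : ℤ) (w : L.X) (m : (L.X →ₗ[k] L.S) × L.S) :
    (L.Psi j w m).2 = L.ι w * m.2 := rfl

/-- The operator attached to an arbitrary generator. -/
def DGLA.PsiAll : L.X →ₗ[k] Module.End k ((L.X →ₗ[k] L.S) × L.S) :=
  byDeg (Z := Module.End k ((L.X →ₗ[k] L.S) × L.S)) L.c_internal L.Psi

lemma DGLA.PsiAll_apply {n : ℤ} {v : L.X} (hv : v ∈ L.cgr n) : L.PsiAll v = L.Psi n v :=
  byDeg_of_mem L.c_internal _ hv

lemma DGLA.Psi_comm : ∀ i j, ∀ v ∈ L.cgr i, ∀ w ∈ L.cgr j,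
    L.PsiAll v * L.PsiAll w =
      sgn k (i * j) • (L.PsiAll w * L.PsiAll v) := by
  intro i j w hw u hu
  rw [L.PsiAll_apply hw, L.PsiAll_apply hu]
  have e := DGLA.ι_comm hw hu
  refine LinearMap.ext fun m => Prod.ext (ext_gr L.c_internal fun n v hv => ?_) ?_
  · rw [Module.End.mul_apply, LinearMap.smul_apply, Module.End.mul_apply, Prod.smul_fst,
      LinearMap.smul_apply, DGLA.Psi_fst, DGLA.Psi_fst, DGLA.Psi_fst, DGLA.Psi_fst, DGLA.Psi_snd,
      DGLA.Psi_snd, tw_of_mem L.internal _ hv, tw_of_mem L.internal _ hv]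
    simp only [map_smul, LinearMap.smul_apply, tw_of_mem L.internal _ hv]
    have e1 := DGLA.ι_comm (DGLA.b_mem hv hw) hu
    have e2 := DGLA.ι_comm hw (DGLA.b_mem hv hu)
    simp only [mul_add, mul_smul_comm, smul_mul_assoc, ← mul_assoc]
    rw [e1, e2, e]
    simp only [smul_mul_assoc]
    rw [show (n - 1 + i) * j = j * (n - 1) + i * j by ring, sgn_add,
      show i * (n - 1 + j) = i * (n - 1) + i * j by ring, sgn_add]
    rcases sgn_cases k (i * j) with e1 | e1 <;> rcases sgn_cases k (i * (n - 1)) with e2 | e2 <;>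
      rcases sgn_cases k (j * (n - 1)) with e3 | e3 <;> simp only [e1, e2, e3] <;> module
  · rw [Module.End.mul_apply, LinearMap.smul_apply, Module.End.mul_apply, Prod.smul_snd,
      DGLA.Psi_snd, DGLA.Psi_snd, DGLA.Psi_snd, DGLA.Psi_snd, ← mul_assoc, e, smul_mul_assoc,
      mul_assoc]

/-- The recursion defining the action. -/
def DGLA.psi : L.S →ₐ[k] Module.End k ((L.X →ₗ[k] L.S) × L.S) :=
  Pres.lift (gV := L.cgr) (R := fun _ _ => False) (B := Module.End k ((L.X →ₗ[k] L.S) × L.S))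
    L.PsiAll L.Psi_comm fun _ _ (h : False) => h.elim

lemma DGLA.psi_cons {j : ℤ} {w : L.X} (hw : w ∈ L.cgr j) (a : L.S)
    (m : (L.X →ₗ[k] L.S) × L.S) : L.psi (L.ι w * a) m = L.Psi j w (L.psi a m) := by
  rw [map_mul, DGLA.psi, Pres.lift_gen, L.PsiAll_apply hw]
  rfl

lemma DGLA.psi_snd (a : L.S) : (L.psi a (0, 1)).2 = a := by
  refine GSym.induction L.c_internal (p := fun a => (L.psi a (0, 1)).2 = a) a ?_ ?_ ?_ ?_
  · rw [map_one]; rfl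
  · intro n v hv a ha
    rw [L.psi_cons hv, DGLA.Psi_snd, ha]
  · intro a b ha hb
    rw [map_add, LinearMap.add_apply, Prod.snd_add, ha, hb]
  · intro r a ha
    rw [map_smul, LinearMap.smul_apply, Prod.smul_snd, ha]

/-- The action of `L` on the symmetric algebra of its suspension: `θ x` is the derivation of degree
`|x|` with `θ x (s y) = b (s x) (s y)`. -/
def DGLA.θ : L.X →ₗ[k] L.S →ₗ[k] L.S :=
  (LinearMap.fst k (L.X →ₗ[k] L.S) L.S ∘ₗ L.psi.toLinearMap.flip (0, 1)).flip

lemma DGLA.θ_def (v : L.X) (a : L.S) : L.θ v a = (L.psi a (0, 1)).1 v := rfl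

lemma DGLA.θ_one (v : L.X) : L.θ v 1 = 0 := by
  rw [L.θ_def, map_one]; rfl

lemma DGLA.θ_cons' {j : ℤ} {w : L.X} (hw : w ∈ L.cgr j) (v : L.X) (a : L.S) :
    L.θ v (L.ι w * a) = L.ι (L.b v w) * a + L.ι w * L.θ (tw L.internal j v) a := by
  rw [L.θ_def, L.psi_cons hw, L.Psi_fst, L.psi_snd]
  rfl

variable {L}

lemma DGLA.θ_cons {n j : ℤ} {v w : L.X} (hv : v ∈ L.cgr n) (hw : w ∈ L.cgr j) (a : L.S) :
    L.θ v (L.ι w * a) = L.ι (L.b v w) * a + sgn k (j * (n - 1)) • (L.ι w * L.θ v a) := by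
  rw [L.θ_cons' hw, tw_of_mem L.internal j hv, map_smul, LinearMap.smul_apply, mul_smul_comm]

lemma DGLA.θ_mem {n m : ℤ} {v : L.X} (hv : v ∈ L.cgr n) {a : L.S} (ha : a ∈ GSym.gr L.cgr m) :
    L.θ v a ∈ GSym.gr L.cgr (n - 1 + m) := by
  refine monoGr_induction (p := fun a => L.θ v a ∈ GSym.gr L.cgr (n - 1 + m)) ha
    (fun a ha => ?_) (by simp) (fun b c hb hc => by rw [map_add]; exact add_mem hb hc)
    (fun r b hb => by rw [map_smul]; exact Submodule.smul_mem _ _ hb)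
  clear * - ha hv
  induction ha with
  | one => rw [L.θ_one]; exact zero_mem _
  | @cons i j m w a hn hw ha ih =>
    rw [DGLA.θ_cons hv hw]
    refine add_mem ?_ (Submodule.smul_mem _ _ ?_)
    · have := monoGr_mul (monoGr_ι (ι := L.ι) (DGLA.b_mem hv hw)) ha.mem
      rwa [show n - 1 + i + j = n - 1 + m by omega] at this
    · have := monoGr_mul (monoGr_ι (ι := L.ι) hw) ih
      rwa [show i + (n - 1 + j) = n - 1 + m by omega] at this

lemma DGLA.θ_θ {n j : ℤ} {v w : L.X} (hv : v ∈ L.cgr n) (hw : w ∈ L.cgr j) (a : L.S) :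
    L.θ v (L.θ w a) = sgn k ((n - 1) * (j - 1)) • L.θ w (L.θ v a) - sgn k n • L.θ (L.b v w) a := by
  refine GSym.induction L.c_internal (p := fun a => L.θ v (L.θ w a) =
    sgn k ((n - 1) * (j - 1)) • L.θ w (L.θ v a) - sgn k n • L.θ (L.b v w) a) a ?_ ?_ ?_ ?_
  · simp [DGLA.θ_one]
  · intro l u hu a ih
    rw [DGLA.θ_cons hw hu, DGLA.θ_cons hv hu, DGLA.θ_cons (DGLA.b_mem hv hw) hu, map_add, map_add,
      map_smul, map_smul, DGLA.θ_cons hv (DGLA.b_mem hw hu), DGLA.θ_cons hw (DGLA.b_mem hv hu),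
      DGLA.θ_cons hv hu, DGLA.θ_cons hw hu, ih, DGLA.b_jacobi hv hw hu, mul_sub (L.ι u), map_sub, map_smul,
      map_smul, sub_mul, smul_mul_assoc, smul_mul_assoc, mul_smul_comm, mul_smul_comm,
      show (j - 1 + l) * (n - 1) = (n - 1) * (j - 1) + l * (n - 1) by ring, sgn_add,
      show (n - 1 + l) * (j - 1) = (n - 1) * (j - 1) + l * (j - 1) by ring, sgn_add,
      show l * (n - 1 + j - 1) = l * (n - 1) + l * (j - 1) by ring, sgn_add]
    rcases sgn_cases k ((n - 1) * (j - 1)) with e1 | e1 <;>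
      rcases sgn_cases k (l * (n - 1)) with e2 | e2 <;>
      rcases sgn_cases k (l * (j - 1)) with e3 | e3 <;> simp only [e1, e2, e3] <;> module
  · intro a b ha hb
    simp only [map_add, ha, hb, smul_add]; abel
  · intro r a ha
    simp only [map_smul, ha, smul_sub, smul_comm r]

variable (L)

/-- The operators from which the differential is defined by recursion. -/
def DGLA.Phi (n : ℤ) : L.X →ₗ[k] Module.End k (L.S × L.S) :=
  LinearMap.mk₂ k (fun v m => (L.ι v * m.1,
      sgn k n • (L.ι v * m.2) - L.ι (L.d v) * m.1 + L.θ v m.1))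
    (fun v v' m => Prod.ext (by simp only [map_add, add_mul, Prod.fst_add])
      (by simp only [map_add, add_mul, Prod.snd_add, LinearMap.add_apply, smul_add]; abel))
    (fun r v m => Prod.ext (by simp only [map_smul, smul_mul_assoc, Prod.smul_fst])
      (by simp only [map_smul, smul_mul_assoc, Prod.smul_snd, LinearMap.smul_apply, smul_add,
        smul_sub, smul_comm r]))
    (fun v m m' => Prod.ext (by simp only [mul_add, Prod.fst_add])
      (by simp only [map_add, mul_add, Prod.snd_add, Prod.fst_add, smul_add]; abel))
    (fun r v m => Prod.ext (by simp only [mul_smul_comm, Prod.smul_fst])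
      (by simp only [map_smul, mul_smul_comm, Prod.smul_snd, Prod.smul_fst, smul_add,
        smul_sub, smul_comm r]))

lemma DGLA.Phi_fst (n : ℤ) (v : L.X) (m : L.S × L.S) : (L.Phi n v m).1 = L.ι v * m.1 := rfl

lemma DGLA.Phi_snd (n : ℤ) (v : L.X) (m : L.S × L.S) : (L.Phi n v m).2 =
    sgn k n • (L.ι v * m.2) - L.ι (L.d v) * m.1 + L.θ v m.1 := rfl

/-- The operator attached to an arbitrary generator. -/
def DGLA.PhiAll : L.X →ₗ[k] Module.End k (L.S × L.S) :=
  byDeg (Z := Module.End k (L.S × L.S)) L.c_internal L.Phi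

lemma DGLA.PhiAll_apply {n : ℤ} {v : L.X} (hv : v ∈ L.cgr n) : L.PhiAll v = L.Phi n v :=
  byDeg_of_mem L.c_internal _ hv

lemma DGLA.Phi_comm : ∀ i j, ∀ v ∈ L.cgr i, ∀ w ∈ L.cgr j,
    L.PhiAll v * L.PhiAll w =
      sgn k (i * j) • (L.PhiAll w * L.PhiAll v) := by
  intro n j v hv w hw
  rw [L.PhiAll_apply hv, L.PhiAll_apply hw]
  have e := DGLA.ι_comm hv hw
  have hdv : L.d v ∈ L.cgr (n - 1) := L.d_mem _ v hv
  have hdw : L.d w ∈ L.cgr (j - 1) := L.d_mem _ w hw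
  have e1 := DGLA.ι_comm hdv hw
  have e2 := DGLA.ι_comm hv hdw
  refine LinearMap.ext fun m => Prod.ext ?_ ?_
  · rw [Module.End.mul_apply, LinearMap.smul_apply, Module.End.mul_apply, Prod.smul_fst,
      DGLA.Phi_fst, DGLA.Phi_fst, DGLA.Phi_fst, DGLA.Phi_fst, ← mul_assoc, e, smul_mul_assoc,
      mul_assoc]
  · rw [Module.End.mul_apply, LinearMap.smul_apply, Module.End.mul_apply, Prod.smul_snd,
      DGLA.Phi_snd, DGLA.Phi_snd, DGLA.Phi_snd, DGLA.Phi_snd, DGLA.Phi_fst, DGLA.Phi_fst,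
      DGLA.θ_cons hv hw, DGLA.θ_cons hw hv, DGLA.b_comm hv hw]
    simp only [mul_add, mul_sub, mul_smul_comm, map_smul, smul_mul_assoc]
    rw [← mul_assoc (L.ι v), e, ← mul_assoc (L.ι v), e2, ← mul_assoc (L.ι (L.d v)), e1]
    simp only [smul_mul_assoc, ← mul_assoc, mul_sub, sub_mul, sgn_sub, mul_one, one_mul, mul_comm j n]
    rcases sgn_cases k (n * j) with e1 | e1 <;>
      rcases sgn_cases k n with e2 | e2 <;>
      rcases sgn_cases k j with e3 | e3 <;> simp only [e1, e2, e3] <;> module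

/-- The recursion defining the differential. -/
def DGLA.phi : L.S →ₐ[k] Module.End k (L.S × L.S) :=
  Pres.lift (gV := L.cgr) (R := fun _ _ => False) (B := Module.End k (L.S × L.S))
    L.PhiAll L.Phi_comm fun _ _ (h : False) => h.elim

lemma DGLA.phi_cons {n : ℤ} {v : L.X} (hv : v ∈ L.cgr n) (a : L.S) (m : L.S × L.S) :
    L.phi (L.ι v * a) m = L.Phi n v (L.phi a m) := by
  rw [map_mul, DGLA.phi, Pres.lift_gen, L.PhiAll_apply hv]
  rfl

lemma DGLA.phi_fst (a : L.S) : (L.phi a (1, 0)).1 = a := by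
  refine GSym.induction L.c_internal (p := fun a => (L.phi a (1, 0)).1 = a) a ?_ ?_ ?_ ?_
  · rw [map_one]; rfl
  · intro n v hv a ha
    rw [L.phi_cons hv, DGLA.Phi_fst, ha]
  · intro a b ha hb
    rw [map_add, LinearMap.add_apply, Prod.fst_add, ha, hb]
  · intro r a ha
    rw [map_smul, LinearMap.smul_apply, Prod.smul_fst, ha]

/-- The differential of the Chevalley-Eilenberg chains: it is determined by `D 1 = 0` and
`D (v a) = (-1) ^ |v| v (D a) - (d v) a + θ v a` for `v` in the suspension of `L`. In particular,
`D (s x) = -s (d x)` and `D (s x * s y) = -s (d x) * s y + (-1) ^ |x| s x * s (d y) +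
(-1) ^ |x| s [x, y]`. -/
def DGLA.D : L.S →ₗ[k] L.S :=
  LinearMap.snd k L.S L.S ∘ₗ L.phi.toLinearMap.flip (1, 0)

lemma DGLA.D_def (a : L.S) : L.D a = (L.phi a (1, 0)).2 := rfl

lemma DGLA.D_one : L.D 1 = 0 := by
  rw [L.D_def, map_one]; rfl

variable {L}

lemma DGLA.D_cons {n : ℤ} {v : L.X} (hv : v ∈ L.cgr n) (a : L.S) :
    L.D (L.ι v * a) = sgn k n • (L.ι v * L.D a) - L.ι (L.d v) * a + L.θ v a := by
  rw [L.D_def, L.phi_cons hv, L.Phi_snd, L.phi_fst]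
  rfl

lemma DGLA.D_mem {m : ℤ} {a : L.S} (ha : a ∈ GSym.gr L.cgr m) : L.D a ∈ GSym.gr L.cgr (m - 1) := by
  refine monoGr_induction (p := fun a => L.D a ∈ GSym.gr L.cgr (m - 1)) ha
    (fun a ha => ?_) (by simp) (fun b c hb hc => by rw [map_add]; exact add_mem hb hc)
    (fun r b hb => by rw [map_smul]; exact Submodule.smul_mem _ _ hb)
  clear * - ha
  induction ha with
  | one => rw [L.D_one]; exact zero_mem _
  | @cons i j m v a hn hv ha ih =>
    rw [DGLA.D_cons hv]
    refine add_mem (sub_mem (Submodule.smul_mem _ _ ?_) ?_) ?_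
    · have := monoGr_mul (monoGr_ι (ι := L.ι) hv) ih
      rwa [show i + (j - 1) = m - 1 by omega] at this
    · have := monoGr_mul (monoGr_ι (gV := L.cgr) (ι := L.ι) (L.d_mem _ v hv)) ha.mem
      rwa [show i - 1 + j = m - 1 by omega] at this
    · have := DGLA.θ_mem hv ha.mem
      rwa [show i - 1 + j = m - 1 by omega] at this

lemma DGLA.D_θ {n : ℤ} {v : L.X} (hv : v ∈ L.cgr n) (a : L.S) :
    L.D (L.θ v a) = L.θ (L.d v) a - sgn k n • L.θ v (L.D a) := by
  have hdv : L.d v ∈ L.cgr (n - 1) := L.d_mem _ v hv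
  refine GSym.induction L.c_internal (p := fun a => L.D (L.θ v a) =
    L.θ (L.d v) a - sgn k n • L.θ v (L.D a)) a ?_ ?_ ?_ ?_
  · simp [DGLA.θ_one, DGLA.D_one]
  · intro j w hw a ih
    have hdw : L.d w ∈ L.cgr (j - 1) := L.d_mem _ w hw
    have hT := DGLA.θ_θ hv hw a
    rw [DGLA.θ_cons hv hw, map_add, map_smul, DGLA.D_cons (DGLA.b_mem hv hw), DGLA.D_cons hw, ih,
      DGLA.D_cons hw, map_add, map_sub, map_smul, DGLA.θ_cons hv hw, DGLA.θ_cons hv hdw,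
      DGLA.θ_cons hdv hw, hT, DGLA.b_d hv hw]
    simp only [map_sub, map_neg, map_smul, sub_mul, neg_mul, smul_mul_assoc, mul_sub, mul_add,
      mul_smul_comm, sgn_sub, sgn_add, mul_one, one_mul, sgn_one, mul_comm j n]
    rcases sgn_cases k (n * j) with e1 | e1 <;>
      rcases sgn_cases k n with e2 | e2 <;>
      rcases sgn_cases k j with e3 | e3 <;> simp only [e1, e2, e3] <;> module
  · intro a b ha hb
    simp only [map_add, ha, hb, smul_add]; abel
  · intro r a ha
    simp only [map_smul, ha, smul_sub, smul_comm r]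

lemma DGLA.D_D (a : L.S) : L.D (L.D a) = 0 := by
  refine GSym.induction L.c_internal (p := fun a => L.D (L.D a) = 0) a ?_ ?_ ?_ ?_
  · simp [DGLA.D_one]
  · intro n v hv a ih
    have hdv : L.d v ∈ L.cgr (n - 1) := L.d_mem _ v hv
    rw [DGLA.D_cons hv, map_add, map_sub, map_smul, DGLA.D_cons hv, DGLA.D_cons hdv, DGLA.D_θ hv,
      ih, L.d_sq, sgn_sub, sgn_one]
    simp only [map_zero, zero_mul, mul_zero]
    rcases sgn_cases k n with e2 | e2 <;> simp only [e2] <;> module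
  · intro a b ha hb
    simp only [map_add, ha, hb, add_zero]
  · intro r a ha
    simp only [map_smul, ha, smul_zero]

lemma DGLA.counit_θ (v : L.X) (a : L.S) : GSym.counit L.cgr (L.θ v a) = 0 := by
  refine GSym.induction L.c_internal (p := fun a => ∀ v, GSym.counit L.cgr (L.θ v a) = 0) a ?_ ?_
    ?_ ?_ v
  · intro v
    rw [L.θ_one, map_zero]
  · intro n w hw a ih v
    rw [L.θ_cons' hw, map_add, GSym.counit_cons, GSym.counit_cons, add_zero]
  · intro a b ha hb v
    rw [map_add, map_add, ha, hb, add_zero]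
  · intro r a ha v
    rw [map_smul, map_smul, ha, smul_zero]

lemma DGLA.counit_D (a : L.S) : GSym.counit L.cgr (L.D a) = 0 := by
  refine GSym.induction L.c_internal (p := fun a => GSym.counit L.cgr (L.D a) = 0) a ?_ ?_ ?_ ?_
  · rw [L.D_one, map_zero]
  · intro n w hw a ih
    rw [DGLA.D_cons hw, map_add, map_sub, map_smul, GSym.counit_cons, GSym.counit_cons,
      DGLA.counit_θ, smul_zero, sub_zero, add_zero]
  · intro a b ha hb
    rw [map_add, map_add, ha, hb, add_zero]
  · intro r a ha
    rw [map_smul, map_smul, ha, smul_zero]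

lemma DGLA.comul_θ {n : ℤ} {v : L.X} (hv : v ∈ L.cgr n) (a : L.S) :
    GSym.comul L.c_internal (L.θ v a) =
      TensorProduct.map (L.θ v) LinearMap.id (GSym.comul L.c_internal a) +
        TensorProduct.map (tw L.S_internal (n - 1)) (L.θ v) (GSym.comul L.c_internal a) := by
  suffices H : GSym.comul L.c_internal ∘ₗ L.θ v = (TensorProduct.map (L.θ v) LinearMap.id +
      TensorProduct.map (tw L.S_internal (n - 1)) (L.θ v)) ∘ₗ GSym.comul L.c_internal from
    LinearMap.congr_fun H a
  refine GSym.ext_of_intertwine L.c_internal ?_ fun j w hw a ih => ?_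
  · simp [L.θ_one, GSym.comul_one]
  · have key : (TensorProduct.map (L.θ v) LinearMap.id +
        TensorProduct.map (tw L.S_internal (n - 1)) (L.θ v)) ∘ₗ GSym.Lam L.c_internal w =
        GSym.Lam L.c_internal (L.b v w) + sgn k (j * (n - 1)) • GSym.Lam L.c_internal w ∘ₗ
          (TensorProduct.map (L.θ v) LinearMap.id +
            TensorProduct.map (tw L.S_internal (n - 1)) (L.θ v)) := by
      refine tensor_ext_gr L.S_internal L.S_internal fun p q x hx y hy => ?_
      simp only [LinearMap.comp_apply, LinearMap.add_apply, LinearMap.smul_apply,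
        GSym.Lam_tmul L.c_internal hw hx, map_add, map_smul, TensorProduct.map_tmul,
        LinearMap.id_apply, GSym.Lam_tmul L.c_internal (DGLA.b_mem hv hw) hx,
        GSym.Lam_tmul L.c_internal hw (DGLA.θ_mem hv hx),
        tw_of_mem L.S_internal _ (GSym.ι_mul_mem hw hx), tw_of_mem L.S_internal _ hx,
        DGLA.θ_cons hv hw, TensorProduct.add_tmul, TensorProduct.tmul_add,
        ← TensorProduct.smul_tmul', TensorProduct.tmul_smul]
      simp only [add_mul, mul_add, sgn_add, mul_comm (n - 1) j, mul_comm (n - 1) p]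
      rcases sgn_cases k (j * (n - 1)) with e1 | e1 <;>
        rcases sgn_cases k (p * (n - 1)) with e2 | e2 <;>
        rcases sgn_cases k (j * p) with e3 | e3 <;> simp only [e1, e2, e3] <;> module
    have key' := LinearMap.congr_fun key (GSym.comul L.c_internal a)
    simp only [LinearMap.comp_apply, LinearMap.add_apply, LinearMap.smul_apply] at key' ih ⊢
    rw [GSym.comul_cons, key', ← ih, DGLA.θ_cons hv hw, map_add, map_smul, GSym.comul_cons,
      GSym.comul_cons]

lemma DGLA.comul_D (a : L.S) :
    GSym.comul L.c_internal (L.D a) =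
      TensorProduct.map L.D LinearMap.id (GSym.comul L.c_internal a) +
        TensorProduct.map (tw L.S_internal 1) L.D (GSym.comul L.c_internal a) := by
  suffices H : GSym.comul L.c_internal ∘ₗ L.D = (TensorProduct.map L.D LinearMap.id +
      TensorProduct.map (tw L.S_internal 1) L.D) ∘ₗ GSym.comul L.c_internal from
    LinearMap.congr_fun H a
  refine GSym.ext_of_intertwine L.c_internal ?_ fun n v hv a ih => ?_
  · simp [L.D_one, GSym.comul_one]
  · have hdv : L.d v ∈ L.cgr (n - 1) := L.d_mem _ v hv
    have key : (TensorProduct.map L.D LinearMap.id +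
        TensorProduct.map (tw L.S_internal 1) L.D) ∘ₗ GSym.Lam L.c_internal v =
        sgn k n • GSym.Lam L.c_internal v ∘ₗ (TensorProduct.map L.D LinearMap.id +
          TensorProduct.map (tw L.S_internal 1) L.D) - GSym.Lam L.c_internal (L.d v) +
          (TensorProduct.map (L.θ v) LinearMap.id +
            TensorProduct.map (tw L.S_internal (n - 1)) (L.θ v)) := by
      refine tensor_ext_gr L.S_internal L.S_internal fun p q x hx y hy => ?_
      simp only [LinearMap.comp_apply, LinearMap.add_apply, LinearMap.smul_apply,
        LinearMap.sub_apply,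
        GSym.Lam_tmul L.c_internal hv hx, map_add, map_smul, TensorProduct.map_tmul,
        LinearMap.id_apply, GSym.Lam_tmul L.c_internal hdv hx,
        GSym.Lam_tmul L.c_internal hv (DGLA.D_mem hx),
        tw_of_mem L.S_internal _ (GSym.ι_mul_mem hv hx), tw_of_mem L.S_internal _ hx,
        DGLA.D_cons hv, TensorProduct.add_tmul, TensorProduct.tmul_add, TensorProduct.sub_tmul,
        TensorProduct.tmul_sub, ← TensorProduct.smul_tmul', TensorProduct.tmul_smul]
      simp only [sub_mul, mul_sub, mul_add, sgn_sub, sgn_add, one_mul, mul_one, sgn_one]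
      rcases sgn_cases k n with e1 | e1 <;>
        rcases sgn_cases k p with e2 | e2 <;>
        rcases sgn_cases k (n * p) with e3 | e3 <;> simp only [e1, e2, e3] <;> module
    have key' := LinearMap.congr_fun key (GSym.comul L.c_internal a)
    simp only [LinearMap.comp_apply, LinearMap.add_apply, LinearMap.smul_apply,
      LinearMap.sub_apply] at key' ih ⊢
    rw [GSym.comul_cons, key', ← ih, DGLA.D_cons hv, map_add, map_sub, map_smul, GSym.comul_cons,
      GSym.comul_cons, DGLA.comul_θ hv]

variable (L)

/-- The Chevalley-Eilenberg chains of `L`: the graded symmetric coalgebra of the suspension of `L`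
with the differential `D`. -/
def ceChains : DGCC k where
  X := L.S
  coalg := GSym.coalgebra L.c_internal
  gr := GSym.gr L.cgr
  internal := L.S_internal
  d := L.D
  d_mem _ _ hx := DGLA.D_mem hx
  d_sq := DGLA.D_D
  comul_mem := GSym.comul_mem L.c_internal
  cocomm := GSym.cocomm L.c_internal
  comul_d := DGLA.comul_D
  counit_gr := GSym.counit_gr
  counit_d := DGLA.counit_D
  one := 1
  one_mem := monoGr_one
  d_one := L.D_one
  comul_one := GSym.comul_one _
  counit_one := map_one (GSym.counit L.cgr)

end Chains

section ChainWeights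

variable {k : Type u} [Field k] {L : DGLA k}

/-- Weights on the generators of the Chevalley-Eilenberg chains: the differential of `L` preserves
them, and the bracket of elements of weights `i` and `j` has weight `i + j - 1`. -/
structure DGLA.WeightFamily (L : DGLA k) (W : ℤ → Submodule k L.X) : Prop where
  proj_mem : ∀ n w, ∀ x ∈ W w, proj L.internal n x ∈ W w
  d_mem : ∀ w, ∀ x ∈ W w, L.d x ∈ W w
  br_mem : ∀ i j, ∀ x ∈ W i, ∀ y ∈ W j, L.br x y ∈ W (i + j - 1)

/-- The weights on the Chevalley-Eilenberg chains, which are additive on products. -/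
def ceWt (L : DGLA k) (W : ℤ → Submodule k L.X) : ℤ → Submodule k (ceChains L).X :=
  fun w => monoGr (A := L.S) W L.ι w

variable {W : ℤ → Submodule k L.X}

lemma DGLA.wt_induction (H : L.WeightFamily W) {p : ℤ → L.S → Prop} (one : p 0 1) (zero : ∀ w, p w 0)
    (cons : ∀ i n j v a, v ∈ W i → v ∈ L.cgr n → a ∈ monoGr W L.ι j → p j a →
      p (i + j) (L.ι v * a))
    (add : ∀ w a b, p w a → p w b → p w (a + b)) (smul : ∀ w (r : k) a, p w a → p w (r • a))
    {w : ℤ} {a : L.S} (ha : a ∈ monoGr W L.ι w) : p w a := by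
  refine monoGr_induction (p := fun a => p w a) ha (fun a ha => ?_) (zero w) (add w) (smul w)
  clear * - ha one zero cons add H
  induction ha with
  | one => exact one
  | @cons i j w v a hn hv ha ih =>
    obtain ⟨s, hs, -⟩ := mem_iSup_proj L.internal v
    rw [hs, map_sum, Finset.sum_mul, ← hn]
    refine Finset.sum_induction _ (p (i + j)) (fun _ _ => add _ _ _) (zero _) fun n _ => ?_
    have : proj L.internal n v ∈ L.cgr (n + 1) := by
      change proj L.internal n v ∈ L.gr (n + 1 - 1)
      rw [add_sub_cancel_right]
      exact proj_mem L.internal n v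
    exact cons i (n + 1) j _ a (H.proj_mem n i v hv) this ha.mem ih

lemma DGLA.wt_b (H : L.WeightFamily W) {i j : ℤ} {v w : L.X} {n : ℤ} (hv : v ∈ W i) (hvn : v ∈ L.cgr n) (hw : w ∈ W j) :
    L.b v w ∈ W (i + j - 1) := by
  rw [DGLA.b_apply hvn]
  exact Submodule.smul_mem _ _ (H.br_mem i j v hv w hw)

lemma GSym.proj_ι_mul {V : Type u} [AddCommGroup V] [Module k V] {gV : ℤ → Submodule k V}
    (h : DirectSum.IsInternal gV) {n : ℤ} {v : V} (hv : v ∈ gV n) (m : ℤ) (a : GSym gV) :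
    proj (GSym.internal h) m (GSym.ι gV v * a) =
      GSym.ι gV v * proj (GSym.internal h) (m - n) a := by
  have := proj_map (GSym.internal h) (GSym.internal h) n
    (LinearMap.mulLeft k (GSym.ι gV v)) (fun j x hx => by
      rw [add_comm]; exact GSym.ι_mul_mem hv hx) (m - n) a
  rw [sub_add_cancel] at this
  exact this.symm

lemma DGLA.wt_proj (H : L.WeightFamily W) (n w : ℤ) (a : L.S) (ha : a ∈ monoGr W L.ι w) :
    proj L.S_internal n a ∈ monoGr W L.ι w := by
  suffices ∀ n, proj L.S_internal n a ∈ monoGr W L.ι w from this n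
  refine DGLA.wt_induction H (p := fun w a => ∀ n, proj L.S_internal n a ∈ monoGr W L.ι w) ?_ ?_ ?_
    ?_ ?_ ha
  · intro n
    by_cases hn : 0 = n
    · rw [← hn, proj_of_mem L.S_internal monoGr_one]; exact monoGr_one
    · rw [proj_of_ne L.S_internal monoGr_one hn]; exact zero_mem _
  · intro w n; rw [map_zero]; exact zero_mem _
  · intro i m j v a hv hvm _ ih n
    rw [GSym.proj_ι_mul L.c_internal hvm]
    exact monoGr_mul (monoGr_ι hv) (ih _)
  · intro w a b ha hb n; rw [map_add]; exact add_mem (ha n) (hb n)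
  · intro w r a ha n; rw [map_smul]; exact Submodule.smul_mem _ _ (ha n)

lemma DGLA.wt_tw (H : L.WeightFamily W) (e w : ℤ) (a : L.S) (ha : a ∈ monoGr W L.ι w) :
    tw L.S_internal e a ∈ monoGr W L.ι w := by
  obtain ⟨s, hs, -⟩ := mem_iSup_proj L.S_internal a
  rw [hs, map_sum]
  refine Submodule.sum_mem _ fun n _ => ?_
  rw [tw_of_mem L.S_internal e (proj_mem L.S_internal n a)]
  exact Submodule.smul_mem _ _ (DGLA.wt_proj H n w a ha)

lemma DGLA.wt_comul (H : L.WeightFamily W) (w : ℤ) (a : L.S) (ha : a ∈ monoGr W L.ι w) :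
    GSym.comul L.c_internal a ∈ tgr (monoGr W L.ι) (monoGr W L.ι) w := by
  refine DGLA.wt_induction H (p := fun w a =>
    GSym.comul L.c_internal a ∈ tgr (monoGr W L.ι) (monoGr W L.ι) w) ?_ ?_ ?_ ?_ ?_ ha
  · rw [GSym.comul_one]; exact tmul_mem_tgr (add_zero 0) monoGr_one monoGr_one
  · intro w; rw [map_zero]; exact zero_mem _
  · intro i m j v a hv hvm _ ih
    rw [GSym.comul_cons]
    refine tgr_le (GSym.Lam L.c_internal v) (fun p q hpq x hx y hy => ?_) ih
    rw [GSym.Lam_tmul' L.c_internal hvm]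
    exact add_mem (tmul_mem_tgr (by omega) (monoGr_mul (monoGr_ι hv) hx) hy)
      (tmul_mem_tgr (j := i + q) (by omega) (DGLA.wt_tw H m p x hx) (monoGr_mul (monoGr_ι hv) hy))
  · intro w a b ha hb; rw [map_add]; exact add_mem ha hb
  · intro w r a ha; rw [map_smul]; exact Submodule.smul_mem _ _ ha

lemma DGLA.wt_θ (H : L.WeightFamily W) {i n : ℤ} {v : L.X} (hv : v ∈ W i) (hvn : v ∈ L.cgr n) {w : ℤ} {a : L.S}
    (ha : a ∈ monoGr W L.ι w) : L.θ v a ∈ monoGr W L.ι (i + w - 1) := by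
  refine DGLA.wt_induction H (p := fun w a => L.θ v a ∈ monoGr W L.ι (i + w - 1)) ?_ ?_ ?_ ?_ ?_ ha
  · rw [L.θ_one]; exact zero_mem _
  · intro w; rw [map_zero]; exact zero_mem _
  · intro j m w u a hu hum ha ih
    rw [DGLA.θ_cons hvn hum]
    refine add_mem ?_ (Submodule.smul_mem _ _ ?_)
    · have := monoGr_mul (monoGr_ι (ι := L.ι) (DGLA.wt_b H hv hvn hu)) ha
      rwa [show i + j - 1 + w = i + (j + w) - 1 by ring] at this
    · have := monoGr_mul (monoGr_ι (ι := L.ι) hu) ih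
      rwa [show j + (i + w - 1) = i + (j + w) - 1 by ring] at this
  · intro w a b ha hb; rw [map_add]; exact add_mem ha hb
  · intro w r a ha; rw [map_smul]; exact Submodule.smul_mem _ _ ha

lemma DGLA.wt_D (H : L.WeightFamily W) (w : ℤ) (a : L.S) (ha : a ∈ monoGr W L.ι w) :
    L.D a ∈ monoGr W L.ι w ⊔ monoGr W L.ι (w - 1) := by
  refine DGLA.wt_induction H (p := fun w a =>
    L.D a ∈ monoGr W L.ι w ⊔ monoGr W L.ι (w - 1)) ?_ ?_ ?_ ?_ ?_ ha
  · rw [L.D_one]; exact zero_mem _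
  · intro w; rw [map_zero]; exact zero_mem _
  · intro i n w v a hv hvn ha ih
    rw [DGLA.D_cons hvn]
    refine add_mem (sub_mem (Submodule.smul_mem _ _ ?_) ?_) ?_
    · obtain ⟨y, hy, z, hz, e⟩ := Submodule.mem_sup.1 ih
      rw [← e, mul_add]
      refine add_mem (Submodule.mem_sup_left (monoGr_mul (monoGr_ι hv) hy))
        (Submodule.mem_sup_right ?_)
      have := monoGr_mul (monoGr_ι (ι := L.ι) hv) hz
      rwa [show i + (w - 1) = i + w - 1 by ring] at this
    · exact Submodule.mem_sup_left (monoGr_mul (monoGr_ι (H.d_mem i v hv)) ha)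
    · exact Submodule.mem_sup_right (DGLA.wt_θ H hv hvn ha)
  · intro w a b ha hb; rw [map_add]; exact add_mem ha hb
  · intro w r a ha; rw [map_smul]; exact Submodule.smul_mem _ _ ha

lemma ceWeight (H : L.WeightFamily W) : (ceChains L).WeightFamily (ceWt L W) where
  proj_mem n w x hx := DGLA.wt_proj H n w x hx
  comul_mem w x hx := DGLA.wt_comul H w x hx
  d_mem w x hx := DGLA.wt_D H w x hx
  counit w hw x hx := by
    refine monoGr_induction (p := fun x => GSym.counit L.cgr x = 0) hx (fun x hx => ?_) (by simp)
      (fun b c hb hc => by simp [hb, hc]) (fun r b hb => by simp [hb])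
    cases hx with
    | one => exact absurd rfl hw
    | cons hn hv ha => exact GSym.counit_cons _ _

end ChainWeights

section DualChains

variable {k : Type u} [Field k]

lemma TGen.proj_mk {M X : Type u} [AddCommGroup M] [Module k M] [AddCommGroup X] [Module k X]
    {gr : ℤ → Submodule k X} (h : DirectSum.IsInternal gr) (n : ℤ) (m : M) (x : X) :
    proj (TGen.internal h M) n (TGen.mk k M X m x) = TGen.mk k M X m (proj h n x) := by
  have := proj_map h (TGen.internal h M) 0 (TGen.mk k M X m) (fun i x hx => by
    rw [add_zero]; exact TGen.mk_mem m hx) n x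
  rw [add_zero] at this
  exact this.symm

variable (g : Type u) [LieRing g] [LieAlgebra k g]

lemma gLieBr_wt (B : NDGCA k) (wB : ℤ → Submodule k B.X)
    (hm : ∀ i j, ∀ x ∈ wB i, ∀ y ∈ wB j, B.mul x y ∈ wB (i + j)) {i j : ℤ} {s t : TGen k g B.X}
    (hs : s ∈ TGen.gr g wB (i - 1)) (ht : t ∈ TGen.gr g wB (j - 1)) :
    gLieBr g B s t ∈ TGen.gr g wB (i + j - 1 - 1) := by
  refine TGen.gr_induction (p := fun s => gLieBr g B s t ∈ TGen.gr g wB (i + j - 1 - 1))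
    hs (by simp) (fun x a ha => ?_) (fun s s' h h' => by
      rw [map_add, LinearMap.add_apply]; exact add_mem h h')
  refine TGen.gr_induction (p := fun t => gLieBr g B (TGen.mk k g B.X x a) t ∈
    TGen.gr g wB (i + j - 1 - 1)) ht (by simp) (fun y b hb => ?_)
    (fun s s' h h' => by rw [map_add]; exact add_mem h h')
  rw [gLieBr_mk]
  have := TGen.mk_mem (M := g) ⁅x, y⁆ (hm _ _ a ha b hb)
  rwa [show i - 1 + (j - 1) = i + j - 1 - 1 by ring] at this

lemma gLie_weight (B : NDGCA k) (wB : ℤ → Submodule k B.X)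
    (hp : ∀ n w, ∀ x ∈ wB w, proj B.internal n x ∈ wB w) (hd : ∀ w, ∀ x ∈ wB w, B.d x ∈ wB w)
    (hm : ∀ i j, ∀ x ∈ wB i, ∀ y ∈ wB j, B.mul x y ∈ wB (i + j)) :
    (gLie g B).WeightFamily fun n => TGen.gr (X := B.X) g wB (n - 1) where
  proj_mem n w t ht := by
    refine TGen.gr_induction (X := B.X) (p := fun t => proj (TGen.internal B.internal g) n t ∈
      TGen.gr g wB (w - 1)) ht (by simp) (fun y a ha => ?_) (fun s t hs ht => by
        rw [map_add]; exact add_mem hs ht)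
    rw [TGen.proj_mk B.internal]
    exact TGen.mk_mem y (hp n _ a ha)
  d_mem w t ht := by
    refine TGen.gr_induction (X := B.X) (p := fun t => TGen.map LinearMap.id B.d t ∈
      TGen.gr g wB (w - 1)) ht (by simp) (fun y a ha => ?_) (fun s t hs ht => by
        rw [map_add]; exact add_mem hs ht)
    rw [TGen.map_mk]
    exact TGen.mk_mem y (hd _ a ha)
  br_mem i j s hs t ht := gLieBr_wt g B wB hm hs ht

variable {C : DGCC k} (W : C.Weighting)

/-- Weights on `g(Ā)`: a generator `x ⊗ a`, with `a` of weight `w`, has weight `w + 1`. Thus the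
weight of an element of the Chevalley-Eilenberg chains is its length plus its weight in the sense of
the weight grading of `A`. -/
def barWt (n : ℤ) : Submodule k (gLie g W.A.bar).X :=
  TGen.gr (X := W.A.bar.X) g
    (fun w => (W.Awt w).comap (LinearMap.ker W.A.aug.toLinearMap).subtype) (n - 1)

lemma DGCC.Weighting.Awt_proj (n w : ℤ) (f) (hf : f ∈ W.Awt w) :
    proj W.A.internal n f ∈ W.Awt w := C.dualWt_proj W.family n w f hf

lemma DGCC.Weighting.Awt_mul (i j : ℤ) (f) (hf : f ∈ W.Awt i) (f') (hf' : f' ∈ W.Awt j) :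
    f * f' ∈ W.Awt (i + j) := C.dualWt_mul W.family i j f hf f' hf'

lemma DGCC.Weighting.Awt_one : 1 ∈ W.Awt 0 := fun m hm x hx => W.counit m hm x hx

lemma sub_proj {X : Type u} [AddCommGroup X] [Module k X] {gr : ℤ → Submodule k X}
    (h : DirectSum.IsInternal gr) (Y : Submodule k X) (hY : ∀ n, ∀ y ∈ Y, proj h n y ∈ Y) (n : ℤ)
    (y : Y) : (proj (sub_internal h Y hY) n y : X) = proj h n y := by
  have := proj_map (sub_internal h Y hY) h 0 Y.subtype (fun i x hx => by
    rw [add_zero]; exact hx) n y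
  rwa [add_zero] at this

lemma barWt_family : (gLie g W.A.bar).WeightFamily (barWt g W) :=
  gLie_weight g W.A.bar _
    (fun n w x hx => by
      change (proj W.A.bar.internal n x).1 ∈ W.Awt w
      have : (proj W.A.bar.internal n x).1 = proj W.A.internal n x.1 :=
        sub_proj W.A.internal (LinearMap.ker W.A.aug.toLinearMap) W.A.aug_proj n x
      rw [this]
      exact W.Awt_proj n w x.1 hx)
    (fun w x hx => W.Awt_d w x.1 hx) (fun i j x hx y hy => W.Awt_mul i j x.1 hx y.1 hy)

/-- Weights on `g(A)`: a generator `x ⊗ a`, with `a` of weight `w`, has weight `w + 1`. -/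
def fullWt (n : ℤ) : Submodule k (gLie g W.A.toN).X :=
  TGen.gr (X := W.A.toN.X) g W.Awt (n - 1)

lemma fullWt_family : (gLie g W.A.toN).WeightFamily (fullWt g W) :=
  gLie_weight g W.A.toN _ W.Awt_proj W.Awt_d W.Awt_mul

/-- The Chevalley-Eilenberg cochain algebra of `g(Ā)`: the (restricted) dual of the
Chevalley-Eilenberg chains. -/
def ceDualBar : ADGCA k :=
  (ceChains (gLie g W.A.bar)).dual (ceWeight (barWt_family g W))

/-- The Chevalley-Eilenberg cochain algebra of `g(A)`. -/
def ceDualFull : ADGCA k :=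
  (ceChains (gLie g W.A.toN)).dual (ceWeight (fullWt_family g W))

variable {g}

/-- The element `y ⊗ 1` of `g(A)`, for `y ∈ g`. -/
def unitElt (y : g) : (gLie g W.A.toN).X := TGen.mk k g W.A.X y 1

lemma unitElt_gr (y : g) : unitElt W y ∈ (gLie g W.A.toN).cgr 1 :=
  TGen.mk_mem y W.A.one_mem

lemma unitElt_wt (y : g) : unitElt W y ∈ fullWt g W 1 := TGen.mk_mem y W.Awt_one

lemma GSym.comul_mulLeft {V : Type u} [AddCommGroup V] [Module k V] {gV : ℤ → Submodule k V}
    (h : DirectSum.IsInternal gV) {v : V} (hv : v ∈ gV 1) (x : GSym gV) :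
    GSym.comul h (GSym.ι gV v * x) =
      TensorProduct.map (LinearMap.mulLeft k (GSym.ι gV v)) LinearMap.id (GSym.comul h x) +
        TensorProduct.map (tw (GSym.internal h) 1) (LinearMap.mulLeft k (GSym.ι gV v))
          (GSym.comul h x) := by
  rw [GSym.comul_cons]
  generalize GSym.comul h x = t
  induction t with
  | zero => simp
  | add s t hs ht => rw [map_add, map_add, map_add, hs, ht]; abel
  | tmul a b =>
    rw [GSym.Lam_tmul' _ hv]
    rfl

/-- The operator of multiplication by `s (y ⊗ 1)` on the Chevalley-Eilenberg chains. -/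
def mulUnit (y : g) : (ceChains (gLie g W.A.toN)).X →ₗ[k] (ceChains (gLie g W.A.toN)).X :=
  LinearMap.mulLeft (A := (gLie g W.A.toN).S) k ((gLie g W.A.toN).ι (unitElt W y))

lemma mulUnit_gr (y : g) (n : ℤ) (x) (hx : x ∈ (ceChains (gLie g W.A.toN)).gr n) :
    mulUnit W y x ∈ (ceChains (gLie g W.A.toN)).gr (n + 1) := by
  rw [add_comm]; exact GSym.ι_mul_mem (unitElt_gr W y) hx

lemma contr_pre (y : g) :
    (ceChains (gLie g W.A.toN)).Pre (wt := ceWt _ (fullWt g W)) (mulUnit W y) :=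
  DGCC.pre_of 1 1 (mulUnit_gr W y) (fun n x hx => Submodule.mem_sup_left (by
      rw [add_comm]; exact monoGr_mul (A := (gLie g W.A.toN).S) (monoGr_ι (unitElt_wt W y)) hx))

/-- The contraction with `y ∈ g`: the transpose of the multiplication by `s (y ⊗ 1)`. -/
def contr (y : g) : (ceDualFull g W).X →ₗ[k] (ceDualFull g W).X :=
  DGCC.precomp (h := ceWeight (fullWt_family g W)) (contr_pre W y)

lemma contr_isDer (y : g) : IsDer (ceDualFull g W).internal 1 (contr W y) :=
  DGCC.precomp_isDer _ (ceWeight (fullWt_family g W)) 1 (mulUnit W y) (contr_pre W y)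
    (GSym.comul_mulLeft (gLie g W.A.toN).c_internal (unitElt_gr W y))

lemma contr_mem (y : g) (n : ℤ) (f) (hf : f ∈ (ceDualFull g W).gr n) :
    contr W y f ∈ (ceDualFull g W).gr (n + 1) :=
  fun m hm x hx => hf (m + 1) (by omega) _ (mulUnit_gr W y m x hx)

variable (g)

/-- The relative Chevalley-Eilenberg cochain algebra of the pair `(g(A), g)`: the (restricted) dual
of the chains `Sym(g(A)[1] / g[1])_g`. It is the subalgebra of the cochains `ω` of `g(A)` with
`i_y ω = 0` (that is, `ω` vanishes on the ideal generated by `g[1]`) and `i_y (dω) = 0` (that is,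
moreover, `ω` is invariant) for all `y ∈ g`. -/
def ceDualPair : ADGCA k :=
  (ceDualFull g W).basic (contr W (g := g)) 1 (contr_isDer W) (contr_mem W)

end DualChains

end LieRep

end

open LieRep

set_option linter.unusedSimpArgs false
set_option linter.unusedSectionVars false

noncomputable section

namespace LieRep

/-! ### Quasi-isomorphisms and isomorphisms -/

section QisoLemmas

variable {k : Type u} [Field k]

lemma HoIso.symm {A B : ADGCA k} (h : HoIso A B) : HoIso B A := h.map Iso.symm

lemma HoIso.trans {A B C : ADGCA k} (h : HoIso A B) (h' : HoIso B C) : HoIso A C := by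
  obtain ⟨e⟩ := h
  obtain ⟨e'⟩ := h'
  exact ⟨e ≪≫ e'⟩

lemma HoIso.of_qiso {A B : ADGCA k} (F : A ⟶ B) (hF : IsQIso A.d B.d (ADGCA.lin F)) :
    HoIso A B := by
  have := (ADGCA.qis k).Q_inverts F hF
  exact ⟨asIso ((ADGCA.qis k).Q.map F)⟩

lemma HomologyIso.symm {A B : ADGCA k} (h : HomologyIso A B) : HomologyIso B A := by
  obtain ⟨e, he⟩ := h
  refine ⟨e.symm, fun n => le_antisymm ?_ fun x hx => ?_⟩
  · rintro _ ⟨y, hy, rfl⟩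
    rw [← he n] at hy
    obtain ⟨x, hx, rfl⟩ := hy
    have : e.symm (e x) = x := e.symm_apply_apply x
    change e.symm (e x) ∈ _
    rwa [this]
  · have h1 : e x ∈ B.Hgr n := by
      rw [← he n]
      exact ⟨x, hx, rfl⟩
    exact ⟨e x, h1, e.symm_apply_apply x⟩

lemma HomologyIso.trans {A B C : ADGCA k} (h : HomologyIso A B) (h' : HomologyIso B C) :
    HomologyIso A C := by
  obtain ⟨e, he⟩ := h
  obtain ⟨e', he'⟩ := h'
  refine ⟨e.trans e', fun n => le_antisymm ?_ fun z hz => ?_⟩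
  · rintro _ ⟨x, hx, rfl⟩
    have h1 : e x ∈ B.Hgr n := by
      rw [← he n]
      exact ⟨x, hx, rfl⟩
    rw [← he' n]
    exact ⟨e x, h1, rfl⟩
  · rw [← he' n] at hz
    obtain ⟨y, hy, rfl⟩ := hz
    rw [← he n] at hy
    obtain ⟨x, hx, rfl⟩ := hy
    exact ⟨x, hx, rfl⟩

/-- The homomorphism between the algebras of cycles. -/
def ADGCA.cyclesMap {A B : ADGCA k} (F : A ⟶ B) : A.cycles →ₐ[k] B.cycles :=
  ((ADGCA.Hom.f F).comp A.cycles.val).codRestrict B.cycles fun x => by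
    have := ADGCA.Hom.map_d F x.1
    rw [A.mem_cycles.1 x.2, map_zero] at this
    exact this.symm

lemma ADGCA.cyclesMap_coe {A B : ADGCA k} (F : A ⟶ B) (x : A.cycles) :
    (ADGCA.cyclesMap F x : B.X) = ADGCA.Hom.f F x := rfl

/-- The homomorphism between the homology algebras. -/
def ADGCA.homMap {A B : ADGCA k} (F : A ⟶ B) : A.H →ₐ[k] B.H :=
  Ideal.quotientMapₐ B.boundaries (ADGCA.cyclesMap F) (by
    rintro x ⟨y, hy⟩
    exact ⟨ADGCA.Hom.f F y, by rw [← ADGCA.Hom.map_d F, hy]; rfl⟩)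

lemma ADGCA.homMap_mk {A B : ADGCA k} (F : A ⟶ B) (x : A.cycles) :
    ADGCA.homMap F (Ideal.Quotient.mk _ x) = Ideal.Quotient.mk _ (ADGCA.cyclesMap F x) := rfl

lemma HomologyIso.of_qiso {A B : ADGCA k} (F : A ⟶ B) (hF : IsQIso A.d B.d (ADGCA.lin F)) :
    HomologyIso A B := by
  have bij : Function.Bijective (ADGCA.homMap F) := by
    constructor
    · rw [injective_iff_map_eq_zero]
      intro x hx
      obtain ⟨x, rfl⟩ := Ideal.Quotient.mk_surjective x
      rw [ADGCA.homMap_mk, Ideal.Quotient.eq_zero_iff_mem] at hx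
      obtain ⟨y, hy⟩ := hx
      obtain ⟨x', hx'⟩ := hF.1 x.1 x.2 ⟨y, hy.symm⟩
      rw [Ideal.Quotient.eq_zero_iff_mem]
      exact ⟨x', hx'.symm⟩
    · intro y
      obtain ⟨y, rfl⟩ := Ideal.Quotient.mk_surjective y
      obtain ⟨x, y', hx, e⟩ := hF.2 y.1 y.2
      refine ⟨Ideal.Quotient.mk _ ⟨x, hx⟩, ?_⟩
      rw [ADGCA.homMap_mk, eq_comm, Ideal.Quotient.mk_eq_mk_iff_sub_mem]
      refine ⟨y', ?_⟩
      rw [AddSubgroupClass.coe_sub, e, ADGCA.cyclesMap_coe]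
      exact (add_sub_cancel_left _ _).symm
  refine ⟨AlgEquiv.ofBijective _ bij, fun n => le_antisymm ?_ ?_⟩
  · rintro _ ⟨_, ⟨x, hx, rfl⟩, rfl⟩
    exact ⟨ADGCA.cyclesMap F x, ADGCA.Hom.map_gr F n _ hx, rfl⟩
  · rintro _ ⟨y, hy, rfl⟩
    obtain ⟨x, y', hx, e⟩ := hF.2 y.1 y.2
    have dA := proj_map A.internal A.internal (-1) A.d
      (by simpa [sub_eq_add_neg] using A.d_mem)
    have dB := proj_map B.internal B.internal (-1) B.d
      (by simpa [sub_eq_add_neg] using B.d_mem)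
    have hFp := proj_map A.internal B.internal 0 (ADGCA.lin F)
      (fun m x hx => by
        rw [add_zero]; exact ADGCA.Hom.map_gr F m x hx) n x
    have hx' : A.d (proj A.internal n x) = 0 := by rw [dA, hx, map_zero]
    refine ⟨Ideal.Quotient.mk _ ⟨proj A.internal n x, hx'⟩,
      ⟨⟨_, hx'⟩, proj_mem A.internal n x, rfl⟩, ?_⟩
    change ADGCA.homMap F (Ideal.Quotient.mk _ _) = Ideal.Quotient.mk _ y
    rw [ADGCA.homMap_mk, eq_comm, Ideal.Quotient.mk_eq_mk_iff_sub_mem]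
    refine ⟨proj B.internal (n + 1) y', ?_⟩
    rw [AddSubgroupClass.coe_sub, ADGCA.cyclesMap_coe, dB, add_neg_cancel_right]
    have h1 : proj B.internal n y.1 = y.1 := proj_of_mem B.internal hy
    rw [add_zero] at hFp
    change _ = _ - ADGCA.lin F _
    rw [hFp]
    conv_rhs => rw [← h1, e, map_add, add_sub_cancel_left]

lemma IsQIso.of_bijective {X Y : Type u} [AddCommGroup X] [Module k X] [AddCommGroup Y]
    [Module k Y] {dX : X →ₗ[k] X} {dY : Y →ₗ[k] Y} {f : X →ₗ[k] Y}
    (hd : ∀ x, f (dX x) = dY (f x)) (hf : Function.Bijective f) : IsQIso dX dY f := by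
  refine ⟨fun x _ ⟨y, hy⟩ => ?_, fun y hy => ?_⟩
  · obtain ⟨x', rfl⟩ := hf.2 y
    exact ⟨x', hf.1 (by rw [hy, hd])⟩
  · obtain ⟨x, rfl⟩ := hf.2 y
    exact ⟨x, 0, hf.1 (by rw [hd, hy, map_zero]), by simp⟩

/-- A surjective chain map with acyclic kernel is a quasi-isomorphism. -/
lemma IsQIso.of_surjective {X Y : Type u} [AddCommGroup X] [Module k X] [AddCommGroup Y]
    [Module k Y] {dX : X →ₗ[k] X} {dY : Y →ₗ[k] Y} {f : X →ₗ[k] Y} (hX : ∀ x, dX (dX x) = 0)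
    (hd : ∀ x, f (dX x) = dY (f x)) (hf : Function.Surjective f)
    (hK : ∀ x, f x = 0 → dX x = 0 → ∃ y, f y = 0 ∧ dX y = x) : IsQIso dX dY f := by
  refine ⟨fun x hx ⟨y, hy⟩ => ?_, fun y hy => ?_⟩
  · obtain ⟨z, rfl⟩ := hf y
    obtain ⟨w, -, hw⟩ := hK (x - dX z) (by rw [map_sub, hd, hy, sub_self])
      (by rw [map_sub, hx, hX, sub_zero])
    exact ⟨w + z, by rw [map_add, hw, sub_add_cancel]⟩
  · obtain ⟨x, rfl⟩ := hf y
    obtain ⟨w, hw, hw'⟩ := hK (dX x) (by rw [hd, hy]) (hX x)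
    exact ⟨x - w, 0, by rw [map_sub, hw', sub_self], by rw [map_sub, hw]; simp⟩

/-- The kernel of a surjective quasi-isomorphism is acyclic. -/
lemma IsQIso.acyclic {X Y : Type u} [AddCommGroup X] [Module k X] [AddCommGroup Y]
    [Module k Y] {dX : X →ₗ[k] X} {dY : Y →ₗ[k] Y} {f : X →ₗ[k] Y} (hX : ∀ x, dX (dX x) = 0)
    (hd : ∀ x, f (dX x) = dY (f x)) (hf : Function.Surjective f) (h : IsQIso dX dY f) {x : X}
    (hx : f x = 0) (hx' : dX x = 0) : ∃ y, f y = 0 ∧ dX y = x := by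
  obtain ⟨y, rfl⟩ := h.1 x hx' ⟨0, by rw [hx, map_zero]⟩
  obtain ⟨z, w, hz, e⟩ := h.2 (f y) (by rw [← hd, hx])
  obtain ⟨w, rfl⟩ := hf w
  exact ⟨y - z - dX w, by rw [map_sub, map_sub, e, hd]; abel, by
    rw [map_sub, map_sub, hz, hX, sub_zero, sub_zero]⟩

/-- A chain map with an inverse up to homotopy is a quasi-isomorphism. -/
lemma IsQIso.of_homotopy {X Y : Type u} [AddCommGroup X] [Module k X] [AddCommGroup Y]
    [Module k Y] {dX : X →ₗ[k] X} {dY : Y →ₗ[k] Y} {f : X →ₗ[k] Y} {f' : Y →ₗ[k] X}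
    (hd' : ∀ y, f' (dY y) = dX (f' y)) (H : X →ₗ[k] X)
    (H' : Y →ₗ[k] Y) (hH : ∀ x, f' (f x) - x = dX (H x) + H (dX x))
    (hH' : ∀ y, f (f' y) - y = dY (H' y) + H' (dY y)) : IsQIso dX dY f := by
  refine ⟨fun x hx ⟨y, hy⟩ => ⟨f' y - H x, ?_⟩, fun y hy => ⟨f' y, -H' y, ?_, ?_⟩⟩
  · have := hH x
    rw [hx, map_zero, add_zero, hy, hd'] at this
    rw [map_sub, ← this, sub_sub_cancel]
  · rw [← hd', hy, map_zero]
  · have := hH' y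
    rw [hy, map_zero, add_zero] at this
    rw [map_neg, ← this]; abel

end QisoLemmas


/-! ### The universal property of the free Lie algebra -/

section FreeLie

variable {k : Type u} [Field k]
variable {V : Type u} [AddCommGroup V] [Module k V] {gV : ℤ → Submodule k V}

variable (k V) in
/-- The grading of `V` which is concentrated in degree one. -/
def unitGr (n : ℤ) : Submodule k V := if n = 1 then ⊤ else ⊥

lemma unitGr_one : unitGr k V 1 = ⊤ := if_pos rfl

lemma unitGr_ne {n : ℤ} (hn : n ≠ 1) : unitGr k V n = ⊥ := if_neg hn

lemma mem_unitGr (v : V) : v ∈ unitGr k V 1 := by rw [unitGr_one]; trivial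

lemma unitGr_internal : DirectSum.IsInternal (unitGr k V) := by
  refine isInternal_of_proj (fun n => if n = 1 then LinearMap.id else 0) (fun n x hx => ?_)
    (fun m n x hx hne => ?_) (fun x => Submodule.mem_iSup_of_mem 1 (mem_unitGr x))
  · by_cases hn : n = 1
    · simp [hn]
    · rw [unitGr_ne hn, Submodule.mem_bot] at hx
      simp [hx]
  · by_cases hn : n = 1
    · have : m ≠ 1 := by omega
      simp [this]
    · rw [unitGr_ne hn, Submodule.mem_bot] at hx
      simp [hx]

variable {L : DGLA k} (f : V →ₗ[k] L.X)

/-- The action of the tensor algebra by iterated brackets. -/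
def adAct : TensorAlgebra k V →ₐ[k] Module.End k L.X := TensorAlgebra.lift k (L.br ∘ₗ f)

lemma adAct_ι (v : V) : adAct f (TensorAlgebra.ι k v) = L.br (f v) := by
  rw [adAct, TensorAlgebra.lift_ι_apply]; rfl

/-- The operator `(x, c) ↦ ([f v, x] + c f v, 0)`. -/
def dynkinGen : V →ₗ[k] Module.End k (L.X × k) :=
  LinearMap.mk₂ k (fun v m => (L.br (f v) m.1 + m.2 • f v, 0))
    (fun v v' m => by simp only [map_add, LinearMap.add_apply, smul_add, Prod.mk_add_mk, add_zero]
                      congr 1; abel)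
    (fun r v m => by simp only [map_smul, LinearMap.smul_apply, smul_add, Prod.smul_mk, smul_zero,
                      smul_comm r])
    (fun v m m' => by simp only [map_add, Prod.fst_add, Prod.snd_add, add_smul, Prod.mk_add_mk,
                        add_zero]
                      congr 1; abel)
    (fun r v m => by simp only [map_smul, Prod.smul_fst, Prod.smul_snd, Prod.smul_mk, smul_zero,
                      smul_add, smul_assoc])

/-- The tensor algebra acts on `L × k` through `dynkinGen`. -/
def dynkinAct : TensorAlgebra k V →ₐ[k] Module.End k (L.X × k) :=
  TensorAlgebra.lift k (dynkinGen f)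

/-- The Dynkin operator `v₁ ⋯ vₙ ↦ [f v₁, [f v₂, ⋯, f vₙ]]`. -/
def dynkin : TensorAlgebra k V →ₗ[k] L.X :=
  LinearMap.fst k L.X k ∘ₗ (dynkinAct f).toLinearMap.flip (0, 1)

lemma dynkinAct_apply (a : TensorAlgebra k V) (x : L.X) (c : k) : dynkinAct f a (x, c) =
    (adAct f a x + c • dynkin f a, TensorAlgebra.lift k (0 : V →ₗ[k] k) a * c) := by
  have h0 : ∀ a, dynkin f a = (dynkinAct f a (0, 1)).1 := fun _ => rfl
  refine gen_induction tensor_adjoin (p := fun a => ∀ x c, dynkinAct f a (x, c) =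
    (adAct f a x + c • dynkin f a, TensorAlgebra.lift k (0 : V →ₗ[k] k) a * c)) a (fun v x c => ?_)
    (fun r x c => ?_) (fun a b ha hb x c => ?_) (fun a b ha hb x c => ?_) x c
  · rw [h0, dynkinAct, TensorAlgebra.lift_ι_apply, adAct_ι, TensorAlgebra.lift_ι_apply]
    simp [dynkinGen]
  · rw [h0, AlgHomClass.commutes, AlgHomClass.commutes, AlgHomClass.commutes]
    simp [Module.algebraMap_end_apply]
  · rw [map_add, LinearMap.add_apply, ha, hb]
    simp only [map_add, LinearMap.add_apply, Prod.mk_add_mk, smul_add, add_mul]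
    congr 1; abel
  · rw [h0 (a * b), map_mul (dynkinAct f), map_mul (adAct f),
      map_mul (TensorAlgebra.lift k (0 : V →ₗ[k] k)), Module.End.mul_apply, Module.End.mul_apply,
      Module.End.mul_apply, hb, ha, hb, ha]
    simp only [map_add, map_smul, map_zero, zero_add, smul_add, one_smul,
      mul_one, mul_assoc, smul_smul]
    congr 1
    rw [add_assoc, mul_comm c]

lemma dynkin_mul (a b : TensorAlgebra k V) : dynkin f (a * b) = adAct f a (dynkin f b) +
    TensorAlgebra.lift k (0 : V →ₗ[k] k) b • dynkin f a := by
  have h0 : ∀ a, dynkin f a = (dynkinAct f a (0, 1)).1 := fun _ => rfl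
  rw [h0, map_mul, Module.End.mul_apply, dynkinAct_apply, dynkinAct_apply]
  simp

lemma dynkin_ι (v : V) : dynkin f (TensorAlgebra.ι k v) = f v := by
  have h0 : ∀ a, dynkin f a = (dynkinAct f a (0, 1)).1 := fun _ => rfl
  rw [h0, dynkinAct, TensorAlgebra.lift_ι_apply]
  simp [dynkinGen]

/-- The linear map on the tensor algebra which extends `f` to a homomorphism from the free Lie
algebra: on tensors of length `n`, it is the Dynkin operator divided by `n`. -/
def lieLift : TensorAlgebra k V →ₗ[k] L.X :=
  byDeg (tensor_isGen unitGr_internal).grInternal fun n => ((n : k)⁻¹) • dynkin f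

lemma lieLift_of_mem {n : ℤ} {a : TensorAlgebra k V}
    (ha : a ∈ monoGr (unitGr k V) (TensorAlgebra.ι k) n) :
    lieLift f a = ((n : k)⁻¹) • dynkin f a := by
  rw [lieLift, byDeg_of_mem _ _ ha]; rfl

lemma lieLift_ι (v : V) : lieLift f (TensorAlgebra.ι k v) = f v := by
  rw [lieLift_of_mem f (monoGr_ι (mem_unitGr v)), dynkin_ι]
  simp

variable [CharZero k] {f} (hf : ∀ n, ∀ v ∈ gV n, f v ∈ L.gr n)

omit [CharZero k] in
lemma smul_sgn_smul {X : Type u} [AddCommGroup X] [Module k X] (n : ℤ) (r : k) (x : X) :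
    sgn k n • r • -sgn k n • x = -(r • x) := by
  rw [smul_smul, smul_smul, mul_comm, ← mul_assoc, neg_mul, sgn_sq]
  module

lemma lieLift_comm {i j p q : ℤ} {a b : TensorAlgebra k V} (hp : 1 ≤ p) (hq : 1 ≤ q)
    (hap : a ∈ monoGr (unitGr k V) (TensorAlgebra.ι k) p)
    (hbq : b ∈ monoGr (unitGr k V) (TensorAlgebra.ι k) q) (ha1 : lieLift f a ∈ L.gr i)
    (ha2 : adAct f a = L.br (lieLift f a)) (ha3 : TensorAlgebra.lift k (0 : V →ₗ[k] k) a = 0)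
    (hb1 : lieLift f b ∈ L.gr j) (hb2 : adAct f b = L.br (lieLift f b))
    (hb3 : TensorAlgebra.lift k (0 : V →ₗ[k] k) b = 0) :
    a * b - sgn k (i * j) • (b * a) ∈ monoGr (unitGr k V) (TensorAlgebra.ι k) (p + q) ∧
    lieLift f (a * b - sgn k (i * j) • (b * a)) = L.br (lieLift f a) (lieLift f b) := by
  have hl : a * b - sgn k (i * j) • (b * a) ∈ monoGr (unitGr k V) (TensorAlgebra.ι k) (p + q) :=
    sub_mem (monoGr_mul hap hbq) (Submodule.smul_mem _ _ (by
      rw [add_comm]; exact monoGr_mul hbq hap))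
  have hp0 : (p : k) ≠ 0 := by exact_mod_cast (by omega : p ≠ 0)
  have hq0 : (q : k) ≠ 0 := by exact_mod_cast (by omega : q ≠ 0)
  have hpq0 : (p : k) + q ≠ 0 := by exact_mod_cast (by omega : p + q ≠ 0)
  have da : dynkin f a = (p : k) • lieLift f a := by
    rw [lieLift_of_mem f hap, smul_smul, mul_inv_cancel₀ hp0, one_smul]
  have db : dynkin f b = (q : k) • lieLift f b := by
    rw [lieLift_of_mem f hbq, smul_smul, mul_inv_cancel₀ hq0, one_smul]
  refine ⟨hl, ?_⟩
  rw [lieLift_of_mem f hl, map_sub, map_smul, dynkin_mul, dynkin_mul, ha3, hb3, ha2, hb2, da, db,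
    map_smul, map_smul, L.br_skew j i _ hb1 _ ha1, mul_comm j i, zero_smul, zero_smul, add_zero,
    add_zero, smul_sgn_smul, sub_neg_eq_add, ← add_smul, smul_smul]
  push_cast
  rw [add_comm (q : k), inv_mul_cancel₀ hpq0, one_smul]

include hf in
lemma lieLift_isLie {n : ℤ} {a : TensorAlgebra k V} (ha : IsLie gV n a) :
    (lieLift f a ∈ L.gr n ∧ adAct f a = L.br (lieLift f a) ∧
      TensorAlgebra.lift k (0 : V →ₗ[k] k) a = 0) ∧
    ∃ m : ℤ, 1 ≤ m ∧ a ∈ monoGr (unitGr k V) (TensorAlgebra.ι k) m := by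
  induction ha with
  | @gen n v hv =>
    refine ⟨⟨?_, ?_, ?_⟩, 1, le_rfl, monoGr_ι (mem_unitGr v)⟩
    · rw [lieLift_ι]; exact hf n v hv
    · rw [lieLift_ι, adAct_ι]
    · rw [TensorAlgebra.lift_ι_apply]; rfl
  | @br i j a b ha hb iha ihb =>
    obtain ⟨⟨ha1, ha2, ha3⟩, p, hp, hap⟩ := iha
    obtain ⟨⟨hb1, hb2, hb3⟩, q, hq, hbq⟩ := ihb
    obtain ⟨hl, key⟩ := lieLift_comm hp hq hap hbq ha1 ha2 ha3 hb1 hb2 hb3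
    refine ⟨⟨?_, ?_, ?_⟩, p + q, by omega, hl⟩
    · rw [key]; exact L.br_mem i j _ ha1 _ hb1
    · rw [key, map_sub, map_smul, map_mul, map_mul, ha2, hb2]
      refine ext_gr L.internal fun l z hz => ?_
      rw [LinearMap.sub_apply, LinearMap.smul_apply, Module.End.mul_apply, Module.End.mul_apply,
        L.br_jacobi i j l _ ha1 _ hb1 z hz, add_sub_cancel_right]
    · rw [map_sub, map_smul, map_mul, map_mul, ha3, hb3]; simp

include hf in
lemma lieLift_br {i j : ℤ} {a b : TensorAlgebra k V} (ha : IsLie gV i a) (hb : IsLie gV j b) :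
    lieLift f (a * b - sgn k (i * j) • (b * a)) = L.br (lieLift f a) (lieLift f b) := by
  obtain ⟨⟨ha1, ha2, ha3⟩, p, hp, hap⟩ := lieLift_isLie hf ha
  obtain ⟨⟨hb1, hb2, hb3⟩, q, hq, hbq⟩ := lieLift_isLie hf hb
  exact (lieLift_comm hp hq hap hbq ha1 ha2 ha3 hb1 hb2 hb3).2

include hf in
lemma lieLift_gbr (h : DirectSum.IsInternal gV) {a b : TensorAlgebra k V} (ha : a ∈ freeLie gV)
    (hb : b ∈ freeLie gV) : lieLift f (gbr (tensor_isGen h).grInternal a b) =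
      L.br (lieLift f a) (lieLift f b) := by
  refine freeLie_induction (p := fun a => lieLift f (gbr (tensor_isGen h).grInternal a b) =
    L.br (lieLift f a) (lieLift f b)) ha (fun i a ha => ?_) (by simp)
    (fun a a' h h' => by simp only [map_add, LinearMap.add_apply, h, h'])
    (fun r a h => by simp only [map_smul, LinearMap.smul_apply, h])
  refine freeLie_induction (p := fun b => lieLift f (gbr (tensor_isGen h).grInternal a b) =
    L.br (lieLift f a) (lieLift f b)) hb (fun j b hb => ?_) (by simp)
    (fun a a' h h' => by simp only [map_add, h, h'])
    (fun r a h => by simp only [map_smul, h])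
  rw [gbr_apply _ ha.mem_gr hb.mem_gr, lieLift_br hf ha hb]

include hf in
lemma lieLift_mem (h : DirectSum.IsInternal gV) {n : ℤ} {a : TensorAlgebra k V}
    (ha : a ∈ freeLie gV) (han : a ∈ monoGr gV (TensorAlgebra.ι k) n) : lieLift f a ∈ L.gr n := by
  have hI := (tensor_isGen h).grInternal
  rw [← proj_of_mem hI han]
  refine freeLie_induction (p := fun a => lieLift f (proj hI n a) ∈ L.gr n) ha (fun i a ha => ?_)
    (by simp) (fun a b ha hb => by simp only [map_add]; exact add_mem ha hb)
    (fun r a ha => by simp only [map_smul]; exact Submodule.smul_mem _ _ ha)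
  by_cases hi : i = n
  · subst hi
    rw [proj_of_mem hI ha.mem_gr]
    exact (lieLift_isLie hf ha).1.1
  · rw [proj_of_ne hI ha.mem_gr hi, map_zero]
    exact zero_mem _

end FreeLie

section OmegaHom

variable {k : Type u} [Field k] [CharZero k] (D : NDGCC k)

/-- The generators of `Ω_Comm(D)`. -/
def NDGCC.ωι : D.X →ₗ[k] D.omegaComm.X :=
  (TensorAlgebra.ι k).codRestrict (freeLie D.sgr) (ι_mem_freeLie D.s_internal)

/-- The inclusion of `Ω_Comm(D)` into the tensor algebra. -/
def NDGCC.ωval : D.omegaComm.X →ₗ[k] TensorAlgebra k D.X := (freeLie D.sgr).subtype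

lemma NDGCC.ωval_injective : Function.Injective D.ωval := Subtype.val_injective

lemma NDGCC.ωval_ωι (x : D.X) : D.ωval (D.ωι x) = TensorAlgebra.ι k x := rfl

lemma NDGCC.ωval_br (x y : D.omegaComm.X) : D.ωval (D.omegaComm.br x y) =
    gbr (tensor_isGen D.s_internal).grInternal (D.ωval x) (D.ωval y) := rfl

lemma NDGCC.ωval_d (x : D.omegaComm.X) : D.ωval (D.omegaComm.d x) = D.cobarD (D.ωval x) := rfl

lemma NDGCC.ωι_mem {n : ℤ} {x : D.X} (hx : x ∈ D.gr (n + 1)) : D.ωι x ∈ D.omegaComm.gr n :=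
  monoGr_ι (gV := D.sgr) (ι := TensorAlgebra.ι k) hx

/-- Statements about elements of the free Lie algebra may be checked on generators and brackets. -/
lemma NDGCC.omega_induction {p : D.omegaComm.X → Prop} (x : D.omegaComm.X)
    (gen : ∀ n, ∀ c ∈ D.gr (n + 1), p (D.ωι c))
    (br : ∀ i j, ∀ y ∈ D.omegaComm.gr i, ∀ z ∈ D.omegaComm.gr j, p y → p z →
      p (D.omegaComm.br y z))
    (zero : p 0) (add : ∀ y z, p y → p z → p (y + z)) (smul : ∀ (r : k) y, p y → p (r • y)) :
    p x := by
  obtain ⟨a, ha⟩ := x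
  suffices H : ∃ h : a ∈ freeLie D.sgr, p ⟨a, h⟩ from H.2
  refine freeLie_induction (p := fun a => ∃ h : a ∈ freeLie D.sgr, p ⟨a, h⟩) ha
    (fun n a ha => ?_) ⟨zero_mem _, zero⟩ (fun b c ⟨hb, hb'⟩ ⟨hc, hc'⟩ =>
      ⟨add_mem hb hc, add _ _ hb' hc'⟩)
    (fun r b ⟨hb, hb'⟩ => ⟨Submodule.smul_mem _ r hb, smul r _ hb'⟩)
  refine ⟨ha.mem, ?_⟩
  induction ha with
  | gen hv => exact gen _ _ hv
  | @br i j a b ha hb iha ihb =>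
    have := br i j ⟨a, ha.mem⟩ ha.mem_gr ⟨b, hb.mem⟩ hb.mem_gr iha ihb
    have e : (⟨_, (IsLie.br ha hb).mem⟩ : D.omegaComm.X) =
        D.omegaComm.br ⟨a, ha.mem⟩ ⟨b, hb.mem⟩ :=
      D.ωval_injective (gbr_apply _ ha.mem_gr hb.mem_gr).symm
    rw [e]
    exact this

/-- The quadratic part `½ ∑ (-1) ^ |c'| [c', c'']` of the differential. -/
def NDGCC.ωquad : D.X ⊗[k] D.X →ₗ[k] D.omegaComm.X :=
  (2⁻¹ : k) • (TensorProduct.lift (D.omegaComm.br.compl₁₂ (D.ωι ∘ₗ tw D.internal 1) D.ωι))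

lemma NDGCC.ωquad_tmul (x y : D.X) : D.ωquad (x ⊗ₜ y) =
    (2⁻¹ : k) • D.omegaComm.br (D.ωι (tw D.internal 1 x)) (D.ωι y) := rfl

lemma NDGCC.ωquad_coe (t : D.X ⊗[k] D.X) :
    D.ωval (D.ωquad t) = (2⁻¹ : k) • D.quad (t + swap D.internal t) := by
  suffices H : D.ωval ∘ₗ D.ωquad =
      (2⁻¹ : k) • (D.quad ∘ₗ (LinearMap.id + swap D.internal)) from LinearMap.congr_fun H t
  refine tensor_ext_gr D.internal D.internal fun i j x hx y hy => ?_
  have hx1 : TensorAlgebra.ι k (tw D.internal 1 x) ∈ monoGr D.sgr (TensorAlgebra.ι k) (i - 1) :=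
    monoGr_ι (by simpa [NDGCC.sgr] using tw_mem D.internal 1 hx)
  have hy1 : TensorAlgebra.ι k y ∈ monoGr D.sgr (TensorAlgebra.ι k) (j - 1) :=
    monoGr_ι (by simpa [NDGCC.sgr] using hy)
  rw [LinearMap.comp_apply, LinearMap.smul_apply, D.ωquad_tmul, map_smul, D.ωval_br]
  congr 1
  simp only [LinearMap.comp_apply, LinearMap.add_apply, LinearMap.id_apply, map_add,
    swap_tmul D.internal hx hy, map_smul, NDGCC.quad_tmul]
  rw [D.ωval_ωι, D.ωval_ωι, gbr_apply _ hx1 hy1, show (i - 1) * (j - 1) = i * j - i - j + 1 by ring, sgn_add, sgn_sub,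
    sgn_sub, sgn_one, tw_one_of_mem D.internal hx, tw_one_of_mem D.internal hy]
  rcases sgn_cases k (i * j) with e1 | e1 <;> rcases sgn_cases k i with e2 | e2 <;>
    rcases sgn_cases k j with e3 | e3 <;> simp [e1, e2, e3, sub_eq_add_neg]

lemma NDGCC.omega_d_ωι (x : D.X) :
    D.omegaComm.d (D.ωι x) = -D.ωι (D.d x) - D.ωquad (D.comul x) := by
  refine D.ωval_injective ?_
  rw [D.ωval_d, D.ωval_ωι, D.cobarD_ι, map_sub, map_neg, D.ωval_ωι, D.ωquad_coe, D.cocomm,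
    ← two_smul k, map_smul, smul_smul, inv_mul_cancel₀ two_ne_zero, one_smul]

variable {D}

lemma NDGCC.omega_hom_ext {E : DGLA k} {F G : D.omegaComm ⟶ E}
    (H : ∀ c, DGLA.lin F (D.ωι c) = DGLA.lin G (D.ωι c)) : F = G := by
  refine DGLA.Hom.ext (LinearMap.ext fun x => ?_)
  change DGLA.lin F x = DGLA.lin G x
  have hF : ∀ y z, DGLA.lin F (D.omegaComm.br y z) = E.br (DGLA.lin F y) (DGLA.lin F z) :=
    DGLA.Hom.map_br F
  have hG : ∀ y z, DGLA.lin G (D.omegaComm.br y z) = E.br (DGLA.lin G y) (DGLA.lin G z) :=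
    DGLA.Hom.map_br G
  refine D.omega_induction (p := fun x => DGLA.lin F x = DGLA.lin G x) x (fun n c _ => H c)
    (fun i j y _ z _ hy hz => ?_) (by simp) (fun y z hy hz => by simp only [map_add, hy, hz])
    (fun r y hy => by simp only [map_smul, hy])
  rw [hF, hG, hy, hz]

variable {E : DGLA k} (τ : D.X →ₗ[k] E.X)

/-- The homomorphism of graded Lie algebras from `Ω_Comm(D)` which extends `τ`. -/
def NDGCC.omegaLift : D.omegaComm.X →ₗ[k] E.X := lieLift τ ∘ₗ D.ωval

lemma NDGCC.omegaLift_ωι (x : D.X) : D.omegaLift τ (D.ωι x) = τ x := lieLift_ι τ x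

variable {τ} (hτ : ∀ n, ∀ x ∈ D.gr (n + 1), τ x ∈ E.gr n)

include hτ in
lemma NDGCC.omegaLift_br (x y : D.omegaComm.X) :
    D.omegaLift τ (D.omegaComm.br x y) = E.br (D.omegaLift τ x) (D.omegaLift τ y) :=
  lieLift_gbr hτ D.s_internal x.2 y.2

include hτ in
lemma NDGCC.omegaLift_mem (n : ℤ) (x : D.omegaComm.X) (hx : x ∈ D.omegaComm.gr n) :
    D.omegaLift τ x ∈ E.gr n :=
  lieLift_mem hτ D.s_internal x.2 hx

variable (τ) in
/-- The map `x ⊗ y ↦ ½ [τ x, τ y]`, up to sign. -/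
def NDGCC.halfBr : D.X ⊗[k] D.X →ₗ[k] E.X :=
  (2⁻¹ : k) • (TensorProduct.lift (E.br.compl₁₂ (τ ∘ₗ tw D.internal 1) τ))

lemma NDGCC.halfBr_tmul (x y : D.X) : D.halfBr τ (x ⊗ₜ y) =
    (2⁻¹ : k) • E.br (τ (tw D.internal 1 x)) (τ y) := rfl

include hτ in
lemma NDGCC.omegaLift_ωquad (t : D.X ⊗[k] D.X) :
    D.omegaLift τ (D.ωquad t) = D.halfBr τ t := by
  induction t with
  | zero => simp
  | add s t hs ht => simp only [map_add, hs, ht]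
  | tmul x y => rw [D.ωquad_tmul, map_smul, NDGCC.omegaLift_br hτ, D.omegaLift_ωι, D.omegaLift_ωι,
      NDGCC.halfBr_tmul]

/-- A twisting cochain extends to a homomorphism from the cobar construction. -/
def NDGCC.omegaHom (hτ : ∀ n, ∀ x ∈ D.gr (n + 1), τ x ∈ E.gr n)
    (hMC : ∀ x, E.d (τ x) = -τ (D.d x) - D.halfBr τ (D.comul x)) : D.omegaComm ⟶ E where
  f := D.omegaLift τ
  map_gr := NDGCC.omegaLift_mem hτ
  map_br := NDGCC.omegaLift_br hτ
  map_d x := by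
    have hb := NDGCC.omegaLift_br hτ
    refine D.omega_induction (p := fun x => D.omegaLift τ (D.omegaComm.d x) = E.d (D.omegaLift τ x))
      x (fun n c _ => ?_) (fun i j y hy z hz hy' hz' => ?_) (by simp)
      (fun y z hy hz => by simp only [map_add, hy, hz]) (fun r y hy => by simp only [map_smul, hy])
    · rw [D.omega_d_ωι, map_sub, map_neg, D.omegaLift_ωι, D.omegaLift_ωι, hMC,
        NDGCC.omegaLift_ωquad hτ]
    · rw [D.omegaComm.br_leibniz i j y hy z hz, map_add, map_smul, hb, hb, hb, hy', hz',
        E.br_leibniz i j _ (NDGCC.omegaLift_mem hτ i y hy) _ (NDGCC.omegaLift_mem hτ j z hz)]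

lemma NDGCC.omegaHom_ωι (hMC : ∀ x, E.d (τ x) = -τ (D.d x) - D.halfBr τ (D.comul x)) (x : D.X) :
    DGLA.lin (NDGCC.omegaHom hτ hMC) (D.ωι x) = τ x := lieLift_ι τ x

/-- The restriction of a homomorphism to the generators is a twisting cochain. -/
lemma NDGCC.hom_ωι_d (F : D.omegaComm ⟶ E) (x : D.X) : E.d (DGLA.lin F (D.ωι x)) =
    -DGLA.lin F (D.ωι (D.d x)) - D.halfBr (DGLA.lin F ∘ₗ D.ωι) (D.comul x) := by
  have hd : ∀ x, DGLA.lin F (D.omegaComm.d x) = E.d (DGLA.lin F x) := DGLA.Hom.map_d F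
  have hb : ∀ y z, DGLA.lin F (D.omegaComm.br y z) = E.br (DGLA.lin F y) (DGLA.lin F z) :=
    DGLA.Hom.map_br F
  rw [← hd, D.omega_d_ωι, map_sub, map_neg]
  congr 1
  generalize D.comul x = t
  induction t with
  | zero => simp
  | add s t hs ht => simp only [map_add, hs, ht]
  | tmul x y => rw [D.ωquad_tmul, map_smul, hb, NDGCC.halfBr_tmul]; rfl

end OmegaHom


/-! ### Graded sections and contractions -/

section Sections

variable {k : Type u} [Field k]
variable {X Y : Type u} [AddCommGroup X] [Module k X] [AddCommGroup Y] [Module k Y]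
  {gX : ℤ → Submodule k X} {gY : ℤ → Submodule k Y}

lemma exists_graded_section (hX : DirectSum.IsInternal gX) (T : Y →ₗ[k] X) (U : ℤ → Submodule k X)
    (S : ℤ → Submodule k Y) (hU : ∀ n, U n ≤ gX n) (H : ∀ n, ∀ x ∈ U n, ∃ y ∈ S n, T y = x) :
    ∃ r : X →ₗ[k] Y, (∀ n, ∀ x ∈ gX n, r x ∈ S n) ∧ ∀ n, ∀ x ∈ U n, T (r x) = x := by
  have key : ∀ n, ∃ r : X →ₗ[k] S n, ∀ x ∈ U n, T (r x) = x := by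
    intro n
    let q : (S n ⊓ (U n).comap T : Submodule k Y) →ₗ[k] U n := T.restrict fun y hy => hy.2
    have hq : Function.Surjective q := by
      rintro ⟨x, hx⟩
      obtain ⟨y, hy, rfl⟩ := H n x hx
      exact ⟨⟨y, hy, hx⟩, rfl⟩
    obtain ⟨j, hj⟩ := q.exists_rightInverse_of_surjective (LinearMap.range_eq_top.2 hq)
    obtain ⟨r, hr⟩ := LinearMap.exists_extend (Submodule.inclusion inf_le_left ∘ₗ j :
      U n →ₗ[k] S n)
    refine ⟨r, fun x hx => ?_⟩
    have h1 : r x = Submodule.inclusion inf_le_left (j ⟨x, hx⟩) := LinearMap.congr_fun hr ⟨x, hx⟩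
    rw [h1]
    exact congrArg Subtype.val (LinearMap.congr_fun hj ⟨x, hx⟩)
  choose r hr using key
  refine ⟨byDeg hX fun n => (S n).subtype ∘ₗ r n, fun n x hx => ?_, fun n x hx => ?_⟩
  · rw [byDeg_of_mem hX _ hx]; exact (r n x).2
  · rw [byDeg_of_mem hX _ (hU n hx)]; exact hr n x hx

lemma proj_map_zero (hX : DirectSum.IsInternal gX) (hY : DirectSum.IsInternal gY) (f : X →ₗ[k] Y)
    (hf : ∀ n, ∀ x ∈ gX n, f x ∈ gY n) (n : ℤ) (x : X) : f (proj hX n x) = proj hY n (f x) := by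
  have := proj_map hX hY 0 f (by simpa using hf) n x
  rwa [add_zero] at this

lemma exists_section (hX : DirectSum.IsInternal gX) (hY : DirectSum.IsInternal gY) (f : X →ₗ[k] Y)
    (hf : ∀ n, ∀ x ∈ gX n, f x ∈ gY n) (hs : Function.Surjective f) :
    ∃ r : Y →ₗ[k] X, (∀ n, ∀ y ∈ gY n, r y ∈ gX n) ∧ ∀ y, f (r y) = y := by
  obtain ⟨r, h1, h2⟩ := exists_graded_section hY f gY gX (fun _ => le_rfl) (fun n y hy => by
    obtain ⟨x, rfl⟩ := hs y
    exact ⟨proj hX n x, proj_mem hX n x, by rw [proj_map_zero hX hY f hf, proj_of_mem hY hy]⟩)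
  exact ⟨r, h1, fun y => hom_induction hY (p := fun y => f (r y) = y) y h2
    (fun y z hy hz => by rw [map_add, map_add, hy, hz])⟩

/-- The kernel of a surjective quasi-isomorphism is contractible. -/
lemma exists_contraction (hX : DirectSum.IsInternal gX) (hY : DirectSum.IsInternal gY)
    {d : X →ₗ[k] X} (hd : ∀ n, ∀ x ∈ gX n, d x ∈ gX (n - 1)) (hdd : ∀ x, d (d x) = 0)
    {d' : Y →ₗ[k] Y} {f : X →ₗ[k] Y} (hf : ∀ n, ∀ x ∈ gX n, f x ∈ gY n)
    (hfd : ∀ x, f (d x) = d' (f x)) (hK : ∀ x, f x = 0 → d x = 0 → ∃ y, f y = 0 ∧ d y = x) :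
    ∃ s : X →ₗ[k] X, (∀ n, ∀ x ∈ gX n, s x ∈ gX (n + 1)) ∧ (∀ x, f (s x) = 0) ∧
      ∀ x, f x = 0 → d (s x) + s (d x) = x := by
  obtain ⟨r, h1, h2⟩ := exists_graded_section hX d
    (fun n => LinearMap.ker f ⊓ LinearMap.ker d ⊓ gX n) (fun n => LinearMap.ker f ⊓ gX (n + 1))
    (fun _ => inf_le_right) (fun n x hx => by
      obtain ⟨y, hy, rfl⟩ := hK x hx.1.1 hx.1.2
      refine ⟨proj hX (n + 1) y, ⟨?_, proj_mem hX _ y⟩, ?_⟩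
      · change f _ = 0
        rw [proj_map_zero hX hY f hf, hy, map_zero]
      · rw [proj_map hX hX (-1) d (by simpa [sub_eq_add_neg] using hd), add_neg_cancel_right,
          proj_of_mem hX hx.2])
  have hr : ∀ x, f (r x) = 0 := fun x => hom_induction hX (p := fun x => f (r x) = 0) x
    (fun n x hx => (h1 n x hx).1) (fun y z hy hz => by rw [map_add, map_add, hy, hz, add_zero])
  have hrd : ∀ n, ∀ x ∈ gX n, r (d x) ∈ gX n := fun n x hx => by
    have := (h1 (n - 1) (d x) (hd n x hx)).2
    rwa [sub_add_cancel] at this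
  refine ⟨r ∘ₗ (LinearMap.id - r ∘ₗ d), fun n x hx => (h1 n _ (sub_mem hx (hrd n x hx))).2,
    fun x => hr _, fun x hx => ?_⟩
  have hom : ∀ n, ∀ x ∈ gX n, f x = 0 → d (r (x - r (d x))) + r (d x) = x := by
    intro n x hx h0
    have h3 : d (r (d x)) = d x := h2 (n - 1) _ ⟨⟨by change f _ = 0; rw [hfd, h0, map_zero],
      hdd x⟩, hd n x hx⟩
    rw [h2 n _ ⟨⟨?_, ?_⟩, sub_mem hx (hrd n x hx)⟩, sub_add_cancel]
    · change f _ = 0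
      rw [map_sub, h0, hr, sub_zero]
    · change d _ = 0
      rw [map_sub, h3, sub_self]
  simp only [LinearMap.comp_apply, LinearMap.sub_apply, LinearMap.id_apply, hdd, map_zero, sub_zero]
  obtain ⟨t, hx', -⟩ := mem_iSup_proj hX x
  have : ∑ n ∈ t, (d (r (proj hX n x - r (d (proj hX n x)))) + r (d (proj hX n x))) =
      ∑ n ∈ t, proj hX n x := Finset.sum_congr rfl fun n _ =>
    hom n _ (proj_mem hX n x) (by rw [proj_map_zero hX hY f hf, hx, map_zero])
  rw [Finset.sum_add_distrib] at this
  simp only [← map_sum, Finset.sum_sub_distrib] at this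
  rwa [← hx'] at this

/-- A sequence of linear maps which is eventually constant on each step of an exhaustive filtration
has a limit. -/
lemma exists_limit {F : ℕ → Submodule k X} (hm : Monotone F) (hF : ∀ x, ∃ n, x ∈ F n)
    (t : ℕ → X →ₗ[k] Y) (ht : ∀ m, ∀ x ∈ F m, t (m + 1) x = t m x) :
    ∃ t' : X →ₗ[k] Y, ∀ m, ∀ x ∈ F m, t' x = t m x := by
  have h1 : ∀ m l, m ≤ l → ∀ x ∈ F m, t l x = t m x := by
    intro m l hl x hx
    induction l, hl using Nat.le_induction with
    | base => rfl
    | succ l hl ih => rw [ht l x (hm hl hx), ih]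
  choose n hn using hF
  have h2 : ∀ m, ∀ x ∈ F m, t (n x) x = t m x := by
    intro m x hx
    rcases le_total m (n x) with h | h
    · exact h1 _ _ h x hx
    · exact (h1 _ _ h x (hn x)).symm
  refine ⟨⟨⟨fun x => t (n x) x, fun x y => ?_⟩, fun r x => ?_⟩, h2⟩
  · have hx := hm (le_max_left (n x) (n y)) (hn x)
    have hy := hm (le_max_right (n x) (n y)) (hn y)
    rw [h2 _ _ (add_mem hx hy), h2 _ _ hx, h2 _ _ hy, map_add]
  · change t (n (r • x)) (r • x) = r • t (n x) x
    rw [h2 (n x) _ (Submodule.smul_mem _ r (hn x)), map_smul]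

end Sections

/-! ### The coradical filtration -/

section Coradical

variable {k : Type u} [Field k]

/-- The operator `(b, t) ↦ (x b, x ⊗ b)`. -/
def tensorConsGen (k V : Type u) [Field k] [AddCommGroup V] [Module k V] :
    V →ₗ[k] Module.End k (TensorAlgebra k V × V ⊗[k] TensorAlgebra k V) :=
  LinearMap.mk₂ k (fun v m => (TensorAlgebra.ι k v * m.1, v ⊗ₜ m.1))
    (fun v v' m => by simp [add_mul, TensorProduct.add_tmul])
    (fun r v m => by simp [TensorProduct.smul_tmul'])
    (fun v m m' => by simp [mul_add, TensorProduct.tmul_add])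
    (fun r v m => by simp)

lemma tensor_cons_injective {V : Type u} [AddCommGroup V] [Module k V] :
    Function.Injective (LinearMap.mul' k _ ∘ₗ
      TensorProduct.map (TensorAlgebra.ι k) (LinearMap.id : TensorAlgebra k V →ₗ[k] _)) := by
  let Φ := TensorAlgebra.lift k (tensorConsGen k V)
  let P : TensorAlgebra k V →ₗ[k] _ := Φ.toLinearMap.flip (1, 0)
  have hP : ∀ v b, P (TensorAlgebra.ι k v * b) = (TensorAlgebra.ι k v * (P b).1, v ⊗ₜ (P b).1) := by
    intro v b
    change Φ (TensorAlgebra.ι k v * b) (1, 0) = _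
    rw [map_mul, Module.End.mul_apply, show Φ (TensorAlgebra.ι k v) = tensorConsGen k V v from
      TensorAlgebra.lift_ι_apply _ v]
    rfl
  have h1 : ∀ a, ∀ b, (Φ a b).1 = a * b.1 := by
    intro a
    refine gen_induction tensor_adjoin (p := fun a => ∀ b, (Φ a b).1 = a * b.1) a (fun v b => ?_)
      (fun r b => ?_) (fun a b ha hb c => ?_) (fun a b ha hb c => ?_)
    · rw [show Φ (TensorAlgebra.ι k v) = tensorConsGen k V v from TensorAlgebra.lift_ι_apply _ v]
      rfl
    · rw [AlgHomClass.commutes, Module.algebraMap_end_apply, Prod.smul_fst, Algebra.smul_def]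
    · rw [map_add, LinearMap.add_apply, Prod.fst_add, ha, hb, add_mul]
    · rw [map_mul, Module.End.mul_apply, ha, hb, mul_assoc]
  have h2 : ∀ b, (P b).1 = b := fun b => (h1 b (1, 0)).trans (mul_one b)
  refine Function.LeftInverse.injective (g := fun a => (P a).2) fun t => ?_
  induction t with
  | zero => simp
  | add s t hs ht => simp only [map_add, Prod.snd_add] at hs ht ⊢; rw [hs, ht]
  | tmul v b =>
    change (P (TensorAlgebra.ι k v * b)).2 = _
    rw [hP, h2]

/-- The coradical filtration. -/
def NDGCC.corad (D : NDGCC k) : ℕ → Submodule k D.X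
  | 0 => ⊥
  | n + 1 => (LinearMap.range ((D.corad n).subtype.lTensor D.X)).comap D.comul

variable (D : NDGCC k)

lemma lTensor_range_mono {X Y : Type u} [AddCommGroup X] [Module k X] [AddCommGroup Y] [Module k Y]
    {S T : Submodule k Y} (h : S ≤ T) :
    LinearMap.range (S.subtype.lTensor X) ≤ LinearMap.range (T.subtype.lTensor X) := by
  rw [← Submodule.subtype_comp_inclusion S T h, LinearMap.lTensor_comp]
  exact LinearMap.range_comp_le_range _ _

lemma NDGCC.corad_mono : Monotone D.corad := by
  refine monotone_nat_of_le_succ fun n => ?_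
  induction n with
  | zero => exact bot_le
  | succ n ih => exact Submodule.comap_mono (lTensor_range_mono ih)

lemma NDGCC.ker_iter_le (n : ℕ) : LinearMap.ker (D.iter n) ≤ D.corad n := by
  induction n with
  | zero =>
    exact (LinearMap.ker_eq_bot.2 (TensorAlgebra.ι_leftInverse (R := k) (M := D.X)).injective).le
  | succ n ih =>
    intro x hx
    refine lTensor_range_mono ih ?_
    have h1 : (D.iter n).lTensor D.X (D.comul x) = 0 := by
      refine tensor_cons_injective ?_
      rw [map_zero, ← LinearMap.mem_ker.1 hx, NDGCC.iter, LinearMap.comp_apply, LinearMap.comp_apply,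
        LinearMap.comp_apply]
      generalize D.comul x = t
      induction t with
      | zero => simp
      | add s t hs ht => simp only [map_add, hs, ht]
      | tmul a b => rfl
    exact (Module.Flat.lTensor_exact D.X
      (LinearMap.exact_subtype_ker_map (D.iter n)) (D.comul x)).1 h1

lemma NDGCC.lTensor_range_induction {X Y : Type u} [AddCommGroup X] [Module k X] [AddCommGroup Y]
    [Module k Y] {S : Submodule k Y} {Z : Type u} [AddCommGroup Z] [Module k Z]
    {f : X ⊗[k] Y →ₗ[k] Z} (hf : ∀ x, ∀ y ∈ S, f (x ⊗ₜ y) = 0) {t : X ⊗[k] Y}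
    (ht : t ∈ LinearMap.range (S.subtype.lTensor X)) : f t = 0 := by
  obtain ⟨t, rfl⟩ := ht
  induction t with
  | zero => simp
  | add s t hs ht => rw [map_add, map_add, hs, ht, add_zero]
  | tmul x y => exact hf x y y.2

end Coradical

/-! ### The cobar construction is cofibrant -/

section OmegaCofibrant

variable {k : Type u} [Field k] [CharZero k] {D : NDGCC k} {E : DGLA k}

/-- The map `x ⊗ y ↦ ½ [ρ x, σ y]`, up to sign. -/
def NDGCC.pairBr (ρ σ : D.X →ₗ[k] E.X) : D.X ⊗[k] D.X →ₗ[k] E.X :=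
  (2⁻¹ : k) • (TensorProduct.lift (E.br.compl₁₂ (ρ ∘ₗ tw D.internal 1) σ))

lemma NDGCC.pairBr_tmul (ρ σ : D.X →ₗ[k] E.X) (x y : D.X) : NDGCC.pairBr ρ σ (x ⊗ₜ y) =
    (2⁻¹ : k) • E.br (ρ (tw D.internal 1 x)) (σ y) := rfl

lemma NDGCC.pairBr_swap {ρ σ : D.X →ₗ[k] E.X} (hρ : ∀ n, ∀ x ∈ D.gr (n + 1), ρ x ∈ E.gr n)
    (hσ : ∀ n, ∀ x ∈ D.gr (n + 1), σ x ∈ E.gr n) (t : D.X ⊗[k] D.X) :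
    NDGCC.pairBr ρ σ (swap D.internal t) = NDGCC.pairBr σ ρ t := by
  suffices H : NDGCC.pairBr ρ σ ∘ₗ swap D.internal = NDGCC.pairBr σ ρ from LinearMap.congr_fun H t
  refine tensor_ext_gr D.internal D.internal fun i j x hx y hy => ?_
  rw [LinearMap.comp_apply, swap_tmul D.internal hx hy, map_smul, NDGCC.pairBr_tmul,
    NDGCC.pairBr_tmul, tw_one_of_mem D.internal hx, tw_one_of_mem D.internal hy, map_smul ρ,
    map_smul σ, map_smul E.br, map_smul E.br, LinearMap.smul_apply, LinearMap.smul_apply,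
    E.br_skew (j - 1) (i - 1) (ρ y) (hρ _ y (by simpa using hy)) (σ x) (hσ _ x (by simpa using hx)),
    show (j - 1) * (i - 1) = i * j - i - j + 1 by ring, sgn_add, sgn_sub, sgn_sub, sgn_one]
  rcases sgn_cases k (i * j) with e1 | e1 <;> rcases sgn_cases k i with e2 | e2 <;>
    rcases sgn_cases k j with e3 | e3 <;> simp [e1, e2, e3]

lemma NDGCC.halfBr_congr {τ τ' : D.X →ₗ[k] E.X} (hτ : ∀ n, ∀ x ∈ D.gr (n + 1), τ x ∈ E.gr n)
    (hτ' : ∀ n, ∀ x ∈ D.gr (n + 1), τ' x ∈ E.gr n) {m : ℕ} (h : ∀ x ∈ D.corad m, τ x = τ' x)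
    {x : D.X} (hx : x ∈ D.corad (m + 1)) :
    D.halfBr τ (D.comul x) = D.halfBr τ' (D.comul x) := by
  have h1 : ∀ ρ : D.X →ₗ[k] E.X, NDGCC.pairBr ρ τ (D.comul x) = NDGCC.pairBr ρ τ' (D.comul x) := by
    intro ρ
    rw [← sub_eq_zero, ← LinearMap.sub_apply]
    refine NDGCC.lTensor_range_induction (S := D.corad m) (fun y z hz => ?_) hx
    rw [LinearMap.sub_apply, NDGCC.pairBr_tmul, NDGCC.pairBr_tmul, h z hz, sub_self]
  calc NDGCC.pairBr τ τ (D.comul x) = NDGCC.pairBr τ τ' (D.comul x) := h1 τ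
    _ = NDGCC.pairBr τ' τ (D.comul x) := by rw [← NDGCC.pairBr_swap hτ hτ', D.cocomm]
    _ = NDGCC.pairBr τ' τ' (D.comul x) := h1 τ'

lemma NDGCC.halfBr_mem {τ : D.X →ₗ[k] E.X} (hτ : ∀ n, ∀ x ∈ D.gr (n + 1), τ x ∈ E.gr n) {n : ℤ}
    {t : D.X ⊗[k] D.X} (ht : t ∈ tgr D.gr D.gr n) : D.halfBr τ t ∈ E.gr (n - 2) := by
  refine tgr_le _ (fun i j hij x hx y hy => ?_) ht
  rw [NDGCC.halfBr_tmul, show n - 2 = (i - 1) + (j - 1) by omega]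
  exact Submodule.smul_mem _ _ (E.br_mem _ _ _ (hτ _ _ (by simpa using tw_mem D.internal 1 hx)) _
    (hτ _ _ (by simpa using hy)))

lemma NDGCC.map_halfBr {B : DGLA k} (p : E ⟶ B) (τ : D.X →ₗ[k] E.X) (t : D.X ⊗[k] D.X) :
    DGLA.lin p (D.halfBr τ t) = D.halfBr (DGLA.lin p ∘ₗ τ) t := by
  have hb : ∀ y z, DGLA.lin p (E.br y z) = B.br (DGLA.lin p y) (DGLA.lin p z) := DGLA.Hom.map_br p
  induction t with
  | zero => simp
  | add s t hs ht => simp only [map_add, hs, ht]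
  | tmul x y => rw [NDGCC.halfBr_tmul, NDGCC.halfBr_tmul, map_smul, hb]; rfl

/-- The failure of `τ` to be a twisting cochain. -/
def NDGCC.mcErr (τ : D.X →ₗ[k] E.X) : D.X →ₗ[k] E.X :=
  E.d ∘ₗ τ + τ ∘ₗ D.d + D.halfBr τ ∘ₗ D.comul

lemma NDGCC.mcErr_apply (τ : D.X →ₗ[k] E.X) (x : D.X) :
    NDGCC.mcErr τ x = E.d (τ x) + τ (D.d x) + D.halfBr τ (D.comul x) := rfl

lemma NDGCC.omegaLift_err_ωι {τ : D.X →ₗ[k] E.X} (hτ : ∀ n, ∀ x ∈ D.gr (n + 1), τ x ∈ E.gr n)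
    (x : D.X) : E.d (D.omegaLift τ (D.ωι x)) - D.omegaLift τ (D.omegaComm.d (D.ωι x)) =
      NDGCC.mcErr τ x := by
  rw [D.omega_d_ωι, map_sub, map_neg, D.omegaLift_ωι, D.omegaLift_ωι, NDGCC.omegaLift_ωquad hτ,
    NDGCC.mcErr_apply]
  abel

/-- The Bianchi identity. -/
lemma NDGCC.mcErr_d {τ : D.X →ₗ[k] E.X} (hτ : ∀ n, ∀ x ∈ D.gr (n + 1), τ x ∈ E.gr n) (x : D.X) :
    E.d (NDGCC.mcErr τ x) - NDGCC.mcErr τ (D.d x) =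
      -(TensorProduct.lift (E.br.compl₁₂ τ (NDGCC.mcErr τ)) (D.comul x)) := by
  have hdd : D.omegaComm.d (D.ωquad (D.comul x)) = D.ωquad (D.comul (D.d x)) := by
    have := D.omegaComm.d_sq (D.ωι x)
    rw [D.omega_d_ωι, map_sub, map_neg, D.omega_d_ωι, D.d_sq, map_zero, neg_zero, zero_sub, neg_neg,
      sub_eq_zero] at this
    exact this.symm
  have h1 : E.d (NDGCC.mcErr τ x) - NDGCC.mcErr τ (D.d x) =
      E.d (D.omegaLift τ (D.ωquad (D.comul x))) -
        D.omegaLift τ (D.omegaComm.d (D.ωquad (D.comul x))) := by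
    rw [hdd, NDGCC.omegaLift_ωquad hτ, NDGCC.omegaLift_ωquad hτ, NDGCC.mcErr_apply,
      NDGCC.mcErr_apply, D.d_sq, map_add, map_add, E.d_sq, map_zero]
    abel
  have herr : ∀ n, ∀ x ∈ D.gr n, NDGCC.mcErr τ x ∈ E.gr (n - 2) := by
    intro n x hx
    rw [NDGCC.mcErr_apply]
    refine add_mem (add_mem ?_ ?_) (NDGCC.halfBr_mem hτ (D.comul_mem n x hx))
    · have := E.d_mem (n - 1) _ (hτ (n - 1) x (by simpa using hx))
      rwa [sub_sub, one_add_one_eq_two] at this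
    · refine hτ _ _ ?_
      have := D.d_mem n x hx
      rwa [show n - 1 = n - 2 + 1 by ring] at this
  set W : D.X ⊗[k] D.X →ₗ[k] E.X :=
    (2⁻¹ : k) • TensorProduct.lift (E.br.compl₁₂ τ (NDGCC.mcErr τ)) with hW
  have h2 : ∀ t, E.d (D.omegaLift τ (D.ωquad t)) - D.omegaLift τ (D.omegaComm.d (D.ωquad t)) =
      -W (t + swap D.internal t) := by
    intro t
    suffices H : E.d ∘ₗ D.omegaLift τ ∘ₗ D.ωquad - D.omegaLift τ ∘ₗ D.omegaComm.d ∘ₗ D.ωquad =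
        -(W ∘ₗ (LinearMap.id + swap D.internal)) from LinearMap.congr_fun H t
    refine tensor_ext_gr D.internal D.internal fun i j x hx y hy => ?_
    have hx1 : tw D.internal 1 x ∈ D.gr (i - 1 + 1) := by simpa using tw_mem D.internal 1 hx
    have hy1 : y ∈ D.gr (j - 1 + 1) := by simpa using hy
    have e1 := NDGCC.omegaLift_err_ωι hτ (tw D.internal 1 x)
    have e2 := NDGCC.omegaLift_err_ωι hτ y
    rw [D.omegaLift_ωι] at e1 e2
    simp only [LinearMap.sub_apply, LinearMap.comp_apply, LinearMap.neg_apply, LinearMap.add_apply,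
      LinearMap.id_apply]
    rw [swap_tmul D.internal hx hy, map_add, map_smul, D.ωquad_tmul, map_smul, map_smul, map_smul,
      map_smul, NDGCC.omegaLift_br hτ, D.omegaComm.br_leibniz _ _ _ (D.ωι_mem hx1) _ (D.ωι_mem hy1),
      D.omegaLift_ωι, D.omegaLift_ωι, E.br_leibniz _ _ _ (hτ _ _ hx1) _ (hτ _ _ hy1), map_add,
      map_smul, NDGCC.omegaLift_br hτ, NDGCC.omegaLift_br hτ, D.omegaLift_ωι, D.omegaLift_ωι,
      ← smul_sub, add_sub_add_comm, ← LinearMap.map_sub₂, ← smul_sub, ← map_sub, e1, e2, hW,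
      LinearMap.smul_apply, LinearMap.smul_apply, TensorProduct.lift.tmul, TensorProduct.lift.tmul,
      LinearMap.compl₁₂_apply, LinearMap.compl₁₂_apply, tw_one_of_mem D.internal hx, map_smul (NDGCC.mcErr τ),
      map_smul E.br, LinearMap.smul_apply, map_smul τ, map_smul E.br, LinearMap.smul_apply,
      E.br_skew (i - 2) (j - 1) _ (herr i x hx) _ (hτ _ _ hy1),
      show (i - 2) * (j - 1) = i * j - i - (j + j - 1 - 1) by ring, sgn_sub, sgn_sub, sgn_sub, sgn_sub,
      sgn_sub, sgn_add, sgn_one]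
    rcases sgn_cases k (i * j) with e1 | e1 <;> rcases sgn_cases k i with e2 | e2 <;>
      rcases sgn_cases k j with e3 | e3 <;> simp [e1, e2, e3, add_comm]
  rw [h1, h2, D.cocomm, ← two_smul k, map_smul, hW, LinearMap.smul_apply, smul_smul,
    mul_inv_cancel₀ two_ne_zero, one_smul]

lemma NDGCC.omega_cofibrant (hD : ∀ x, ∃ n, D.iter n x = 0) : D.omegaComm.Cofibrant := by
  intro E B p F hp hq
  have hF : ∀ x, ∃ n, x ∈ D.corad n := fun x => (hD x).imp fun n hn => D.ker_iter_le n hn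
  have hpd : ∀ x, DGLA.lin p (E.d x) = B.d (DGLA.lin p x) := DGLA.Hom.map_d p
  have hpg : ∀ n, ∀ x ∈ E.gr n, DGLA.lin p x ∈ B.gr n := DGLA.Hom.map_gr p
  have hFg : ∀ n, ∀ x ∈ D.omegaComm.gr n, DGLA.lin F x ∈ B.gr n := DGLA.Hom.map_gr F
  obtain ⟨σ, hσ, hpσ⟩ := exists_section E.internal B.internal (DGLA.lin p) hpg hp
  obtain ⟨s, hs, hps, hsK⟩ := exists_contraction E.internal B.internal E.d_mem E.d_sq hpg hpd
    (fun x hx hx' => IsQIso.acyclic E.d_sq hpd hp hq hx hx')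
  set τ₀ : D.X →ₗ[k] E.X := σ ∘ₗ DGLA.lin F ∘ₗ D.ωι with hτ₀
  have hτ₀g : ∀ n, ∀ x ∈ D.gr (n + 1), τ₀ x ∈ E.gr n := fun n x hx =>
    hσ n _ (hFg n _ (D.ωι_mem hx))
  set R : (D.X →ₗ[k] E.X) → D.X →ₗ[k] E.X := fun τ =>
    -(E.d ∘ₗ τ₀ + τ₀ ∘ₗ D.d + D.halfBr τ ∘ₗ D.comul) with hR
  have hRx : ∀ τ x, R τ x = -(E.d (τ₀ x) + τ₀ (D.d x) + D.halfBr τ (D.comul x)) := fun _ _ => rfl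
  have hRg : ∀ τ, (∀ n, ∀ x ∈ D.gr (n + 1), τ x ∈ E.gr n) → ∀ n, ∀ x ∈ D.gr (n + 1),
      R τ x ∈ E.gr (n - 1) := by
    intro τ hτ n x hx
    rw [hRx]
    refine neg_mem (add_mem (add_mem (E.d_mem n _ (hτ₀g n x hx)) ?_) ?_)
    · exact hτ₀g _ _ (by simpa using D.d_mem _ x hx)
    · have := NDGCC.halfBr_mem hτ (D.comul_mem _ x hx)
      rwa [show n + 1 - 2 = n - 1 by ring] at this
  let T : (D.X →ₗ[k] E.X) → D.X →ₗ[k] E.X := fun τ => τ₀ + s ∘ₗ R τ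
  have hTx : ∀ τ x, T τ x = τ₀ x + s (R τ x) := fun _ _ => rfl
  let t : ℕ → D.X →ₗ[k] E.X := fun m => T^[m] τ₀
  have htS : ∀ m, t (m + 1) = T (t m) := fun m => Function.iterate_succ_apply' T m τ₀
  have htg : ∀ m, ∀ n, ∀ x ∈ D.gr (n + 1), t m x ∈ E.gr n := by
    intro m
    induction m with
    | zero => exact hτ₀g
    | succ m ih =>
      intro n x hx
      rw [htS, hTx]
      refine add_mem (hτ₀g n x hx) ?_
      have := hs _ _ (hRg _ ih n x hx)
      rwa [sub_add_cancel] at this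
  have htc : ∀ m, ∀ x ∈ D.corad m, t (m + 1) x = t m x := by
    intro m
    induction m with
    | zero =>
      intro x hx
      rw [(Submodule.mem_bot k).1 hx, map_zero, map_zero]
    | succ m ih =>
      intro x hx
      rw [htS (m + 1), htS m, hTx, hTx, hRx, hRx, ← htS m,
        NDGCC.halfBr_congr (htg (m + 1)) (htg m) ih hx]
  obtain ⟨τ, hτ⟩ := exists_limit D.corad_mono hF t htc
  have hτg : ∀ n, ∀ x ∈ D.gr (n + 1), τ x ∈ E.gr n := by
    intro n x hx
    obtain ⟨m, hm⟩ := hF x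
    rw [hτ m x hm]
    exact htg m n x hx
  have hfix : ∀ x, τ x = τ₀ x + s (R τ x) := by
    intro x
    obtain ⟨m, hm⟩ := hF x
    have hm' := D.corad_mono (Nat.le_succ m) hm
    rw [hτ (m + 1) x hm', htS m, hTx, hRx, hRx, NDGCC.halfBr_congr hτg (htg m) (hτ m) hm']
  have hpτ : DGLA.lin p ∘ₗ τ = DGLA.lin F ∘ₗ D.ωι := by
    refine LinearMap.ext fun x => ?_
    rw [LinearMap.comp_apply, hfix, map_add, hps, add_zero, hτ₀, LinearMap.comp_apply, hpσ]
  have hpτ₀ : ∀ y, DGLA.lin p (τ₀ y) = DGLA.lin F (D.ωι y) := fun y => hpσ _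
  have hpR : ∀ x, DGLA.lin p (R τ x) = 0 := by
    intro x
    rw [hRx, map_neg, map_add, map_add, hpd, NDGCC.map_halfBr, hpτ, hpτ₀, hpτ₀,
      NDGCC.hom_ωι_d]
    abel
  have herr : ∀ x, NDGCC.mcErr τ x = s (E.d (NDGCC.mcErr τ x) - NDGCC.mcErr τ (D.d x)) := by
    intro x
    have h1 : E.d (NDGCC.mcErr τ x) - NDGCC.mcErr τ (D.d x) = -(E.d (R τ x) - R τ (D.d x)) := by
      simp only [NDGCC.mcErr_apply, hRx, map_add, map_neg, E.d_sq, D.d_sq, map_zero]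
      abel
    have h2 := hsK (R τ x) (hpR x)
    rw [h1, map_neg, map_sub, NDGCC.mcErr_apply, hfix x, hfix (D.d x), map_add]
    rw [eq_sub_of_add_eq h2]
    rw [hRx τ x]
    abel
  have hzero : ∀ m, ∀ x ∈ D.corad m, NDGCC.mcErr τ x = 0 := by
    intro m
    induction m with
    | zero =>
      intro x hx
      rw [(Submodule.mem_bot k).1 hx, map_zero]
    | succ m ih =>
      intro x hx
      rw [herr, NDGCC.mcErr_d hτg, NDGCC.lTensor_range_induction (S := D.corad m) (fun y z hz => ?_)
        hx, neg_zero, map_zero]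
      rw [TensorProduct.lift.tmul, LinearMap.compl₁₂_apply, ih z hz, map_zero]
  refine ⟨NDGCC.omegaHom hτg fun x => ?_, NDGCC.omega_hom_ext fun c => ?_⟩
  · obtain ⟨m, hm⟩ := hF x
    have := hzero m x hm
    rw [NDGCC.mcErr_apply, add_assoc, add_eq_zero_iff_eq_neg] at this
    rw [this]
    abel
  · change DGLA.lin p (DGLA.lin (NDGCC.omegaHom hτg _) (D.ωι c)) = _
    rw [NDGCC.omegaHom_ωι, ← LinearMap.comp_apply, hpτ]
    rfl

end OmegaCofibrant

/-! ### Constructions of differential graded Lie algebras -/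

section Constructions

variable {k : Type u} [Field k]

lemma prod_internal {X Y : Type u} [AddCommGroup X] [Module k X] [AddCommGroup Y] [Module k Y]
    {gX gY : ℤ → Submodule k _} (hX : DirectSum.IsInternal (M := X) gX)
    (hY : DirectSum.IsInternal (M := Y) gY) :
    DirectSum.IsInternal fun n => (gX n).prod (gY n) := by
  refine isInternal_of_proj (fun n => (proj hX n).prodMap (proj hY n)) (fun n x hx => ?_)
    (fun m n x hx hne => ?_) (fun x => ?_)
  · exact Prod.ext (proj_of_mem hX hx.1) (proj_of_mem hY hx.2)
  · exact Prod.ext (proj_of_ne hX hx.1 hne) (proj_of_ne hY hx.2 hne)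
  · rw [← Prod.fst_add_snd x]
    refine add_mem (hom_induction hX (p := fun a => (a, (0 : Y)) ∈ _) x.1 (fun n a ha =>
      Submodule.mem_iSup_of_mem n ⟨ha, zero_mem _⟩) fun a b ha hb => ?_)
      (hom_induction hY (p := fun a => ((0 : X), a) ∈ _) x.2 (fun n a ha =>
      Submodule.mem_iSup_of_mem n ⟨zero_mem _, ha⟩) fun a b ha hb => ?_)
    · simpa using add_mem ha hb
    · simpa using add_mem ha hb

namespace DGLA

variable {L M : DGLA k}

lemma lin_d (F : L ⟶ M) (x : L.X) : lin F (L.d x) = M.d (lin F x) := Hom.map_d F x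

lemma lin_br (F : L ⟶ M) (x y : L.X) : lin F (L.br x y) = M.br (lin F x) (lin F y) :=
  Hom.map_br F x y

lemma lin_gr (F : L ⟶ M) {n : ℤ} {x : L.X} (hx : x ∈ L.gr n) : lin F x ∈ M.gr n :=
  Hom.map_gr F n x hx

lemma lin_comp {N : DGLA k} (F : L ⟶ M) (G : M ⟶ N) (x : L.X) :
    lin (F ≫ G) x = lin G (lin F x) := rfl

lemma lin_id (x : L.X) : lin (𝟙 L) x = x := rfl

lemma hom_ext {F G : L ⟶ M} (h : ∀ x, lin F x = lin G x) : F = G :=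
  Hom.ext (LinearMap.ext h)

variable (L M) in
/-- The product of two differential graded Lie algebras. -/
def prod : DGLA k where
  X := L.X × M.X
  gr n := (L.gr n).prod (M.gr n)
  internal := prod_internal L.internal M.internal
  d := L.d.prodMap M.d
  d_mem n x hx := ⟨L.d_mem n _ hx.1, M.d_mem n _ hx.2⟩
  d_sq x := Prod.ext (L.d_sq _) (M.d_sq _)
  br := LinearMap.mk₂ k (fun x y => (L.br x.1 y.1, M.br x.2 y.2)) (fun _ _ _ => by simp)
    (fun _ _ _ => by simp) (fun _ _ _ => by simp) (fun _ _ _ => by simp)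
  br_mem i j x hx y hy := ⟨L.br_mem i j _ hx.1 _ hy.1, M.br_mem i j _ hx.2 _ hy.2⟩
  br_skew i j x hx y hy := Prod.ext (L.br_skew i j _ hx.1 _ hy.1) (M.br_skew i j _ hx.2 _ hy.2)
  br_jacobi i j l x hx y hy z hz := Prod.ext (L.br_jacobi i j l _ hx.1 _ hy.1 _ hz.1)
    (M.br_jacobi i j l _ hx.2 _ hy.2 _ hz.2)
  br_leibniz i j x hx y hy := Prod.ext (L.br_leibniz i j _ hx.1 _ hy.1)
    (M.br_leibniz i j _ hx.2 _ hy.2)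

/-- The projections. -/
def fst : prod L M ⟶ L := Hom.mk (LinearMap.fst k L.X M.X) (fun _ _ h => h.1) (fun _ => rfl)
  (fun _ _ => rfl)

/-- The projections. -/
def snd : prod L M ⟶ M := Hom.mk (LinearMap.snd k L.X M.X) (fun _ _ h => h.2) (fun _ => rfl)
  (fun _ _ => rfl)

/-- The homomorphism to a product. -/
def pairHom {N : DGLA k} (F : N ⟶ L) (G : N ⟶ M) : N ⟶ prod L M :=
  Hom.mk ((lin F).prod (lin G)) (fun _ _ h => ⟨lin_gr F h, lin_gr G h⟩)
    (fun x => Prod.ext (lin_d F x) (lin_d G x)) (fun x y => Prod.ext (lin_br F x y) (lin_br G x y))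

/-- The equalizer of two homomorphisms. -/
def eqz (F G : L ⟶ M) : DGLA k :=
  L.sub (LinearMap.eqLocus (lin F) (lin G))
    (fun n x hx => by
      have hF := fun y => proj_map_zero L.internal M.internal (lin F) (fun _ _ h => lin_gr F h) n y
      have hG := fun y => proj_map_zero L.internal M.internal (lin G) (fun _ _ h => lin_gr G h) n y
      rw [LinearMap.mem_eqLocus] at hx ⊢
      rw [hF, hG, hx])
    (fun x hx => by
      rw [LinearMap.mem_eqLocus] at hx ⊢
      rw [lin_d, lin_d, hx])
    (fun x hx y hy => by
      rw [LinearMap.mem_eqLocus] at hx hy ⊢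
      rw [lin_br, lin_br, hx, hy])

/-- The inclusion of the equalizer. -/
def eqzι (F G : L ⟶ M) : eqz F G ⟶ L :=
  Hom.mk (LinearMap.eqLocus (lin F) (lin G)).subtype (fun _ _ h => h) (fun _ => rfl)
    (fun _ _ => rfl)

lemma eqzι_inj {F G : L ⟶ M} {x y : (eqz F G).X} (h : lin (eqzι F G) x = lin (eqzι F G) y) :
    x = y := Subtype.ext h

lemma eqzι_spec {F G : L ⟶ M} (x : (eqz F G).X) :
    lin F (lin (eqzι F G) x) = lin G (lin (eqzι F G) x) := x.2

lemma eqzι_exists {F G : L ⟶ M} {x : L.X} (h : lin F x = lin G x) :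
    ∃ y, lin (eqzι F G) y = x := ⟨⟨x, h⟩, rfl⟩

/-- The homomorphism to an equalizer. -/
def eqzLift {N : DGLA k} {F G : L ⟶ M} (H : N ⟶ L) (h : ∀ x, lin F (lin H x) = lin G (lin H x)) :
    N ⟶ eqz F G :=
  Hom.mk ((lin H).codRestrict _ h) (fun _ _ hx => lin_gr H hx)
    (fun x => Subtype.ext (lin_d H x)) (fun x y => Subtype.ext (lin_br H x y))

/-- A surjective homomorphism with acyclic kernel is a quasi-isomorphism. -/
lemma QIso.of_surjective {F : L ⟶ M} (hF : Function.Surjective (lin F))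
    (hK : ∀ x, lin F x = 0 → L.d x = 0 → ∃ y, lin F y = 0 ∧ L.d y = x) : QIso F :=
  IsQIso.of_surjective L.d_sq (lin_d F) hF hK

section BaseChange

variable (R : Type u) [CommRing R] [Algebra k R] (L)

/-- The bracket of `R ⊗ L`. -/
def bcBr : TGen k R L.X →ₗ[k] TGen k R L.X →ₗ[k] TGen k R L.X :=
  TGen.lift (LinearMap.mk₂ k (fun r x => TGen.map (LinearMap.mul k R r) (L.br x))
    (fun x y a => TGen.ext fun z b => by
      simp only [TGen.map_mk, map_add, LinearMap.add_apply])
    (fun r x a => TGen.ext fun z b => by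
      simp only [TGen.map_mk, map_smul, LinearMap.smul_apply])
    (fun x a b => TGen.ext fun z c => by
      simp only [TGen.map_mk, map_add, LinearMap.add_apply])
    (fun r x a => TGen.ext fun z b => by
      simp only [TGen.map_mk, map_smul, LinearMap.smul_apply]))

lemma bcBr_mk (r s : R) (x y : L.X) : L.bcBr R (TGen.mk k R L.X r x) (TGen.mk k R L.X s y) =
    TGen.mk k R L.X (r * s) (L.br x y) := rfl

/-- The differential graded Lie algebra `R ⊗ L`, for a commutative algebra `R` in degree zero. -/
def baseChange : DGLA k where
  X := TGen k R L.X
  gr := TGen.gr R L.gr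
  internal := TGen.internal L.internal R
  d := TGen.map LinearMap.id L.d
  d_mem n x hx := by
    have := TGen.map_mem (gr' := L.gr) (LinearMap.id : R →ₗ[k] R) L.d (-1)
      (by simpa [sub_eq_add_neg] using L.d_mem) hx
    rwa [← sub_eq_add_neg] at this
  d_sq x := by
    rw [TGen.map_map, show L.d ∘ₗ L.d = 0 from LinearMap.ext L.d_sq, TGen.map_zero_right]
  br := L.bcBr R
  br_mem i j s hs t ht := by
    refine TGen.gr_induction (p := fun s => L.bcBr R s t ∈ TGen.gr R L.gr (i + j)) hs (by simp)
      (fun x a ha => ?_) (fun s s' h h' => by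
        rw [map_add, LinearMap.add_apply]; exact add_mem h h')
    refine TGen.gr_induction (p := fun t => L.bcBr R (TGen.mk k R L.X x a) t ∈
      TGen.gr R L.gr (i + j)) ht (by simp)
      (fun y b hb => ?_) (fun s s' h h' => by rw [map_add]; exact add_mem h h')
    rw [bcBr_mk]
    exact TGen.mk_mem _ (L.br_mem i j a ha b hb)
  br_skew i j s hs t ht := by
    refine TGen.gr_induction (p := fun s => L.bcBr R s t = -sgn k (i * j) • L.bcBr R t s) hs
      (by simp) (fun x a ha => ?_) (fun s s' h h' => by
        rw [map_add, LinearMap.add_apply, map_add, smul_add, h, h'])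
    refine TGen.gr_induction (p := fun t => L.bcBr R (TGen.mk k R L.X x a) t =
      -sgn k (i * j) • L.bcBr R t (TGen.mk k R L.X x a)) ht (by simp) (fun y b hb => ?_)
      (fun s s' h h' => by rw [map_add, map_add, LinearMap.add_apply, smul_add, h, h'])
    rw [bcBr_mk, bcBr_mk, L.br_skew i j a ha b hb, mul_comm x, map_smul]
  br_jacobi i j l s hs t ht w hw := by
    refine TGen.gr_induction (p := fun s => L.bcBr R s (L.bcBr R t w) =
      L.bcBr R (L.bcBr R s t) w + sgn k (i * j) • L.bcBr R t (L.bcBr R s w)) hs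
      (by simp) (fun x a ha => ?_) (fun s s' h h' => by
        simp only [map_add, LinearMap.add_apply, smul_add, h, h']; abel)
    refine TGen.gr_induction (p := fun t => L.bcBr R (TGen.mk k R L.X x a) (L.bcBr R t w) =
      L.bcBr R (L.bcBr R (TGen.mk k R L.X x a) t) w +
        sgn k (i * j) • L.bcBr R t (L.bcBr R (TGen.mk k R L.X x a) w)) ht
      (by simp) (fun y b hb => ?_) (fun s s' h h' => by
        simp only [map_add, LinearMap.add_apply, smul_add, h, h']; abel)
    refine TGen.gr_induction (p := fun w => L.bcBr R (TGen.mk k R L.X x a)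
      (L.bcBr R (TGen.mk k R L.X y b) w) =
      L.bcBr R (L.bcBr R (TGen.mk k R L.X x a) (TGen.mk k R L.X y b)) w +
        sgn k (i * j) • L.bcBr R (TGen.mk k R L.X y b) (L.bcBr R (TGen.mk k R L.X x a) w)) hw
      (by simp) (fun z c hc => ?_) (fun s s' h h' => by
        simp only [map_add, LinearMap.add_apply, smul_add, h, h']; abel)
    simp only [bcBr_mk]
    rw [L.br_jacobi i j l a ha b hb c hc, map_add, map_smul, mul_assoc, mul_left_comm y]
  br_leibniz i j s hs t ht := by
    refine TGen.gr_induction (p := fun s => TGen.map LinearMap.id L.d (L.bcBr R s t) =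
      L.bcBr R (TGen.map LinearMap.id L.d s) t +
        sgn k i • L.bcBr R s (TGen.map LinearMap.id L.d t)) hs (by simp) (fun x a ha => ?_)
      (fun s s' h h' => by simp only [map_add, LinearMap.add_apply, smul_add, h, h']; abel)
    refine TGen.gr_induction (p := fun t => TGen.map LinearMap.id L.d
      (L.bcBr R (TGen.mk k R L.X x a) t) =
      L.bcBr R (TGen.map LinearMap.id L.d (TGen.mk k R L.X x a)) t + sgn k i •
        L.bcBr R (TGen.mk k R L.X x a) (TGen.map LinearMap.id L.d t)) ht (by simp)
      (fun y b hb => ?_)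
      (fun s s' h h' => by simp only [map_add, LinearMap.add_apply, smul_add, h, h']; abel)
    simp only [bcBr_mk, TGen.map_mk, LinearMap.id_apply]
    rw [L.br_leibniz i j a ha b hb, map_add, map_smul]

end BaseChange

section Path

variable (L)

/-- The Lie algebra `L[t]`. -/
abbrev poly : DGLA k := L.baseChange (Polynomial k)

/-- The element `p ⊗ x` of `L[t]`. -/
def pmk : Polynomial k →ₗ[k] L.X →ₗ[k] L.poly.X := TGen.mk k (Polynomial k) L.X

variable {L} in
lemma poly_induction {p : L.poly.X → Prop} (a : L.poly.X) (zero : p 0)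
    (mk : ∀ r x, p (L.pmk r x)) (add : ∀ a b, p a → p b → p (a + b)) : p a :=
  TGen.induction (p := p) a zero mk add

variable {L} in
lemma poly_gr_induction {p : L.poly.X → Prop} {n : ℤ} {a : L.poly.X} (ha : a ∈ L.poly.gr n)
    (zero : p 0) (mk : ∀ r, ∀ x ∈ L.gr n, p (L.pmk r x)) (add : ∀ a b, p a → p b → p (a + b)) :
    p a :=
  TGen.gr_induction (p := p) ha zero mk add

variable {L} in
lemma pmk_mem (r : Polynomial k) {n : ℤ} {x : L.X} (hx : x ∈ L.gr n) : L.pmk r x ∈ L.poly.gr n :=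
  TGen.mk_mem _ hx

/-- The derivative on `L[t]`. -/
def pder : L.poly.X →ₗ[k] L.poly.X := TGen.map Polynomial.derivative LinearMap.id

lemma pder_mk (p : Polynomial k) (x : L.X) : L.pder (L.pmk p x) = L.pmk p.derivative x := rfl

lemma poly_d_mk (p : Polynomial k) (x : L.X) : L.poly.d (L.pmk p x) = L.pmk p (L.d x) := rfl

lemma poly_br_mk (p q : Polynomial k) (x y : L.X) : L.poly.br (L.pmk p x) (L.pmk q y) =
    L.pmk (p * q) (L.br x y) := rfl

variable {L} in
lemma poly_ext {Z : Type u} [AddCommGroup Z] [Module k Z] {f h : L.poly.X →ₗ[k] Z}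
    (H : ∀ p x, f (L.pmk p x) = h (L.pmk p x)) : f = h := TGen.ext H

lemma pder_mem {n : ℤ} {a : L.poly.X} (ha : a ∈ L.poly.gr n) : L.pder a ∈ L.poly.gr n := by
  have := TGen.map_mem (gr' := L.gr) (Polynomial.derivative (R := k)) (LinearMap.id : L.X →ₗ[k] _) 0
    (by simp) ha
  rwa [add_zero] at this

lemma pder_d (a : L.poly.X) : L.pder (L.poly.d a) = L.poly.d (L.pder a) := by
  suffices H : L.pder ∘ₗ L.poly.d = L.poly.d ∘ₗ L.pder from LinearMap.congr_fun H a
  exact poly_ext fun p x => rfl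

lemma pder_br (a b : L.poly.X) :
    L.pder (L.poly.br a b) = L.poly.br (L.pder a) b + L.poly.br a (L.pder b) := by
  induction a using poly_induction with
  | zero => simp
  | add s t hs ht => simp only [map_add, LinearMap.add_apply, hs, ht]; abel
  | mk p x =>
    induction b using poly_induction with
    | zero => simp
    | add s t hs ht => simp only [map_add, LinearMap.add_apply, hs, ht]; abel
    | mk q y => rw [poly_br_mk, pder_mk, pder_mk, pder_mk, poly_br_mk, poly_br_mk,
        Polynomial.derivative_mul, map_add, LinearMap.add_apply]

/-- The path object `L[t] ⊕ L[t] dt`, where `(a, b)` stands for `a + dt b`. -/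
def path : DGLA k where
  X := L.poly.X × L.poly.X
  gr n := (L.poly.gr n).prod (L.poly.gr (n + 1))
  internal := prod_internal L.poly.internal (shift_internal L.poly.internal 1)
  d := (L.poly.d ∘ₗ LinearMap.fst k _ _).prod
    (L.pder ∘ₗ LinearMap.fst k _ _ - L.poly.d ∘ₗ LinearMap.snd k _ _)
  d_mem n x hx := by
    refine ⟨L.poly.d_mem n _ hx.1, sub_mem ?_ ?_⟩
    · rw [sub_add_cancel]; exact L.pder_mem hx.1
    · have := L.poly.d_mem _ _ hx.2
      rwa [add_sub_right_comm] at this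
  d_sq x := by
    refine Prod.ext (L.poly.d_sq _) ?_
    change L.pder (L.poly.d x.1) - L.poly.d (L.pder x.1 - L.poly.d x.2) = 0
    rw [map_sub, L.poly.d_sq, pder_d, sub_zero, sub_self]
  br := LinearMap.mk₂ k (fun x y => (L.poly.br x.1 y.1,
      L.poly.br x.2 y.1 + L.poly.br (tw L.poly.internal 1 x.1) y.2))
    (fun _ _ _ => Prod.ext (by simp) (by simp; abel))
    (fun _ _ _ => Prod.ext (by simp) (by simp))
    (fun _ _ _ => Prod.ext (by simp) (by simp; abel))
    (fun _ _ _ => Prod.ext (by simp) (by simp))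
  br_mem i j x hx y hy := by
    refine ⟨L.poly.br_mem i j _ hx.1 _ hy.1, add_mem ?_ ?_⟩
    · have := L.poly.br_mem _ _ _ hx.2 _ hy.1
      rwa [add_right_comm] at this
    · have := L.poly.br_mem _ _ _ (tw_mem L.poly.internal 1 hx.1) _ hy.2
      rwa [← add_assoc] at this
  br_skew i j x hx y hy := by
    refine Prod.ext (L.poly.br_skew i j _ hx.1 _ hy.1) ?_
    change L.poly.br x.2 y.1 + L.poly.br (tw L.poly.internal 1 x.1) y.2 =
      -sgn k (i * j) • (L.poly.br y.2 x.1 + L.poly.br (tw L.poly.internal 1 y.1) x.2)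
    rw [tw_one_of_mem _ hx.1, tw_one_of_mem _ hy.1, L.poly.br_skew _ _ _ hx.2 _ hy.1, map_smul,
      map_smul, LinearMap.smul_apply, LinearMap.smul_apply, L.poly.br_skew _ _ _ hx.1 _ hy.2,
      add_one_mul, mul_add_one, sgn_add, sgn_add]
    rcases sgn_cases k (i * j) with e1 | e1 <;> rcases sgn_cases k i with e2 | e2 <;>
      rcases sgn_cases k j with e3 | e3 <;> simp [e1, e2, e3, add_comm]
  br_jacobi i j l x hx y hy z hz := by
    refine Prod.ext (L.poly.br_jacobi i j l _ hx.1 _ hy.1 _ hz.1) ?_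
    change L.poly.br x.2 (L.poly.br y.1 z.1) + L.poly.br (tw L.poly.internal 1 x.1)
        (L.poly.br y.2 z.1 + L.poly.br (tw L.poly.internal 1 y.1) z.2) =
      (L.poly.br (L.poly.br x.2 y.1 + L.poly.br (tw L.poly.internal 1 x.1) y.2) z.1 +
        L.poly.br (tw L.poly.internal 1 (L.poly.br x.1 y.1)) z.2) +
      sgn k (i * j) • (L.poly.br y.2 (L.poly.br x.1 z.1) + L.poly.br (tw L.poly.internal 1 y.1)
        (L.poly.br x.2 z.1 + L.poly.br (tw L.poly.internal 1 x.1) z.2))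
    rw [tw_one_of_mem _ hx.1, tw_one_of_mem _ hy.1,
      tw_one_of_mem _ (L.poly.br_mem _ _ _ hx.1 _ hy.1), sgn_add]
    simp only [map_smul, LinearMap.smul_apply, map_add, LinearMap.add_apply]
    rw [L.poly.br_jacobi _ _ _ _ hx.2 _ hy.1 _ hz.1, L.poly.br_jacobi _ _ _ _ hx.1 _ hy.2 _ hz.1,
      L.poly.br_jacobi _ _ _ _ hx.1 _ hy.1 _ hz.2, add_one_mul, mul_add_one, sgn_add, sgn_add]
    rcases sgn_cases k (i * j) with e1 | e1 <;> rcases sgn_cases k i with e2 | e2 <;>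
      rcases sgn_cases k j with e3 | e3 <;> simp [e1, e2, e3] <;> abel
  br_leibniz i j x hx y hy := by
    refine Prod.ext (L.poly.br_leibniz i j _ hx.1 _ hy.1) ?_
    change L.pder (L.poly.br x.1 y.1) -
        L.poly.d (L.poly.br x.2 y.1 + L.poly.br (tw L.poly.internal 1 x.1) y.2) =
      (L.poly.br (L.pder x.1 - L.poly.d x.2) y.1 +
        L.poly.br (tw L.poly.internal 1 (L.poly.d x.1)) y.2) +
      sgn k i • (L.poly.br x.2 (L.poly.d y.1) +
        L.poly.br (tw L.poly.internal 1 x.1) (L.pder y.1 - L.poly.d y.2))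
    rw [tw_one_of_mem _ hx.1, tw_one_of_mem _ (L.poly.d_mem i _ hx.1), sgn_sub, sgn_one, pder_br]
    simp only [map_smul, LinearMap.smul_apply, map_add, map_sub, LinearMap.sub_apply]
    rw [L.poly.br_leibniz _ _ _ hx.2 _ hy.1, L.poly.br_leibniz _ _ _ hx.1 _ hy.2, sgn_add, sgn_one]
    rcases sgn_cases k i with e2 | e2 <;> simp [e2] <;> abel

lemma path_d (x : L.path.X) : L.path.d x = (L.poly.d x.1, L.pder x.1 - L.poly.d x.2) := rfl

/-- Evaluation on `L[t]`. -/
def pev (c : k) : L.poly.X →ₗ[k] L.X :=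
  TGen.lift (LinearMap.lsmul k L.X ∘ₗ Polynomial.leval c)

lemma pev_mk (c : k) (p : Polynomial k) (x : L.X) : L.pev c (L.pmk p x) = p.eval c • x := rfl

lemma pev_d (c : k) (a : L.poly.X) : L.pev c (L.poly.d a) = L.d (L.pev c a) := by
  suffices H : L.pev c ∘ₗ L.poly.d = L.d ∘ₗ L.pev c from LinearMap.congr_fun H a
  exact poly_ext fun p x => by
    rw [LinearMap.comp_apply, LinearMap.comp_apply, poly_d_mk, pev_mk, pev_mk, map_smul]

/-- Evaluation on the path object. -/
def ev (c : k) : L.path ⟶ L :=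
  Hom.mk (L.pev c ∘ₗ LinearMap.fst k L.poly.X L.poly.X)
    (fun n x hx => poly_gr_induction (p := fun a => L.pev c a ∈ L.gr n) hx.1 (by simp)
      (fun p x hx => Submodule.smul_mem _ _ hx)
      (fun s t hs ht => by rw [map_add]; exact add_mem hs ht))
    (fun x => L.pev_d c x.1)
    (fun x y => by
      change L.pev c (L.poly.br x.1 y.1) = L.br (L.pev c x.1) (L.pev c y.1)
      generalize x.1 = a
      generalize y.1 = b
      induction a using poly_induction with
      | zero => simp
      | add s t hs ht => simp only [map_add, LinearMap.add_apply, hs, ht]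
      | mk p x =>
        induction b using poly_induction with
        | zero => simp
        | add s t hs ht => simp only [map_add, LinearMap.add_apply, hs, ht]
        | mk q y => rw [poly_br_mk, pev_mk, pev_mk, pev_mk, Polynomial.eval_mul, map_smul, map_smul,
            LinearMap.smul_apply, smul_smul, mul_comm])

lemma ev_apply (c : k) (x : L.path.X) : lin (L.ev c) x = L.pev c x.1 := rfl

/-- The constant paths. -/
def constPath : L ⟶ L.path :=
  Hom.mk ((L.pmk 1).prod 0) (fun n x hx => ⟨pmk_mem _ hx, zero_mem _⟩)
    (fun x => Prod.ext rfl (by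
      change (0 : L.poly.X) = L.pder (L.pmk 1 x) - L.poly.d 0
      rw [pder_mk, Polynomial.derivative_one, map_zero, map_zero, LinearMap.zero_apply, sub_zero]))
    (fun x y => Prod.ext (by
      change L.pmk 1 (L.br x y) = L.poly.br (L.pmk 1 x) (L.pmk 1 y)
      rw [poly_br_mk, one_mul]) (by
      change (0 : L.poly.X) = L.poly.br 0 (L.pmk 1 y) + L.poly.br _ 0
      rw [map_zero, map_zero, LinearMap.zero_apply, add_zero]))

lemma constPath_apply (x : L.X) : lin L.constPath x = (L.pmk 1 x, 0) := rfl

variable {L}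

/-- The map on polynomials induced by a linear map. -/
def pmap (f : L.X →ₗ[k] M.X) : L.poly.X →ₗ[k] M.poly.X := TGen.map LinearMap.id f

lemma pmap_mk (f : L.X →ₗ[k] M.X) (p : Polynomial k) (x : L.X) :
    pmap f (L.pmk p x) = M.pmk p (f x) := rfl

lemma pmap_d (f : L.X →ₗ[k] M.X) (hf : ∀ x, f (L.d x) = M.d (f x)) (a : L.poly.X) :
    pmap f (L.poly.d a) = M.poly.d (pmap f a) := by
  suffices H : pmap f ∘ₗ L.poly.d = M.poly.d ∘ₗ pmap f from LinearMap.congr_fun H a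
  exact poly_ext fun p x => by
    rw [LinearMap.comp_apply, LinearMap.comp_apply, poly_d_mk, pmap_mk, pmap_mk, poly_d_mk, hf]

lemma pmap_pder (f : L.X →ₗ[k] M.X) (a : L.poly.X) : pmap f (L.pder a) = M.pder (pmap f a) := by
  suffices H : pmap f ∘ₗ L.pder = M.pder ∘ₗ pmap f from LinearMap.congr_fun H a
  exact poly_ext fun p x => rfl

lemma pev_pmap (c : k) (f : L.X →ₗ[k] M.X) (a : L.poly.X) :
    M.pev c (pmap f a) = f (L.pev c a) := by
  suffices H : M.pev c ∘ₗ pmap f = f ∘ₗ L.pev c from LinearMap.congr_fun H a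
  exact poly_ext fun p x => by
    rw [LinearMap.comp_apply, LinearMap.comp_apply, pmap_mk, pev_mk, pev_mk, map_smul]

lemma pmap_mem (f : L.X →ₗ[k] M.X) (hf : ∀ n, ∀ x ∈ L.gr n, f x ∈ M.gr n) {n : ℤ} {a : L.poly.X}
    (ha : a ∈ L.poly.gr n) : pmap f a ∈ M.poly.gr n := by
  have := TGen.map_mem (gr' := M.gr) (LinearMap.id : Polynomial k →ₗ[k] _) f 0
    (by simpa using hf) ha
  rwa [add_zero] at this

lemma pmap_br (F : L ⟶ M) (a b : L.poly.X) :
    pmap (lin F) (L.poly.br a b) = M.poly.br (pmap (lin F) a) (pmap (lin F) b) := by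
  induction a using poly_induction with
  | zero => simp
  | add s t hs ht => simp only [map_add, LinearMap.add_apply, hs, ht]
  | mk p x =>
    induction b using poly_induction with
    | zero => simp
    | add s t hs ht => simp only [map_add, LinearMap.add_apply, hs, ht]
    | mk q y => rw [poly_br_mk, pmap_mk, pmap_mk, pmap_mk, poly_br_mk, lin_br]

/-- The homomorphism of path objects induced by a homomorphism. -/
def pathMap (F : L ⟶ M) : L.path ⟶ M.path :=
  Hom.mk ((pmap (lin F)).prodMap (pmap (lin F)))
    (fun _ _ h => ⟨pmap_mem _ (fun _ _ h => lin_gr F h) h.1,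
      pmap_mem _ (fun _ _ h => lin_gr F h) h.2⟩)
    (fun x => Prod.ext (pmap_d _ (lin_d F) _) (by
      change pmap (lin F) (L.pder x.1 - L.poly.d x.2) =
        M.pder (pmap (lin F) x.1) - M.poly.d (pmap (lin F) x.2)
      rw [map_sub, pmap_pder, pmap_d _ (lin_d F)]))
    (fun x y => Prod.ext (pmap_br F _ _) (by
      change pmap (lin F) (L.poly.br x.2 y.1 + L.poly.br (tw L.poly.internal 1 x.1) y.2) =
        M.poly.br (pmap (lin F) x.2) (pmap (lin F) y.1) +
          M.poly.br (tw M.poly.internal 1 (pmap (lin F) x.1)) (pmap (lin F) y.2)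
      rw [map_add, pmap_br, pmap_br, tw_map_zero L.poly.internal M.poly.internal (pmap (lin F))
        (fun _ _ h => pmap_mem _ (fun _ _ h => lin_gr F h) h)]))

lemma pathMap_ev (F : L ⟶ M) (c : k) : pathMap F ≫ M.ev c = L.ev c ≫ F :=
  hom_ext fun x => pev_pmap c (lin F) x.1

end Path

end DGLA

end Constructions

/-! ### Comparison of cofibrant resolutions -/

section Comparison

variable {k : Type u} [Field k] [CharZero k]

lemma exists_antiderivative (c : k) : ∃ J : Polynomial k →ₗ[k] Polynomial k,
    (∀ p, (J p).derivative = p) ∧ (∀ p, (J p).eval c = 0) ∧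
      ∀ p, J p.derivative = p - Polynomial.C (p.eval c) := by
  have hs : Function.Surjective (Polynomial.derivative (R := k)) := by
    intro p
    induction p using Polynomial.induction_on' with
    | add p q hp hq =>
      obtain ⟨a, rfl⟩ := hp
      obtain ⟨b, rfl⟩ := hq
      exact ⟨a + b, map_add _ _ _⟩
    | monomial n a =>
      refine ⟨Polynomial.monomial (n + 1) (a * (((n + 1 : ℕ) : k)⁻¹)), ?_⟩
      rw [Polynomial.derivative_monomial, Nat.add_sub_cancel, mul_assoc, inv_mul_cancel₀, mul_one]
      exact Nat.cast_ne_zero.2 n.succ_ne_zero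
  obtain ⟨J, hJ⟩ := (Polynomial.derivative (R := k)).exists_rightInverse_of_surjective
    (LinearMap.range_eq_top.2 hs)
  have h1 : ∀ p, (J p - Polynomial.C ((J p).eval c)).derivative = p := fun p => by
    rw [Polynomial.derivative_sub, Polynomial.derivative_C, sub_zero]
    exact LinearMap.congr_fun hJ p
  have h2 : ∀ p, (J p - Polynomial.C ((J p).eval c)).eval c = 0 := fun p => by simp
  refine ⟨J - (Polynomial.leval c ∘ₗ J).smulRight (1 : Polynomial k), fun p => ?_, fun p => ?_,
    fun p => ?_⟩
  all_goals
    rw [LinearMap.sub_apply, LinearMap.smulRight_apply, ← Polynomial.C_mul', mul_one]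
  · exact h1 p
  · exact h2 p
  · set r := J p.derivative - Polynomial.C ((J p.derivative).eval c) with hr
    have h3 : (r - p).derivative = 0 := by
      rw [Polynomial.derivative_sub, h1, sub_self]
    obtain ⟨a, ha⟩ := Polynomial.natDegree_eq_zero.1
      (Polynomial.natDegree_eq_zero_of_derivative_eq_zero h3)
    have h4 := congrArg (Polynomial.eval c) ha
    rw [Polynomial.eval_C, Polynomial.eval_sub, h2, zero_sub] at h4
    change r = _
    rw [sub_eq_iff_eq_add'.1 ha.symm, sub_eq_add_neg, ← map_neg, ← h4]

namespace DGLA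

variable {L M A Q Q' Z : DGLA k}

lemma exists_pint (L : DGLA k) (c : k) : ∃ J : L.poly.X →ₗ[k] L.poly.X, (∀ a, L.pder (J a) = a) ∧
    (∀ a, L.pev c (J a) = 0) ∧ (∀ a, J (L.pder a) = a - L.pmk 1 (L.pev c a)) ∧
    ∀ a, L.poly.d (J a) = J (L.poly.d a) := by
  obtain ⟨J, h1, h2, h3⟩ := exists_antiderivative c
  obtain ⟨T, hJ⟩ : ∃ T : L.poly.X →ₗ[k] L.poly.X, ∀ p x, T (L.pmk p x) = L.pmk (J p) x :=
    ⟨TGen.map J LinearMap.id, fun _ _ => rfl⟩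
  refine ⟨T, fun a => ?_, fun a => ?_, fun a => ?_, fun a => ?_⟩
  · induction a using poly_induction with
    | zero => simp only [map_zero]
    | add a b ha hb => simp only [map_add, ha, hb]
    | mk p x => rw [hJ, pder_mk, h1]
  · induction a using poly_induction with
    | zero => simp only [map_zero]
    | add a b ha hb => simp only [map_add, ha, hb, add_zero]
    | mk p x => rw [hJ, pev_mk, h2, zero_smul]
  · induction a using poly_induction with
    | zero => simp only [map_zero, sub_zero]
    | add a b ha hb => simp only [map_add, ha, hb]; abel
    | mk p x =>
      rw [pder_mk, hJ, h3, pev_mk, map_sub, LinearMap.sub_apply, ← mul_one (Polynomial.C _),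
        Polynomial.C_mul', map_smul, map_smul, LinearMap.smul_apply]
  · induction a using poly_induction with
    | zero => simp only [map_zero]
    | add a b ha hb => simp only [map_add, ha, hb]
    | mk p x => rw [hJ, poly_d_mk, poly_d_mk, hJ]

lemma ev_constPath (c : k) (x : L.X) : lin (L.ev c) (lin L.constPath x) = x := by
  rw [ev_apply, constPath_apply, pev_mk, Polynomial.eval_one, one_smul]

/-- A path with prescribed end points. -/
lemma exists_path {c c' : k} (hc : c' - c ≠ 0) (x y : A.X) :
    ∃ a : A.poly.X, A.pev c a = x ∧ A.pev c' a = y ∧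
      ∀ {B : DGLA k} (f : A.X →ₗ[k] B.X), f x = f y → pmap f a = B.pmk 1 (f x) := by
  refine ⟨A.pmk 1 x + A.pmk (Polynomial.C (c' - c)⁻¹ * (Polynomial.X - Polynomial.C c)) (y - x),
    ?_, ?_, fun f hf => ?_⟩
  · rw [map_add, pev_mk, pev_mk]
    simp
  · rw [map_add, pev_mk, pev_mk]
    simp [hc]
  · rw [map_add, pmap_mk, pmap_mk, map_sub, hf, sub_self, map_zero, add_zero]

lemma exists_cycle_lift {p : Q ⟶ A} (hp : QIso p) {c c' : k} (hc : c' - c ≠ 0) {a : A.path.X}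
    (ha : A.path.d a = 0) (h0 : lin (A.ev c) a = 0) {y : Q.X} (hy : Q.d y = 0)
    (h1 : lin (A.ev c') a = lin p y) : ∃ (a' : A.path.X) (y' : Q.X), A.path.d a' = a ∧ Q.d y' = y ∧
      lin (A.ev c) a' = 0 ∧ lin (A.ev c') a' = lin p y' := by
  obtain ⟨J, hJ1, hJ2, hJ3, hJ4⟩ := exists_pint A c
  obtain ⟨a, b⟩ := a
  have hb : A.pder a = A.poly.d b := sub_eq_zero.1 (congrArg Prod.snd ha)
  replace ha : A.poly.d a = 0 := congrArg Prod.fst ha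
  replace h0 : A.pev c a = 0 := h0
  replace h1 : A.pev c' a = lin p y := h1
  have hJb : A.poly.d (J b) = a := by
    rw [hJ4]
    change J (A.poly.d b) = a
    rw [← hb, hJ3]
    change a - A.pmk 1 (A.pev c a) = a
    rw [h0, map_zero, sub_zero]
  set z := A.pev c' (J b) with hz
  have hz1 : A.d z = lin p y := by rw [hz, ← pev_d, hJb]; exact h1
  obtain ⟨y0, hy0⟩ := hp.1 y hy ⟨z, hz1.symm⟩
  obtain ⟨x, w, hx, hw⟩ := hp.2 (z - lin p y0) (by rw [map_sub, hz1, ← lin_d, hy0, sub_self])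
  obtain ⟨e, he0, he1, -⟩ := exists_path hc (0 : A.X) w
  let u : A.path.X := (J b, 0)
  let v : A.path.X := (e, 0)
  refine ⟨u - A.path.d v, y0 + x, ?_, ?_, ?_, ?_⟩
  · rw [map_sub, A.path.d_sq, sub_zero, path_d]
    exact Prod.ext hJb (by change A.pder (J b) - A.poly.d 0 = b; rw [hJ1, map_zero, sub_zero])
  · rw [map_add, hx, add_zero, hy0]
  · rw [map_sub, lin_d, ev_apply, ev_apply]
    change A.pev c (J b) - A.d (A.pev c e) = 0
    rw [hJ2, he0, map_zero, sub_zero]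
  · rw [map_sub, lin_d, ev_apply, ev_apply]
    change A.pev c' (J b) - A.d (A.pev c' e) = _
    rw [he1, ← hz, eq_add_of_sub_eq hw, map_add]
    abel

/-- Homomorphisms from a cofibrant algebra which become equal after composition with a surjective
quasi-isomorphism are homotopic. -/
lemma exists_homotopy (hQ : Q.Cofibrant) {π : Z ⟶ A} (hs : Function.Surjective (lin π))
    (hπ : QIso π) {f h : Q ⟶ Z} (hfh : f ≫ π = h ≫ π) :
    ∃ H : Q ⟶ Z.path, H ≫ Z.ev 0 = f ∧ H ≫ Z.ev 1 = h := by
  let E := eqz (L := prod Z.path A) (fst ≫ pathMap π) (snd ≫ A.constPath)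
  let B := eqz (L := prod Z Z) (fst ≫ π) (snd ≫ π)
  let ιE : E ⟶ prod Z.path A := eqzι _ _
  let ιB : B ⟶ prod Z Z := eqzι _ _
  have hE : ∀ x, lin (pathMap π) (lin ιE x).1 = lin A.constPath (lin ιE x).2 := fun x =>
    eqzι_spec x
  have hev : ∀ (c : k) x, lin π (lin (Z.ev c) (lin ιE x).1) = (lin ιE x).2 := fun c x => by
    rw [← lin_comp, ← pathMap_ev, lin_comp, hE, ev_constPath]
  let Θ : E ⟶ B := eqzLift (ιE ≫ fst ≫ pairHom (Z.ev 0) (Z.ev 1))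
    (fun x => (hev 0 x).trans (hev 1 x).symm)
  have hΘ : ∀ x, lin ιB (lin Θ x) = (lin (Z.ev 0) (lin ιE x).1, lin (Z.ev 1) (lin ιE x).1) :=
    fun x => rfl
  have hΘs : Function.Surjective (lin Θ) := by
    intro y
    obtain ⟨e, he0, he1, hef⟩ := exists_path (c := 0) (c' := 1) (by simp) (lin ιB y).1 (lin ιB y).2
    obtain ⟨x, hx⟩ : ∃ x, lin ιE x = ((e, 0), lin π (lin ιB y).1) := by
      refine eqzι_exists (Prod.ext ?_ ?_)
      · exact hef (lin π) (eqzι_spec y)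
      · change pmap (lin π) 0 = 0
        rw [map_zero]
    refine ⟨x, eqzι_inj ?_⟩
    change lin ιB (lin Θ x) = lin ιB y
    rw [hΘ, hx]
    exact Prod.ext he0 he1
  have hΘq : QIso Θ := by
    refine QIso.of_surjective hΘs fun x hx hdx => ?_
    obtain ⟨s, -, hs1, hs2⟩ := exists_contraction Z.internal A.internal Z.d_mem Z.d_sq
      (fun _ _ h => lin_gr π h) (lin_d π)
      (fun x hx hx' => IsQIso.acyclic Z.d_sq (lin_d π) hs hπ hx hx')
    obtain ⟨r, hr⟩ := (lin π).exists_rightInverse_of_surjective (LinearMap.range_eq_top.2 hs)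
    have hr' : ∀ y, lin π (r y) = y := fun y => LinearMap.congr_fun hr y
    have hfac : ∀ z, Z.d (s z) + s (Z.d z) = z + (Z.d (s (r (lin π z))) + s (Z.d (r (lin π z))) -
        r (lin π z)) := by
      intro z
      have := hs2 (z - r (lin π z)) (by rw [map_sub, hr', sub_self])
      rw [map_sub, map_sub, map_sub, map_sub, sub_add_sub_comm, sub_eq_iff_eq_add] at this
      rw [this]; abel
    have hS : ∀ a, pmap (lin π) a = 0 → Z.poly.d (pmap s a) + pmap s (Z.poly.d a) = a := by
      intro a ha
      have h1 : ∀ a, Z.poly.d (pmap s a) + pmap s (Z.poly.d a) =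
          a + pmap (L := A) (M := Z) (Z.d ∘ₗ s ∘ₗ r + s ∘ₗ Z.d ∘ₗ r - r) (pmap (lin π) a) := by
        intro a
        induction a using poly_induction with
        | zero => simp only [map_zero, add_zero]
        | add a b ha hb => simp only [map_add] at ha hb ⊢; rw [add_add_add_comm, ha, hb]; abel
        | mk p z =>
          rw [pmap_mk, poly_d_mk, poly_d_mk, pmap_mk, pmap_mk, pmap_mk, ← map_add, hfac, map_add]
          rfl
      rw [h1, ha, map_zero, add_zero]
    have hπs : ∀ a, pmap (lin π) (pmap s a) = 0 := by
      intro a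
      induction a using poly_induction with
      | zero => simp only [map_zero]
      | add a b ha hb => simp only [map_add, ha, hb, add_zero]
      | mk p z => rw [pmap_mk, pmap_mk, hs1, map_zero]
    have hx' := hΘ x
    rw [hx, map_zero] at hx'
    have hx0 : lin (Z.ev 0) (lin ιE x).1 = 0 := (congrArg Prod.fst hx').symm
    have hx1 : lin (Z.ev 1) (lin ιE x).1 = 0 := (congrArg Prod.snd hx').symm
    have hy : (lin ιE x).2 = 0 := by rw [← hev 0, hx0, map_zero]
    have hE' := hE x
    rw [hy, map_zero] at hE'
    have hd : (prod Z.path A).d (lin ιE x) = 0 := by rw [← lin_d, hdx, map_zero]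
    have hd' : Z.path.d (lin ιE x).1 = 0 := congrArg Prod.fst hd
    generalize hab : (lin ιE x).1 = ab at hx0 hx1 hE' hd'
    obtain ⟨a, b⟩ := ab
    replace hd' : Z.poly.d a = 0 ∧ Z.pder a = Z.poly.d b :=
      ⟨congrArg Prod.fst hd', sub_eq_zero.1 (congrArg Prod.snd hd')⟩
    replace hE' : pmap (lin π) a = 0 ∧ pmap (lin π) b = 0 := Prod.mk_eq_zero.1 hE'
    replace hx0 : Z.pev 0 a = 0 := hx0
    replace hx1 : Z.pev 1 a = 0 := hx1
    obtain ⟨w, hw⟩ : ∃ w, lin ιE w = ((pmap s a, -pmap s b), 0) := by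
      refine eqzι_exists (Prod.ext ?_ ?_)
      · change pmap (lin π) (pmap s a) = A.pmk 1 0
        rw [hπs, map_zero]
      · change pmap (lin π) (-pmap s b) = 0
        rw [map_neg, hπs, neg_zero]
    refine ⟨w, eqzι_inj ?_, eqzι_inj ?_⟩
    · change lin ιB (lin Θ w) = lin ιB 0
      rw [hΘ, hw, map_zero]
      refine Prod.ext ?_ ?_
      · change Z.pev 0 (pmap s a) = 0
        rw [pev_pmap, hx0, map_zero]
      · change Z.pev 1 (pmap s a) = 0
        rw [pev_pmap, hx1, map_zero]
    · change lin ιE (E.d w) = lin ιE x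
      rw [lin_d, hw]
      refine Prod.ext ?_ (by
        change A.d 0 = _
        rw [map_zero, hy])
      rw [hab]
      have ha := hS a hE'.1
      have hb := hS b hE'.2
      refine Prod.ext ?_ ?_
      · change Z.poly.d (pmap s a) = a
        have h3 : Z.poly.d a = 0 := hd'.1
        rw [h3, map_zero, add_zero] at ha
        exact ha
      · change Z.pder (pmap s a) - Z.poly.d (-pmap s b) = b
        have h3 : Z.pder a = Z.poly.d b := hd'.2
        rw [← pmap_pder, h3, map_neg, sub_neg_eq_add, add_comm]
        exact hb
  obtain ⟨G, hG⟩ := hQ E B Θ (eqzLift (pairHom f h) fun x => by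
    have := congrArg (fun F => lin F x) hfh
    exact this) hΘs hΘq
  have hG' : ∀ x, lin ιB (lin Θ (lin G x)) = (lin f x, lin h x) := fun x =>
    congrArg (fun F => lin ιB (lin F x)) hG
  refine ⟨G ≫ ιE ≫ fst, hom_ext fun x => ?_, hom_ext fun x => ?_⟩
  · exact congrArg Prod.fst (hG' x)
  · exact congrArg Prod.snd (hG' x)

/-- The homotopy fibre product of `q` and `p`. -/
def hopb (q : Q ⟶ A) (p : Q' ⟶ A) : DGLA k :=
  eqz (L := prod Q (prod A.path Q'))
    (pairHom (snd ≫ fst ≫ A.ev 0) (snd ≫ fst ≫ A.ev 1)) (pairHom (fst ≫ q) (snd ≫ snd ≫ p))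

/-- The inclusion of the homotopy fibre product. -/
def hopbι (q : Q ⟶ A) (p : Q' ⟶ A) : hopb q p ⟶ prod Q (prod A.path Q') := eqzι _ _

lemma hopbι_spec {q : Q ⟶ A} {p : Q' ⟶ A} (x : (hopb q p).X) :
    lin (A.ev 0) (lin (hopbι q p) x).2.1 = lin q (lin (hopbι q p) x).1 ∧
      lin (A.ev 1) (lin (hopbι q p) x).2.1 = lin p (lin (hopbι q p) x).2.2 :=
  ⟨congrArg Prod.fst (eqzι_spec x), congrArg Prod.snd (eqzι_spec x)⟩

lemma hopbι_exists {q : Q ⟶ A} {p : Q' ⟶ A} {x : Q.X} {a : A.path.X} {y : Q'.X}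
    (h0 : lin (A.ev 0) a = lin q x) (h1 : lin (A.ev 1) a = lin p y) :
    ∃ z, lin (hopbι q p) z = (x, a, y) := eqzι_exists (Prod.ext h0 h1)

lemma hopb_d {q : Q ⟶ A} {p : Q' ⟶ A} {x : (hopb q p).X} (hx : (hopb q p).d x = 0) :
    Q.d (lin (hopbι q p) x).1 = 0 ∧ A.path.d (lin (hopbι q p) x).2.1 = 0 ∧
      Q'.d (lin (hopbι q p) x).2.2 = 0 := by
  have hd : (prod Q (prod A.path Q')).d (lin (hopbι q p) x) = 0 := by rw [← lin_d, hx, map_zero]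
  exact ⟨congrArg Prod.fst hd, congrArg (fun t => t.2.1) hd, congrArg (fun t => t.2.2) hd⟩

lemma hopb_fst {q : Q ⟶ A} {p : Q' ⟶ A} (hp : QIso p) :
    Function.Surjective (lin (hopbι q p ≫ fst)) ∧ QIso (hopbι q p ≫ fst) := by
  have hs : Function.Surjective (lin (hopbι q p ≫ fst)) := by
    intro x
    obtain ⟨e, he0, he1, -⟩ := exists_path (c := 0) (c' := 1) (by simp) (lin q x) 0
    obtain ⟨z, hz⟩ := hopbι_exists (p := p) (a := (e, 0)) (y := 0) he0 (he1.trans (map_zero _).symm)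
    exact ⟨z, congrArg Prod.fst hz⟩
  refine ⟨hs, QIso.of_surjective hs fun z hz hdz => ?_⟩
  obtain ⟨-, hd2, hd3⟩ := hopb_d hdz
  obtain ⟨h0, h1⟩ := hopbι_spec z
  have hz' : (lin (hopbι q p) z).1 = 0 := hz
  rw [hz', map_zero] at h0
  obtain ⟨a, y, ha, hy, ha0, ha1⟩ := exists_cycle_lift hp (by simp) hd2 h0 hd3 h1
  obtain ⟨w, hw⟩ := hopbι_exists (q := q) (x := 0) (ha0.trans (map_zero _).symm) ha1
  refine ⟨w, congrArg Prod.fst hw, eqzι_inj ?_⟩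
  change lin (hopbι q p) _ = lin (hopbι q p) _
  rw [lin_d, hw]
  exact Prod.ext ((map_zero Q.d).trans hz'.symm) (Prod.ext ha hy)

lemma hopb_snd {q : Q ⟶ A} {p : Q' ⟶ A} (hq : QIso q) :
    Function.Surjective (lin (hopbι q p ≫ snd ≫ snd)) ∧ QIso (hopbι q p ≫ snd ≫ snd) := by
  have hs : Function.Surjective (lin (hopbι q p ≫ snd ≫ snd)) := by
    intro y
    obtain ⟨e, he0, he1, -⟩ := exists_path (c := 0) (c' := 1) (by simp) 0 (lin p y)
    obtain ⟨z, hz⟩ := hopbι_exists (q := q) (a := (e, 0)) (x := 0) (he0.trans (map_zero _).symm) he1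
    exact ⟨z, congrArg (fun t => t.2.2) hz⟩
  refine ⟨hs, QIso.of_surjective hs fun z hz hdz => ?_⟩
  obtain ⟨hd1, hd2, -⟩ := hopb_d hdz
  obtain ⟨h0, h1⟩ := hopbι_spec z
  have hz' : (lin (hopbι q p) z).2.2 = 0 := hz
  rw [hz', map_zero] at h1
  obtain ⟨a, y, ha, hy, ha0, ha1⟩ := exists_cycle_lift hq (by simp) hd2 h1 hd1 h0
  obtain ⟨w, hw⟩ := hopbι_exists (p := p) (y := 0) ha1 (ha0.trans (map_zero _).symm)
  refine ⟨w, congrArg (fun t => t.2.2) hw, eqzι_inj ?_⟩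
  change lin (hopbι q p) _ = lin (hopbι q p) _
  rw [lin_d, hw]
  exact Prod.ext hy (Prod.ext ha ((map_zero Q'.d).trans hz'.symm))

/-- Two cofibrant resolutions of the same algebra are homotopy equivalent. -/
theorem exists_homotopyEquiv (hQ : Q.Cofibrant) (hQ' : Q'.Cofibrant) {q : Q ⟶ A} {p : Q' ⟶ A}
    (hq : QIso q) (hp : QIso p) : ∃ (f : Q ⟶ Q') (h : Q' ⟶ Q) (H : Q ⟶ Q.path) (H' : Q' ⟶ Q'.path),
      H ≫ Q.ev 0 = f ≫ h ∧ H ≫ Q.ev 1 = 𝟙 Q ∧ H' ≫ Q'.ev 0 = h ≫ f ∧ H' ≫ Q'.ev 1 = 𝟙 Q' := by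
  obtain ⟨s1, q1⟩ := hopb_fst (q := q) hp
  obtain ⟨s2, q2⟩ := hopb_snd (p := p) hq
  set π := hopbι q p ≫ fst
  set π' := hopbι q p ≫ snd ≫ snd
  obtain ⟨s, hs⟩ := hQ _ _ π (𝟙 Q) s1 q1
  obtain ⟨s', hs'⟩ := hQ' _ _ π' (𝟙 Q') s2 q2
  obtain ⟨H, h0, h1⟩ := exists_homotopy hQ s2 q2 (f := (s ≫ π') ≫ s') (h := s) (by
    rw [Category.assoc, hs', Category.comp_id])
  obtain ⟨H', h0', h1'⟩ := exists_homotopy hQ' s1 q1 (f := (s' ≫ π) ≫ s) (h := s') (by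
    rw [Category.assoc, hs, Category.comp_id])
  refine ⟨s ≫ π', s' ≫ π, H ≫ pathMap π, H' ≫ pathMap π', ?_, ?_, ?_, ?_⟩
  · rw [Category.assoc, pathMap_ev, ← Category.assoc, h0, Category.assoc]
  · rw [Category.assoc, pathMap_ev, ← Category.assoc, h1, hs]
  · rw [Category.assoc, pathMap_ev, ← Category.assoc, h0', Category.assoc]
  · rw [Category.assoc, pathMap_ev, ← Category.assoc, h1', hs']

end DGLA

end Comparison

/-! ### Functoriality and homotopy invariance of representation algebras -/

section RepMap

variable {k : Type u} [Field k]

lemma monoGr_hom {V W A B : Type u} [AddCommGroup V] [Module k V] [AddCommGroup W] [Module k W]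
    [Ring A] [Algebra k A] [Ring B] [Algebra k B] {gV : ℤ → Submodule k V} {gW : ℤ → Submodule k W}
    {ι : V →ₗ[k] A} {ι' : W →ₗ[k] B} (f : A →ₐ[k] B)
    (hf : ∀ n, ∀ v ∈ gV n, f (ι v) ∈ monoGr gW ι' n) {n : ℤ} {a : A} (ha : a ∈ monoGr gV ι n) :
    f a ∈ monoGr gW ι' n := by
  refine monoGr_induction (p := fun a => f a ∈ monoGr gW ι' n) ha (fun b hb => ?_) (by simp)
    (fun b c hb hc => by rw [map_add]; exact add_mem hb hc)
    (fun r b hb => by rw [map_smul]; exact Submodule.smul_mem _ r hb)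
  clear ha
  induction hb with
  | one => rw [map_one]; exact monoGr_one
  | @cons i j n v b hn hv hb ih =>
    rw [map_mul, ← hn]
    exact monoGr_mul (hf i v hv) ih

lemma IsDer.hom_comm {V A B : Type u} [AddCommGroup V] [Module k V] [Ring A] [Algebra k A] [Ring B]
    [Algebra k B] {ι : V →ₗ[k] A} {gA : ℤ → Submodule k A} {gB : ℤ → Submodule k B}
    {hA : DirectSum.IsInternal gA} {hB : DirectSum.IsInternal gB} {e : ℤ} {D : A →ₗ[k] A}
    {D' : B →ₗ[k] B} (hgen : Algebra.adjoin k (Set.range ι) = ⊤) (hD : IsDer hA e D)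
    (hD' : IsDer hB e D') (f : A →ₐ[k] B) (hf : ∀ n, ∀ x ∈ gA n, f x ∈ gB n) (h1 : (1 : A) ∈ gA 0)
    (h1' : (1 : B) ∈ gB 0) (h0 : ∀ v, f (D (ι v)) = D' (f (ι v))) (a : A) : f (D a) = D' (f a) := by
  have ht : ∀ a, f (tw hA e a) = tw hB e (f a) := fun a =>
    (tw_map_zero hA hB f.toLinearMap hf e a).symm
  refine gen_induction hgen (p := fun a => f (D a) = D' (f a)) a h0 (fun r => ?_)
    (fun a b ha hb => by simp only [map_add, ha, hb]) (fun a b ha hb => ?_)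
  · rw [hD.map_algebraMap h1, AlgHom.commutes, hD'.map_algebraMap h1', map_zero]
  · rw [hD, map_add, map_mul, map_mul, map_mul, hD', ha, hb, ht]

variable {g : Type u} [LieRing g] [LieAlgebra k g] [Module.Finite k g] {L M : DGLA k}

variable (g L) in
/-- The grading of the representation algebra. -/
abbrev repGrad : ℤ → Submodule k (RepAlg g L) := monoGr (repGr g L) (Pres.gen (repGr g L) (RepRel g L))

variable (g L) in
lemma rep_isGen : IsGen (repGr g L) (Pres.gen (repGr g L) (RepRel g L)) :=
  Pres.isGen (repGr_internal g L) (repRel_hom L)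

variable (g L) in
lemma rep_internal : DirectSum.IsInternal (repGrad g L) := (rep_isGen g L).grInternal

variable (g L) in
/-- The differential of the representation algebra. -/
def repD : RepAlg g L →ₗ[k] RepAlg g L := Pres.der (rep_dData L)

variable (g L) in
/-- The generators of the representation algebra. -/
def repGen : Module.Dual k g →ₗ[k] L.X →ₗ[k] RepAlg g L :=
  (TGen.mk k (Module.Dual k g) L.X).compr₂ (Pres.gen (repGr g L) (RepRel g L))

lemma repGen_apply (φ : Module.Dual k g) (ξ : L.X) :
    repGen g L φ ξ = Pres.gen (repGr g L) (RepRel g L) (TGen.mk k _ _ φ ξ) := rfl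

lemma repGen_mem (φ : Module.Dual k g) {n : ℤ} {ξ : L.X} (hξ : ξ ∈ L.gr n) :
    repGen g L φ ξ ∈ repGrad g L n :=
  monoGr_ι (TGen.mk_mem φ hξ)

lemma repD_repGen (φ : Module.Dual k g) (ξ : L.X) :
    repD g L (repGen g L φ ξ) = repGen g L φ (L.d ξ) := by
  rw [repD, repGen_apply, Pres.der_gen]; rfl

lemma repAct_repGen (y : g) (φ : Module.Dual k g) (ξ : L.X) :
    repAct L y (repGen g L φ ξ) = repGen g L (coad y φ) ξ := by
  rw [repAct, repGen_apply, Pres.der_gen]; rfl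

lemma repGen_comm (φ χ : Module.Dual k g) {i j : ℤ} {ξ η : L.X} (hξ : ξ ∈ L.gr i)
    (hη : η ∈ L.gr j) : repGen g L φ ξ * repGen g L χ η =
      sgn k (i * j) • (repGen g L χ η * repGen g L φ ξ) :=
  Pres.gen_comm i j _ (TGen.mk_mem φ hξ) _ (TGen.mk_mem χ hη)

lemma repGen_br (φ : Module.Dual k g) {i j : ℤ} {ξ η : L.X} (hξ : ξ ∈ L.gr i) (hη : η ∈ L.gr j) :
    repGen g L φ (L.br ξ η) = LinearMap.mul' k _ (TensorProduct.map ((repGen g L).flip ξ)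
      ((repGen g L).flip η) (coLie φ)) := by
  rw [repGen_apply, rep_rel L hξ hη]
  generalize coLie φ = t
  induction t with
  | zero => simp
  | add s t hs ht => simp only [map_add, hs, ht]
  | tmul χ ψ =>
    simp only [repProd, LinearMap.comp_apply, TensorProduct.map_tmul, LinearMap.mul'_apply, map_mul,
      LinearMap.flip_apply, Pres.mk_ι, repGen_apply]

lemma repAlg_induction {p : RepAlg g L → Prop} (a : RepAlg g L) (gen : ∀ φ ξ, p (repGen g L φ ξ))
    (zero : p 0) (scalar : ∀ r, p (algebraMap k _ r)) (add : ∀ a b, p a → p b → p (a + b))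
    (mul : ∀ a b, p a → p b → p (a * b)) : p a := by
  refine gen_induction (Pres.isGen (repGr_internal g L) (repRel_hom L)).gen a (fun v => ?_) scalar
    add mul
  induction v using TGen.induction with
  | zero => rw [map_zero]; exact zero
  | add s t hs ht => rw [map_add]; exact add _ _ hs ht
  | mk φ ξ => exact gen φ ξ

lemma repAlg_hom_ext {B : Type u} [Ring B] [Algebra k B] {F G : RepAlg g L →ₐ[k] B}
    (h : ∀ φ ξ, F (repGen g L φ ξ) = G (repGen g L φ ξ)) : F = G :=
  AlgHom.ext fun a => repAlg_induction (p := fun a => F a = G a) a h (by simp) (by simp)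
    (fun a b ha hb => by rw [map_add, map_add, ha, hb])
    (fun a b ha hb => by rw [map_mul, map_mul, ha, hb])

/-- The universal property of the representation algebra. -/
def repLift {B : Type u} [Ring B] [Algebra k B] (ψ : Module.Dual k g →ₗ[k] L.X →ₗ[k] B)
    (hc : ∀ φ χ i j, ∀ ξ ∈ L.gr i, ∀ η ∈ L.gr j, ψ φ ξ * ψ χ η = sgn k (i * j) • (ψ χ η * ψ φ ξ))
    (hb : ∀ φ i j, ∀ ξ ∈ L.gr i, ∀ η ∈ L.gr j, ψ φ (L.br ξ η) =
      LinearMap.mul' k _ (TensorProduct.map (ψ.flip ξ) (ψ.flip η) (coLie φ))) :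
    RepAlg g L →ₐ[k] B :=
  Pres.lift (TGen.lift ψ)
    (fun i j v hv w hw => by
      refine TGen.gr_induction (p := fun v => TGen.lift ψ v * TGen.lift ψ w =
        sgn k (i * j) • (TGen.lift ψ w * TGen.lift ψ v)) hv (by simp) (fun φ ξ hξ => ?_)
        (fun s t hs ht => by simp only [map_add, add_mul, mul_add, smul_add, hs, ht])
      refine TGen.gr_induction (p := fun w => TGen.lift ψ (TGen.mk k _ _ φ ξ) * TGen.lift ψ w =
        sgn k (i * j) • (TGen.lift ψ w * TGen.lift ψ (TGen.mk k _ _ φ ξ))) hw (by simp)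
        (fun χ η hη => ?_)
        (fun s t hs ht => by simp only [map_add, add_mul, mul_add, smul_add, hs, ht])
      simp only [TGen.lift_mk]
      exact hc φ χ i j ξ hξ η hη)
    (by
      rintro _ _ ⟨hξ, hη, φ⟩
      rw [TensorAlgebra.lift_ι_apply, TGen.lift_mk, hb φ _ _ _ hξ _ hη]
      generalize coLie φ = t
      induction t with
      | zero => simp
      | add s t hs ht => simp only [map_add, hs, ht]
      | tmul χ ψ =>
        simp only [repProd, LinearMap.comp_apply, TensorProduct.map_tmul, LinearMap.mul'_apply,
          map_mul, LinearMap.flip_apply, TensorAlgebra.lift_ι_apply, TGen.lift_mk])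

lemma repLift_repGen {B : Type u} [Ring B] [Algebra k B] (ψ : Module.Dual k g →ₗ[k] L.X →ₗ[k] B)
    (hc : ∀ φ χ i j, ∀ ξ ∈ L.gr i, ∀ η ∈ L.gr j, ψ φ ξ * ψ χ η = sgn k (i * j) • (ψ χ η * ψ φ ξ))
    (hb : ∀ φ i j, ∀ ξ ∈ L.gr i, ∀ η ∈ L.gr j, ψ φ (L.br ξ η) =
      LinearMap.mul' k _ (TensorProduct.map (ψ.flip ξ) (ψ.flip η) (coLie φ)))
    (φ : Module.Dual k g) (ξ : L.X) : repLift ψ hc hb (repGen g L φ ξ) = ψ φ ξ := by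
  rw [repLift, repGen_apply, Pres.lift_gen, TGen.lift_mk]

variable (g) in
/-- The homomorphism of representation algebras induced by a homomorphism of Lie algebras. -/
def repMapAlg (F : L ⟶ M) : RepAlg g L →ₐ[k] RepAlg g M :=
  repLift ((repGen g M).compl₂ (DGLA.lin F))
    (fun φ χ i j ξ hξ η hη => repGen_comm φ χ (DGLA.lin_gr F hξ) (DGLA.lin_gr F hη))
    (fun φ i j ξ hξ η hη => by
      rw [LinearMap.compl₂_apply, DGLA.lin_br, repGen_br φ (DGLA.lin_gr F hξ) (DGLA.lin_gr F hη)]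
      rfl)

lemma repMapAlg_repGen (F : L ⟶ M) (φ : Module.Dual k g) (ξ : L.X) :
    repMapAlg g F (repGen g L φ ξ) = repGen g M φ (DGLA.lin F ξ) := repLift_repGen _ _ _ _ _

lemma repMapAlg_comp {N : DGLA k} (F : L ⟶ M) (G : M ⟶ N) (a : RepAlg g L) :
    repMapAlg g (F ≫ G) a = repMapAlg g G (repMapAlg g F a) := by
  suffices H : repMapAlg g (F ≫ G) = (repMapAlg g G).comp (repMapAlg g F) from
    DFunLike.congr_fun H a
  refine repAlg_hom_ext fun φ ξ => ?_
  rw [AlgHom.comp_apply, repMapAlg_repGen, repMapAlg_repGen, repMapAlg_repGen, DGLA.lin_comp]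

lemma repMapAlg_id (a : RepAlg g L) : repMapAlg g (𝟙 L) a = a := by
  suffices H : repMapAlg g (𝟙 L) = AlgHom.id k _ from DFunLike.congr_fun H a
  refine repAlg_hom_ext fun φ ξ => ?_
  rw [repMapAlg_repGen, DGLA.lin_id]; rfl

lemma repMapAlg_mem (F : L ⟶ M) (n : ℤ) (a : RepAlg g L) (ha : a ∈ repGrad g L n) :
    repMapAlg g F a ∈ repGrad g M n := by
  refine monoGr_hom (gW := repGr g M) (ι' := Pres.gen (repGr g M) (RepRel g M)) (repMapAlg g F)
    (fun n v hv => ?_) ha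
  refine TGen.gr_induction (p := fun v => repMapAlg g F (Pres.gen _ _ v) ∈
    monoGr (repGr g M) (Pres.gen (repGr g M) (RepRel g M)) n) hv (by simp) (fun φ ξ hξ => ?_)
    (fun s t hs ht => by rw [map_add, map_add]; exact add_mem hs ht)
  rw [← repGen_apply, repMapAlg_repGen]
  exact repGen_mem φ (DGLA.lin_gr F hξ)

lemma rep_der_comm {N : DGLA k} {e : ℤ} {D : RepAlg g L →ₗ[k] RepAlg g L}
    {D' : RepAlg g N →ₗ[k] RepAlg g N} (hD : IsDer (rep_internal g L) e D)
    (hD' : IsDer (rep_internal g N) e D') (f : RepAlg g L →ₐ[k] RepAlg g N)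
    (hf : ∀ n, ∀ x ∈ repGrad g L n, f x ∈ repGrad g N n)
    (h0 : ∀ φ ξ, f (D (repGen g L φ ξ)) = D' (f (repGen g L φ ξ))) (a : RepAlg g L) :
    f (D a) = D' (f a) := by
  refine hD.hom_comm (Pres.isGen (repGr_internal g L) (repRel_hom L)).gen hD' f hf
    monoGr_one monoGr_one (fun v => ?_) a
  induction v using TGen.induction with
  | zero => simp
  | add s t hs ht => simp only [map_add, hs, ht]
  | mk φ ξ => exact h0 φ ξ

lemma repD_isDer : IsDer (rep_internal g L) 1 (repD g L) := Pres.der_isDer _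

lemma repAct_isDer (y : g) : IsDer (rep_internal g L) 0 (repAct L y) := Pres.der_isDer _

lemma repMapAlg_d (F : L ⟶ M) (a : RepAlg g L) :
    repMapAlg g F (repD g L a) = repD g M (repMapAlg g F a) :=
  rep_der_comm repD_isDer repD_isDer _ (repMapAlg_mem F) (fun φ ξ => by
    rw [repD_repGen, repMapAlg_repGen, repMapAlg_repGen, repD_repGen, DGLA.lin_d]) a

lemma repMapAlg_act (F : L ⟶ M) (y : g) (a : RepAlg g L) :
    repMapAlg g F (repAct L y a) = repAct M y (repMapAlg g F a) :=
  rep_der_comm (repAct_isDer y) (repAct_isDer y) _ (repMapAlg_mem F) (fun φ ξ => by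
    rw [repAct_repGen, repMapAlg_repGen, repMapAlg_repGen, repAct_repGen]) a

lemma rep_aug_repGen (φ : Module.Dual k g) (ξ : L.X) : (rep g L).aug (repGen g L φ ξ) = 0 := by
  refine Pres.aug_gen (gV := repGr g L) (R := RepRel g L) ?_ (TGen.mk k _ _ φ ξ)
  rintro _ _ ⟨hξ, hη, φ⟩
  rw [TensorAlgebra.lift_ι_apply]
  generalize coLie φ = t
  induction t with
  | zero => simp
  | add s t hs ht => rw [map_add, map_add, ← hs, ← ht]; simp
  | tmul p q => simp [repProd]

variable (g) in
/-- The morphism of representation algebras induced by a homomorphism of Lie algebras. -/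
def repMap (F : L ⟶ M) : rep g L ⟶ rep g M :=
  ADGCA.Hom.mk (repMapAlg g F) (repMapAlg_mem F) (repMapAlg_d F) (fun a => by
    suffices H : (rep g M).aug.comp (repMapAlg g F) = (rep g L).aug from DFunLike.congr_fun H a
    refine repAlg_hom_ext fun φ ξ => ?_
    have h : (rep g M).aug (repMapAlg g F (repGen g L φ ξ)) = 0 := by
      rw [repMapAlg_repGen]
      exact rep_aug_repGen φ _
    exact h.trans (rep_aug_repGen φ ξ).symm)

/-- A morphism restricts to the algebras of invariants. -/
def ADGCA.invariantsMap {A B : ADGCA k} {Y : Type u} {θ : Y → A.X →ₗ[k] A.X}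
    {θ' : Y → B.X →ₗ[k] B.X} (hθ : ∀ y, IsDer A.internal 0 (θ y))
    (hm : ∀ y n, ∀ x ∈ A.gr n, θ y x ∈ A.gr n) (hc : ∀ y x, A.d (θ y x) = θ y (A.d x))
    (hθ' : ∀ y, IsDer B.internal 0 (θ' y)) (hm' : ∀ y n, ∀ x ∈ B.gr n, θ' y x ∈ B.gr n)
    (hc' : ∀ y x, B.d (θ' y x) = θ' y (B.d x)) (F : A ⟶ B)
    (hF : ∀ y x, ADGCA.lin F (θ y x) = θ' y (ADGCA.lin F x)) :
    A.invariants θ hθ hm hc ⟶ B.invariants θ' hθ' hm' hc' :=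
  ADGCA.Hom.mk (((ADGCA.Hom.f F).comp (Subalgebra.val _)).codRestrict _ (fun x y => by
      have := hF y x.1
      rw [x.2 y, map_zero] at this
      exact this.symm))
    (fun n x hx => ADGCA.Hom.map_gr F n x.1 hx) (fun x => Subtype.ext (ADGCA.Hom.map_d F x.1))
    (fun x => ADGCA.Hom.map_aug F x.1)

variable (g) in
/-- The morphism of invariant subalgebras induced by a homomorphism of Lie algebras. -/
def repInvMap (F : L ⟶ M) : repInv g L ⟶ repInv g M :=
  ADGCA.invariantsMap _ _ _ _ _ _ (repMap g F) (fun y x => repMapAlg_act F y x)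

end RepMap

section RepHomotopy

variable {k : Type u} [Field k] [CharZero k]
variable (g : Type u) [LieRing g] [LieAlgebra k g] [Module.Finite k g] (L : DGLA k)

/-- The algebra of polynomials over the representation algebra. -/
abbrev RepPoly : Type u := Polynomial k ⊗[k] RepAlg g L

/-- The map `p ⊗ ξ ↦ p ⊗ (φ ⊗ ξ)`. -/
def polyGen : Module.Dual k g →ₗ[k] L.poly.X →ₗ[k] RepPoly g L :=
  show Module.Dual k g →ₗ[k] TGen k (Polynomial k) L.X →ₗ[k] RepPoly g L from
  { toFun := fun φ => TGen.lift ((TensorProduct.mk k (Polynomial k) (RepAlg g L)).compl₂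
      (repGen g L φ))
    map_add' := fun φ χ => TGen.ext fun p x => by
      simp only [TGen.lift_mk, LinearMap.add_apply, LinearMap.compl₂_apply, map_add]
    map_smul' := fun r φ => TGen.ext fun p x => by
      simp only [TGen.lift_mk, LinearMap.smul_apply, LinearMap.compl₂_apply, map_smul,
        RingHom.id_apply] }

variable {g L}

lemma polyGen_mk (φ : Module.Dual k g) (p : Polynomial k) (x : L.X) :
    polyGen g L φ (L.pmk p x) = p ⊗ₜ repGen g L φ x := rfl

lemma polyGen_comm (φ χ : Module.Dual k g) {i j : ℤ} {a b : L.poly.X} (ha : a ∈ L.poly.gr i)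
    (hb : b ∈ L.poly.gr j) : polyGen g L φ a * polyGen g L χ b =
      sgn k (i * j) • (polyGen g L χ b * polyGen g L φ a) := by
  refine DGLA.poly_gr_induction (p := fun a => polyGen g L φ a * polyGen g L χ b =
      sgn k (i * j) • (polyGen g L χ b * polyGen g L φ a)) ha (by simp) (fun p x hx => ?_)
    (fun s t hs ht => by simp only [map_add, add_mul, mul_add, smul_add, hs, ht])
  refine DGLA.poly_gr_induction (p := fun b => polyGen g L φ (L.pmk p x) * polyGen g L χ b =
      sgn k (i * j) • (polyGen g L χ b * polyGen g L φ (L.pmk p x))) hb (by simp) (fun q y hy => ?_)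
    (fun s t hs ht => by simp only [map_add, add_mul, mul_add, smul_add, hs, ht])
  rw [polyGen_mk, polyGen_mk, Algebra.TensorProduct.tmul_mul_tmul,
    Algebra.TensorProduct.tmul_mul_tmul, repGen_comm φ χ hx hy, mul_comm p, TensorProduct.tmul_smul]

lemma polyGen_br (φ : Module.Dual k g) {i j : ℤ} {a b : L.poly.X} (ha : a ∈ L.poly.gr i)
    (hb : b ∈ L.poly.gr j) : polyGen g L φ (L.poly.br a b) =
      LinearMap.mul' k _ (TensorProduct.map ((polyGen g L).flip a) ((polyGen g L).flip b)
        (coLie φ)) := by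
  have key : ∀ (a b : L.poly.X) (t : Module.Dual k g ⊗[k] Module.Dual k g),
      LinearMap.mul' k _ (TensorProduct.map ((polyGen g L).flip a) ((polyGen g L).flip b) t) =
      TensorProduct.lift ((LinearMap.mul k (RepPoly g L)).compl₁₂ ((polyGen g L).flip a)
        ((polyGen g L).flip b)) t := by
    intro a b t
    induction t with
    | zero => simp
    | add s t hs ht => simp only [map_add, hs, ht]
    | tmul x y => rfl
  refine DGLA.poly_gr_induction (p := fun a => polyGen g L φ (L.poly.br a b) =
    LinearMap.mul' k _ (TensorProduct.map ((polyGen g L).flip a) ((polyGen g L).flip b)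
      (coLie φ))) ha (by simp) (fun p x hx => ?_)
    (fun s t hs ht => by
      simp only [map_add, LinearMap.add_apply, hs, ht, TensorProduct.map_add_left])
  refine DGLA.poly_gr_induction (p := fun b => polyGen g L φ (L.poly.br (L.pmk p x) b) =
    LinearMap.mul' k _ (TensorProduct.map ((polyGen g L).flip (L.pmk p x)) ((polyGen g L).flip b)
      (coLie φ))) hb (by simp) (fun q y hy => ?_)
    (fun s t hs ht => by
      simp only [map_add, LinearMap.add_apply, hs, ht, TensorProduct.map_add_right])
  rw [DGLA.poly_br_mk, polyGen_mk, repGen_br φ hx hy]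
  generalize coLie φ = t
  induction t with
  | zero => simp
  | add s t hs ht => simp only [map_add, TensorProduct.tmul_add, hs, ht]
  | tmul χ ψ =>
    simp only [TensorProduct.map_tmul, LinearMap.mul'_apply, LinearMap.flip_apply, polyGen_mk,
      Algebra.TensorProduct.tmul_mul_tmul]

variable (g L) in
/-- The map `φ ⊗ (a + dt b) ↦ (± a, b; 0, a)`. -/
def pathGen : Module.Dual k g →ₗ[k] L.path.X →ₗ[k] Matrix (Fin 2) (Fin 2) (RepPoly g L) :=
  LinearMap.mk₂ k (fun φ x => derMat (polyGen g L φ (tw L.poly.internal 1 x.1))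
      (polyGen g L φ x.2) (polyGen g L φ x.1))
    (fun φ χ x => by ext i j; fin_cases i <;> fin_cases j <;> simp [derMat])
    (fun r φ x => by ext i j; fin_cases i <;> fin_cases j <;> simp [derMat])
    (fun φ x y => by
      change derMat (polyGen g L φ (tw L.poly.internal 1 (x.1 + y.1))) (polyGen g L φ (x.2 + y.2))
        (polyGen g L φ (x.1 + y.1)) = _
      ext i j; fin_cases i <;> fin_cases j <;> simp [derMat])
    (fun r φ x => by
      change derMat (polyGen g L φ (tw L.poly.internal 1 (r • x.1))) (polyGen g L φ (r • x.2))
        (polyGen g L φ (r • x.1)) = _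
      ext i j; fin_cases i <;> fin_cases j <;> simp [derMat])

lemma pathGen_apply (φ : Module.Dual k g) (x : L.path.X) : pathGen g L φ x =
    derMat (polyGen g L φ (tw L.poly.internal 1 x.1)) (polyGen g L φ x.2) (polyGen g L φ x.1) := rfl

lemma derMat_mul {A : Type u} [Ring A] (a b c a' b' c' : A) :
    derMat a b c * derMat a' b' c' = derMat (a * a') (a * b' + b * c') (c * c') := by
  ext i j; fin_cases i <;> fin_cases j <;> simp [derMat, Matrix.mul_apply]

lemma smul_derMat {A : Type u} [Ring A] [Algebra k A] (r : k) (a b c : A) :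
    r • derMat a b c = derMat (r • a) (r • b) (r • c) := by
  ext i j; fin_cases i <;> fin_cases j <;> simp [derMat]

lemma derMat_add {A : Type u} [Ring A] (a b c a' b' c' : A) :
    derMat a b c + derMat a' b' c' = derMat (a + a') (b + b') (c + c') := by
  ext i j; fin_cases i <;> fin_cases j <;> simp [derMat]

variable (g L) in
/-- The homomorphism from the representation algebra of the path object to the algebra of
polynomial differential forms on the interval with values in the representation algebra. -/
def pathHom : RepAlg g L.path →ₐ[k] Matrix (Fin 2) (Fin 2) (RepPoly g L) :=
  repLift (pathGen g L)
    (fun φ χ i j x hx y hy => by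
      rw [pathGen_apply, pathGen_apply, derMat_mul, derMat_mul, smul_derMat,
        tw_one_of_mem _ hx.1, tw_one_of_mem _ hy.1]
      congr 1
      · simp only [map_smul, smul_mul_assoc, mul_smul_comm, smul_smul, polyGen_comm φ χ hx.1 hy.1]
        congr 1
        ring
      · simp only [map_smul, smul_mul_assoc, mul_smul_comm, polyGen_comm φ χ hx.1 hy.2,
          polyGen_comm φ χ hx.2 hy.1, mul_add_one, add_one_mul, sgn_add, smul_add, smul_smul]
        rw [add_comm]
        congr 2
        rw [mul_left_comm, sgn_sq, mul_one]
      · exact polyGen_comm φ χ hx.1 hy.1)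
    (fun φ i j x hx y hy => by
      have h0 : pathGen g L φ (L.path.br x y) = derMat
          (polyGen g L φ (tw L.poly.internal 1 (L.poly.br x.1 y.1)))
          (polyGen g L φ (L.poly.br x.2 y.1 + L.poly.br (tw L.poly.internal 1 x.1) y.2))
          (polyGen g L φ (L.poly.br x.1 y.1)) := rfl
      have hx1 := tw_mem L.poly.internal 1 hx.1
      have hy1 := tw_mem L.poly.internal 1 hy.1
      have h1 : tw L.poly.internal 1 (L.poly.br x.1 y.1) =
          L.poly.br (tw L.poly.internal 1 x.1) (tw L.poly.internal 1 y.1) := by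
        rw [tw_one_of_mem _ hx.1, tw_one_of_mem _ hy.1,
          tw_one_of_mem _ (L.poly.br_mem _ _ _ hx.1 _ hy.1), map_smul, map_smul,
          LinearMap.smul_apply, smul_smul, sgn_add, mul_comm]
      rw [h0, h1, map_add, polyGen_br φ hx1 hy1, polyGen_br φ hx.1 hy.1, polyGen_br φ hx.2 hy.1,
        polyGen_br φ hx1 hy.2]
      generalize coLie φ = t
      induction t with
      | zero =>
        ext i j
        fin_cases i <;> fin_cases j <;> simp [derMat]
      | add s t hs ht =>
        simp only [map_add] at hs ht ⊢
        rw [← hs, ← ht, derMat_add]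
        congr 1
        abel
      | tmul χ ψ =>
        simp only [TensorProduct.map_tmul, LinearMap.mul'_apply, LinearMap.flip_apply,
          pathGen_apply, derMat_mul]
        rw [add_comm])

lemma pathHom_repGen (φ : Module.Dual k g) (x : L.path.X) :
    pathHom g L (repGen g L.path φ x) = pathGen g L φ x := repLift_repGen _ _ _ _ _

variable (g L) in
/-- Extension of scalars of a linear map. -/
abbrev polyMap (f : RepAlg g L →ₗ[k] RepAlg g L) : RepPoly g L →ₗ[k] RepPoly g L :=
  f.lTensor (Polynomial k)

lemma polyMap_isDer (e : ℤ) {f : RepAlg g L →ₗ[k] RepAlg g L} (hf : IsDer (rep_internal g L) e f)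
    (s t : RepPoly g L) : polyMap g L f (s * t) = polyMap g L f s * t +
      polyMap g L (tw (rep_internal g L) e) s * polyMap g L f t := by
  induction s using TensorProduct.induction_on with
  | zero => simp
  | add s s' hs hs' => simp only [map_add, add_mul, hs, hs']; abel
  | tmul p a =>
    induction t using TensorProduct.induction_on with
    | zero => simp
    | add t t' ht ht' => simp only [map_add, mul_add, ht, ht']; abel
    | tmul q b =>
      simp only [Algebra.TensorProduct.tmul_mul_tmul, LinearMap.lTensor_tmul]
      rw [hf, TensorProduct.tmul_add]

lemma polyMap_tw_mul (e : ℤ) (s t : RepPoly g L) : polyMap g L (tw (rep_internal g L) e) (s * t) =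
    polyMap g L (tw (rep_internal g L) e) s * polyMap g L (tw (rep_internal g L) e) t := by
  induction s using TensorProduct.induction_on with
  | zero => simp
  | add s s' hs hs' => simp only [map_add, add_mul, hs, hs']
  | tmul p a =>
    induction t using TensorProduct.induction_on with
    | zero => simp
    | add t t' ht ht' => simp only [map_add, mul_add, ht, ht']
    | tmul q b =>
      simp only [Algebra.TensorProduct.tmul_mul_tmul, LinearMap.lTensor_tmul]
      rw [show tw (rep_internal g L) e (a * b) = _ from
        tw_mul (rep_internal g L) (fun _ _ _ hx _ hy => monoGr_mul hx hy) e a b]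

variable (g L) in
/-- The derivative with respect to the polynomial variable. -/
abbrev polyDer : RepPoly g L →ₗ[k] RepPoly g L :=
  (Polynomial.derivative (R := k)).rTensor (RepAlg g L)

lemma polyDer_mul (s t : RepPoly g L) :
    polyDer g L (s * t) = polyDer g L s * t + s * polyDer g L t := by
  induction s using TensorProduct.induction_on with
  | zero => simp
  | add s s' hs hs' => simp only [map_add, add_mul, hs, hs']; abel
  | tmul p a =>
    induction t using TensorProduct.induction_on with
    | zero => simp
    | add t t' ht ht' => simp only [map_add, mul_add, ht, ht']; abel
    | tmul q b =>
      simp only [Algebra.TensorProduct.tmul_mul_tmul, LinearMap.rTensor_tmul,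
        Polynomial.derivative_mul, TensorProduct.add_tmul]

lemma polyMap_polyGen_d (φ : Module.Dual k g) (a : L.poly.X) :
    polyMap g L (repD g L) (polyGen g L φ a) = polyGen g L φ (L.poly.d a) := by
  induction a using DGLA.poly_induction with
  | zero => simp
  | add a b ha hb => simp only [map_add, ha, hb]
  | mk p x => rw [polyGen_mk, LinearMap.lTensor_tmul, repD_repGen, DGLA.poly_d_mk, polyGen_mk]

lemma polyMap_polyGen_act (y : g) (φ : Module.Dual k g) (a : L.poly.X) :
    polyMap g L (repAct L y) (polyGen g L φ a) = polyGen g L (coad y φ) a := by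
  induction a using DGLA.poly_induction with
  | zero => simp
  | add a b ha hb => simp only [map_add, ha, hb]
  | mk p x => rw [polyGen_mk, LinearMap.lTensor_tmul, repAct_repGen, polyGen_mk]

lemma polyDer_polyGen (φ : Module.Dual k g) (a : L.poly.X) :
    polyDer g L (polyGen g L φ a) = polyGen g L φ (L.pder a) := by
  induction a using DGLA.poly_induction with
  | zero => simp
  | add a b ha hb => simp only [map_add, ha, hb]
  | mk p x => rw [polyGen_mk, LinearMap.rTensor_tmul, DGLA.pder_mk, polyGen_mk]

lemma polyMap_polyGen_tw (φ : Module.Dual k g) {n : ℤ} {a : L.poly.X} (ha : a ∈ L.poly.gr n) :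
    polyMap g L (tw (rep_internal g L) 1) (polyGen g L φ a) = sgn k n • polyGen g L φ a := by
  refine DGLA.poly_gr_induction (p := fun a => polyMap g L (tw (rep_internal g L) 1)
    (polyGen g L φ a) = sgn k n • polyGen g L φ a) ha (by simp) (fun p x hx => ?_)
    (fun s t hs ht => by simp only [map_add, smul_add, hs, ht])
  rw [polyGen_mk, LinearMap.lTensor_tmul]
  rw [show tw (rep_internal g L) 1 (repGen g L φ x) = sgn k n • repGen g L φ x from
    tw_one_of_mem _ (repGen_mem φ hx), TensorProduct.tmul_smul]

lemma polyMap_tw_polyGen (φ : Module.Dual k g) (a : L.poly.X) :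
    polyMap g L (tw (rep_internal g L) 1) (polyGen g L φ a) =
      polyGen g L φ (tw L.poly.internal 1 a) :=
  hom_induction L.poly.internal (p := fun a => polyMap g L (tw (rep_internal g L) 1)
    (polyGen g L φ a) = polyGen g L φ (tw L.poly.internal 1 a)) a
    (fun n a ha => by rw [polyMap_polyGen_tw φ ha, tw_one_of_mem _ ha, map_smul])
    (fun a b ha hb => by simp only [map_add, ha, hb])

lemma polyMap_tw_one : polyMap g L (tw (rep_internal g L) 1) 1 = 1 := by
  rw [Algebra.TensorProduct.one_def, LinearMap.lTensor_tmul, tw_of_mem _ 1 monoGr_one, mul_zero,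
    sgn_zero, one_smul]

lemma polyMap_one {e : ℤ} {D : RepAlg g L →ₗ[k] RepAlg g L} (hD : IsDer (rep_internal g L) e D) :
    polyMap g L D 1 = 0 := by
  rw [Algebra.TensorProduct.one_def, LinearMap.lTensor_tmul, hD.map_one monoGr_one,
    TensorProduct.tmul_zero]

lemma polyDer_one : polyDer g L 1 = 0 := by
  rw [Algebra.TensorProduct.one_def, LinearMap.rTensor_tmul, Polynomial.derivative_one,
    TensorProduct.zero_tmul]

lemma polyMap_tw_tw (s : RepPoly g L) : polyMap g L (tw (rep_internal g L) 1)
    (polyMap g L (tw (rep_internal g L) 1) s) = s := by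
  induction s using TensorProduct.induction_on with
  | zero => simp
  | add s s' hs hs' => simp only [map_add, hs, hs']
  | tmul p a => rw [LinearMap.lTensor_tmul, LinearMap.lTensor_tmul, tw_tw]

lemma repD_mem (n : ℤ) (x : RepAlg g L) (hx : x ∈ repGrad g L n) : repD g L x ∈ repGrad g L (n - 1) :=
  (rep g L).d_mem n x hx

lemma polyMap_tw_d (s : RepPoly g L) : polyMap g L (tw (rep_internal g L) 1)
    (polyMap g L (repD g L) s) =
      -polyMap g L (repD g L) (polyMap g L (tw (rep_internal g L) 1) s) := by
  induction s using TensorProduct.induction_on with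
  | zero => simp
  | add s s' hs hs' => simp only [map_add, hs, hs', neg_add]
  | tmul p a =>
    simp only [LinearMap.lTensor_tmul]
    rw [tw_d (rep_internal g L) (repD g L) repD_mem, TensorProduct.tmul_neg]

lemma polyMap_tw_act (y : g) (s : RepPoly g L) : polyMap g L (tw (rep_internal g L) 1)
    (polyMap g L (repAct L y) s) =
      polyMap g L (repAct L y) (polyMap g L (tw (rep_internal g L) 1) s) := by
  induction s using TensorProduct.induction_on with
  | zero => simp
  | add s s' hs hs' => simp only [map_add, hs, hs']
  | tmul p a =>
    simp only [LinearMap.lTensor_tmul]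
    rw [tw_map_zero (rep_internal g L) (rep_internal g L) (repAct L y) (repAct_mem L y)]

lemma tw_repGen (e : ℤ) (φ : Module.Dual k g) (ξ : L.X) :
    tw (rep_internal g L) e (repGen g L φ ξ) = repGen g L φ (tw L.internal e ξ) :=
  hom_induction L.internal (p := fun ξ => tw (rep_internal g L) e (repGen g L φ ξ) =
    repGen g L φ (tw L.internal e ξ)) ξ
    (fun n a ha => by rw [tw_of_mem _ e (repGen_mem φ ha), tw_of_mem _ e ha, map_smul])
    (fun a b ha hb => by simp only [map_add, ha, hb])

lemma DGLA.tw_path (x : L.path.X) : tw L.path.internal 1 x =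
    ((tw L.poly.internal 1 x.1, -tw L.poly.internal 1 x.2) : L.poly.X × L.poly.X) := by
  refine hom_induction L.path.internal (p := fun x : L.path.X => tw L.path.internal 1 x =
    ((tw L.poly.internal 1 x.1, -tw L.poly.internal 1 x.2) : L.poly.X × L.poly.X)) x
    (fun n a ha => ?_) (fun a b ha hb => ?_)
  · rw [tw_one_of_mem _ ha, tw_one_of_mem _ ha.1, tw_one_of_mem _ ha.2, sgn_add, sgn_one, mul_neg,
      mul_one, neg_smul, neg_neg]
    rfl
  · refine (map_add _ a b).trans ?_
    rw [ha, hb]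
    change ((_ + _, -_ + -_) : L.poly.X × L.poly.X) =
      ((tw L.poly.internal 1 (a.1 + b.1), -tw L.poly.internal 1 (a.2 + b.2)) : L.poly.X × L.poly.X)
    rw [map_add, map_add, neg_add]

lemma pathHom_entries (z : RepAlg g L.path) : pathHom g L z 1 0 = 0 ∧
    pathHom g L z 0 0 = polyMap g L (tw (rep_internal g L) 1) (pathHom g L z 1 1) := by
  refine repAlg_induction (p := fun z => pathHom g L z 1 0 = 0 ∧ pathHom g L z 0 0 =
    polyMap g L (tw (rep_internal g L) 1) (pathHom g L z 1 1)) z (fun φ x => ?_) ?_ (fun r => ?_)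
    (fun a b ha hb => ?_) (fun a b ha hb => ?_)
  · rw [pathHom_repGen]
    exact ⟨rfl, (polyMap_tw_polyGen φ x.1).symm⟩
  · simp
  · rw [Algebra.algebraMap_eq_smul_one, map_smul, map_one]
    simp [polyMap_tw_one]
  · simp [map_add, ha, hb]
  · simp [map_mul, Matrix.mul_apply, Fin.sum_univ_two, ha, hb, polyMap_tw_mul]

lemma pathHom_mul_zero_one (z w : RepAlg g L.path) : pathHom g L (z * w) 0 1 =
    polyMap g L (tw (rep_internal g L) 1) (pathHom g L z 1 1) * pathHom g L w 0 1 +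
      pathHom g L z 0 1 * pathHom g L w 1 1 := by
  rw [map_mul, Matrix.mul_apply, Fin.sum_univ_two, (pathHom_entries z).2]

lemma pathHom_mul_one_one (z w : RepAlg g L.path) : pathHom g L (z * w) 1 1 =
    pathHom g L z 1 1 * pathHom g L w 1 1 := by
  rw [map_mul, Matrix.mul_apply, Fin.sum_univ_two, (pathHom_entries z).1, zero_mul, zero_add]

lemma pathHom_scalar (r : k) : pathHom g L (algebraMap k _ r) 0 1 = 0 ∧
    pathHom g L (algebraMap k _ r) 1 1 = r • 1 := by
  rw [Algebra.algebraMap_eq_smul_one, map_smul, map_one]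
  simp

lemma pathHom_tw (z : RepAlg g L.path) :
    pathHom g L (tw (rep_internal g L.path) 1 z) 1 1 =
      polyMap g L (tw (rep_internal g L) 1) (pathHom g L z 1 1) ∧
    pathHom g L (tw (rep_internal g L.path) 1 z) 0 1 =
      -polyMap g L (tw (rep_internal g L) 1) (pathHom g L z 0 1) := by
  refine repAlg_induction (p := fun z => pathHom g L (tw (rep_internal g L.path) 1 z) 1 1 =
      polyMap g L (tw (rep_internal g L) 1) (pathHom g L z 1 1) ∧
    pathHom g L (tw (rep_internal g L.path) 1 z) 0 1 =
      -polyMap g L (tw (rep_internal g L) 1) (pathHom g L z 0 1)) z (fun φ x => ?_) ?_ (fun r => ?_)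
    (fun a b ha hb => ?_) (fun a b ha hb => ?_)
  · rw [tw_repGen, pathHom_repGen, pathHom_repGen, DGLA.tw_path]
    exact ⟨(polyMap_tw_polyGen φ x.1).symm, (map_neg (polyGen g L φ) _).trans
      (congrArg Neg.neg (polyMap_tw_polyGen φ x.2).symm)⟩
  · simp
  · rw [Algebra.algebraMap_eq_smul_one, map_smul, tw_of_mem _ 1 monoGr_one, mul_zero, sgn_zero,
      one_smul, map_smul, map_one]
    simp [polyMap_tw_one]
  · simp only [map_add, Matrix.add_apply, ha, hb, true_and]
    exact (neg_add _ _).symm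
  · rw [tw_mul (rep_internal g L.path) (fun _ _ _ hx _ hy => monoGr_mul hx hy) 1 a b]
    simp only [pathHom_mul_one_one, pathHom_mul_zero_one, ha, hb, polyMap_tw_mul, map_add]
    have key : ∀ {R : Type u} [Ring R] (p q r s : R), p * -q + -r * s = -(p * q + r * s) := by
      intro R _ p q r s
      simp only [mul_neg, neg_mul, neg_add]
    exact ⟨trivial, key _ _ _ _⟩

lemma pathHom_d (z : RepAlg g L.path) :
    pathHom g L (repD g L.path z) 1 1 = polyMap g L (repD g L) (pathHom g L z 1 1) ∧
    pathHom g L (repD g L.path z) 0 1 =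
      polyDer g L (pathHom g L z 1 1) - polyMap g L (repD g L) (pathHom g L z 0 1) := by
  refine repAlg_induction (p := fun z =>
    pathHom g L (repD g L.path z) 1 1 = polyMap g L (repD g L) (pathHom g L z 1 1) ∧
    pathHom g L (repD g L.path z) 0 1 = polyDer g L (pathHom g L z 1 1) -
      polyMap g L (repD g L) (pathHom g L z 0 1)) z (fun φ x => ?_) ?_ (fun r => ?_)
    (fun a b ha hb => ?_) (fun a b ha hb => ?_)
  · rw [repD_repGen, pathHom_repGen, pathHom_repGen, DGLA.path_d]
    refine ⟨(polyMap_polyGen_d φ x.1).symm, (map_sub (polyGen g L φ) _ _).trans ?_⟩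
    rw [← polyDer_polyGen, ← polyMap_polyGen_d]
    rfl
  · simp
  · rw [repD_isDer.map_algebraMap monoGr_one, (pathHom_scalar r).1, (pathHom_scalar r).2, map_smul,
      map_smul, polyMap_one repD_isDer, polyDer_one]
    simp
  · simp only [map_add, Matrix.add_apply, ha, hb, true_and]
    abel
  · rw [repD_isDer a b, map_add, Matrix.add_apply, Matrix.add_apply]
    simp only [pathHom_mul_one_one, pathHom_mul_zero_one, ha, hb, (pathHom_tw a).1, (pathHom_tw a).2,
      map_add, polyMap_isDer 1 repD_isDer, polyMap_tw_tw, polyMap_tw_d, polyDer_mul, true_and]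
    have key : ∀ {R : Type u} [Ring R] (p b q r b' a s t u v : R), -p * b + (q - r) * b' +
        (a * (s - t) + -u * v) = q * b' + a * s - (p * b + a * t + (r * b' + u * v)) := by
      intros
      simp only [mul_sub, sub_mul, neg_mul]
      abel
    exact key _ _ _ _ _ _ _ _ _ _

lemma pathHom_act (y : g) (z : RepAlg g L.path) :
    pathHom g L (repAct L.path y z) 1 1 = polyMap g L (repAct L y) (pathHom g L z 1 1) ∧
    pathHom g L (repAct L.path y z) 0 1 = polyMap g L (repAct L y) (pathHom g L z 0 1) := by
  have ht : ∀ s : RepPoly g L, polyMap g L (tw (rep_internal g L) 0) s = s := fun s => by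
    rw [polyMap, tw_zero, LinearMap.lTensor_id]; rfl
  refine repAlg_induction (p := fun z =>
    pathHom g L (repAct L.path y z) 1 1 = polyMap g L (repAct L y) (pathHom g L z 1 1) ∧
    pathHom g L (repAct L.path y z) 0 1 = polyMap g L (repAct L y) (pathHom g L z 0 1)) z
    (fun φ x => ?_) ?_ (fun r => ?_) (fun a b ha hb => ?_) (fun a b ha hb => ?_)
  · rw [repAct_repGen, pathHom_repGen, pathHom_repGen]
    exact ⟨(polyMap_polyGen_act y φ x.1).symm, (polyMap_polyGen_act y φ x.2).symm⟩
  · simp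
  · rw [(repAct_isDer y).map_algebraMap monoGr_one, (pathHom_scalar r).1, (pathHom_scalar r).2,
      map_smul, polyMap_one (repAct_isDer y)]
    simp
  · simp only [map_add, Matrix.add_apply, ha, hb, and_self]
  · rw [repAct_isDer y a b, map_add, Matrix.add_apply, Matrix.add_apply, tw_zero, LinearMap.id_apply]
    simp only [pathHom_mul_one_one, pathHom_mul_zero_one, ha, hb,
      map_add, polyMap_isDer 0 (repAct_isDer y), ht, polyMap_tw_act, true_and]
    abel

variable (g L) in
/-- The map `p ⊗ a ↦ I p • a`. -/
def polyContr (I : Polynomial k →ₗ[k] k) : RepPoly g L →ₗ[k] RepAlg g L :=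
  TensorProduct.lift (LinearMap.lsmul k (RepAlg g L) ∘ₗ I)

lemma polyContr_tmul (I : Polynomial k →ₗ[k] k) (p : Polynomial k) (a : RepAlg g L) :
    polyContr g L I (p ⊗ₜ a) = I p • a := rfl

lemma polyContr_map (I : Polynomial k →ₗ[k] k) (D : RepAlg g L →ₗ[k] RepAlg g L) (s : RepPoly g L) :
    polyContr g L I (polyMap g L D s) = D (polyContr g L I s) := by
  induction s using TensorProduct.induction_on with
  | zero => simp
  | add s s' hs hs' => simp only [map_add, hs, hs']
  | tmul p a => rw [LinearMap.lTensor_tmul, polyContr_tmul, polyContr_tmul, map_smul]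

lemma polyContr_polyGen (c : k) (φ : Module.Dual k g) (a : L.poly.X) :
    polyContr g L (Polynomial.leval c) (polyGen g L φ a) = repGen g L φ (L.pev c a) := by
  induction a using DGLA.poly_induction with
  | zero => simp
  | add a b ha hb => simp only [map_add, ha, hb]
  | mk p x => rw [polyGen_mk, polyContr_tmul, DGLA.pev_mk, map_smul]; rfl

lemma polyContr_mul (c : k) (s t : RepPoly g L) : polyContr g L (Polynomial.leval c) (s * t) =
    polyContr g L (Polynomial.leval c) s * polyContr g L (Polynomial.leval c) t := by
  induction s using TensorProduct.induction_on with
  | zero => simp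
  | add s s' hs hs' => simp only [map_add, add_mul, hs, hs']
  | tmul p a =>
    induction t using TensorProduct.induction_on with
    | zero => simp
    | add t t' ht ht' => simp only [map_add, mul_add, ht, ht']
    | tmul q b =>
      rw [Algebra.TensorProduct.tmul_mul_tmul, polyContr_tmul, polyContr_tmul, polyContr_tmul,
        smul_mul_smul_comm, Polynomial.leval_apply, Polynomial.leval_apply, Polynomial.leval_apply,
        Polynomial.eval_mul]

lemma polyContr_pathHom (c : k) (z : RepAlg g L.path) :
    polyContr g L (Polynomial.leval c) (pathHom g L z 1 1) = repMapAlg g (L.ev c) z := by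
  refine repAlg_induction (p := fun z => polyContr g L (Polynomial.leval c) (pathHom g L z 1 1) =
    repMapAlg g (L.ev c) z) z (fun φ x => ?_) ?_ (fun r => ?_)
    (fun a b ha hb => ?_) (fun a b ha hb => ?_)
  · rw [pathHom_repGen, repMapAlg_repGen, DGLA.ev_apply]
    exact polyContr_polyGen c φ x.1
  · simp
  · rw [(pathHom_scalar r).2, map_smul, Algebra.TensorProduct.one_def, polyContr_tmul,
      Polynomial.leval_apply, Polynomial.eval_one, one_smul, AlgHom.commutes,
      Algebra.algebraMap_eq_smul_one]
  · simp only [map_add, Matrix.add_apply, ha, hb]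
  · rw [pathHom_mul_one_one, polyContr_mul, ha, hb, map_mul]

variable (g L) in
/-- The two evaluations of the representation algebra of the path object are homotopic, by a
homotopy which is compatible with the action of `g`. -/
lemma exists_repHomotopy : ∃ H : RepAlg g L.path →ₗ[k] RepAlg g L,
    (∀ z, H (repD g L.path z) = repMapAlg g (L.ev 1) z - repMapAlg g (L.ev 0) z -
      repD g L (H z)) ∧ ∀ y z, H (repAct L.path y z) = repAct L y (H z) := by
  obtain ⟨J, -, h2, h3⟩ := exists_antiderivative (0 : k)
  let E : Matrix (Fin 2) (Fin 2) (RepPoly g L) →ₗ[k] RepPoly g L :=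
    { toFun := fun M => M 0 1, map_add' := fun _ _ => rfl, map_smul' := fun _ _ => rfl }
  let I : Polynomial k →ₗ[k] k := Polynomial.leval 1 ∘ₗ J
  have hI : ∀ s : RepPoly g L, polyContr g L I (polyDer g L s) =
      polyContr g L (Polynomial.leval 1) s - polyContr g L (Polynomial.leval 0) s := by
    intro s
    induction s using TensorProduct.induction_on with
    | zero => simp
    | add s s' hs hs' => simp only [map_add, hs, hs']; abel
    | tmul p a =>
      rw [LinearMap.rTensor_tmul, polyContr_tmul, polyContr_tmul, polyContr_tmul, ← sub_smul]
      congr 1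
      change (J p.derivative).eval 1 = p.eval 1 - p.eval 0
      rw [h3, Polynomial.eval_sub, Polynomial.eval_C]
  refine ⟨polyContr g L I ∘ₗ E ∘ₗ (pathHom g L).toLinearMap, fun z => ?_, fun y z => ?_⟩
  · change polyContr g L I (pathHom g L (repD g L.path z) 0 1) =
      _ - repD g L (polyContr g L I (pathHom g L z 0 1))
    rw [(pathHom_d z).2, map_sub, hI, polyContr_pathHom, polyContr_pathHom, polyContr_map]
  · change polyContr g L I (pathHom g L (repAct L.path y z) 0 1) =
      repAct L y (polyContr g L I (pathHom g L z 0 1))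
    rw [(pathHom_act y z).2, polyContr_map]

variable (g) in
lemma exists_repHomotopy_of_path {F G : L ⟶ L} (K : L ⟶ L.path) (h0 : K ≫ L.ev 0 = F)
    (h1 : K ≫ L.ev 1 = 𝟙 L) : ∃ H : RepAlg g L →ₗ[k] RepAlg g L,
    (∀ z, repMapAlg g F z - z = repD g L (H z) + H (repD g L z)) ∧
      ∀ y z, H (repAct L y z) = repAct L y (H z) := by
  obtain ⟨H, h, h'⟩ := exists_repHomotopy g L
  refine ⟨-(H ∘ₗ (repMapAlg g K).toLinearMap), fun z => ?_, fun y z => ?_⟩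
  · have e := h (repMapAlg g K z)
    rw [← repMapAlg_d, ← repMapAlg_comp, ← repMapAlg_comp, h0, h1, repMapAlg_id] at e
    change _ = repD g L (-H (repMapAlg g K z)) + -H (repMapAlg g K (repD g L z))
    rw [e, map_neg]
    abel
  · change -H (repMapAlg g K (repAct L y z)) = repAct L y (-H (repMapAlg g K z))
    rw [repMapAlg_act, h', map_neg]

variable {Q Q' A : DGLA k}

variable (g) in
/-- Representation algebras of cofibrant resolutions are quasi-isomorphic. -/
theorem exists_rep_qiso (hQ : Q.Cofibrant) (hQ' : Q'.Cofibrant) {q : Q ⟶ A} {p : Q' ⟶ A}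
    (hq : DGLA.QIso q) (hp : DGLA.QIso p) : ∃ f : Q ⟶ Q',
    IsQIso (rep g Q).d (rep g Q').d (ADGCA.lin (repMap g f)) ∧
      IsQIso (repInv g Q).d (repInv g Q').d (ADGCA.lin (repInvMap g f)) := by
  obtain ⟨f, h, K, K', h0, h1, h0', h1'⟩ := DGLA.exists_homotopyEquiv hQ hQ' hq hp
  obtain ⟨H, e, a⟩ := exists_repHomotopy_of_path g (G := 𝟙 Q) K h0 h1
  obtain ⟨H', e', a'⟩ := exists_repHomotopy_of_path g (G := 𝟙 Q') K' h0' h1'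
  simp only [repMapAlg_comp] at e e'
  refine ⟨f, IsQIso.of_homotopy (f' := ADGCA.lin (repMap g h)) (fun y => repMapAlg_d h y) H H' e e',
    ?_⟩
  let S : Submodule k (RepAlg g Q) := { carrier := {x | ∀ y, repAct Q y x = 0}
                                        add_mem' := fun hx hx' y => by rw [map_add, hx, hx', add_zero]
                                        zero_mem' := fun y => map_zero _
                                        smul_mem' := fun r x hx y => by rw [map_smul, hx, smul_zero] }
  let S' : Submodule k (RepAlg g Q') := { carrier := {x | ∀ y, repAct Q' y x = 0}
                                          add_mem' := fun hx hx' y => by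
                                            rw [map_add, hx, hx', add_zero]
                                          zero_mem' := fun y => map_zero _
                                          smul_mem' := fun r x hx y => by
                                            rw [map_smul, hx, smul_zero] }
  exact IsQIso.of_homotopy (f' := ADGCA.lin (repInvMap g h))
    (fun y => Subtype.ext (repMapAlg_d h y.1))
    (H.restrict (p := S) (q := S) fun x hx y => by rw [← a, hx, map_zero])
    (H'.restrict (p := S') (q := S') fun x hx y => by rw [← a', hx, map_zero])
    (fun x => Subtype.ext (e x.1)) (fun x => Subtype.ext (e' x.1))

end RepHomotopy

/-! ### The representation algebra of a cobar construction -/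

section RepOmega

variable {k : Type u} [Field k]
variable {g : Type u} [LieRing g] [LieAlgebra k g] [Module.Finite k g]

section Contraction

variable (B : NDGCA k)

variable (g) in
/-- The contraction `φ, x ⊗ b ↦ φ x • b`. -/
def gCtr : Module.Dual k g →ₗ[k] TGen k g B.X →ₗ[k] B.X where
  toFun φ := TGen.lift (LinearMap.lsmul k B.X ∘ₗ φ)
  map_add' φ χ := TGen.ext fun x b => by
    simp only [TGen.lift_mk, LinearMap.add_apply, LinearMap.comp_apply, map_add]
  map_smul' r φ := TGen.ext fun x b => by
    simp only [TGen.lift_mk, LinearMap.smul_apply, LinearMap.comp_apply, map_smul,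
      RingHom.id_apply]

variable {B}

lemma gCtr_mk (φ : Module.Dual k g) (x : g) (b : B.X) :
    gCtr g B φ (TGen.mk k g B.X x b) = φ x • b := TGen.lift_mk _ _ _

/-- The product of two contractions. -/
def gCtr₂ (u : Module.Dual k g ⊗[k] Module.Dual k g) (s t : TGen k g B.X) : B.X :=
  TensorProduct.lift (B.mul.compl₁₂ ((gCtr g B).flip s) ((gCtr g B).flip t)) u

lemma gCtr₂_tmul (χ ψ : Module.Dual k g) (s t : TGen k g B.X) :
    gCtr₂ (χ ⊗ₜ ψ) s t = B.mul (gCtr g B χ s) (gCtr g B ψ t) := rfl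

lemma gCtr₂_add (u v : Module.Dual k g ⊗[k] Module.Dual k g) (s t : TGen k g B.X) :
    gCtr₂ (u + v) s t = gCtr₂ u s t + gCtr₂ v s t := map_add _ _ _

lemma gCtr₂_zero (s t : TGen k g B.X) : gCtr₂ 0 s t = 0 := map_zero _

lemma gCtr_br (φ : Module.Dual k g) (s t : TGen k g B.X) :
    gCtr g B φ (gLieBr g B s t) = gCtr₂ (coLie φ) s t := by
  have h1 : ∀ u (s s' t : TGen k g B.X), gCtr₂ u (s + s') t = gCtr₂ u s t + gCtr₂ u s' t := by
    intro u s s' t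
    induction u with
    | zero => simp only [gCtr₂_zero, add_zero]
    | add u v hu hv => simp only [gCtr₂_add, hu, hv]; abel
    | tmul χ ψ => simp only [gCtr₂_tmul, map_add, LinearMap.add_apply]
  have h2 : ∀ u (s t t' : TGen k g B.X), gCtr₂ u s (t + t') = gCtr₂ u s t + gCtr₂ u s t' := by
    intro u s t t'
    induction u with
    | zero => simp only [gCtr₂_zero, add_zero]
    | add u v hu hv => simp only [gCtr₂_add, hu, hv]; abel
    | tmul χ ψ => simp only [gCtr₂_tmul, map_add, LinearMap.add_apply]
  induction s using TGen.induction with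
  | zero =>
    have := h1 (coLie φ) 0 0 t
    rw [add_zero] at this
    rw [left_eq_add.1 this, map_zero, LinearMap.zero_apply, map_zero]
  | add s s' hs hs' => rw [map_add, LinearMap.add_apply, map_add, hs, hs', h1]
  | mk x a =>
    induction t using TGen.induction with
    | zero =>
      have := h2 (coLie φ) (TGen.mk k g B.X x a) 0 0
      rw [add_zero] at this
      rw [left_eq_add.1 this, map_zero, map_zero]
    | add t t' ht ht' => rw [map_add, map_add, ht, ht', h2]
    | mk y b =>
      rw [gLieBr_mk, gCtr_mk, ← coLie_spec]
      generalize coLie φ = u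
      induction u with
      | zero => simp [gCtr₂_zero]
      | add u v hu hv => simp only [map_add, LinearMap.add_apply, add_smul, hu, hv, gCtr₂_add]
      | tmul χ ψ =>
        rw [TensorProduct.dualDistrib_apply, gCtr₂_tmul, gCtr_mk, gCtr_mk, map_smul, map_smul,
          LinearMap.smul_apply, smul_smul, mul_comm]

end Contraction

variable [CharZero k] (D : NDGCC k)

variable (g) in
/-- The inclusion of the generators of the Chevalley-Eilenberg algebra of `g^*(D)`. -/
def starS : TGen k (Module.Dual k g) D.X →ₗ[k] (gStar g D).S := (gStar g D).s

variable (g) in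
/-- The quadratic part of the differential. -/
def starQuad : TGen k (Module.Dual k g) D.X ⊗[k] TGen k (Module.Dual k g) D.X →ₗ[k] (gStar g D).S :=
  (gStar g D).quad

lemma starQuad_tmul (x y : TGen k (Module.Dual k g) D.X) : starQuad g D (x ⊗ₜ y) =
    starS g D (tw (TGen.internal D.internal _) 1 x) * starS g D y := rfl

variable (g) in
/-- The generators of the Chevalley-Eilenberg algebra of `g^*(D)`. -/
def starGen (φ : Module.Dual k g) : D.X →ₗ[k] (gStar g D).S :=
  starS g D ∘ₗ (TGen.mk k (Module.Dual k g) D.X φ)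

lemma starS_mk (φ : Module.Dual k g) (c : D.X) :
    starS g D (TGen.mk k _ _ φ c) = starGen g D φ c := rfl

lemma starGen_mem (φ : Module.Dual k g) {n : ℤ} {c : D.X} (hc : c ∈ D.gr (n + 1)) :
    starGen g D φ c ∈ GSym.gr (gStar g D).sgr n :=
  monoGr_ι (gV := (gStar g D).sgr) (TGen.mk_mem φ hc)

variable (g) in
/-- The universal twisting cochain. -/
def univTwist : D.X →ₗ[k] TGen k g (gStar g D).S :=
  ∑ i, (TGen.mk k g (gStar g D).S (Module.finBasis k g i)) ∘ₗ
    starGen g D ((Module.finBasis k g).coord i)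

lemma univTwist_apply (c : D.X) : univTwist g D c = ∑ i, TGen.mk k g (gStar g D).S
    (Module.finBasis k g i) (starGen g D ((Module.finBasis k g).coord i) c) :=
  LinearMap.sum_apply _ _ _

lemma univTwist_mem (n : ℤ) (c : D.X) (hc : c ∈ D.gr (n + 1)) :
    univTwist g D c ∈ TGen.gr g (GSym.gr (gStar g D).sgr) n := by
  rw [univTwist_apply]
  exact Submodule.sum_mem _ fun i _ => TGen.mk_mem _ (starGen_mem D _ hc)

lemma starGen_sum (φ : Module.Dual k g) (c : D.X) : ∑ i, φ (Module.finBasis k g i) •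
    starGen g D ((Module.finBasis k g).coord i) c = starGen g D φ c := by
  have h : φ = ∑ i, φ (Module.finBasis k g i) • (Module.finBasis k g).coord i :=
    (Module.finBasis k g).ext fun i => by
      rw [LinearMap.sum_apply, Finset.sum_eq_single i]
      · simp
      · intro j _ hj
        simp [Finsupp.single_apply, hj.symm]
      · simp
  let E : Module.Dual k g →ₗ[k] (gStar g D).S :=
    starS g D ∘ₗ (TGen.mk k (Module.Dual k g) D.X).flip c
  have h' : ∀ φ, starGen g D φ c = E φ := fun _ => rfl
  simp only [h']
  conv_rhs => rw [h, map_sum]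
  exact Finset.sum_congr rfl fun i _ => by rw [map_smul]

variable (g) in
/-- The contraction of the elements of `g ⊗ Sym` with functionals on `g`. -/
def starCtr : Module.Dual k g →ₗ[k] TGen k g (gStar g D).S →ₗ[k] (gStar g D).S :=
  gCtr g (gStar g D).cec.toN

lemma starCtr_univTwist (φ : Module.Dual k g) (c : D.X) :
    starCtr g D φ (univTwist g D c) = starGen g D φ c := by
  rw [univTwist_apply, map_sum, ← starGen_sum]
  exact Finset.sum_congr rfl fun i _ => gCtr_mk _ _ _

variable (g) in
/-- The universal homomorphism of graded Lie algebras. -/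
def univHom : D.omegaComm.X →ₗ[k] TGen k g (gStar g D).S :=
  NDGCC.omegaLift (E := gLie g (gStar g D).cec.toN) (univTwist g D)

lemma univHom_ωι (c : D.X) : univHom g D (D.ωι c) = univTwist g D c :=
  NDGCC.omegaLift_ωι (E := gLie g (gStar g D).cec.toN) (univTwist g D) c

lemma univHom_mem {n : ℤ} {x : D.omegaComm.X} (hx : x ∈ D.omegaComm.gr n) :
    univHom g D x ∈ TGen.gr g (GSym.gr (gStar g D).sgr) n :=
  NDGCC.omegaLift_mem (E := gLie g (gStar g D).cec.toN) (univTwist_mem D) n x hx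

lemma univHom_br (x y : D.omegaComm.X) : univHom g D (D.omegaComm.br x y) =
    gLieBr g (gStar g D).cec.toN (univHom g D x) (univHom g D y) :=
  NDGCC.omegaLift_br (E := gLie g (gStar g D).cec.toN) (univTwist_mem D) x y

lemma starCtr_mem (φ : Module.Dual k g) {n : ℤ} {t : TGen k g (gStar g D).S}
    (ht : t ∈ TGen.gr g (GSym.gr (gStar g D).sgr) n) :
    starCtr g D φ t ∈ GSym.gr (gStar g D).sgr n :=
  TGen.gr_induction (p := fun t => starCtr g D φ t ∈ GSym.gr (gStar g D).sgr n) ht (by simp)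
    (fun x b hb => by
      have e : starCtr g D φ (TGen.mk k g _ x b) = φ x • b :=
        gCtr_mk (B := (gStar g D).cec.toN) φ x b
      rw [e]; exact Submodule.smul_mem _ _ hb)
    (fun s t hs ht => by rw [map_add]; exact add_mem hs ht)

lemma starCtr_br (φ : Module.Dual k g) (x y : D.omegaComm.X) :
    starCtr g D φ (univHom g D (D.omegaComm.br x y)) = LinearMap.mul' k (gStar g D).S
      (TensorProduct.map ((starCtr g D).flip (univHom g D x)) ((starCtr g D).flip (univHom g D y))
        (coLie φ)) := by
  rw [univHom_br]
  refine (gCtr_br φ _ _).trans ?_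
  generalize coLie φ = u
  induction u with
  | zero => exact (gCtr₂_zero _ _).trans (by rw [map_zero, map_zero]; rfl)
  | add u v hu hv => rw [map_add, map_add, ← hu, ← hv]; exact gCtr₂_add _ _ _ _
  | tmul χ ψ => rfl

variable (g) in
/-- The homomorphism from the representation algebra of the cobar construction of `D` to the
Chevalley-Eilenberg algebra of `g^*(D)`. -/
def repToStar : RepAlg g D.omegaComm →ₐ[k] (gStar g D).S :=
  repLift ((starCtr g D).compl₂ (univHom g D))
    (fun φ χ i j ξ hξ η hη => GSym.comm (starCtr_mem D φ (univHom_mem D hξ))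
      (starCtr_mem D χ (univHom_mem D hη)))
    (fun φ i j ξ hξ η hη => starCtr_br D φ ξ η)

lemma repToStar_repGen (φ : Module.Dual k g) (c : D.X) :
    repToStar g D (repGen g D.omegaComm φ (D.ωι c)) = starGen g D φ c := by
  refine (repLift_repGen _ _ _ φ (D.ωι c)).trans ?_
  rw [LinearMap.compl₂_apply, univHom_ωι, starCtr_univTwist]

variable (g) in
/-- The homomorphism from the Chevalley-Eilenberg algebra of `g^*(D)` to the representation algebra
of the cobar construction of `D`. -/
def starToRep : (gStar g D).S →ₐ[k] RepAlg g D.omegaComm :=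
  Pres.lift (TGen.lift ((repGen g D.omegaComm).compl₂ D.ωι))
    (fun i j v hv w hw => mono_comm Pres.gen_comm (ι := Pres.gen (repGr g _) (RepRel g _))
      (gV := repGr g D.omegaComm)
      (TGen.gr_induction (p := fun v => TGen.lift ((repGen g D.omegaComm).compl₂ D.ωι) v ∈
        repGrad g D.omegaComm i) hv (by simp)
        (fun φ c hc => by rw [TGen.lift_mk]; exact repGen_mem φ (D.ωι_mem hc))
        (fun s t hs ht => by rw [map_add]; exact add_mem hs ht))
      (TGen.gr_induction (p := fun v => TGen.lift ((repGen g D.omegaComm).compl₂ D.ωι) v ∈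
        repGrad g D.omegaComm j) hw (by simp)
        (fun φ c hc => by rw [TGen.lift_mk]; exact repGen_mem φ (D.ωι_mem hc))
        (fun s t hs ht => by rw [map_add]; exact add_mem hs ht)))
    (fun _ _ h => h.elim)

lemma starToRep_starGen (φ : Module.Dual k g) (c : D.X) :
    starToRep g D (starGen g D φ c) = repGen g D.omegaComm φ (D.ωι c) :=
  (Pres.lift_gen _ _ _ _).trans (TGen.lift_mk _ _ _)

variable {D}

lemma star_hom_ext {B : Type u} [Ring B] [Algebra k B] {F G : (gStar g D).S →ₐ[k] B}
    (h : ∀ φ c, F (starGen g D φ c) = G (starGen g D φ c)) : F = G := by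
  refine AlgHom.ext fun a => gen_induction (Pres.isGen (gStar g D).s_internal homRel_false).gen
    (p := fun a => F a = G a) a (fun v => ?_) (by simp)
    (fun a b ha hb => by rw [map_add, map_add, ha, hb])
    (fun a b ha hb => by rw [map_mul, map_mul, ha, hb])
  exact LinearMap.congr_fun (f := F.toLinearMap ∘ₗ (gStar g D).s)
    (g := G.toLinearMap ∘ₗ (gStar g D).s) (TGen.ext h) v

lemma repToStar_starToRep (a : (gStar g D).S) : repToStar g D (starToRep g D a) = a := by
  suffices H : (repToStar g D).comp (starToRep g D) = AlgHom.id k _ from DFunLike.congr_fun H a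
  exact star_hom_ext fun φ c => by
    rw [AlgHom.comp_apply, starToRep_starGen, repToStar_repGen]; rfl

lemma starToRep_surjective : Function.Surjective (starToRep g D) := by
  have key : ∀ ξ φ, repGen g D.omegaComm φ ξ ∈ (starToRep g D).range := by
    intro ξ
    refine D.omega_induction (p := fun ξ => ∀ φ, repGen g D.omegaComm φ ξ ∈ (starToRep g D).range)
      ξ (fun n c hc φ => ⟨_, starToRep_starGen D φ c⟩) (fun i j y hy z hz hy' hz' φ => ?_)
      (fun φ => by rw [map_zero]; exact zero_mem _)
      (fun y z hy hz φ => by rw [map_add]; exact add_mem (hy φ) (hz φ))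
      (fun r y hy φ => by rw [map_smul]; exact Subalgebra.smul_mem _ (hy φ) r)
    rw [repGen_br φ hy hz]
    generalize coLie φ = u
    induction u with
    | zero => simp only [map_zero]; exact zero_mem _
    | add u v hu hv => simp only [map_add]; exact add_mem hu hv
    | tmul χ ψ => exact mul_mem (hy' χ) (hz' ψ)
  intro a
  exact repAlg_induction (p := fun a => a ∈ (starToRep g D).range) a (fun φ ξ => key ξ φ)
    (zero_mem _) (fun r => Subalgebra.algebraMap_mem _ r) (fun _ _ => add_mem)
    (fun _ _ => mul_mem)

lemma starToRep_repToStar (a : RepAlg g D.omegaComm) : starToRep g D (repToStar g D a) = a := by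
  obtain ⟨b, rfl⟩ := starToRep_surjective a
  rw [repToStar_starToRep]

lemma starToRep_mem {n : ℤ} {a : (gStar g D).S} (ha : a ∈ GSym.gr (gStar g D).sgr n) :
    starToRep g D a ∈ repGrad g D.omegaComm n :=
  monoGr_hom (starToRep g D) (fun n v hv => TGen.gr_induction
    (p := fun v => starToRep g D (starS g D v) ∈ repGrad g D.omegaComm n) hv (by simp)
    (fun φ c hc => by
      rw [starS_mk, starToRep_starGen]
      exact repGen_mem φ (D.ωι_mem hc))
    (fun s t hs ht => by rw [map_add, map_add]; exact add_mem hs ht)) ha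

/-- Homogeneous linear maps compatible with derivations on generators commute with derivations. -/
lemma star_der_comm {B : Type u} [Ring B] [Algebra k B] {gB : ℤ → Submodule k B}
    {hB : DirectSum.IsInternal gB} {e : ℤ} {E : (gStar g D).S →ₗ[k] (gStar g D).S} {E' : B →ₗ[k] B}
    (hE : IsDer (GSym.internal (gStar g D).s_internal) e E) (hE' : IsDer hB e E')
    (f : (gStar g D).S →ₐ[k] B) (hf : ∀ n, ∀ x ∈ GSym.gr (gStar g D).sgr n, f x ∈ gB n)
    (h1 : (1 : B) ∈ gB 0)
    (h0 : ∀ φ c, f (E (starGen g D φ c)) = E' (f (starGen g D φ c))) (a : (gStar g D).S) :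
    f (E a) = E' (f a) :=
  hE.hom_comm (Pres.isGen (gStar g D).s_internal homRel_false).gen hE' f hf monoGr_one h1
    (fun v => LinearMap.congr_fun (f := f.toLinearMap ∘ₗ E ∘ₗ (gStar g D).s)
      (g := E' ∘ₗ f.toLinearMap ∘ₗ (gStar g D).s) (TGen.ext h0) v) a

lemma starQuad_pair (χ ψ : Module.Dual k g) {i : ℤ} {x : D.X} (hx : x ∈ D.gr i) (y : D.X) :
    starQuad g D (pair k _ _ (χ ⊗ₜ ψ) (x ⊗ₜ y)) =
      sgn k i • (starGen g D χ x * starGen g D ψ y) := by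
  rw [pair_tmul, starQuad_tmul, tw_one_of_mem _ (TGen.mk_mem χ hx), map_smul, smul_mul_assoc,
    starS_mk, starS_mk]

variable (D) in
lemma starToRep_quad (φ : Module.Dual k g) (t : D.X ⊗[k] D.X) :
    starToRep g D (starQuad g D (pair k _ _ (coLie φ) t)) =
      (2 : k) • repGen g D.omegaComm φ (D.ωquad t) := by
  suffices H : (starToRep g D).toLinearMap ∘ₗ starQuad g D ∘ₗ pair k _ _ (coLie φ) =
      (2 : k) • (repGen g D.omegaComm φ ∘ₗ D.ωquad) from LinearMap.congr_fun H t
  refine tensor_ext_gr D.internal D.internal fun i j x hx y hy => ?_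
  simp only [LinearMap.comp_apply, LinearMap.smul_apply, AlgHom.toLinearMap_apply]
  rw [D.ωquad_tmul, map_smul, smul_smul, mul_inv_cancel₀ two_ne_zero, one_smul,
    tw_one_of_mem _ hx, map_smul, map_smul, LinearMap.smul_apply, map_smul,
    repGen_br φ (D.ωι_mem (n := i - 1) (by rwa [sub_add_cancel]))
      (D.ωι_mem (n := j - 1) (by rwa [sub_add_cancel]))]
  generalize coLie φ = u
  induction u with
  | zero => simp
  | add u v hu hv => simp only [map_add, LinearMap.add_apply, smul_add, hu, hv]
  | tmul χ ψ =>
    rw [starQuad_pair χ ψ hx, map_smul, map_mul, starToRep_starGen, starToRep_starGen]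
    rfl

lemma starToRep_d (a : (gStar g D).S) :
    starToRep g D ((gStar g D).ceD a) = repD g D.omegaComm (starToRep g D a) := by
  refine star_der_comm (gStar g D).ceD_isDer repD_isDer (starToRep g D) (fun n x => starToRep_mem)
    monoGr_one (fun φ c => ?_) a
  have e : (gStar g D).ceD (starGen g D φ c) = -starGen g D φ (D.d c) -
      (2⁻¹ : k) • starQuad g D (pair k _ _ (coLie φ) (D.comul c)) :=
    ((gStar g D).ceD_s _).trans rfl
  rw [e, map_sub, map_neg, map_smul, starToRep_quad, starToRep_starGen, starToRep_starGen,
    repD_repGen, D.omega_d_ωι, map_sub, map_neg, smul_smul, inv_mul_cancel₀ two_ne_zero, one_smul]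

variable (g D) in
/-- The isomorphism from the Chevalley-Eilenberg algebra of `g^*(D)` to the representation algebra
of the cobar construction of `D`. -/
def starRepHom : (gStar g D).cec ⟶ rep g D.omegaComm :=
  ADGCA.Hom.mk (starToRep g D) (fun n x => starToRep_mem) starToRep_d (fun a => by
    suffices H : (rep g D.omegaComm).aug.comp (starToRep g D) = (gStar g D).cec.aug from
      DFunLike.congr_fun H a
    refine star_hom_ext fun φ c => ?_
    have e1 : (rep g D.omegaComm).aug (starToRep g D (starGen g D φ c)) = 0 := by
      rw [starToRep_starGen]
      exact rep_aug_repGen φ _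
    exact e1.trans (Pres.aug_gen (gV := (gStar g D).sgr) (R := fun _ _ => False)
      (fun _ _ h => h.elim) _).symm)

lemma starRepHom_qiso :
    IsQIso (gStar g D).cec.d (rep g D.omegaComm).d (ADGCA.lin (starRepHom g D)) :=
  IsQIso.of_bijective starToRep_d ⟨fun a b h => by
    rw [← repToStar_starToRep a, ← repToStar_starToRep b]
    exact congrArg (repToStar g D) h, starToRep_surjective⟩

end RepOmega

/-! ### The relative Chevalley-Eilenberg algebra -/

section SecondGrading

variable {k : Type u} [Field k] {V : Type u} [AddCommGroup V] [Module k V]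
  {gV wt : ℤ → Submodule k V}

/-- A symmetric algebra inherits a second grading of its generators. -/
lemma GSym.isGen_of_bigraded (h : DirectSum.IsInternal gV) (hw : DirectSum.IsInternal wt)
    (hp : ∀ n w, ∀ x ∈ wt w, proj h n x ∈ wt w) : IsGen wt (GSym.ι gV) where
  internal := hw
  gen := (Pres.isGen h homRel_false).gen
  coact := by
    let s : ℤ → V →ₗ[k] AddMonoidAlgebra (GSym gV) ℤ := fun i => singleLin i ∘ₗ GSym.ι gV
    have hs : ∀ i, ∀ v ∈ wt i, byDeg hw s v = AddMonoidAlgebra.single i (GSym.ι gV v) := by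
      intro i v hv
      rw [byDeg_of_mem hw s hv]
      simp only [s, singleLin, LinearMap.comp_apply, LinearMap.coe_mk, AddHom.coe_mk]
    have hc : ∀ i a, ∀ v ∈ gV i, proj hw a v ∈ gV i := by
      intro i a v hv
      have e := proj_map hw hw 0 (proj h i) (by simpa using hp i) a v
      rw [proj_of_mem h hv, add_zero] at e
      rw [← e]
      exact proj_mem h i _
    have ind : ∀ (p : V → Prop) i, ∀ v ∈ gV i, (∀ a, ∀ w ∈ gV i, w ∈ wt a → p w) →
        (∀ v w, p v → p w → p (v + w)) → p v := by
      intro p i v hv h1 h2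
      obtain ⟨t, ht, -⟩ := mem_iSup_proj hw v
      rw [ht]
      exact Finset.sum_induction _ p (fun _ _ => h2 _ _) (h1 0 0 (zero_mem _) (zero_mem _))
        fun a _ => h1 a _ (hc i a v hv) (proj_mem hw a v)
    refine ⟨Pres.lift (byDeg hw s) (fun i j v hv w hw' => ?_) (fun _ _ h => h.elim), fun i v hv => ?_⟩
    · refine ind (fun v => byDeg hw s v * byDeg hw s w =
        sgn k (i * j) • (byDeg hw s w * byDeg hw s v)) i v hv (fun a v hv hva => ?_)
        (fun v v' e e' => by simp only [map_add, add_mul, mul_add, smul_add, e, e'])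
      refine ind (fun w => byDeg hw s v * byDeg hw s w =
        sgn k (i * j) • (byDeg hw s w * byDeg hw s v)) j w hw' (fun b w hw' hwb => ?_)
        (fun v v' e e' => by simp only [map_add, add_mul, mul_add, smul_add, e, e'])
      rw [hs a v hva, hs b w hwb, AddMonoidAlgebra.single_mul_single,
        AddMonoidAlgebra.single_mul_single, Pres.gen_comm i j v hv w hw', add_comm,
        AddMonoidAlgebra.smul_single]
    · rw [Pres.lift_gen, hs i v hv]

end SecondGrading

section StarMaps

variable {k : Type u} [Field k] [CharZero k]
variable {g : Type u} [LieRing g] [LieAlgebra k g] [Module.Finite k g]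
variable {D D' : NDGCC k}

lemma star_induction {p : (gStar g D).S → Prop} (a : (gStar g D).S)
    (gen : ∀ φ c, p (starGen g D φ c)) (scalar : ∀ r, p (algebraMap k _ r))
    (add : ∀ a b, p a → p b → p (a + b)) (mul : ∀ a b, p a → p b → p (a * b)) : p a := by
  refine gen_induction (Pres.isGen (gStar g D).s_internal homRel_false).gen a (fun v => ?_) scalar
    add mul
  have h0 : p 0 := by simpa using scalar 0
  have key : ∀ v : TGen k (Module.Dual k g) D.X, p (starS g D v) := by
    intro v
    induction v using TGen.induction with
    | zero => rw [map_zero]; exact h0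
    | add s t hs ht => rw [map_add]; exact add _ _ hs ht
    | mk φ c => exact gen φ c
  exact key v

lemma starS_mem {n : ℤ} {v : TGen k (Module.Dual k g) D.X}
    (hv : v ∈ TGen.gr (Module.Dual k g) D.gr (n + 1)) :
    starS g D v ∈ GSym.gr (gStar g D).sgr n := monoGr_ι (gV := (gStar g D).sgr) hv

variable (g) in
/-- The homomorphism of symmetric algebras induced by a map of coalgebras of degree zero. -/
def starMap (f : D.X →ₗ[k] D'.X) (hf : ∀ n, ∀ x ∈ D.gr n, f x ∈ D'.gr n) :
    (gStar g D).S →ₐ[k] (gStar g D').S :=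
  Pres.lift (starS g D' ∘ₗ TGen.map LinearMap.id f)
    (fun i j v hv w hw => by
      have key : ∀ i v, v ∈ TGen.gr (Module.Dual k g) D.gr (i + 1) →
          starS g D' (TGen.map LinearMap.id f v) ∈ GSym.gr (gStar g D').sgr i := by
        intro i v hv
        have := TGen.map_mem (gr' := D'.gr) (LinearMap.id : Module.Dual k g →ₗ[k] _) f 0
          (by simpa using hf) hv
        rw [add_zero] at this
        exact starS_mem this
      exact GSym.comm (key i v hv) (key j w hw))
    (fun _ _ h => h.elim)

section

variable (f : D.X →ₗ[k] D'.X) (hf : ∀ n, ∀ x ∈ D.gr n, f x ∈ D'.gr n)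

lemma starMap_starGen (φ : Module.Dual k g) (c : D.X) :
    starMap g f hf (starGen g D φ c) = starGen g D' φ (f c) := by
  refine (Pres.lift_gen _ _ _ _).trans ?_
  exact congrArg (starS g D') (TGen.map_mk _ _ _ _)

lemma starMap_mem {n : ℤ} {a : (gStar g D).S} (ha : a ∈ GSym.gr (gStar g D).sgr n) :
    starMap g f hf a ∈ GSym.gr (gStar g D').sgr n :=
  monoGr_hom (starMap g f hf) (fun n v hv => TGen.gr_induction
    (p := fun v => starMap g f hf (starS g D v) ∈ GSym.gr (gStar g D').sgr n) hv (by simp)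
    (fun φ c hc => by
      rw [starS_mk, starMap_starGen]
      exact starGen_mem D' φ (hf _ _ hc))
    (fun s t hs ht => by rw [map_add, map_add]; exact add_mem hs ht)) ha

lemma starMap_starQuad (u : Module.Dual k g ⊗[k] Module.Dual k g) (t : D.X ⊗[k] D.X) :
    starMap g f hf (starQuad g D (pair k _ _ u t)) =
      starQuad g D' (pair k _ _ u (TensorProduct.map f f t)) := by
  induction u with
  | zero => simp
  | add u v hu hv => simp only [map_add, LinearMap.add_apply, hu, hv]
  | tmul χ ψ =>
    suffices H : (starMap g f hf).toLinearMap ∘ₗ starQuad g D ∘ₗ pair k _ _ (χ ⊗ₜ ψ) =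
        starQuad g D' ∘ₗ pair k _ _ (χ ⊗ₜ ψ) ∘ₗ TensorProduct.map f f from LinearMap.congr_fun H t
    refine tensor_ext_gr D.internal D.internal fun i j x hx y hy => ?_
    simp only [LinearMap.comp_apply, AlgHom.toLinearMap_apply, TensorProduct.map_tmul]
    rw [starQuad_pair χ ψ hx, starQuad_pair χ ψ (hf i x hx), map_smul, map_mul, starMap_starGen,
      starMap_starGen]

end

section

variable (f : TGen k (Module.Dual k g) D.X →ₗ[k] TGen k (Module.Dual k g) D.X)
  (hf : ∀ n, ∀ x ∈ TGen.gr (Module.Dual k g) D.gr n, f x ∈ TGen.gr (Module.Dual k g) D.gr n)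

include hf in
lemma starDer_data : Pres.DerData (gStar g D).s_internal homRel_false 0 0 (starS g D ∘ₗ f) :=
  GSym.derData _ (by decide) _ fun n v hv => by
    rw [add_zero]
    exact starS_mem (hf _ _ hv)

/-- The derivation of degree zero of the symmetric algebra induced by a linear map. -/
def starDer : (gStar g D).S →ₗ[k] (gStar g D).S := Pres.der (starDer_data f hf)

lemma starDer_isDer : IsDer (GSym.internal (gStar g D).s_internal) 0 (starDer f hf) :=
  Pres.der_isDer _

lemma starDer_starS (v : TGen k (Module.Dual k g) D.X) :
    starDer f hf (starS g D v) = starS g D (f v) := Pres.der_gen _ _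

end

variable (D) in
/-- The coadjoint action on the Chevalley-Eilenberg algebra of `g^*(D)`. -/
def starAct (y : g) : (gStar g D).S →ₗ[k] (gStar g D).S :=
  starDer (TGen.map (coad y) LinearMap.id) fun n x hx => by
    have := TGen.map_mem (gr' := D.gr) (coad y) LinearMap.id 0 (by simp) hx
    rwa [add_zero] at this

lemma starAct_isDer (y : g) : IsDer (GSym.internal (gStar g D).s_internal) 0 (starAct D y) :=
  starDer_isDer _ _

lemma starAct_starGen (y : g) (φ : Module.Dual k g) (c : D.X) :
    starAct D y (starGen g D φ c) = starGen g D (coad y φ) c := by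
  refine (starDer_starS _ _ _).trans ?_
  rw [TGen.map_mk]
  rfl

lemma starToRep_act (y : g) (a : (gStar g D).S) :
    starToRep g D (starAct D y a) = repAct D.omegaComm y (starToRep g D a) :=
  star_der_comm (starAct_isDer y) (repAct_isDer y) (starToRep g D) (fun n x => starToRep_mem)
    monoGr_one (fun φ c => by
      rw [starAct_starGen, starToRep_starGen, starToRep_starGen, repAct_repGen]) a

lemma starDer_mul {E : (gStar g D).S →ₗ[k] (gStar g D).S}
    (hE : IsDer (GSym.internal (gStar g D).s_internal) 0 E) (a b : (gStar g D).S) :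
    E (a * b) = E a * b + a * E b := by
  rw [hE, tw_zero, LinearMap.id_apply]

lemma starAct_sum (y : g) (a : (gStar g D).S) : ∑ i, (Module.finBasis k g).coord i y •
    starAct D (Module.finBasis k g i) a = starAct D y a := by
  refine star_induction (p := fun a => ∑ i, (Module.finBasis k g).coord i y •
    starAct D (Module.finBasis k g i) a = starAct D y a) a (fun φ c => ?_) (fun r => ?_)
    (fun a b ha hb => ?_) (fun a b ha hb => ?_)
  · simp only [starAct_starGen]
    let E : g →ₗ[k] (gStar g D).S := (starS g D ∘ₗ (TGen.mk k (Module.Dual k g) D.X).flip c) ∘ₗ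
      (brLin k g).compr₂ φ
    have h : ∀ y, starGen g D (coad y φ) c = E y := fun _ => rfl
    simp only [h]
    conv_rhs => rw [← (Module.finBasis k g).sum_repr y, map_sum]
    exact Finset.sum_congr rfl fun i _ => by rw [map_smul]; rfl
  · simp only [(starAct_isDer _).map_algebraMap monoGr_one, smul_zero, Finset.sum_const_zero]
  · simp only [map_add, smul_add, Finset.sum_add_distrib, ha, hb]
  · simp only [starDer_mul (starAct_isDer _), smul_add, Finset.sum_add_distrib, ← ha, ← hb,
      Finset.sum_mul, Finset.mul_sum, smul_mul_assoc, mul_smul_comm]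

lemma coLie_eq_sum (φ : Module.Dual k g) : coLie φ =
    ∑ i, (Module.finBasis k g).coord i ⊗ₜ[k] coad (Module.finBasis k g i) φ := by
  refine dualDistrib_inj fun x y => ?_
  rw [coLie_spec, map_sum, LinearMap.sum_apply]
  conv_lhs => rw [← (Module.finBasis k g).sum_repr x]
  simp only [TensorProduct.dualDistrib_apply, coad_apply, sum_lie, smul_lie, map_sum, map_smul]
  rfl

/-- A splitting of a coalgebra `D'` as the direct sum of the ground field and a coalgebra `D`. -/
structure NDGCC.Splitting (D' D : NDGCC k) where
  one : D'.X
  ε : D'.X →ₗ[k] k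
  π : D'.X →ₗ[k] D.X
  σ : D.X →ₗ[k] D'.X
  one_mem : one ∈ D'.gr 0
  ε_one : ε one = 1
  ε_gr : ∀ n, n ≠ 0 → ∀ x ∈ D'.gr n, ε x = 0
  σ_π : ∀ c, σ (π c) = c - ε c • one
  π_σ : ∀ x, π (σ x) = x
  ε_σ : ∀ x, ε (σ x) = 0
  π_mem : ∀ n, ∀ x ∈ D'.gr n, π x ∈ D.gr n
  σ_mem : ∀ n, ∀ x ∈ D.gr n, σ x ∈ D'.gr n
  σ_d : ∀ x, σ (D.d x) = D'.d (σ x)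
  comul_σ : ∀ x, D'.comul (σ x) =
    TensorProduct.map σ σ (D.comul x) + (one ⊗ₜ σ x + σ x ⊗ₜ one)

namespace NDGCC.Splitting

variable (P : NDGCC.Splitting D' D)

/-- The composite of `g^*(D') → g^*` with the evaluation at `y`. -/
def ev (y : g) : Module.Dual k (gStar g D').X :=
  TGen.lift (X := D'.X) ((LinearMap.mul k k).compl₁₂ (Module.Dual.eval k g y) P.ε)

lemma ev_gr (y : g) (n : ℤ) (hn : n ≠ 0) (x : (gStar g D').X) (hx : x ∈ (gStar g D').gr n) :
    P.ev y x = 0 := by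
  refine TGen.gr_induction (X := D'.X) (p := fun x => P.ev y x = 0) hx
    (LinearMap.map_zero _) (fun φ c hc => ?_) (fun s t hs ht => ?_)
  · have : P.ev y (TGen.mk k _ D'.X φ c) = φ y * P.ε c := TGen.lift_mk _ _ _
    exact this.trans (by rw [P.ε_gr n hn c hc, mul_zero])
  · exact ((P.ev y).map_add s t).trans (by rw [hs, ht, add_zero])

/-- The contractions. -/
def ctr (y : g) : (gStar g D').S →ₗ[k] (gStar g D').S := (gStar g D').contr (P.ev y) (P.ev_gr y)

lemma ctr_isDer (y : g) : IsDer (GSym.internal (gStar g D').s_internal) 1 (P.ctr y) :=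
  Pres.der_isDer _

lemma ctr_starGen (y : g) (φ : Module.Dual k g) (c : D'.X) :
    P.ctr y (starGen g D' φ c) = (φ y * P.ε c) • 1 := by
  refine (Pres.der_gen _ _).trans ?_
  exact congrArg (fun r : k => r • (1 : (gStar g D').S)) (TGen.lift_mk _ _ _)

variable (g) in
/-- The inclusion of the symmetric algebras. -/
def j : (gStar g D).S →ₐ[k] (gStar g D').S := starMap g P.σ P.σ_mem

variable (g) in
/-- The projection of the symmetric algebras. -/
def q : (gStar g D').S →ₐ[k] (gStar g D).S := starMap g P.π P.π_mem

lemma j_starGen (φ : Module.Dual k g) (c : D.X) :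
    P.j g (starGen g D φ c) = starGen g D' φ (P.σ c) := starMap_starGen _ _ _ _

lemma q_starGen (φ : Module.Dual k g) (c : D'.X) :
    P.q g (starGen g D' φ c) = starGen g D φ (P.π c) := starMap_starGen _ _ _ _

lemma q_j (a : (gStar g D).S) : P.q g (P.j g a) = a := by
  suffices H : (P.q g).comp (P.j g) = AlgHom.id k _ from DFunLike.congr_fun H a
  refine star_hom_ext fun φ c => ?_
  rw [AlgHom.comp_apply, j_starGen, q_starGen, P.π_σ]
  rfl

lemma j_mem {n : ℤ} {a : (gStar g D).S} (ha : a ∈ GSym.gr (gStar g D).sgr n) :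
    P.j g a ∈ GSym.gr (gStar g D').sgr n := starMap_mem _ _ ha

lemma ctr_j (y : g) (a : (gStar g D).S) : P.ctr y (P.j g a) = 0 := by
  refine star_induction (p := fun a => P.ctr y (P.j g a) = 0) a (fun φ c => ?_) (fun r => ?_)
    (fun a b ha hb => by rw [map_add, map_add, ha, hb, add_zero]) (fun a b ha hb => ?_)
  · rw [j_starGen, ctr_starGen, P.ε_σ, mul_zero, zero_smul]
  · rw [AlgHom.commutes]
    exact (P.ctr_isDer y).map_algebraMap monoGr_one r
  · rw [map_mul, P.ctr_isDer, ha, hb, zero_mul, mul_zero, add_zero]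

/-- The generators `φ ⊗ 1`. -/
def unitGen (φ : Module.Dual k g) : (gStar g D').S := starGen g D' φ P.one

lemma unitGen_mem (φ : Module.Dual k g) :
    P.unitGen φ ∈ GSym.gr (gStar g D').sgr (-1) :=
  starGen_mem D' φ (n := -1) P.one_mem

lemma unitGen_mul (φ : Module.Dual k g) (z : (gStar g D').S) : P.unitGen φ * z =
    tw (GSym.internal (gStar g D').s_internal) 1 z * P.unitGen φ := by
  refine hom_induction (GSym.internal (gStar g D').s_internal) (p := fun z => P.unitGen φ * z =
    tw (GSym.internal (gStar g D').s_internal) 1 z * P.unitGen φ) z (fun n z hz => ?_)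
    (fun a b ha hb => by rw [mul_add, ha, hb, map_add, add_mul])
  rw [tw_one_of_mem _ hz, GSym.comm (P.unitGen_mem φ) hz, smul_mul_assoc,
    show -1 * n = -n by ring, sgn_neg]

lemma starQuad_unit (u : Module.Dual k g ⊗[k] Module.Dual k g) (x : D.X) :
    starQuad g D' (pair k _ _ u (P.one ⊗ₜ P.σ x + P.σ x ⊗ₜ P.one)) =
      LinearMap.mul' k _ (TensorProduct.map ((starS g D' ∘ₗ (TGen.mk k _ D'.X).flip P.one))
        (starS g D' ∘ₗ (TGen.mk k _ D'.X).flip (P.σ x)) (u - TensorProduct.comm k _ _ u)) := by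
  induction u with
  | zero => simp
  | add u v hu hv =>
    rw [map_add (pair k _ _) u v, LinearMap.add_apply, map_add, hu, hv, ← map_add, ← map_add,
      map_add (TensorProduct.comm k _ _)]
    congr 2
    abel
  | tmul χ ψ =>
    refine hom_induction D.internal (p := fun x => starQuad g D' (pair k _ _ (χ ⊗ₜ ψ)
      (P.one ⊗ₜ P.σ x + P.σ x ⊗ₜ P.one)) =
      LinearMap.mul' k _ (TensorProduct.map ((starS g D' ∘ₗ (TGen.mk k _ D'.X).flip P.one))
        (starS g D' ∘ₗ (TGen.mk k _ D'.X).flip (P.σ x))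
        (χ ⊗ₜ ψ - TensorProduct.comm k _ _ (χ ⊗ₜ ψ)))) x (fun n x hx => ?_) (fun x y hx hy => ?_)
    · have h := GSym.comm (starGen_mem D' χ (n := n - 1) (c := P.σ x)
        (by rw [sub_add_cancel]; exact P.σ_mem n x hx)) (P.unitGen_mem ψ)
      rw [map_add, map_add, starQuad_pair χ ψ P.one_mem, starQuad_pair χ ψ (P.σ_mem n x hx)]
      have h2 : sgn k n • (starGen g D' χ (P.σ x) * P.unitGen ψ) =
          -(P.unitGen ψ * starGen g D' χ (P.σ x)) := by
        rw [h, smul_smul, ← sgn_add, show n + (n - 1) * -1 = 1 by ring, sgn_one, neg_one_smul]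
      rw [unitGen] at h2
      rw [h2, sgn_zero, one_smul, TensorProduct.comm_tmul, map_sub, map_sub, sub_eq_add_neg]
      rfl
    · have e : starS g D' ∘ₗ (TGen.mk k (Module.Dual k g) D'.X).flip (P.σ (x + y)) =
          starS g D' ∘ₗ (TGen.mk k (Module.Dual k g) D'.X).flip (P.σ x) +
          starS g D' ∘ₗ (TGen.mk k (Module.Dual k g) D'.X).flip (P.σ y) := by
        rw [map_add, map_add, LinearMap.comp_add]
      rw [e, TensorProduct.map_add_right, LinearMap.add_apply, map_add (LinearMap.mul' k _), ← hx,
        ← hy, ← map_add, ← map_add, map_add P.σ, TensorProduct.tmul_add, TensorProduct.add_tmul]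
      congr 2
      abel

/-- The failure of `j` to commute with the differentials. -/
def defect : (gStar g D).S →ₗ[k] (gStar g D').S :=
  ∑ i, LinearMap.mulLeft k (P.unitGen ((Module.finBasis k g).coord i)) ∘ₗ
    (P.j g).toLinearMap ∘ₗ starAct D (Module.finBasis k g i)

lemma defect_apply (a : (gStar g D).S) : P.defect a =
    ∑ i, P.unitGen ((Module.finBasis k g).coord i) *
      P.j g (starAct D (Module.finBasis k g i) a) := LinearMap.sum_apply _ _ _

lemma ceD_starGen (D : NDGCC k) (φ : Module.Dual k g) (c : D.X) :
    (gStar g D).ceD (starGen g D φ c) = -starGen g D φ (D.d c) -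
      (2⁻¹ : k) • starQuad g D (pair k _ _ (coLie φ) (D.comul c)) :=
  ((gStar g D).ceD_s _).trans rfl

lemma ceD_j (a : (gStar g D).S) :
    (gStar g D').ceD (P.j g a) = P.j g ((gStar g D).ceD a) - P.defect a := by
  refine star_induction (p := fun a => (gStar g D').ceD (P.j g a) =
    P.j g ((gStar g D).ceD a) - P.defect a) a (fun φ c => ?_) (fun r => ?_)
    (fun a b ha hb => by simp only [map_add, ha, hb]; abel) (fun a b ha hb => ?_)
  · have hs : coLie φ - TensorProduct.comm k _ _ (coLie φ) = (2 : k) • coLie φ := by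
      have key : ∀ z : Module.Dual k g ⊗[k] Module.Dual k g, z - (-1 : k) • z = (2 : k) • z :=
        fun z => by module
      rw [coLie_skew, key]
    have e : LinearMap.mul' k _ (TensorProduct.map (starS g D' ∘ₗ (TGen.mk k _ D'.X).flip P.one)
        (starS g D' ∘ₗ (TGen.mk k _ D'.X).flip (P.σ c)) (coLie φ)) =
        P.defect (starGen g D φ c) := by
      rw [coLie_eq_sum, map_sum, map_sum, defect_apply]
      refine Finset.sum_congr rfl fun i _ => ?_
      rw [starAct_starGen, j_starGen]
      rfl
    rw [j_starGen, ceD_starGen, ceD_starGen, P.comul_σ, map_sub, map_neg, map_smul, j_starGen,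
      P.σ_d, map_add, map_add, starQuad_unit, j, starMap_starQuad, hs, map_smul, map_smul, smul_add,
      smul_smul, inv_mul_cancel₀ two_ne_zero, one_smul, e]
    abel
  · rw [AlgHom.commutes, ((gStar g D').ceD_isDer).map_algebraMap monoGr_one,
      ((gStar g D).ceD_isDer).map_algebraMap monoGr_one, map_zero, defect_apply]
    simp only [(starAct_isDer _).map_algebraMap monoGr_one, map_zero, mul_zero,
      Finset.sum_const_zero, sub_zero]
  · have e : P.defect (a * b) = P.defect a * P.j g b +
        tw (GSym.internal (gStar g D').s_internal) 1 (P.j g a) * P.defect b := by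
      simp only [defect_apply, starDer_mul (starAct_isDer _), map_add, map_mul, mul_add,
        Finset.sum_add_distrib, Finset.sum_mul, Finset.mul_sum, mul_assoc]
      refine congrArg₂ _ rfl (Finset.sum_congr rfl fun i _ => ?_)
      rw [← mul_assoc, unitGen_mul, mul_assoc]
    have e2 : P.j g (tw (GSym.internal (gStar g D).s_internal) 1 a) =
        tw (GSym.internal (gStar g D').s_internal) 1 (P.j g a) :=
      (tw_map_zero _ _ (P.j g).toLinearMap (fun n x => P.j_mem) 1 a).symm
    rw [map_mul, (gStar g D').ceD_isDer, (gStar g D).ceD_isDer, ha, hb, e, map_add, map_mul,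
      map_mul, ← e2]
    simp only [sub_mul, mul_sub]
    abel

lemma ctr_ceD_j (y : g) (a : (gStar g D).S) :
    P.ctr y ((gStar g D').ceD (P.j g a)) = -P.j g (starAct D y a) := by
  rw [ceD_j, map_sub, ctr_j, zero_sub, neg_inj, defect_apply, map_sum, ← starAct_sum, map_sum]
  refine Finset.sum_congr rfl fun i _ => ?_
  rw [P.ctr_isDer, ctr_j, mul_zero, add_zero, unitGen, ctr_starGen, P.ε_one, mul_one,
    smul_one_mul, map_smul]

lemma unitMap_mem (n : ℤ) (x) (hx : x ∈ TGen.gr (Module.Dual k g) D'.gr n) :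
    TGen.map LinearMap.id (P.ε.smulRight P.one) x ∈ TGen.gr (Module.Dual k g) D'.gr n := by
  have := TGen.map_mem (gr' := D'.gr) (LinearMap.id : Module.Dual k g →ₗ[k] _)
    (P.ε.smulRight P.one) 0 (fun n x hx => by
      rw [add_zero, LinearMap.smulRight_apply]
      by_cases hn : n = 0
      · subst hn; exact Submodule.smul_mem _ _ P.one_mem
      · rw [P.ε_gr n hn x hx, zero_smul]; exact zero_mem _) hx
  rwa [add_zero] at this

/-- The Euler derivation counting the generators `φ ⊗ 1`. -/
def euler : (gStar g D').S →ₗ[k] (gStar g D').S :=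
  starDer (TGen.map LinearMap.id (P.ε.smulRight P.one)) P.unitMap_mem

lemma euler_starGen (φ : Module.Dual k g) (c : D'.X) :
    P.euler (starGen g D' φ c) = P.ε c • P.unitGen φ := by
  refine (starDer_starS _ _ _).trans ?_
  rw [TGen.map_mk, LinearMap.smulRight_apply, map_smul, map_smul]
  rfl

lemma euler_eq_sum (b : (gStar g D').S) : P.euler b =
    ∑ i, P.unitGen ((Module.finBasis k g).coord i) * P.ctr (Module.finBasis k g i) b := by
  refine star_induction (p := fun b => P.euler b = ∑ i, P.unitGen ((Module.finBasis k g).coord i) *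
    P.ctr (Module.finBasis k g i) b) b (fun φ c => ?_) (fun r => ?_)
    (fun a b ha hb => ?_) (fun a b ha hb => ?_)
  · simp only [euler_starGen, ctr_starGen, mul_smul_one]
    rw [unitGen, ← starGen_sum, Finset.smul_sum]
    exact Finset.sum_congr rfl fun i _ => by rw [smul_smul, mul_comm]; rfl
  · simp only [(P.ctr_isDer _).map_algebraMap monoGr_one, mul_zero, Finset.sum_const_zero]
    exact (starDer_isDer _ _).map_algebraMap monoGr_one r
  · simp only [map_add, mul_add, Finset.sum_add_distrib, ha, hb]
  · have e : P.euler (a * b) = P.euler a * b + a * P.euler b := starDer_mul (starDer_isDer _ _) a b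
    rw [e, ha, hb, Finset.sum_mul, Finset.mul_sum, ← Finset.sum_add_distrib]
    refine Finset.sum_congr rfl fun i _ => ?_
    rw [P.ctr_isDer, mul_add, mul_assoc, ← mul_assoc _ (tw _ _ _),
      P.unitGen_mul _ (tw _ 1 a), tw_tw, mul_assoc]

lemma _root_.LieRep.monomial_add_comm {R : Type u} [Ring R] [Algebra k R] {a a' b b' : R} {r : k}
    (h : a * b = r • (b * a)) (h₁ : a * b' = r • (b' * a)) (h₂ : a' * b = r • (b * a'))
    (h₃ : a' * b' = r • (b' * a')) :
    (Polynomial.monomial 0 a + Polynomial.monomial 1 a') *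
      (Polynomial.monomial 0 b + Polynomial.monomial 1 b') =
    r • ((Polynomial.monomial 0 b + Polynomial.monomial 1 b') *
      (Polynomial.monomial 0 a + Polynomial.monomial 1 a')) := by
  simp only [add_mul, mul_add, Polynomial.monomial_mul_monomial, smul_add,
    Polynomial.smul_monomial, h, h₁, h₂, h₃, add_zero, zero_add]
  abel

variable (g) in
/-- The homomorphism recording the number of the generators `φ ⊗ 1` by the powers of a variable. -/
def wtPoly : (gStar g D').S →ₐ[k] Polynomial (gStar g D').S :=
  Pres.lift
    ((Polynomial.monomial 0).restrictScalars k ∘ₗ starS g D' ∘ₗ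
        TGen.map LinearMap.id (P.σ ∘ₗ P.π) +
      (Polynomial.monomial 1).restrictScalars k ∘ₗ starS g D' ∘ₗ
        TGen.map LinearMap.id (P.ε.smulRight P.one))
    (fun i j v hv w hw => by
      have h0 : ∀ i v, v ∈ TGen.gr (Module.Dual k g) D'.gr (i + 1) →
          starS g D' (TGen.map LinearMap.id (P.σ ∘ₗ P.π) v) ∈ GSym.gr (gStar g D').sgr i := by
        intro i v hv
        have := TGen.map_mem (gr' := D'.gr) (LinearMap.id : Module.Dual k g →ₗ[k] _) (P.σ ∘ₗ P.π) 0
          (fun n x hx => by rw [add_zero]; exact P.σ_mem _ _ (P.π_mem _ _ hx)) hv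
        rw [add_zero] at this
        exact starS_mem this
      have h1 : ∀ i v, v ∈ TGen.gr (Module.Dual k g) D'.gr (i + 1) →
          starS g D' (TGen.map LinearMap.id (P.ε.smulRight P.one) v) ∈
            GSym.gr (gStar g D').sgr i := by
        intro i v hv
        rw [← starDer_starS _ P.unitMap_mem]
        have := Pres.der_mem (starDer_data _ (P.unitMap_mem (g := g))) i _ (starS_mem hv)
        rwa [add_zero] at this
      exact monomial_add_comm (GSym.comm (h0 i v hv) (h0 j w hw))
        (GSym.comm (h0 i v hv) (h1 j w hw)) (GSym.comm (h1 i v hv) (h0 j w hw))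
        (GSym.comm (h1 i v hv) (h1 j w hw)))
    (fun _ _ h => h.elim)

lemma wtPoly_starGen (φ : Module.Dual k g) (c : D'.X) : P.wtPoly g (starGen g D' φ c) =
    Polynomial.monomial 0 (starGen g D' φ (P.σ (P.π c))) +
      Polynomial.monomial 1 (P.ε c • P.unitGen φ) := by
  have e1 : starS g D' (TGen.map LinearMap.id (P.σ ∘ₗ P.π) (TGen.mk k _ _ φ c)) =
      starGen g D' φ (P.σ (P.π c)) := by rw [TGen.map_mk]; rfl
  have e2 : starS g D' (TGen.map LinearMap.id (P.ε.smulRight P.one) (TGen.mk k _ _ φ c)) =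
      P.ε c • P.unitGen φ := by
    rw [TGen.map_mk, LinearMap.smulRight_apply, map_smul, map_smul]; rfl
  rw [← e1, ← e2]
  exact Pres.lift_gen _ _ _ _

lemma wtPoly_euler (b : (gStar g D').S) :
    Polynomial.X * Polynomial.derivative (P.wtPoly g b) = P.wtPoly g (P.euler b) := by
  refine star_induction (p := fun b => Polynomial.X * Polynomial.derivative (P.wtPoly g b) =
    P.wtPoly g (P.euler b)) b (fun φ c => ?_) (fun r => ?_)
    (fun a b ha hb => by simp only [map_add, mul_add, ha, hb]) (fun a b ha hb => ?_)
  · rw [euler_starGen, map_smul, unitGen, wtPoly_starGen, wtPoly_starGen]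
    have h : P.σ (P.π P.one) = 0 := by rw [P.σ_π, P.ε_one, one_smul, sub_self]
    rw [h, map_zero, map_zero, P.ε_one, one_smul, zero_add, map_add,
      Polynomial.derivative_monomial, Polynomial.derivative_monomial, Nat.cast_zero, mul_zero,
      map_zero, zero_add, Nat.cast_one, mul_one, Polynomial.X_mul_monomial,
      Polynomial.smul_monomial]
  · have e : P.euler (algebraMap k (gStar g D').S r) = 0 :=
      (starDer_isDer _ _).map_algebraMap monoGr_one r
    rw [e, map_zero, AlgHom.commutes, Polynomial.algebraMap_apply,
      Polynomial.derivative_C, mul_zero]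
  · have e : P.euler (a * b) = P.euler a * b + a * P.euler b := starDer_mul (starDer_isDer _ _) a b
    rw [e, map_mul (P.wtPoly g), map_add, map_mul (P.wtPoly g), map_mul (P.wtPoly g), ← ha, ← hb,
      Polynomial.derivative_mul, mul_add,
      ← mul_assoc, ← mul_assoc Polynomial.X (P.wtPoly g a),
      Polynomial.X_mul (p := P.wtPoly g a), mul_assoc (P.wtPoly g a)]

lemma eq_j_q {b : (gStar g D').S} (hb : P.euler b = 0) : P.j g (P.q g b) = b := by
  have h1 : Polynomial.eval₂RingHom' (RingHom.id _) 1 (fun a => Commute.one_right a)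
      (P.wtPoly g b) = b := by
    refine star_induction (p := fun b => Polynomial.eval₂RingHom' (RingHom.id _) 1
      (fun a => Commute.one_right a) (P.wtPoly g b) = b) b (fun φ c => ?_) (fun r => ?_)
      (fun a b ha hb => by rw [map_add, map_add, ha, hb])
      (fun a b ha hb => by rw [map_mul, map_mul, ha, hb])
    · rw [wtPoly_starGen, map_add]
      simp only [Polynomial.eval₂RingHom'_apply, Polynomial.eval₂_monomial, RingHom.id_apply,
        one_pow, mul_one]
      rw [P.σ_π, map_sub, map_smul, unitGen, sub_add_cancel]
    · rw [AlgHom.commutes, Polynomial.algebraMap_apply]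
      simp
  have h0 : Polynomial.constantCoeff (P.wtPoly g b) = P.j g (P.q g b) := by
    refine star_induction (p := fun b => Polynomial.constantCoeff (P.wtPoly g b) =
      P.j g (P.q g b)) b (fun φ c => ?_) (fun r => ?_)
      (fun a b ha hb => by rw [map_add, map_add, map_add, map_add, ha, hb])
      (fun a b ha hb => by rw [map_mul, map_mul, map_mul, map_mul, ha, hb])
    · rw [wtPoly_starGen, map_add, q_starGen, j_starGen]
      simp [Polynomial.coeff_monomial]
    · rw [AlgHom.commutes, AlgHom.commutes, AlgHom.commutes,
        Polynomial.algebraMap_apply]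
      simp
  have h2 : P.wtPoly g b = Polynomial.C (Polynomial.constantCoeff (P.wtPoly g b)) := by
    have h := P.wtPoly_euler b
    rw [hb, map_zero] at h
    refine Polynomial.ext fun n => ?_
    cases n with
    | zero => simp
    | succ n =>
      have := congrArg (fun p => Polynomial.coeff p (n + 1)) h
      simp only [Polynomial.coeff_X_mul, Polynomial.coeff_derivative, Polynomial.coeff_zero] at this
      have e : (P.wtPoly g b).coeff (n + 1) * ((n : (gStar g D').S) + 1) =
          ((n + 1 : ℕ) : k) • (P.wtPoly g b).coeff (n + 1) := by
        rw [Nat.cast_smul_eq_nsmul, nsmul_eq_mul, ← Nat.cast_succ, Nat.cast_comm]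
      rw [e] at this
      rw [(smul_eq_zero.1 this).resolve_left (Nat.cast_ne_zero.2 n.succ_ne_zero),
        Polynomial.coeff_C_succ]
  rw [← h0]
  conv_rhs => rw [← h1, h2]
  simp

variable (g) in
/-- The basic subalgebra. -/
def rel : ADGCA k := (gStar g D').cecRel P.ev P.ev_gr

variable (g) in
lemma rel_condition (b : (gStar g D').S) : (∀ y, P.ctr y b = 0 ∧ P.ctr y ((gStar g D').ceD b) = 0) ↔
    ∃ a, (∀ y : g, starAct D y a = 0) ∧ P.j g a = b := by
  constructor
  · intro h
    have e : P.j g (P.q g b) = b := P.eq_j_q (by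
      rw [euler_eq_sum]
      exact Finset.sum_eq_zero fun i _ => by rw [(h _).1, mul_zero])
    refine ⟨P.q g b, fun y => ?_, e⟩
    have := (h y).2
    rw [← e, ctr_ceD_j, neg_eq_zero] at this
    rw [← P.q_j (starAct D y _), this, map_zero]
  · rintro ⟨a, ha, rfl⟩ y
    exact ⟨P.ctr_j y a, by rw [ctr_ceD_j, ha, map_zero, neg_zero]⟩

end NDGCC.Splitting

end StarMaps

/-- The morphism from a basic subalgebra to an algebra of invariants induced by a homomorphism
compatible with the differentials on the basic subalgebra. -/
def ADGCA.basicHom {k : Type u} [Field k] {A B : ADGCA k} {Y Y' : Type u}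
    {θ : Y → A.X →ₗ[k] A.X} {m : ℤ} (hθ : ∀ y, IsDer A.internal 1 (θ y))
    (hm : ∀ y n, ∀ x ∈ A.gr n, θ y x ∈ A.gr (n + m)) {θ' : Y' → B.X →ₗ[k] B.X}
    (hθ' : ∀ y, IsDer B.internal 0 (θ' y)) (hm' : ∀ y n, ∀ x ∈ B.gr n, θ' y x ∈ B.gr n)
    (hc' : ∀ y x, B.d (θ' y x) = θ' y (B.d x)) (F : A.X →ₐ[k] B.X)
    (hF : ∀ n, ∀ x ∈ A.gr n, F x ∈ B.gr n)
    (hFθ : ∀ x, (∀ y, θ y x = 0 ∧ θ y (A.d x) = 0) → ∀ y, θ' y (F x) = 0)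
    (hFd : ∀ x, (∀ y, θ y x = 0 ∧ θ y (A.d x) = 0) → F (A.d x) = B.d (F x))
    (ha : ∀ x, B.aug (F x) = A.aug x) :
    A.basic θ m hθ hm ⟶ B.invariants θ' hθ' hm' hc' :=
  ADGCA.Hom.mk ((F.comp (Subalgebra.val _)).codRestrict _ (fun x => hFθ x.1 x.2))
    (fun n x hx => hF n x.1 hx) (fun x => Subtype.ext (hFd x.1 x.2)) (fun x => ha x.1)

section RelComparison

variable {k : Type u} [Field k] [CharZero k]
variable {g : Type u} [LieRing g] [LieAlgebra k g] [Module.Finite k g]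
variable {D D' : NDGCC k} (P : NDGCC.Splitting D' D)

namespace NDGCC.Splitting

lemma repAct_starToRep_q {b : (gStar g D').S}
    (hb : ∀ y, P.ctr y b = 0 ∧ P.ctr y ((gStar g D').ceD b) = 0) (y : g) :
    repAct D.omegaComm y (starToRep g D (P.q g b)) = 0 := by
  obtain ⟨a, ha, rfl⟩ := (P.rel_condition g b).1 hb
  rw [P.q_j, ← starToRep_act, ha, map_zero]

lemma starToRep_q_ceD {b : (gStar g D').S}
    (hb : ∀ y, P.ctr y b = 0 ∧ P.ctr y ((gStar g D').ceD b) = 0) :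
    starToRep g D (P.q g ((gStar g D').ceD b)) = repD g D.omegaComm (starToRep g D (P.q g b)) := by
  obtain ⟨a, ha, rfl⟩ := (P.rel_condition g b).1 hb
  have h : P.defect a = 0 := by
    rw [defect_apply]
    exact Finset.sum_eq_zero fun i _ => by rw [ha, map_zero, mul_zero]
  rw [ceD_j, h, sub_zero, P.q_j, P.q_j, starToRep_d]

lemma aug_starToRep_q (b : (gStar g D').S) :
    (rep g D.omegaComm).aug (starToRep g D (P.q g b)) = (gStar g D').cec.aug b := by
  suffices H : ((rep g D.omegaComm).aug.comp (starToRep g D)).comp (P.q g) =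
    (gStar g D').cec.aug from DFunLike.congr_fun H b
  refine star_hom_ext fun φ c => ?_
  have e1 : (rep g D.omegaComm).aug (starToRep g D (P.q g (starGen g D' φ c))) = 0 := by
    rw [q_starGen, starToRep_starGen]
    exact rep_aug_repGen φ _
  exact e1.trans (Pres.aug_gen (gV := (gStar g D').sgr) (R := fun _ _ => False)
    (fun _ _ h => h.elim) _).symm

variable (g) in
/-- The isomorphism from the relative Chevalley-Eilenberg algebra to the algebra of invariants of
the representation algebra of the cobar construction. -/
def relHom : P.rel g ⟶ repInv g D.omegaComm :=
  ADGCA.basicHom (A := (gStar g D').cec) (B := rep g D.omegaComm) (m := 1)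
    (fun y => P.ctr_isDer y) (fun _ => Pres.der_mem _) _ _ _
    ((starToRep g D).comp (P.q g)) (fun _ _ hb => starToRep_mem (starMap_mem P.π P.π_mem hb))
    (fun _ hb => P.repAct_starToRep_q hb) (fun _ hb => P.starToRep_q_ceD hb) P.aug_starToRep_q

lemma relHom_qiso : IsQIso (P.rel g).d (repInv g D.omegaComm).d (ADGCA.lin (P.relHom g)) := by
  refine IsQIso.of_bijective (ADGCA.Hom.map_d (P.relHom g)) ⟨fun b b' h => ?_, fun a => ?_⟩
  · obtain ⟨x, -, hx⟩ := (P.rel_condition g b.1).1 b.2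
    obtain ⟨x', -, hx'⟩ := (P.rel_condition g b'.1).1 b'.2
    have h := congrArg (fun z : (repInv g D.omegaComm).X => repToStar g D z.1) h
    have h : repToStar g D (starToRep g D (P.q g b.1)) =
      repToStar g D (starToRep g D (P.q g b'.1)) := h
    rw [repToStar_starToRep, repToStar_starToRep, ← hx, ← hx', P.q_j, P.q_j] at h
    exact Subtype.ext (by rw [← hx, ← hx', h])
  · have ha : ∀ y : g, starAct D y (repToStar g D a.1) = 0 := fun y => by
      have h := starToRep_act y (repToStar g D a.1)
      rw [starToRep_repToStar (D := D) a.1] at h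
      rw [← repToStar_starToRep (starAct D y (repToStar g D a.1)), h]
      exact (congrArg (repToStar g D) (a.2 y)).trans (map_zero _)
    have h2 := (P.rel_condition g _).2 ⟨_, ha, rfl⟩
    exact ⟨⟨P.j g (repToStar g D a.1), h2⟩, Subtype.ext (by
      change starToRep g D (P.q g (P.j g (repToStar g D a.1))) = a.1
      rw [P.q_j]
      exact starToRep_repToStar (D := D) a.1)⟩

end NDGCC.Splitting

section Splitting

variable (C : DGCC k)

/-- The projection of a coaugmented coalgebra onto its coaugmentation, along the kernel of the
counit. -/
def DGCC.unitProj : C.X →ₗ[k] C.X := (Coalgebra.counit (R := k) (A := C.X)).smulRight C.one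

lemma DGCC.unitProj_apply (c : C.X) :
    C.unitProj c = Coalgebra.counit (R := k) c • C.one := rfl

/-- The section of the projection `C → C̄` with values in the kernel of the counit. -/
def DGCC.ofBar : C.Bar →ₗ[k] C.X := Submodule.liftQ _ (LinearMap.id - C.unitProj) (by
  intro c hc
  obtain ⟨r, rfl⟩ := Submodule.mem_span_singleton.1 hc
  simp [DGCC.unitProj_apply, C.counit_one])

lemma DGCC.ofBar_toBar (c : C.X) :
    C.ofBar (C.toBar c) = c - Coalgebra.counit (R := k) c • C.one := rfl

lemma DGCC.ofBar_mem (n : ℤ) (x) (hx : x ∈ C.barGr n) : C.ofBar x ∈ C.gr n := by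
  obtain ⟨c, hc, rfl⟩ := hx
  rw [C.ofBar_toBar]
  refine sub_mem hc ?_
  by_cases hn : n = 0
  · subst hn; exact Submodule.smul_mem _ _ C.one_mem
  · rw [C.counit_gr n hn c hc, zero_smul]; exact zero_mem _

lemma DGCC.toBar_ofBar (x : C.Bar) : C.toBar (C.ofBar x) = x := by
  obtain ⟨c, rfl⟩ := C.toBar_surj x
  rw [C.ofBar_toBar, map_sub, map_smul, C.toBar_one, smul_zero, sub_zero]

lemma DGCC.counit_ofBar (x : C.Bar) : Coalgebra.counit (R := k) (C.ofBar x) = 0 := by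
  obtain ⟨c, rfl⟩ := C.toBar_surj x
  rw [C.ofBar_toBar, map_sub, map_smul, C.counit_one, smul_eq_mul, mul_one, sub_self]

lemma DGCC.ofBar_d (x : C.Bar) : C.ofBar (C.barD x) = C.d (C.ofBar x) := by
  obtain ⟨c, rfl⟩ := C.toBar_surj x
  rw [C.barD_toBar, C.ofBar_toBar, C.ofBar_toBar, C.counit_d, map_sub, map_smul, C.d_one,
    smul_zero, zero_smul]

lemma DGCC.comul_unitProj_right (c : C.X) :
    TensorProduct.map LinearMap.id C.unitProj (Coalgebra.comul c) = c ⊗ₜ[k] C.one := by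
  have h := congrArg (TensorProduct.map (LinearMap.id : C.X →ₗ[k] C.X)
    (LinearMap.toSpanSingleton k C.X C.one)) (Coalgebra.lTensor_counit_comul (R := k) c)
  rw [LinearMap.lTensor, ← LinearMap.comp_apply, ← TensorProduct.map_comp,
    TensorProduct.map_tmul, LinearMap.toSpanSingleton_apply, one_smul] at h
  exact h

lemma DGCC.comul_unitProj_left (c : C.X) :
    TensorProduct.map C.unitProj LinearMap.id (Coalgebra.comul c) = C.one ⊗ₜ[k] c := by
  have h := congrArg (TensorProduct.map (LinearMap.toSpanSingleton k C.X C.one)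
    (LinearMap.id : C.X →ₗ[k] C.X)) (Coalgebra.rTensor_counit_comul (R := k) c)
  rw [LinearMap.rTensor, ← LinearMap.comp_apply, ← TensorProduct.map_comp,
    TensorProduct.map_tmul, LinearMap.toSpanSingleton_apply, one_smul] at h
  exact h

lemma DGCC.comul_ofBar (x : C.Bar) : Coalgebra.comul (R := k) (C.ofBar x) =
    TensorProduct.map C.ofBar C.ofBar (C.barComul x) +
      (C.one ⊗ₜ[k] C.ofBar x + C.ofBar x ⊗ₜ[k] C.one) := by
  obtain ⟨c, rfl⟩ := C.toBar_surj x
  have e : C.ofBar ∘ₗ C.toBar = LinearMap.id - C.unitProj := LinearMap.ext C.ofBar_toBar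
  have h : TensorProduct.map C.unitProj C.unitProj (Coalgebra.comul c) =
      Coalgebra.counit (R := k) c • (C.one ⊗ₜ[k] C.one) := by
    have h := congrArg (TensorProduct.map (LinearMap.id : C.X →ₗ[k] C.X) C.unitProj)
      (C.comul_unitProj_left c)
    rw [← LinearMap.comp_apply, ← TensorProduct.map_comp, TensorProduct.map_tmul,
      LinearMap.id_comp, LinearMap.comp_id] at h
    rw [h, C.unitProj_apply, TensorProduct.tmul_smul]
    rfl
  have h' : ∀ t : C.X ⊗[k] C.X, TensorProduct.map (LinearMap.id - C.unitProj)
      (LinearMap.id - C.unitProj) t = t - TensorProduct.map C.unitProj LinearMap.id t -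
      TensorProduct.map LinearMap.id C.unitProj t + TensorProduct.map C.unitProj C.unitProj t := by
    intro t
    induction t with
    | zero => simp
    | add s t hs ht => simp only [map_add, hs, ht]; abel
    | tmul x y =>
      simp only [TensorProduct.map_tmul, LinearMap.sub_apply, LinearMap.id_apply,
        TensorProduct.sub_tmul, TensorProduct.tmul_sub]
      abel
  rw [C.barComul_toBar, ← LinearMap.comp_apply (TensorProduct.map C.ofBar C.ofBar),
    ← TensorProduct.map_comp, e, h', h, C.comul_unitProj_left, C.comul_unitProj_right,
    C.ofBar_toBar]
  simp only [map_sub, map_smul, C.comul_one, TensorProduct.tmul_sub, TensorProduct.sub_tmul,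
    TensorProduct.tmul_smul, ← TensorProduct.smul_tmul']
  module

/-- The splitting of a coaugmented coalgebra. -/
def DGCC.splitting : NDGCC.Splitting C.toN C.reduced where
  one := C.one
  ε := Coalgebra.counit (R := k) (A := C.X)
  π := C.toBar
  σ := C.ofBar
  one_mem := C.one_mem
  ε_one := C.counit_one
  ε_gr := C.counit_gr
  σ_π := C.ofBar_toBar
  π_σ := C.toBar_ofBar
  ε_σ := C.counit_ofBar
  π_mem := C.toBar_mem
  σ_mem := C.ofBar_mem
  σ_d := C.ofBar_d
  comul_σ := C.comul_ofBar

end Splitting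

variable (g) in
lemma exists_cecPair_hom (C : DGCC k) : ∃ F : cecPair g C ⟶ repInv g C.omegaComm,
    IsQIso (cecPair g C).d (repInv g C.omegaComm).d (ADGCA.lin F) :=
  ⟨C.splitting.relHom g, C.splitting.relHom_qiso⟩

end RelComparison

/-! ### Partial derivatives on symmetric algebras -/

section Partial

variable {k : Type u} [Field k] {V : Type u} [AddCommGroup V] [Module k V]
  {gV : ℤ → Submodule k V}

variable (k V) in
/-- The square-zero action of `V` on `V ⊕ k`. -/
def sqZeroAct : V →ₗ[k] Module.End k (V × k) :=
  LinearMap.mk₂ k (fun v m => (m.2 • v, 0))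
    (fun v w m => Prod.ext (smul_add _ _ _) (add_zero _).symm)
    (fun r v m => Prod.ext (smul_comm _ _ _) (mul_zero _).symm)
    (fun v m m' => Prod.ext (add_smul _ _ _) (add_zero _).symm)
    (fun r v m => Prod.ext (smul_assoc _ _ _) (mul_zero _).symm)

lemma sqZeroAct_apply (v : V) (m : V × k) : sqZeroAct k V v m = (m.2 • v, 0) := rfl

lemma sqZeroAct_mul (v w : V) : sqZeroAct k V v * sqZeroAct k V w = 0 :=
  LinearMap.ext fun m => by
    rw [Module.End.mul_apply, sqZeroAct_apply, sqZeroAct_apply, zero_smul]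
    rfl

variable (gV) in
/-- The action of the symmetric algebra on `V ⊕ k` through the elements of length at most one. -/
def GSym.trunc : GSym gV →ₐ[k] Module.End k (V × k) :=
  Pres.lift (sqZeroAct k V)
    (fun i j v _ w _ => by rw [sqZeroAct_mul, sqZeroAct_mul, smul_zero]) (fun _ _ h => h.elim)

variable (gV) in
/-- The projection of the symmetric algebra onto the generators. -/
def GSym.pr1 : GSym gV →ₗ[k] V :=
  LinearMap.fst k V k ∘ₗ (GSym.trunc gV).toLinearMap.flip (0, 1)

lemma GSym.pr1_apply (a : GSym gV) : GSym.pr1 gV a = (GSym.trunc gV a (0, 1)).1 := rfl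

lemma GSym.trunc_cons (v : V) (a : GSym gV) (m : V × k) : GSym.trunc gV (GSym.ι gV v * a) m =
    ((GSym.trunc gV a m).2 • v, 0) := by
  rw [map_mul, GSym.trunc, Pres.lift_gen, Module.End.mul_apply, sqZeroAct_apply]

lemma GSym.pr1_one : GSym.pr1 gV 1 = 0 := by
  rw [GSym.pr1_apply, map_one]
  rfl

variable (h : DirectSum.IsInternal gV)

include h in
lemma GSym.trunc_snd (a : GSym gV) : (GSym.trunc gV a (0, 1)).2 = GSym.counit gV a := by
  refine GSym.induction h (p := fun a => (GSym.trunc gV a (0, 1)).2 = GSym.counit gV a) a ?_ ?_ ?_ ?_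
  · rw [map_one, map_one]; rfl
  · intro n v hv a ha
    rw [GSym.trunc_cons, GSym.counit_cons]
  · intro a b ha hb
    rw [map_add, LinearMap.add_apply, Prod.snd_add, ha, hb, map_add]
  · intro r a ha
    rw [map_smul, LinearMap.smul_apply, Prod.smul_snd, ha, map_smul]

include h in
lemma GSym.pr1_cons (v : V) (a : GSym gV) :
    GSym.pr1 gV (GSym.ι gV v * a) = GSym.counit gV a • v := by
  rw [GSym.pr1_apply, GSym.trunc_cons, GSym.trunc_snd h]

include h in
lemma GSym.pr1_mem {n : ℤ} {a : GSym gV} (ha : a ∈ GSym.gr gV n) : GSym.pr1 gV a ∈ gV n := by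
  refine monoGr_induction (p := fun a => GSym.pr1 gV a ∈ gV n) ha (fun a ha => ?_)
    (by rw [map_zero]; exact zero_mem _)
    (fun b c hb hc => by rw [map_add]; exact add_mem hb hc)
    (fun r b hb => by rw [map_smul]; exact Submodule.smul_mem _ _ hb)
  cases ha with
  | one => rw [GSym.pr1_one]; exact zero_mem _
  | @cons i j _ v a hn hv ha =>
    rw [GSym.pr1_cons h]
    by_cases hj : j = 0
    · rw [← hn, hj, add_zero]; exact Submodule.smul_mem _ _ hv
    · rw [GSym.counit_gr j hj a ha.mem, zero_smul]; exact zero_mem _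

/-- The component of the coproduct of length one in the first factor. -/
def GSym.δ : GSym gV →ₗ[k] V ⊗[k] GSym gV := (GSym.pr1 gV).rTensor _ ∘ₗ GSym.comul h

lemma GSym.δ_one : GSym.δ h 1 = 0 := by
  rw [GSym.δ, LinearMap.comp_apply, GSym.comul_one, LinearMap.rTensor_tmul, GSym.pr1_one,
    TensorProduct.zero_tmul]

lemma GSym.δ_cons {n : ℤ} {v : V} (hv : v ∈ gV n) (a : GSym gV) :
    GSym.δ h (GSym.ι gV v * a) = v ⊗ₜ a +
      TensorProduct.map (tw h n) (LinearMap.mulLeft k (GSym.ι gV v)) (GSym.δ h a) := by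
  have key : ∀ t, (GSym.pr1 gV).rTensor _ (GSym.Lam h v t) =
      (LinearMap.toSpanSingleton k V v).rTensor _ ((GSym.counit gV).toLinearMap.rTensor _ t) +
        TensorProduct.map (tw h n) (LinearMap.mulLeft k (GSym.ι gV v))
          ((GSym.pr1 gV).rTensor _ t) := by
    intro t
    induction t with
    | zero => simp
    | add s t hs ht => simp only [map_add, hs, ht]; abel
    | tmul x y =>
      rw [GSym.Lam_tmul' h hv, map_add, LinearMap.rTensor_tmul, LinearMap.rTensor_tmul,
        GSym.pr1_cons h, ← tw_map_zero (GSym.internal h) h _ (fun n x => GSym.pr1_mem h)]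
      rfl
  rw [GSym.δ, LinearMap.comp_apply, GSym.comul_cons, key, GSym.rTensor_counit,
    LinearMap.rTensor_tmul, LinearMap.toSpanSingleton_apply, one_smul]
  rfl

/-- The partial derivative in the direction of a functional on the generators. -/
def GSym.pd (p : Module.Dual k V) : GSym gV →ₗ[k] GSym gV :=
  (TensorProduct.lid k (GSym gV)).toLinearMap ∘ₗ p.rTensor _ ∘ₗ GSym.δ h

lemma GSym.pd_one (p : Module.Dual k V) : GSym.pd h p 1 = 0 := by
  rw [GSym.pd, LinearMap.comp_apply, LinearMap.comp_apply, GSym.δ_one, map_zero, map_zero]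

lemma GSym.pd_cons (p : Module.Dual k V) {n : ℤ} {v : V} (hv : v ∈ gV n) (a : GSym gV) :
    GSym.pd h p (GSym.ι gV v * a) = p v • a + GSym.ι gV v * GSym.pd h (p ∘ₗ tw h n) a := by
  simp only [GSym.pd, LinearMap.comp_apply, LinearEquiv.coe_coe]
  rw [GSym.δ_cons h hv, map_add, map_add, LinearMap.rTensor_tmul, TensorProduct.lid_tmul]
  congr 1
  induction GSym.δ h a with
  | zero => simp
  | add s t hs ht => simp only [map_add, hs, ht, mul_add]
  | tmul x y => simp

/-- The Euler operator. -/
def GSym.euler : GSym gV →ₗ[k] GSym gV :=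
  LinearMap.mul' k _ ∘ₗ (GSym.ι gV).rTensor _ ∘ₗ GSym.δ h

lemma GSym.euler_one : GSym.euler h 1 = 0 := by
  rw [GSym.euler, LinearMap.comp_apply, LinearMap.comp_apply, GSym.δ_one, map_zero, map_zero]

lemma GSym.euler_cons (v : V) (a : GSym gV) : GSym.euler h (GSym.ι gV v * a) =
    GSym.ι gV v * a + GSym.ι gV v * GSym.euler h a := by
  refine hom_induction h (p := fun v => GSym.euler h (GSym.ι gV v * a) =
    GSym.ι gV v * a + GSym.ι gV v * GSym.euler h a) v (fun n v hv => ?_)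
    (fun v w hv hw => by rw [map_add, add_mul, map_add, hv, hw, add_mul]; abel)
  simp only [GSym.euler, LinearMap.comp_apply]
  rw [GSym.δ_cons h hv, map_add, map_add, LinearMap.rTensor_tmul, LinearMap.mul'_apply]
  congr 1
  generalize GSym.δ h a = t
  induction t with
  | zero => simp
  | add s t hs ht => simp only [map_add, hs, ht, mul_add]
  | tmul w y =>
    rw [TensorProduct.map_tmul, LinearMap.rTensor_tmul, LinearMap.rTensor_tmul,
      LinearMap.mul'_apply, LinearMap.mul'_apply, LinearMap.mulLeft_apply, ← mul_assoc, ← mul_assoc]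
    congr 1
    refine hom_induction h (p := fun w => GSym.ι gV (tw h n w) * GSym.ι gV v =
      GSym.ι gV v * GSym.ι gV w) w (fun m w hw => ?_)
      (fun v w hv hw => by rw [map_add, map_add, add_mul, hv, hw, map_add, mul_add])
    rw [tw_of_mem h n hw, map_smul, smul_mul_assoc]
    exact (Pres.gen_comm (R := fun _ _ => False) n m v hv w hw).symm

variable (k V) in
/-- The grading of the generators for which all of them have degree one. -/
def lenGr (i : ℤ) : Submodule k V := if i = 1 then ⊤ else ⊥

variable (k V) in
lemma lenGr_internal : DirectSum.IsInternal (lenGr k V) := by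
  refine isInternal_of_proj (fun n => if n = 1 then LinearMap.id else 0) (fun n x hx => ?_)
    (fun m n x hx hne => ?_) (fun x => Submodule.mem_iSup_of_mem 1 (by simp [lenGr]))
  · by_cases hn : n = 1
    · simp [hn]
    · simp only [lenGr, hn, if_false, Submodule.mem_bot] at hx
      simp [hx]
  · by_cases hn : n = 1
    · simp [← hn, hne.symm]
    · simp only [lenGr, hn, if_false, Submodule.mem_bot] at hx
      simp [hx]

variable (gV) in
/-- The length grading of the symmetric algebra. -/
abbrev GSym.len (n : ℤ) : Submodule k (GSym gV) := monoGr (lenGr k V) (GSym.ι gV) n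

include h in
lemma GSym.len_internal : DirectSum.IsInternal (GSym.len gV) :=
  (GSym.isGen_of_bigraded h (lenGr_internal k V) (fun n w x hx => by
    by_cases hw : w = 1
    · simp [lenGr, hw]
    · simp only [lenGr, hw, if_false, Submodule.mem_bot] at hx ⊢
      rw [hx, map_zero])).grInternal

lemma isMono_lenGr {n : ℤ} {a : GSym gV} (ha : IsMono (lenGr k V) (GSym.ι gV) n a) :
    a = 0 ∨ (0 ≤ n ∧ (n = 0 → a = 1)) := by
  induction ha with
  | one => exact Or.inr ⟨le_rfl, fun _ => rfl⟩
  | @cons i j n v a hn hv ha ih =>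
    by_cases hi : i = 1
    · rcases ih with rfl | ih
      · exact Or.inl (mul_zero _)
      · exact Or.inr ⟨by omega, by omega⟩
    · simp only [lenGr, hi, if_false, Submodule.mem_bot] at hv
      exact Or.inl (by rw [hv, map_zero, zero_mul])

lemma GSym.len_neg {n : ℤ} (hn : n < 0) {a : GSym gV} (ha : a ∈ GSym.len gV n) : a = 0 :=
  monoGr_induction (p := fun a => a = 0) ha
    (fun b hb => (isMono_lenGr hb).resolve_right (by omega)) rfl
    (fun b c hb hc => by rw [hb, hc, add_zero]) (fun r b hb => by rw [hb, smul_zero])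

lemma GSym.len_zero {a : GSym gV} (ha : a ∈ GSym.len gV 0) : ∃ r, a = algebraMap k _ r :=
  monoGr_induction (p := fun a => ∃ r, a = algebraMap k (GSym gV) r) ha
    (fun b hb => by
      rcases isMono_lenGr hb with rfl | hb
      · exact ⟨0, (map_zero _).symm⟩
      · exact ⟨1, by rw [hb.2 rfl, map_one]⟩)
    ⟨0, (map_zero _).symm⟩
    (fun b c ⟨r, hr⟩ ⟨s, hs⟩ => ⟨r + s, by rw [hr, hs, map_add]⟩)
    (fun r b ⟨s, hs⟩ => ⟨r * s, by rw [hs, map_mul, Algebra.smul_def]⟩)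

lemma GSym.euler_len {n : ℤ} {a : GSym gV} (ha : a ∈ GSym.len gV n) :
    GSym.euler h a = (n : k) • a := by
  refine monoGr_induction (p := fun a => GSym.euler h a = (n : k) • a) ha (fun b hb => ?_) (by simp)
    (fun b c hb hc => by rw [map_add, hb, hc, smul_add])
    (fun r b hb => by rw [map_smul, hb, smul_comm])
  clear ha
  induction hb with
  | one => rw [GSym.euler_one, Int.cast_zero, zero_smul]
  | @cons i j n v a hn hv ha ih =>
    by_cases hi : i = 1
    · rw [GSym.euler_cons, ih, ← hn, hi, Int.cast_add, Int.cast_one, add_smul, one_smul,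
        mul_smul_comm]
    · simp only [lenGr, hi, if_false, Submodule.mem_bot] at hv
      rw [hv, map_zero, zero_mul, map_zero, smul_zero]

lemma GSym.pd_len (p : Module.Dual k V) {n : ℤ} {a : GSym gV} (ha : a ∈ GSym.len gV n) :
    GSym.pd h p a ∈ GSym.len gV (n + -1) := by
  refine monoGr_induction (p := fun a => GSym.pd h p a ∈ GSym.len gV (n + -1)) ha (fun b hb => ?_)
    (by rw [map_zero]; exact zero_mem _)
    (fun b c hb hc => by rw [map_add]; exact add_mem hb hc)
    (fun r b hb => by rw [map_smul]; exact Submodule.smul_mem _ _ hb)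
  clear ha
  induction hb generalizing p with
  | one => rw [GSym.pd_one]; exact zero_mem _
  | @cons i j n v a hn hv ha ih =>
    by_cases hi : i = 1
    · refine hom_induction h (p := fun v => GSym.pd h p (GSym.ι gV v * a) ∈ GSym.len gV (n + -1)) v
        (fun m v hv => ?_) (fun v w hv hw => by rw [map_add, add_mul, map_add]; exact add_mem hv hw)
      rw [GSym.pd_cons h p hv]
      refine add_mem (Submodule.smul_mem _ _ ?_) ?_
      · rw [show n + -1 = j by omega]; exact ha.mem
      · have := monoGr_mul (monoGr_ι (gV := lenGr k V) (ι := GSym.ι gV) (n := 1) (v := v)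
          (by simp [lenGr])) (ih (p ∘ₗ tw h m))
        rwa [show 1 + (j + -1) = n + -1 by omega] at this
    · simp only [lenGr, hi, if_false, Submodule.mem_bot] at hv
      rw [hv, map_zero, zero_mul, map_zero]
      exact zero_mem _

lemma eq_zero_of_separating {Z : Type u} [AddCommGroup Z] [Module k Z] (P : Set (Module.Dual k V))
    (hP : ∀ v, (∀ p ∈ P, p v = 0) → v = 0) {t : V ⊗[k] Z} (ht : ∀ p ∈ P, p.rTensor Z t = 0) :
    t = 0 := by
  let b := Module.Free.chooseBasis k Z
  refine (TensorProduct.equivFinsuppOfBasisRight (M := V) b).injective (Finsupp.ext fun i => ?_)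
  rw [map_zero, Finsupp.zero_apply]
  refine hP _ fun p hp => ?_
  have key : ∀ t : V ⊗[k] Z, p (TensorProduct.equivFinsuppOfBasisRight (M := V) b t i) =
      TensorProduct.equivFinsuppOfBasisRight (M := k) b (p.rTensor Z t) i := by
    intro t
    induction t with
    | zero => simp
    | add s t hs ht => simp only [map_add, Finsupp.add_apply, hs, ht]
    | tmul v z => simp [TensorProduct.equivFinsuppOfBasisRight_apply_tmul]
  rw [key, ht p hp, map_zero, Finsupp.zero_apply]

/-- A subspace of the symmetric algebra which is closed under sufficiently many partial derivatives
and contains no nonzero scalars vanishes. -/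
lemma GSym.eq_zero_of_closed [CharZero k] (P : Set (Module.Dual k V))
    (hP : ∀ v, (∀ p ∈ P, p v = 0) → v = 0) (N : Submodule k (GSym gV))
    (hN : ∀ p ∈ P, ∀ a ∈ N, GSym.pd h p a ∈ N) (h1 : ∀ r, algebraMap k (GSym gV) r ∈ N → r = 0)
    (a : GSym gV) (ha : a ∈ N) : a = 0 := by
  have H := GSym.len_internal h
  have zero_of_proj : ∀ a, (∀ i, 0 ≤ i → proj H i a = 0) → a = 0 := by
    intro a ha
    obtain ⟨s, hs, -⟩ := mem_iSup_proj H a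
    rw [hs]
    refine Finset.sum_eq_zero fun i _ => ?_
    by_cases hi : 0 ≤ i
    · exact ha i hi
    · exact GSym.len_neg (by omega) (proj_mem H i a)
  have key : ∀ n : ℕ, ∀ a ∈ N, (∀ i : ℤ, n ≤ i → proj H i a = 0) → a = 0 := by
    intro n
    induction n with
    | zero => exact fun a _ hi => zero_of_proj a fun i h0 => hi i (by simpa using h0)
    | succ n ih =>
      intro a ha hi
      have hpd : ∀ p ∈ P, GSym.pd h p a = 0 := fun p hp => by
        refine ih _ (hN p hp a ha) fun i hin => ?_
        have e := proj_map H H (-1) (GSym.pd h p) (fun n x => GSym.pd_len h p) (i + 1) a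
        rw [hi (i + 1) (by push_cast; omega), map_zero, show i + 1 + -1 = i by ring] at e
        exact e.symm
      have hδ : GSym.δ h a = 0 := eq_zero_of_separating P hP fun p hp => by
        have := hpd p hp
        simp only [GSym.pd, LinearMap.comp_apply, LinearEquiv.coe_coe,
          LinearEquiv.map_eq_zero_iff] at this
        exact this
      have he : GSym.euler h a = 0 := by
        rw [GSym.euler, LinearMap.comp_apply, LinearMap.comp_apply, hδ, map_zero, map_zero]
      have hp : ∀ i : ℤ, i ≠ 0 → proj H i a = 0 := by
        intro i hi0
        have e := proj_map H H 0 (GSym.euler h) (fun n x hx => by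
          rw [add_zero, GSym.euler_len h hx]; exact Submodule.smul_mem _ _ hx) i a
        rw [he, map_zero, GSym.euler_len h (proj_mem H i a)] at e
        exact (smul_eq_zero.1 e).resolve_left (Int.cast_ne_zero.2 hi0)
      obtain ⟨s, hs, -⟩ := mem_iSup_proj H a
      have ha0 : a = proj H 0 a := by
        have : a - proj H 0 a = 0 := zero_of_proj _ fun i _ => by
          rw [map_sub]
          by_cases hi0 : i = 0
          · subst hi0; rw [proj_of_mem H (proj_mem H 0 a), sub_self]
          · rw [hp i hi0, proj_of_ne H (proj_mem H 0 a) (Ne.symm hi0), sub_zero]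
        exact sub_eq_zero.1 this
      have hlen := proj_mem H 0 a
      rw [← ha0] at hlen
      obtain ⟨r, hr⟩ := GSym.len_zero hlen
      rw [hr] at ha ⊢
      rw [h1 r ha, map_zero]
  obtain ⟨s, -, hs⟩ := mem_iSup_proj H a
  refine key (s.sup Int.natAbs + 1) a ha fun i hi => hs i fun his => ?_
  have : i.natAbs ≤ s.sup Int.natAbs := Finset.le_sup his
  omega

end Partial

/-! ### Chevalley-Eilenberg algebras as duals of Chevalley-Eilenberg chains -/

section Pairing

variable {k : Type u} [Field k]

lemma iSup_monoGr_eq_top {V : Type u} [AddCommGroup V] [Module k V] {gV : ℤ → Submodule k V}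
    (h : DirectSum.IsInternal gV) {wt : ℤ → Submodule k V} (ht : ⨆ i, wt i = ⊤) :
    ⨆ i, monoGr wt (GSym.ι gV) i = ⊤ := by
  refine eq_top_iff.2 fun a _ => ?_
  refine GSym.induction h (p := fun a => a ∈ ⨆ i, monoGr wt (GSym.ι gV) i) a
    (Submodule.mem_iSup_of_mem 0 monoGr_one) (fun n v hvn a ha => ?_) (fun a b => add_mem)
    (fun r a ha => Submodule.smul_mem _ _ ha)
  clear hvn
  have hv : v ∈ ⨆ i, wt i := by rw [ht]; trivial
  induction hv using Submodule.iSup_induction' with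
  | zero => rw [map_zero, zero_mul]; exact zero_mem _
  | add v w _ _ hv hw => rw [map_add, add_mul]; exact add_mem hv hw
  | mem i v hv =>
    induction ha using Submodule.iSup_induction' with
    | zero => rw [mul_zero]; exact zero_mem _
    | add a b _ _ ha hb => rw [mul_add]; exact add_mem ha hb
    | mem j a ha => exact Submodule.mem_iSup_of_mem (i + j) (monoGr_mul (monoGr_ι hv) ha)

section Finiteness

variable {V A : Type u} [AddCommGroup V] [Module k V] [Ring A] [Algebra k A] {ι : V →ₗ[k] A}
  {wt : ℤ → Submodule k V} (hn : ∀ i ≤ 0, wt i = ⊥)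

include hn in
lemma IsMono.eq_zero_of_neg {n : ℤ} {a : A} (ha : IsMono wt ι n a) : a = 0 ∨ 0 ≤ n := by
  induction ha with
  | one => exact Or.inr le_rfl
  | @cons i j n v a e hv ha ih =>
    by_cases hi : i ≤ 0
    · rw [hn i hi, Submodule.mem_bot] at hv
      exact Or.inl (by rw [hv, map_zero, zero_mul])
    · rcases ih with rfl | ih
      · exact Or.inl (mul_zero _)
      · exact Or.inr (by omega)

include hn in
lemma monoGr_eq_bot {n : ℤ} (h : n < 0) : monoGr wt ι n = ⊥ :=
  Submodule.span_eq_bot.2 fun _ ha => (IsMono.eq_zero_of_neg hn ha).resolve_right (by omega)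

include hn in
lemma monoGr_finite (hf : ∀ i, Module.Finite k (wt i)) (n : ℤ) : Module.Finite k (monoGr wt ι n) := by
  have key : ∀ N : ℕ, ∀ n : ℤ, n ≤ N → Module.Finite k (monoGr wt ι n) := by
    intro N
    induction N using Nat.strong_induction_on with
    | _ N ih =>
      intro n hN
      have hle : monoGr wt ι n ≤ (k ∙ (1 : A)) ⊔ (Finset.Icc 1 n).sup fun i =>
          Submodule.map₂ (LinearMap.mul k A) ((wt i).map ι) (monoGr wt ι (n - i)) := by
        refine Submodule.span_le.2 fun a ha => ?_
        cases ha with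
        | one => exact Submodule.mem_sup_left (Submodule.mem_span_singleton_self _)
        | @cons i j _ v a e hv ha =>
          by_cases hi : i ≤ 0
          · rw [hn i hi, Submodule.mem_bot] at hv
            rw [hv, map_zero, zero_mul]
            exact zero_mem _
          · rcases IsMono.eq_zero_of_neg hn ha with rfl | hj
            · rw [mul_zero]; exact zero_mem _
            · refine Submodule.mem_sup_right (Finset.le_sup (b := i) (f := fun i =>
                Submodule.map₂ (LinearMap.mul k A) ((wt i).map ι) (monoGr wt ι (n - i)))
                (Finset.mem_Icc.2 ⟨by omega, by omega⟩) ?_)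
              refine Submodule.apply_mem_map₂ _ (Submodule.mem_map_of_mem hv) ?_
              rw [show n - i = j by omega]
              exact ha.mem
      have hfg : ((k ∙ (1 : A)) ⊔ (Finset.Icc 1 n).sup fun i =>
          Submodule.map₂ (LinearMap.mul k A) ((wt i).map ι) (monoGr wt ι (n - i))).FG := by
        refine (Submodule.fg_span_singleton _).sup (Submodule.fg_finset_sup _ _ fun i hi => ?_)
        rw [Finset.mem_Icc] at hi
        have hN1 : n - i ≤ ((N - 1 : ℕ) : ℤ) := by omega
        refine Submodule.FG.map₂ _ ((Module.Finite.iff_fg.1 (hf i)).map ι) (Module.Finite.iff_fg.1 ?_)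
        exact ih (N - 1) (by omega) (n - i) hN1
      have := Module.Finite.iff_fg.2 hfg
      exact Submodule.finiteDimensional_of_le hle
  exact key n.toNat n (Int.self_le_toNat n)

end Finiteness

/-- A perfect pairing of a Lie coalgebra and a Lie algebra equipped with weights. -/
structure CEPairing (G : DGLC k) (L : DGLA k) (wG : ℤ → Submodule k G.X)
    (wL : ℤ → Submodule k L.X) where
  β : G.X →ₗ[k] L.X →ₗ[k] k
  deg : ∀ i j, i + j ≠ 0 → ∀ x ∈ G.gr i, ∀ v ∈ L.gr j, β x v = 0
  wt : ∀ i j, i ≠ j → ∀ x ∈ wG i, ∀ v ∈ wL j, β x v = 0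
  d : ∀ x v, β (G.d x) v = β x (L.d v)
  cobr : ∀ x v w, LinearMap.mul' k k (TensorProduct.map (β.flip v) (β.flip w) (G.cobr x)) =
    β x (L.br v w)
  left : ∀ x, (∀ v, β x v = 0) → x = 0
  right : ∀ v, (∀ x, β x v = 0) → v = 0
  topG : ⨆ i, wG i = ⊤
  topL : ⨆ i, wL i = ⊤
  neg : ∀ i ≤ 0, wL i = ⊥
  fin : ∀ i, Module.Finite k (wL i)
  fam : L.WeightFamily wL

namespace CEPairing

variable {G : DGLC k} {L : DGLA k} {wG : ℤ → Submodule k G.X} {wL : ℤ → Submodule k L.X}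
  (P : CEPairing G L wG wL)

/-- The cochains. -/
abbrev Du : Type u := (ceChains L).Dual (ceWeight P.fam)

/-- The evaluation of cochains. -/
def evS : P.Du →ₗ[k] L.S →ₗ[k] k := (ceChains L).ev (ceWeight P.fam)

lemma evS_mul (f f' : P.Du) (a : L.S) : P.evS (f * f') a =
    LinearMap.mul' k k (TensorProduct.map (P.evS f) (P.evS f') (GSym.comul L.c_internal a)) := rfl

lemma evS_one (a : L.S) : P.evS 1 a = GSym.counit L.cgr a := rfl

lemma du_ext {f f' : P.Du} (h : ∀ a, P.evS f a = P.evS f' a) : f = f' :=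
  (ceChains L).dual_ext h

/-- The cochain of length one defined by an element of `G`. -/
def cochain (x : G.X) : L.S →ₗ[k] k := -(P.β x ∘ₗ GSym.pr1 L.cgr)

lemma cochain_apply (x : G.X) (a : L.S) : P.cochain x a = -P.β x (GSym.pr1 L.cgr a) := rfl

lemma cochain_add (x y : G.X) : P.cochain (x + y) = P.cochain x + P.cochain y :=
  LinearMap.ext fun a => by
    simp only [cochain_apply, map_add, LinearMap.add_apply, neg_add]

lemma cochain_gr {i n : ℤ} (hn : n ≠ -i) {x : G.X} (hx : x ∈ G.gr (i + 1)) {a : L.S}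
    (ha : a ∈ GSym.gr L.cgr n) : P.cochain x a = 0 := by
  rw [cochain_apply, P.deg (i + 1) (n - 1) (by omega) x hx _ (GSym.pr1_mem L.c_internal ha),
    neg_zero]

include P in
lemma pr1_wt {n : ℤ} {a : L.S} (ha : a ∈ monoGr wL L.ι n) : GSym.pr1 L.cgr a ∈ wL n := by
  refine monoGr_induction (p := fun a => GSym.pr1 L.cgr a ∈ wL n) ha (fun a ha => ?_)
    (by rw [map_zero]; exact zero_mem _)
    (fun b c hb hc => by rw [map_add]; exact add_mem hb hc)
    (fun r b hb => by rw [map_smul]; exact Submodule.smul_mem _ _ hb)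
  cases ha with
  | one => rw [GSym.pr1_one]; exact zero_mem _
  | @cons i j _ v a hn hv ha =>
    rw [GSym.pr1_cons L.c_internal]
    by_cases hj : j = 0
    · rw [← hn, hj, add_zero]; exact Submodule.smul_mem _ _ hv
    · have e : GSym.counit L.cgr a = 0 := (ceWeight P.fam).counit j hj a ha.mem
      rw [e, zero_smul]; exact zero_mem _

lemma cochain_wt {i n : ℤ} (hn : n ≠ i) {x : G.X} (hx : x ∈ wG i) {a : L.S}
    (ha : a ∈ monoGr wL L.ι n) : P.cochain x a = 0 := by
  rw [cochain_apply, P.wt i n hn.symm x hx _ (P.pr1_wt ha), neg_zero]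

lemma finSupp_of {X : Type u} [AddCommGroup X] [Module k X] {gr : ℤ → Submodule k X}
    {f : X →ₗ[k] k} (i : ℤ) (h : ∀ n, n ≠ i → ∀ x ∈ gr n, f x = 0) : FinSupp gr f :=
  ⟨i.natAbs + 1, fun n hn x hx => h n (by rintro rfl; push_cast at hn; omega) x hx⟩

lemma cochain_finSupp (x : G.X) : FinSupp (GSym.gr L.cgr) (P.cochain x) :=
  hom_induction G.s_internal (p := fun x => FinSupp (GSym.gr L.cgr) (P.cochain x)) x
    (fun i _ hx => finSupp_of (-i) fun _ hn _ ha => P.cochain_gr hn hx ha)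
    (fun x y hx hy => by rw [cochain_add]; exact hx.add hy)

lemma cochain_finSupp' (x : G.X) : FinSupp (ceWt L wL) (P.cochain x) := by
  have hx : x ∈ ⨆ i, wG i := by rw [P.topG]; trivial
  induction hx using Submodule.iSup_induction' with
  | zero => exact ⟨0, fun n _ a _ => by
      change -P.β 0 (GSym.pr1 L.cgr a) = 0
      rw [map_zero, LinearMap.zero_apply, neg_zero]⟩
  | add x y _ _ hx hy => rw [cochain_add]; exact hx.add hy
  | mem i x hx => exact finSupp_of i fun _ hn _ ha => P.cochain_wt hn hx ha

/-- The cochains of length one. -/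
def gen : G.X →ₗ[k] P.Du where
  toFun x := (ceChains L).mkDual (ceWeight P.fam) (P.cochain x) (P.cochain_finSupp x)
    (P.cochain_finSupp' x)
  map_add' x y := P.du_ext fun a => LinearMap.congr_fun (P.cochain_add x y) a
  map_smul' r x := P.du_ext fun a => by
    change -P.β (r • x) (GSym.pr1 L.cgr a) = r • -P.β x (GSym.pr1 L.cgr a)
    rw [map_smul, LinearMap.smul_apply, smul_neg]

lemma evS_gen (x : G.X) (a : L.S) : P.evS (P.gen x) a = -P.β x (GSym.pr1 L.cgr a) := rfl

lemma gen_mem {i : ℤ} {x : G.X} (hx : x ∈ G.sgr i) :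
    P.gen x ∈ (ceChains L).dualGr (ceWeight P.fam) i :=
  fun _ hn _ ha => P.cochain_gr hn hx ha

lemma gen_wt {i : ℤ} {x : G.X} (hx : x ∈ wG i) :
    P.gen x ∈ (ceChains L).dualWt (ceWeight P.fam) i :=
  fun _ hn _ ha => P.cochain_wt hn hx ha

/-- The homomorphism from the Chevalley-Eilenberg algebra of `G` to the cochains of `L`. -/
def toDu : G.S →ₐ[k] P.Du :=
  Pres.lift P.gen (fun i j v hv w hw =>
    ((ceChains L).dual (ceWeight P.fam)).mul_comm i j _ (P.gen_mem hv) _ (P.gen_mem hw))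
    (fun _ _ h => h.elim)

lemma toDu_s (x : G.X) : P.toDu (G.s x) = P.gen x := Pres.lift_gen _ _ _ _

lemma toDu_mem {n : ℤ} {a : G.S} (ha : a ∈ GSym.gr G.sgr n) :
    P.toDu a ∈ (ceChains L).dualGr (ceWeight P.fam) n := by
  refine monoGr_induction (p := fun a => P.toDu a ∈ (ceChains L).dualGr (ceWeight P.fam) n) ha
    (fun b hb => ?_) (by rw [map_zero]; exact zero_mem _)
    (fun b c hb hc => by rw [map_add]; exact add_mem hb hc)
    (fun r b hb => by rw [map_smul]; exact Submodule.smul_mem _ r hb)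
  clear ha
  induction hb with
  | one => rw [map_one]; exact ((ceChains L).dual (ceWeight P.fam)).one_mem
  | @cons i j _ v a hn hv ha ih =>
    rw [map_mul, P.toDu_s, ← hn]
    exact ((ceChains L).dual (ceWeight P.fam)).mul_mem i j _ (P.gen_mem hv) _ ih

lemma toDu_wt {n : ℤ} {a : G.S} (ha : a ∈ monoGr wG G.s n) :
    P.toDu a ∈ (ceChains L).dualWt (ceWeight P.fam) n := by
  refine monoGr_induction (p := fun a => P.toDu a ∈ (ceChains L).dualWt (ceWeight P.fam) n) ha
    (fun b hb => ?_) (by rw [map_zero]; exact zero_mem _)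
    (fun b c hb hc => by rw [map_add]; exact add_mem hb hc)
    (fun r b hb => by rw [map_smul]; exact Submodule.smul_mem _ r hb)
  clear ha
  induction hb with
  | one => rw [map_one]; exact fun m hm x hx => (ceWeight P.fam).counit m hm x hx
  | @cons i j _ v a hn hv ha ih =>
    rw [map_mul, P.toDu_s, ← hn]
    exact (ceChains L).dualWt_mul (ceWeight P.fam) i j _ (P.gen_wt hv) _ ih

lemma evS_gen_mul (x : G.X) (f : P.Du) (a : L.S) :
    P.evS (P.gen x * f) a = -P.evS f (GSym.pd L.c_internal (P.β x) a) := by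
  rw [evS_mul, GSym.pd, LinearMap.comp_apply, LinearMap.comp_apply, GSym.δ, LinearMap.comp_apply]
  induction GSym.comul L.c_internal a with
  | zero => simp
  | add s t hs ht => simp only [map_add, hs, ht, neg_add]
  | tmul b c => simp [evS_gen]

/-- Contractions of cochains. -/
lemma evS_ι_mul {n : ℤ} {v : L.X} (hv : v ∈ L.cgr n) (ω : G.S) (a : L.S) :
    P.evS (P.toDu ω) (L.ι v * a) = -P.evS (P.toDu (GSym.pd G.s_internal (P.β.flip v) ω)) a := by
  refine GSym.induction G.s_internal (p := fun ω => ∀ a, P.evS (P.toDu ω) (L.ι v * a) =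
    -P.evS (P.toDu (GSym.pd G.s_internal (P.β.flip v) ω)) a) ω (fun a => ?_) (fun m x hx ω ih a => ?_)
    (fun ω ω' h h' a => ?_) (fun r ω h a => ?_) a
  · rw [map_one, evS_one, GSym.counit_cons, GSym.pd_one, map_zero, map_zero, LinearMap.zero_apply,
      neg_zero]
  · have h1 : P.β x ∘ₗ tw L.c_internal n = sgn k (n * m) • P.β x := by
      refine ext_gr L.c_internal fun j w hw => ?_
      rw [LinearMap.comp_apply, tw_of_mem _ _ hw, map_smul, LinearMap.smul_apply]
      by_cases hj : j = -m
      · rw [hj, mul_neg, sgn_neg]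
      · rw [P.deg (m + 1) (j - 1) (by omega) x hx w hw, smul_zero, smul_zero]
    have h2 : P.β.flip v ∘ₗ tw G.s_internal m = sgn k (n * m) • P.β.flip v := by
      refine ext_gr G.s_internal fun j y hy => ?_
      rw [LinearMap.comp_apply, tw_of_mem _ _ hy, map_smul, LinearMap.smul_apply]
      by_cases hj : j = -n
      · rw [hj, mul_neg, sgn_neg, mul_comm]
      · rw [LinearMap.flip_apply, P.deg (j + 1) (n - 1) (by omega) y hy v hv, smul_zero, smul_zero]
    have h3 : ∀ (r : k) (p : Module.Dual k L.X) (a : L.S), GSym.pd L.c_internal (r • p) a =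
        r • GSym.pd L.c_internal p a := fun r p a => by
      simp only [GSym.pd, LinearMap.comp_apply, LinearMap.rTensor_smul, LinearMap.smul_apply,
        map_smul]
    have h4 : ∀ (r : k) (p : Module.Dual k G.X) (a : G.S), GSym.pd G.s_internal (r • p) a =
        r • GSym.pd G.s_internal p a := fun r p a => by
      simp only [GSym.pd, LinearMap.comp_apply, LinearMap.rTensor_smul, LinearMap.smul_apply,
        map_smul]
    have e : ∀ ω', P.toDu (GSym.ι G.sgr x * ω') = P.gen x * P.toDu ω' := fun ω' =>
      (map_mul P.toDu _ _).trans (congrArg (· * P.toDu ω') (P.toDu_s x))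
    rw [e, P.evS_gen_mul, GSym.pd_cons _ _ hv, GSym.pd_cons _ _ hx, h1, h2, h3, h4,
      map_add, map_smul, mul_smul_comm, map_smul, ih, map_add, map_smul, mul_smul_comm, map_smul,
      e, map_add, map_smul, map_smul, LinearMap.add_apply, LinearMap.smul_apply,
      LinearMap.smul_apply, P.evS_gen_mul, LinearMap.flip_apply]
  · simp only [map_add, LinearMap.add_apply, h, h', neg_add]
  · simp only [map_smul, LinearMap.smul_apply, h, smul_neg]

section Bijectivity

variable [CharZero k]

lemma toDu_injective : Function.Injective P.toDu := by
  refine (injective_iff_map_eq_zero P.toDu).2 fun ω hω => ?_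
  refine GSym.eq_zero_of_closed G.s_internal {p | ∃ n, ∃ v ∈ L.cgr n, p = P.β.flip v}
    (fun x hx => P.left x fun v => ?_) (LinearMap.ker P.toDu.toLinearMap) ?_ (fun r hr => ?_) ω hω
  · exact hom_induction L.c_internal (p := fun v => P.β x v = 0) v
      (fun n v hv => hx _ ⟨n, v, hv, rfl⟩) (fun v w hv hw => by rw [map_add, hv, hw, add_zero])
  · rintro _ ⟨n, v, hv, rfl⟩ a ha
    have ha : P.toDu a = 0 := ha
    refine P.du_ext fun b => ?_
    have := P.evS_ι_mul hv a b
    rw [ha, map_zero, LinearMap.zero_apply, eq_comm, neg_eq_zero] at this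
    rw [map_zero, LinearMap.zero_apply]
    exact this
  · have hr : P.toDu (algebraMap k _ r) = 0 := hr
    rw [AlgHom.commutes] at hr
    have := congrArg ((ceChains L).dual (ceWeight P.fam)).aug hr
    exact (((ceChains L).dual (ceWeight P.fam)).aug.commutes r).symm.trans
      (this.trans (map_zero ((ceChains L).dual (ceWeight P.fam)).aug))

lemma eq_zero_of_evS {a : L.S} (ha : ∀ ω, P.evS (P.toDu ω) a = 0) : a = 0 := by
  let N : Submodule k L.S :=
    { carrier := {a | ∀ ω, P.evS (P.toDu ω) a = 0}
      add_mem' := fun ha hb ω => by rw [map_add, ha, hb, add_zero]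
      zero_mem' := fun ω => map_zero _
      smul_mem' := fun r a ha ω => by rw [map_smul, ha, smul_zero] }
  refine GSym.eq_zero_of_closed L.c_internal (Set.range P.β)
    (fun v hv => P.right v fun x => hv _ ⟨x, rfl⟩) N ?_ (fun r hr => ?_) a ha
  · rintro _ ⟨x, rfl⟩ a ha ω
    have := ha (G.s x * ω)
    rwa [map_mul, P.toDu_s, P.evS_gen_mul, neg_eq_zero] at this
  · have := hr 1
    rw [map_one, evS_one, AlgHom.commutes] at this
    exact this

lemma toDu_surjective : Function.Surjective P.toDu := by
  intro f
  obtain ⟨N, hN⟩ := (ceChains L).ev_finSupp' f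
  let K : Submodule k L.S := (Finset.Ico (0 : ℤ) N).sup fun n => monoGr wL L.ι n
  have : Module.Finite k K := Module.Finite.iff_fg.2
    (Submodule.fg_finset_sup _ _ fun n _ => Module.Finite.iff_fg.1 (monoGr_finite P.neg P.fin n))
  let M : Submodule k G.S := ⨆ i : ℤ, ⨆ _ : i < N, monoGr wG G.s i
  have hM : ∀ ω ∈ M, ∀ n : ℤ, N ≤ n → ∀ a ∈ monoGr wL L.ι n, P.evS (P.toDu ω) a = 0 := by
    intro ω hω n hn a ha
    let Z : Submodule k G.S := LinearMap.ker ((P.evS.flip a) ∘ₗ P.toDu.toLinearMap)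
    have : M ≤ Z := iSup₂_le fun i hi ω hω => by
      change P.evS (P.toDu ω) a = 0
      exact P.toDu_wt hω n (by omega) a ha
    exact this hω
  have hK : ∀ n : ℤ, N ≤ n → ∀ ω ∈ monoGr wG G.s n, ∀ a ∈ K, P.evS (P.toDu ω) a = 0 := by
    intro n hn ω hω a ha
    have : K ≤ LinearMap.ker (P.evS (P.toDu ω)) := Finset.sup_le fun i hi a ha => by
      rw [Finset.mem_Ico] at hi
      exact P.toDu_wt hω i (by omega) a ha
    exact this ha
  let R : G.S →ₗ[k] Module.Dual k K :=
    (LinearMap.lcomp k k K.subtype) ∘ₗ P.evS ∘ₗ P.toDu.toLinearMap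
  have hR : ∀ ω (a : K), R ω a = P.evS (P.toDu ω) a := fun _ _ => rfl
  have htop : M.map R = ⊤ := by
    have h0 : (M.map R).dualCoannihilator = ⊥ := by
      refine (Submodule.eq_bot_iff _).2 fun a ha => ?_
      rw [Submodule.mem_dualCoannihilator] at ha
      refine Subtype.ext (P.eq_zero_of_evS fun ω => ?_)
      have hω : ω ∈ ⨆ i, monoGr wG G.s i := by
        rw [iSup_monoGr_eq_top G.s_internal P.topG]; trivial
      induction hω using Submodule.iSup_induction' with
      | zero => rw [map_zero, map_zero, LinearMap.zero_apply]
      | add x y _ _ hx hy => rw [map_add, map_add, LinearMap.add_apply, hx, hy, add_zero]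
      | mem i ω hω =>
        by_cases hi : i < N
        · exact ha _ (Submodule.mem_map_of_mem
            (Submodule.mem_iSup_of_mem i (Submodule.mem_iSup_of_mem hi hω)))
        · exact hK i (by omega) ω hω a a.2
    rw [← Subspace.dualCoannihilator_dualAnnihilator_eq (W := M.map R), h0,
      Submodule.dualAnnihilator_bot]
  have hf : P.evS f ∘ₗ K.subtype ∈ M.map R := by rw [htop]; trivial
  obtain ⟨ω, hω, e⟩ := hf
  refine ⟨ω, P.du_ext fun a => ?_⟩
  have ha : a ∈ ⨆ i, monoGr wL L.ι i := by
    rw [iSup_monoGr_eq_top L.c_internal P.topL]; trivial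
  induction ha using Submodule.iSup_induction' with
  | zero => rw [map_zero, map_zero]
  | add x y _ _ hx hy => rw [map_add, map_add, hx, hy]
  | mem i a ha =>
    by_cases hi : i < 0
    · rw [monoGr_eq_bot P.neg hi, Submodule.mem_bot] at ha
      rw [ha, map_zero, map_zero]
    · by_cases hi' : i < N
      · have haK : a ∈ K := Finset.le_sup (f := fun n => monoGr wL L.ι n)
          (Finset.mem_Ico.2 ⟨by omega, hi'⟩) ha
        exact LinearMap.congr_fun e ⟨a, haK⟩
      · rw [hM ω hω i (by omega) a ha]
        exact (hN i ((by omega : (N : ℤ) ≤ i).trans (le_abs_self i)) a ha).symm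

end Bijectivity

section Differential

lemma pr1_θ (v : L.X) (a : L.S) : GSym.pr1 L.cgr (L.θ v a) = L.b v (GSym.pr1 L.cgr a) := by
  refine GSym.induction L.c_internal (p := fun a =>
    GSym.pr1 L.cgr (L.θ v a) = L.b v (GSym.pr1 L.cgr a)) a ?_ ?_ ?_ ?_
  · rw [L.θ_one, GSym.pr1_one, map_zero, map_zero]
  · intro n w hw a _
    rw [L.θ_cons' hw, map_add, GSym.pr1_cons L.c_internal, GSym.pr1_cons L.c_internal,
      GSym.pr1_cons L.c_internal, DGLA.counit_θ, zero_smul, add_zero, map_smul]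
  · intro a b ha hb
    simp only [map_add, ha, hb]
  · intro r a ha
    simp only [map_smul, ha]

lemma pr1_D [CharZero k] (a : L.S) : GSym.pr1 L.cgr (L.D a) = -L.d (GSym.pr1 L.cgr a) +
    (2⁻¹ : k) • TensorProduct.lift L.b
      (TensorProduct.map (GSym.pr1 L.cgr) (GSym.pr1 L.cgr) (GSym.comul L.c_internal a)) := by
  refine GSym.induction L.c_internal (p := fun a => GSym.pr1 L.cgr (L.D a) =
    -L.d (GSym.pr1 L.cgr a) + (2⁻¹ : k) • TensorProduct.lift L.b
      (TensorProduct.map (GSym.pr1 L.cgr) (GSym.pr1 L.cgr) (GSym.comul L.c_internal a))) a ?_ ?_ ?_ ?_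
  · rw [L.D_one, GSym.comul_one, TensorProduct.map_tmul, GSym.pr1_one]
    simp
  · intro n v hv a _
    have e : ∀ t, TensorProduct.map (GSym.pr1 L.cgr) (GSym.pr1 L.cgr)
        (GSym.Lam L.c_internal v t) = TensorProduct.map (LinearMap.toSpanSingleton k L.X v)
          (GSym.pr1 L.cgr) ((GSym.counit L.cgr).toLinearMap.rTensor _ t) +
        TensorProduct.map (tw L.c_internal n ∘ₗ GSym.pr1 L.cgr)
          (LinearMap.toSpanSingleton k L.X v) ((GSym.counit L.cgr).toLinearMap.lTensor _ t) := by
      intro t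
      induction t with
      | zero => simp
      | add s t hs ht => simp only [map_add, hs, ht]; abel
      | tmul x y =>
        rw [GSym.Lam_tmul' _ hv, map_add, TensorProduct.map_tmul, TensorProduct.map_tmul,
          GSym.pr1_cons L.c_internal, GSym.pr1_cons L.c_internal,
          ← tw_map_zero (GSym.internal L.c_internal) L.c_internal _
            (fun n x => GSym.pr1_mem L.c_internal)]
        rfl
    have hb : L.b (tw L.c_internal n (GSym.pr1 L.cgr a)) v = L.b v (GSym.pr1 L.cgr a) := by
      generalize GSym.pr1 L.cgr a = w
      refine hom_induction L.c_internal (p := fun w => L.b (tw L.c_internal n w) v = L.b v w) w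
        (fun m w hw => ?_) (fun w w' h h' => by
          rw [map_add, map_add, LinearMap.add_apply, h, h', map_add])
      rw [tw_of_mem _ _ hw, map_smul, LinearMap.smul_apply, ← DGLA.b_comm hv hw]
    rw [DGLA.D_cons hv, GSym.comul_cons, e, GSym.rTensor_counit, GSym.lTensor_counit, map_add,
      map_sub, map_smul, GSym.pr1_cons L.c_internal, GSym.pr1_cons L.c_internal,
      GSym.pr1_cons L.c_internal, pr1_θ, DGLA.counit_D, TensorProduct.map_tmul,
      TensorProduct.map_tmul, map_add, TensorProduct.lift.tmul, TensorProduct.lift.tmul,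
      LinearMap.toSpanSingleton_apply, one_smul, LinearMap.comp_apply, hb, map_smul]
    have e2 : ∀ z : L.X, (2⁻¹ : k) • (z + z) = z := fun z => by
      rw [← two_smul k z, smul_smul, inv_mul_cancel₀ two_ne_zero, one_smul]
    rw [e2, zero_smul, smul_zero]
    abel
  · intro a b ha hb
    simp only [map_add, ha, hb, neg_add, smul_add]; abel
  · intro r a ha
    simp only [map_smul, ha, smul_add, smul_neg, smul_comm r]

lemma β_tw (x : G.X) (v : L.X) : P.β (tw G.internal 1 x) v = P.β x (tw L.internal 1 v) := by
  refine hom_induction G.internal (p := fun x => P.β (tw G.internal 1 x) v =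
    P.β x (tw L.internal 1 v)) x (fun i x hx => ?_) (fun x y hx hy => by
      simp only [map_add, LinearMap.add_apply, hx, hy])
  refine hom_induction L.internal (p := fun v => P.β (tw G.internal 1 x) v =
    P.β x (tw L.internal 1 v)) v (fun j v hv => ?_) (fun x y hx hy => by
      simp only [map_add, hx, hy])
  rw [tw_one_of_mem _ hx, tw_one_of_mem _ hv, map_smul, map_smul, LinearMap.smul_apply]
  by_cases h : i + j = 0
  · rw [show j = -i by omega, sgn_neg]
  · rw [P.deg i j h x hx v hv, smul_zero, smul_zero]

lemma evS_quad (t : G.X ⊗[k] G.X) (a : L.S) : P.evS (P.toDu (G.quad t)) a =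
    TensorProduct.dualDistrib k G.X G.X
      (TensorProduct.map (P.β.flip ∘ₗ tw L.internal 1 ∘ₗ GSym.pr1 L.cgr)
        (P.β.flip ∘ₗ GSym.pr1 L.cgr) (GSym.comul L.c_internal a)) t := by
  induction t with
  | zero => simp only [map_zero, LinearMap.zero_apply]
  | add s t hs ht => simp only [map_add, LinearMap.add_apply, hs, ht]
  | tmul y z =>
    rw [G.quad_tmul, map_mul P.toDu, P.toDu_s, P.toDu_s, evS_mul]
    induction GSym.comul L.c_internal a with
    | zero => simp only [map_zero, LinearMap.zero_apply]
    | add s t hs ht => simp only [map_add, LinearMap.add_apply, hs, ht]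
    | tmul b c =>
      rw [TensorProduct.map_tmul, TensorProduct.map_tmul, LinearMap.mul'_apply, evS_gen, evS_gen,
        β_tw, neg_mul_neg, TensorProduct.dualDistrib_apply]
      rfl

lemma evS_quad_cobr (x : G.X) (a : L.S) : P.evS (P.toDu (G.quad (G.cobr x))) a =
    P.β x (TensorProduct.lift L.b
      (TensorProduct.map (GSym.pr1 L.cgr) (GSym.pr1 L.cgr) (GSym.comul L.c_internal a))) := by
  rw [evS_quad]
  induction GSym.comul L.c_internal a with
  | zero => simp only [map_zero, LinearMap.zero_apply]
  | add s t hs ht => simp only [map_add, LinearMap.add_apply, hs, ht]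
  | tmul b c =>
    rw [TensorProduct.map_tmul, TensorProduct.map_tmul, TensorProduct.lift.tmul]
    refine Eq.trans ?_ (P.cobr x (tw L.internal 1 (GSym.pr1 L.cgr b)) (GSym.pr1 L.cgr c))
    generalize G.cobr x = t
    induction t with
    | zero => simp only [map_zero]
    | add s t hs ht => simp only [map_add, hs, ht]
    | tmul y z => rfl

variable [CharZero k]

lemma toDu_ceD (ω : G.S) : P.toDu (G.ceD ω) =
    ((ceChains L).dual (ceWeight P.fam)).d (P.toDu ω) := by
  refine G.ceD_isDer.hom_comm (Pres.isGen G.s_internal homRel_false).gen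
    ((ceChains L).precomp_isDer (ceWeight P.fam) 1 L.D ((ceChains L).pre_d (ceWeight P.fam))
      (ceChains L).comul_d) P.toDu (fun n x hx => P.toDu_mem hx) monoGr_one
    ((ceChains L).dual (ceWeight P.fam)).one_mem (fun x => P.du_ext fun a => ?_) ω
  have e1 : P.evS (P.toDu (G.ceD (G.s x))) a = P.β (G.d x) (GSym.pr1 L.cgr a) -
      (2⁻¹ : k) • P.evS (P.toDu (G.quad (G.cobr x))) a := by
    rw [G.ceD_s, map_sub, map_neg, map_smul, P.toDu_s, map_sub, map_neg, map_smul,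
      LinearMap.sub_apply, LinearMap.neg_apply, LinearMap.smul_apply, evS_gen, neg_neg]
  have e2 : P.evS (P.gen x) (L.D a) = P.β (G.d x) (GSym.pr1 L.cgr a) -
      (2⁻¹ : k) • P.evS (P.toDu (G.quad (G.cobr x))) a := by
    rw [evS_gen, pr1_D, map_add, map_neg, map_smul, evS_quad_cobr, P.d]
    ring
  refine e1.trans (e2.symm.trans ?_)
  exact congrArg (fun f => P.evS f (L.D a)) (P.toDu_s x).symm

lemma aug_toDu (ω : G.S) : ((ceChains L).dual (ceWeight P.fam)).aug (P.toDu ω) = G.cec.aug ω := by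
  refine gen_induction (Pres.isGen G.s_internal homRel_false).gen (p := fun ω =>
    ((ceChains L).dual (ceWeight P.fam)).aug (P.toDu ω) = G.cec.aug ω) ω (fun x => ?_)
    (fun r => ?_) (fun a b ha hb => ?_) (fun a b ha hb => ?_)
  · refine (congrArg ((ceChains L).dual (ceWeight P.fam)).aug (P.toDu_s x)).trans ?_
    refine Eq.trans ?_ (Pres.aug_gen (gV := G.sgr) (R := fun _ _ => False)
      (fun _ _ h => h.elim) x).symm
    change -P.β x (GSym.pr1 L.cgr 1) = 0
    rw [GSym.pr1_one, map_zero, neg_zero]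
  · refine (congrArg ((ceChains L).dual (ceWeight P.fam)).aug (P.toDu.commutes r)).trans ?_
    exact (((ceChains L).dual (ceWeight P.fam)).aug.commutes r).trans (G.cec.aug.commutes r).symm
  · refine (congrArg ((ceChains L).dual (ceWeight P.fam)).aug (map_add P.toDu a b)).trans ?_
    exact (map_add _ _ _).trans ((congrArg₂ (· + ·) ha hb).trans (map_add G.cec.aug a b).symm)
  · refine (congrArg ((ceChains L).dual (ceWeight P.fam)).aug (map_mul P.toDu a b)).trans ?_
    exact (map_mul _ _ _).trans ((congrArg₂ (· * ·) ha hb).trans (map_mul G.cec.aug a b).symm)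

/-- The isomorphism from the Chevalley-Eilenberg algebra of `G` to the cochains of `L`. -/
def toDuHom : G.cec ⟶ (ceChains L).dual (ceWeight P.fam) :=
  ADGCA.Hom.mk P.toDu (fun n a ha => P.toDu_mem ha) P.toDu_ceD P.aug_toDu

end Differential

end CEPairing

end Pairing

/-! ### The pairing of `g^*(D)` and `g(B)` -/

section TGenPairing

variable {k : Type u} [Field k] {M N X Y : Type u} [AddCommGroup M] [Module k M] [AddCommGroup N]
  [Module k N] [AddCommGroup X] [Module k X] [AddCommGroup Y] [Module k Y]

/-- The tensor product of two pairings. -/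
def TGen.pairing (p : M →ₗ[k] N →ₗ[k] k) (e : X →ₗ[k] Y →ₗ[k] k) :
    TGen k M X →ₗ[k] TGen k N Y →ₗ[k] k :=
  TGen.lift (LinearMap.mk₂ k (fun m x => TGen.lift ((LinearMap.mul k k).compl₁₂ (p m) (e x)))
    (fun m m' x => TGen.ext fun n y => by
      simp only [LinearMap.add_apply, TGen.lift_mk, LinearMap.compl₁₂_apply, map_add])
    (fun r m x => TGen.ext fun n y => by
      simp only [LinearMap.smul_apply, TGen.lift_mk, LinearMap.compl₁₂_apply, map_smul])
    (fun m x x' => TGen.ext fun n y => by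
      simp only [LinearMap.add_apply, TGen.lift_mk, LinearMap.compl₁₂_apply, map_add])
    (fun r m x => TGen.ext fun n y => by
      simp only [LinearMap.smul_apply, TGen.lift_mk, LinearMap.compl₁₂_apply, map_smul]))

lemma TGen.pairing_mk (p : M →ₗ[k] N →ₗ[k] k) (e : X →ₗ[k] Y →ₗ[k] k) (m : M) (x : X) (n : N)
    (y : Y) : TGen.pairing p e (TGen.mk k M X m x) (TGen.mk k N Y n y) = p m n * e x y := by
  rw [TGen.pairing, TGen.lift_mk, LinearMap.mk₂_apply, TGen.lift_mk]
  rfl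

/-- The contraction of the first factor with a functional. -/
def TGen.contract (f : Module.Dual k M) : TGen k M X →ₗ[k] X :=
  TGen.lift (LinearMap.lsmul k X ∘ₗ f)

lemma TGen.contract_mk (f : Module.Dual k M) (m : M) (x : X) :
    TGen.contract f (TGen.mk k M X m x) = f m • x := TGen.lift_mk _ _ _

lemma TGen.eq_zero_of_contract {ι : Type*} [Finite ι] (b : Module.Basis ι k M) {t : TGen k M X}
    (h : ∀ i, TGen.contract (b.coord i) t = 0) : t = 0 := by
  have := Fintype.ofFinite ι
  have key : ∑ i, TGen.mk k M X (b i) (TGen.contract (b.coord i) t) = t := by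
    clear h
    induction t using TGen.induction with
    | zero => simp only [map_zero, Finset.sum_const_zero]
    | add s t hs ht => simp only [map_add, Finset.sum_add_distrib, hs, ht]
    | mk m x =>
      have e : ∀ i, TGen.mk k M X (b i) (TGen.contract (b.coord i) (TGen.mk k M X m x)) =
          (TGen.mk k M X).flip x (b.repr m i • b i) := fun i => by
        rw [TGen.contract_mk, map_smul, map_smul]; rfl
      rw [Finset.sum_congr rfl fun i _ => e i, ← map_sum, b.sum_repr]
      rfl
  rw [← key]
  exact Finset.sum_eq_zero fun i _ => by rw [h, map_zero]

lemma TGen.pairing_contract_left (p : M →ₗ[k] N →ₗ[k] k) (e : X →ₗ[k] Y →ₗ[k] k) (t : TGen k M X)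
    (n : N) (y : Y) : TGen.pairing p e t (TGen.mk k N Y n y) = e (TGen.contract (p.flip n) t) y := by
  induction t using TGen.induction with
  | zero => simp only [map_zero, LinearMap.zero_apply]
  | add s t hs ht => simp only [map_add, LinearMap.add_apply, hs, ht]
  | mk m x => rw [TGen.pairing_mk, TGen.contract_mk, map_smul]; rfl

lemma TGen.pairing_contract_right (p : M →ₗ[k] N →ₗ[k] k) (e : X →ₗ[k] Y →ₗ[k] k) (t : TGen k N Y)
    (m : M) (x : X) : TGen.pairing p e (TGen.mk k M X m x) t = e x (TGen.contract (p m) t) := by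
  induction t using TGen.induction with
  | zero => simp only [map_zero]
  | add s t hs ht => simp only [map_add, hs, ht]
  | mk n y => rw [TGen.pairing_mk, TGen.contract_mk, map_smul]; rfl

lemma TGen.iSup_gr (M : Type u) [AddCommGroup M] [Module k M] {w : ℤ → Submodule k X}
    (h : ⨆ i, w i = ⊤) : ⨆ i, TGen.gr M w (i - 1) = ⊤ := by
  refine eq_top_iff.2 fun t _ => ?_
  induction t using TGen.induction with
  | zero => exact zero_mem _
  | add s t hs ht => exact add_mem (hs trivial) (ht trivial)
  | mk m x =>
    clear * - h
    have hx : x ∈ ⨆ i, w i := by rw [h]; trivial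
    induction hx using Submodule.iSup_induction' with
    | zero => rw [map_zero]; exact zero_mem _
    | add x y _ _ hx hy => rw [map_add]; exact add_mem hx hy
    | mem i x hx =>
      refine Submodule.mem_iSup_of_mem (i + 1) ?_
      rw [add_sub_cancel_right]
      exact TGen.mk_mem m hx

lemma TGen.gr_eq_bot {w : ℤ → Submodule k X} {n : ℤ} (h : w n = ⊥) : TGen.gr M w n = ⊥ := by
  refine (Submodule.eq_bot_iff _).2 fun t ht => ?_
  refine TGen.gr_induction (p := fun t => t = 0) ht rfl (fun m x hx => ?_) (fun s t hs ht => by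
    rw [hs, ht, add_zero])
  rw [h, Submodule.mem_bot] at hx
  rw [hx, map_zero]

lemma TGen.gr_finite [Module.Finite k M] {w : ℤ → Submodule k X} {n : ℤ}
    (h : Module.Finite k (w n)) : Module.Finite k (TGen.gr M w n) := by
  have hfg : (Submodule.map₂ (TGen.mk k M X) ⊤ (w n)).FG :=
    Submodule.FG.map₂ _ Module.Finite.fg_top (Module.Finite.iff_fg.1 h)
  have hle : TGen.gr M w n ≤ Submodule.map₂ (TGen.mk k M X) ⊤ (w n) := fun t ht =>
    TGen.gr_induction (p := fun t => t ∈ Submodule.map₂ (TGen.mk k M X) ⊤ (w n)) ht (zero_mem _)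
      (fun m x hx => Submodule.apply_mem_map₂ _ trivial hx) (fun s t hs ht => add_mem hs ht)
  have := Module.Finite.iff_fg.2 hfg
  exact Submodule.finiteDimensional_of_le hle

lemma TGen.pairing_gr (p : M →ₗ[k] N →ₗ[k] k) (e : X →ₗ[k] Y →ₗ[k] k) {gX : ℤ → Submodule k X}
    {gY : ℤ → Submodule k Y} {i j : ℤ} (h : ∀ x ∈ gX i, ∀ y ∈ gY j, e x y = 0) {s : TGen k M X}
    (hs : s ∈ TGen.gr M gX i) {t : TGen k N Y} (ht : t ∈ TGen.gr N gY j) :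
    TGen.pairing p e s t = 0 := by
  refine TGen.gr_induction (p := fun s => TGen.pairing p e s t = 0) hs
    (by rw [map_zero, LinearMap.zero_apply]) (fun m x hx => ?_)
    (fun s s' h h' => by rw [map_add, LinearMap.add_apply, h, h', add_zero])
  refine TGen.gr_induction (p := fun t => TGen.pairing p e (TGen.mk k M X m x) t = 0) ht
    (map_zero _) (fun n y hy => ?_) (fun s s' h h' => by rw [map_add, h, h', add_zero])
  rw [TGen.pairing_mk, h x hx y hy, mul_zero]

lemma TGen.pairing_pair (p : M →ₗ[k] N →ₗ[k] k) (e : X →ₗ[k] Y →ₗ[k] k) (u : M ⊗[k] M)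
    (t : X ⊗[k] X) (n n' : N) (y y' : Y) :
    LinearMap.mul' k k (TensorProduct.map ((TGen.pairing p e).flip (TGen.mk k N Y n y))
      ((TGen.pairing p e).flip (TGen.mk k N Y n' y')) (pair k M X u t)) =
    LinearMap.mul' k k (TensorProduct.map (p.flip n) (p.flip n') u) *
      LinearMap.mul' k k (TensorProduct.map (e.flip y) (e.flip y') t) := by
  induction u with
  | zero => simp only [map_zero, LinearMap.zero_apply, zero_mul]
  | add u u' h h' => simp only [map_add, LinearMap.add_apply, h, h', add_mul]
  | tmul m m' =>
    induction t with
    | zero => simp only [map_zero, mul_zero]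
    | add t t' h h' => simp only [map_add, h, h', mul_add]
    | tmul x x' =>
      rw [pair_tmul]
      simp only [TensorProduct.map_tmul, LinearMap.mul'_apply, LinearMap.flip_apply,
        TGen.pairing_mk]
      ring

end TGenPairing

section AlgPairing

variable {k : Type u} [Field k]

/-- A perfect pairing of a coalgebra and an algebra equipped with weights. -/
structure AlgPairing (D : NDGCC k) (B : NDGCA k) (wD : ℤ → Submodule k D.X)
    (wB : ℤ → Submodule k B.X) where
  e : D.X →ₗ[k] B.X →ₗ[k] k
  deg : ∀ i j, i + j ≠ 0 → ∀ x ∈ D.gr i, ∀ v ∈ B.gr j, e x v = 0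
  wt : ∀ i j, i ≠ j → ∀ x ∈ wD i, ∀ v ∈ wB j, e x v = 0
  d : ∀ x v, e (D.d x) v = e x (B.d v)
  comul : ∀ x v w, LinearMap.mul' k k (TensorProduct.map (e.flip v) (e.flip w) (D.comul x)) =
    e x (B.mul v w)
  left : ∀ x, (∀ v, e x v = 0) → x = 0
  right : ∀ v, (∀ x, e x v = 0) → v = 0
  topD : ⨆ i, wD i = ⊤
  topB : ⨆ i, wB i = ⊤
  neg : ∀ i < 0, wB i = ⊥
  fin : ∀ i, Module.Finite k (wB i)

variable {D : NDGCC k} {B : NDGCA k} {wD : ℤ → Submodule k D.X} {wB : ℤ → Submodule k B.X}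
  (P : AlgPairing D B wD wB) (g : Type u) [LieRing g] [LieAlgebra k g] [Module.Finite k g]

/-- The pairing of `g^*(D)` and `g(B)`. -/
def AlgPairing.gβ : TGen k (Module.Dual k g) D.X →ₗ[k] TGen k g B.X →ₗ[k] k :=
  TGen.pairing LinearMap.id P.e

variable {g}

lemma AlgPairing.gβ_mk (φ : Module.Dual k g) (c : D.X) (y : g) (f : B.X) :
    P.gβ g (TGen.mk k _ _ φ c) (TGen.mk k _ _ y f) = φ y * P.e c f := TGen.pairing_mk _ _ _ _ _ _

lemma AlgPairing.gβ_d (s : TGen k (Module.Dual k g) D.X) (t : TGen k g B.X) :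
    P.gβ g (TGen.map LinearMap.id D.d s) t = P.gβ g s (TGen.map LinearMap.id B.d t) := by
  induction s using TGen.induction with
  | zero => simp only [map_zero, LinearMap.zero_apply]
  | add s t hs ht => simp only [map_add, LinearMap.add_apply, hs, ht]
  | mk φ c =>
    induction t using TGen.induction with
    | zero => simp only [map_zero]
    | add s t hs ht => simp only [map_add, hs, ht]
    | mk y f => rw [TGen.map_mk, TGen.map_mk, gβ_mk, gβ_mk, P.d]; rfl

lemma AlgPairing.gβ_cobr (s : TGen k (Module.Dual k g) D.X) (t u : TGen k g B.X) :
    LinearMap.mul' k k (TensorProduct.map ((P.gβ g).flip t) ((P.gβ g).flip u) (gStarCobr g D s)) =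
      P.gβ g s (gLieBr g B t u) := by
  induction t using TGen.induction with
  | zero => simp only [map_zero, TensorProduct.map_zero_left, LinearMap.zero_apply]
  | add s t hs ht => simp only [map_add, TensorProduct.map_add_left, LinearMap.add_apply, hs, ht]
  | mk y f =>
    induction u using TGen.induction with
    | zero => simp only [map_zero, TensorProduct.map_zero_right, LinearMap.zero_apply]
    | add s t hs ht => simp only [map_add, TensorProduct.map_add_right, LinearMap.add_apply, hs, ht]
    | mk y' f' =>
      induction s using TGen.induction with
      | zero => simp only [map_zero, LinearMap.zero_apply]
      | add s t hs ht => simp only [map_add, LinearMap.add_apply, hs, ht]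
      | mk φ c =>
        rw [gStarCobr_mk, gLieBr_mk, gβ_mk, ← P.comul, ← coLie_spec φ y y']
        refine (TGen.pairing_pair _ _ _ _ _ _ _ _).trans (congrArg (· * _) ?_)
        generalize coLie φ = v
        induction v with
        | zero => simp only [map_zero, LinearMap.zero_apply]
        | add s t hs ht => simp only [map_add, LinearMap.add_apply, hs, ht]
        | tmul p q => rfl

lemma AlgPairing.gβ_left (s : TGen k (Module.Dual k g) D.X) (h : ∀ t, P.gβ g s t = 0) : s = 0 := by
  let b := Module.finBasis k g
  refine TGen.eq_zero_of_contract b.dualBasis fun i => P.left _ fun f => ?_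
  rw [← h (TGen.mk k g B.X (b i) f)]
  refine Eq.trans ?_ (TGen.pairing_contract_left _ _ _ _ _).symm
  have e : b.dualBasis.coord i = (LinearMap.id : Module.Dual k g →ₗ[k] _).flip (b i) := by
    ext φ
    simp [Module.Basis.dualBasis_repr]
  rw [e]

lemma AlgPairing.gβ_right (t : TGen k g B.X) (h : ∀ s, P.gβ g s t = 0) : t = 0 := by
  let b := Module.finBasis k g
  refine TGen.eq_zero_of_contract b fun i => P.right _ fun c => ?_
  exact (TGen.pairing_contract_right (LinearMap.id : Module.Dual k g →ₗ[k] _) P.e t (b.coord i)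
    c).symm.trans (h (TGen.mk k (Module.Dual k g) D.X (b.coord i) c))

/-- The perfect pairing of `g^*(D)` and `g(B)`. -/
def AlgPairing.toCE (fam : (gLie g B).WeightFamily fun n => TGen.gr (X := B.X) g wB (n - 1)) :
    CEPairing (gStar g D) (gLie g B) (fun n => TGen.gr (X := D.X) (Module.Dual k g) wD (n - 1))
      (fun n => TGen.gr (X := B.X) g wB (n - 1)) where
  β := P.gβ g
  deg i j h _ hs _ ht := TGen.pairing_gr _ _ (P.deg i j h) hs ht
  wt i j h _ hs _ ht := TGen.pairing_gr _ _ (P.wt (i - 1) (j - 1) (by omega)) hs ht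
  d := P.gβ_d
  cobr := P.gβ_cobr
  left := P.gβ_left
  right := P.gβ_right
  topG := TGen.iSup_gr _ P.topD
  topL := TGen.iSup_gr _ P.topB
  neg i hi := TGen.gr_eq_bot (P.neg (i - 1) (by omega))
  fin i := TGen.gr_finite (P.fin (i - 1))
  fam := fam

end AlgPairing

section DualPairing

variable {k : Type u} [Field k] {C : DGCC k} (W : C.Weighting)

lemma comap_subtype_finite {V : Type u} [AddCommGroup V] [Module k V] (Y Z : Submodule k V)
    [Module.Finite k Z] : Module.Finite k (Z.comap Y.subtype) :=
  Module.Finite.of_injective ((Y.subtype.comp (Z.comap Y.subtype).subtype).codRestrict Z fun f => f.2)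
    fun _ _ h => Subtype.ext (Subtype.ext (congrArg (fun z : Z => (z : V)) h))

namespace DGCC.Weighting

/-- The evaluation of the elements of `A = C^*`. -/
def pev : C.X →ₗ[k] W.A.X →ₗ[k] k := (C.ev W.family).flip

variable {W}

lemma pev_mul (c : C.X) (f f' : W.A.X) : LinearMap.mul' k k
    (TensorProduct.map (W.pev.flip f) (W.pev.flip f') (Coalgebra.comul c)) = W.pev c (f * f') := rfl

lemma pev_deg {i j : ℤ} (h : i + j ≠ 0) {c : C.X} (hc : c ∈ C.gr i) {f : W.A.X}
    (hf : f ∈ W.A.gr j) : W.pev c f = 0 :=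
  hf i (by omega) c hc

lemma pev_wt {i j : ℤ} (h : i ≠ j) {c : C.X} (hc : c ∈ W.wt i) {f : W.A.X}
    (hf : f ∈ W.Awt j) : W.pev c f = 0 :=
  hf i h c hc

lemma pev_right {f : W.A.X} (h : ∀ c, W.pev c f = 0) : f = 0 :=
  C.dual_ext (f := f) (f' := 0) fun c => h c

lemma proj_gr (w n : ℤ) {c : C.X} (hc : c ∈ C.gr n) : proj W.internal w c ∈ C.gr n := by
  have e := proj_map W.internal W.internal 0 (proj C.internal n) (fun i x hx => by
    rw [add_zero]; exact W.proj_mem n i x hx) w c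
  rw [proj_of_mem C.internal hc, add_zero] at e
  rw [← e]
  exact LieRep.proj_mem C.internal n (proj W.internal w c)

/-- The component of weight `w` of an element of the dual. -/
def component (w : ℤ) (f : W.A.X) : W.A.X :=
  C.mkDual W.family (C.ev W.family f ∘ₗ proj W.internal w)
    (by
      obtain ⟨N, hN⟩ := C.ev_finSupp f
      exact ⟨N, fun n hn x hx => hN n hn _ (proj_gr w n hx)⟩)
    (CEPairing.finSupp_of w fun n hn x hx => by
      rw [LinearMap.comp_apply, proj_of_ne W.internal hx hn, map_zero])

lemma pev_component (w : ℤ) (f : W.A.X) (c : C.X) :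
    W.pev c (component w f) = W.pev (proj W.internal w c) f := rfl

lemma component_mem (w : ℤ) (f : W.A.X) : component w f ∈ W.Awt w := fun m hm x hx => by
  change W.pev (proj W.internal w x) f = 0
  rw [proj_of_ne W.internal hx hm, map_zero, LinearMap.zero_apply]

lemma exists_sum_component (f : W.A.X) : ∃ s : Finset ℤ, f = ∑ w ∈ s, component w f := by
  obtain ⟨N, hN⟩ := DGCC.ev_finSupp' (h := W.family) C f
  refine ⟨Finset.Icc (-N : ℤ) N, C.dual_ext fun x => ?_⟩
  change W.pev x f = W.pev x _
  rw [map_sum]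
  simp only [pev_component]
  refine hom_induction W.internal (p := fun x => W.pev x f = ∑ w ∈ Finset.Icc (-N : ℤ) N,
    W.pev (proj W.internal w x) f) x (fun i x hx => ?_) (fun x y hx hy => by
      simp only [map_add, LinearMap.add_apply, Finset.sum_add_distrib, ← hx, ← hy])
  by_cases hi : i ∈ Finset.Icc (-N : ℤ) N
  · rw [Finset.sum_eq_single_of_mem i hi, proj_of_mem W.internal hx]
    intro b _ hb
    rw [proj_of_ne W.internal hx hb.symm, map_zero, LinearMap.zero_apply]
  · rw [Finset.sum_eq_zero]
    · refine hN i ?_ x hx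
      rw [Finset.mem_Icc] at hi
      by_contra h
      rw [not_le, abs_lt] at h
      exact hi ⟨h.1.le, h.2.le⟩
    · intro b hb
      rw [proj_of_ne W.internal hx (by rintro rfl; exact hi hb), map_zero, LinearMap.zero_apply]

lemma iSup_wt : ⨆ w, W.wt w = ⊤ := W.internal.submodule_iSup_eq_top

lemma iSup_Awt : ⨆ w, W.Awt w = ⊤ := by
  refine eq_top_iff.2 fun f _ => ?_
  obtain ⟨s, hs⟩ := exists_sum_component f
  rw [hs]
  exact sum_mem fun w _ => Submodule.mem_iSup_of_mem w (component_mem w f)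

lemma Awt_eq_bot {w : ℤ} (h : W.wt w = ⊥) : W.Awt w = ⊥ := by
  refine (Submodule.eq_bot_iff _).2 fun f hf => pev_right fun c => ?_
  refine hom_induction W.internal (p := fun c => W.pev c f = 0) c (fun i c hc => ?_)
    (fun x y hx hy => by rw [map_add, LinearMap.add_apply, hx, hy, add_zero])
  by_cases hi : i = w
  · rw [hi, h, Submodule.mem_bot] at hc
    rw [hc, map_zero, LinearMap.zero_apply]
  · exact pev_wt hi hc hf

lemma Awt_finite {w : ℤ} (h : Module.Finite k (W.wt w)) : Module.Finite k (W.Awt w) := by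
  let R : W.Awt w →ₗ[k] Module.Dual k (W.wt w) :=
    LinearMap.lcomp k k (W.wt w).subtype ∘ₗ W.pev.flip ∘ₗ (W.Awt w).subtype
  refine Module.Finite.of_injective R ((injective_iff_map_eq_zero R).2 fun f hf => ?_)
  refine Subtype.ext (pev_right fun c => ?_)
  refine hom_induction W.internal (p := fun c => W.pev c f.1 = 0) c (fun i c hc => ?_)
    (fun x y hx hy => by rw [map_add, LinearMap.add_apply, hx, hy, add_zero])
  by_cases hi : i = w
  · subst hi
    exact LinearMap.congr_fun hf ⟨c, hc⟩
  · exact pev_wt hi hc f.2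

lemma pev_left {c : C.X} (h : ∀ f, W.pev c f = 0) : c = 0 := by
  have key : ∀ n w, proj W.internal w (proj C.internal n c) = 0 := by
    intro n w
    refine (Module.forall_dual_apply_eq_zero_iff k _).1 fun p => ?_
    exact h (C.mkDual W.family (p ∘ₗ proj W.internal w ∘ₗ proj C.internal n)
      (CEPairing.finSupp_of n fun m hm x hx => by
        rw [LinearMap.comp_apply, LinearMap.comp_apply, proj_of_ne C.internal hx hm, map_zero,
          map_zero])
      (CEPairing.finSupp_of w fun m hm x hx => by
        rw [LinearMap.comp_apply, LinearMap.comp_apply,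
          proj_of_ne W.internal (W.proj_mem n m x hx) hm, map_zero]))
  obtain ⟨s, hs, -⟩ := mem_iSup_proj C.internal c
  rw [hs]
  refine Finset.sum_eq_zero fun n _ => ?_
  obtain ⟨t, ht, -⟩ := mem_iSup_proj W.internal (proj C.internal n c)
  rw [ht]
  exact Finset.sum_eq_zero fun w _ => key n w

variable (W)

/-- The perfect pairing of `C` and `A = C^*`. -/
def fullPairing (hn : ∀ w < 0, W.wt w = ⊥) (hf : ∀ w, Module.Finite k (W.wt w)) :
    AlgPairing C.toN W.A.toN W.wt W.Awt where
  e := W.pev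
  deg _ _ h _ hc _ hf := pev_deg h hc hf
  wt _ _ h _ hc _ hf := pev_wt h hc hf
  d _ _ := rfl
  comul := pev_mul
  left _ := pev_left
  right _ := pev_right
  topD := iSup_wt
  topB := iSup_Awt
  neg w hw := Awt_eq_bot (hn w hw)
  fin w := Awt_finite (hf w)

/-- The pairing of `C̄` and `Ā`. -/
def barPev : C.Bar →ₗ[k] LinearMap.ker W.A.aug.toLinearMap →ₗ[k] k :=
  Submodule.liftQ _ ((LinearMap.lcomp k k (LinearMap.ker W.A.aug.toLinearMap).subtype) ∘ₗ W.pev) (by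
    rw [Submodule.span_singleton_le_iff_mem, LinearMap.mem_ker]
    exact LinearMap.ext fun f => f.2)

variable {W}

lemma barPev_toBar (c : C.X) (f : LinearMap.ker W.A.aug.toLinearMap) :
    W.barPev (C.toBar c) f = W.pev c f.1 := rfl

lemma barPev_left (c : C.Bar) (h : ∀ f, W.barPev c f = 0) : c = 0 := by
  obtain ⟨c, rfl⟩ := C.toBar_surj c
  have hc : c - Coalgebra.counit (R := k) c • C.one = 0 := pev_left (W := W) fun f => by
    have hf : W.A.aug (f - algebraMap k W.A.X (W.A.aug f)) = 0 := by
      rw [map_sub W.A.aug, AlgHom.commutes]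
      exact sub_self _
    have e := h ⟨f - algebraMap k W.A.X (W.A.aug f), hf⟩
    rw [barPev_toBar] at e
    have e1 : W.pev c (algebraMap k W.A.X (W.A.aug f)) =
        W.A.aug f * Coalgebra.counit (R := k) c := by
      rw [Algebra.algebraMap_eq_smul_one, map_smul]; rfl
    have e2 : W.pev C.one f = W.A.aug f := rfl
    rw [map_sub, e1] at e
    rw [map_sub, LinearMap.sub_apply, map_smul, LinearMap.smul_apply, e2, smul_eq_mul, mul_comm]
    exact e
  rw [sub_eq_zero] at hc
  rw [hc, map_smul, C.toBar_one, smul_zero]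

lemma barPev_right (f : LinearMap.ker W.A.aug.toLinearMap) (h : ∀ c, W.barPev c f = 0) : f = 0 :=
  Subtype.ext (pev_right fun c => h (C.toBar c))

lemma barPev_comul (c : C.Bar) (f f' : LinearMap.ker W.A.aug.toLinearMap) :
    LinearMap.mul' k k (TensorProduct.map (W.barPev.flip f) (W.barPev.flip f') (C.barComul c)) =
      W.barPev c (W.A.bar.mul f f') := by
  obtain ⟨c, rfl⟩ := C.toBar_surj c
  rw [C.barComul_toBar, ← LinearMap.comp_apply (TensorProduct.map _ _), ← TensorProduct.map_comp]
  exact pev_mul c f.1 f'.1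

lemma iSup_wt_map : ⨆ w, (W.wt w).map C.toBar = ⊤ := by
  rw [← Submodule.map_iSup, iSup_wt, Submodule.map_top, LinearMap.range_eq_top]
  exact C.toBar_surj

lemma aug_component (w : ℤ) {f : W.A.X} (hf : W.A.aug f = 0) : W.A.aug (component w f) = 0 := by
  change W.pev (proj W.internal w C.one) f = 0
  by_cases hw : w = 0
  · rw [hw, proj_of_mem W.internal W.one_mem]
    exact hf
  · rw [proj_of_ne W.internal W.one_mem (Ne.symm hw), map_zero, LinearMap.zero_apply]

lemma iSup_Awt_comap :
    ⨆ w, (W.Awt w).comap (LinearMap.ker W.A.aug.toLinearMap).subtype = ⊤ := by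
  refine eq_top_iff.2 fun f _ => ?_
  obtain ⟨s, hs⟩ := exists_sum_component f.1
  have e : f = ∑ w ∈ s, ⟨component w f.1, aug_component w f.2⟩ := by
    refine Subtype.ext (hs.trans ?_)
    rw [AddSubmonoidClass.coe_finsetSum]
  rw [e]
  exact sum_mem fun w _ => Submodule.mem_iSup_of_mem w (component_mem w f.1)

variable (W)

/-- The perfect pairing of `C̄` and `Ā`. -/
def barPairing (hn : ∀ w < 0, W.wt w = ⊥) (hf : ∀ w, Module.Finite k (W.wt w)) :
    AlgPairing C.reduced W.A.bar (fun w => (W.wt w).map C.toBar)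
      (fun w => (W.Awt w).comap (LinearMap.ker W.A.aug.toLinearMap).subtype) where
  e := W.barPev
  deg i j h := by
    rintro _ ⟨c, hc, rfl⟩ f hf
    exact pev_deg h hc hf
  wt i j h := by
    rintro _ ⟨c, hc, rfl⟩ f hf
    exact pev_wt h hc hf
  d c f := by
    obtain ⟨c, rfl⟩ := C.toBar_surj c
    exact congrArg (fun x => W.barPev x f) (C.barD_toBar c)
  comul := barPev_comul
  left := barPev_left
  right := barPev_right
  topD := iSup_wt_map
  topB := iSup_Awt_comap
  neg w hw := by
    refine (Submodule.eq_bot_iff _).2 fun f hf => Subtype.ext ?_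
    have h : f.1 ∈ W.Awt w := hf
    rwa [Awt_eq_bot (hn w hw), Submodule.mem_bot] at h
  fin w := by
    have := Awt_finite (hf w)
    exact comap_subtype_finite _ _

lemma wt_neg (h : (W.IsTrivial ∧ Module.Finite k C.X) ∨ W.IsBigraded) :
    ∀ w < 0, W.wt w = ⊥ := by
  rcases h with h | h
  · intro w hw
    refine (Submodule.eq_bot_iff _).2 fun x hx => ?_
    have h0 : x ∈ W.wt 0 := by
      have : W.wt 0 = ⊤ := h.1
      rw [this]; trivial
    rw [← proj_of_mem W.internal hx, proj_of_ne W.internal h0 (by omega)]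
  · exact h.neg

lemma wt_finite (h : (W.IsTrivial ∧ Module.Finite k C.X) ∨ W.IsBigraded) :
    ∀ w, Module.Finite k (W.wt w) := by
  rcases h with h | h
  · intro w
    have := h.2
    infer_instance
  · exact h.finite

end DGCC.Weighting

end DualPairing

section DualComparison

variable {k : Type u} [Field k] [CharZero k] (g : Type u) [LieRing g] [LieAlgebra k g]
  [Module.Finite k g] {C : DGCC k} (W : C.Weighting)

lemma DGLC.contr_eq_pd (G : DGLC k) (p : Module.Dual k G.X)
    (hp : ∀ n, n ≠ 0 → ∀ x ∈ G.gr n, p x = 0) (ω : G.S) :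
    G.contr p hp ω = GSym.pd G.s_internal p ω := by
  have hD := Pres.der_isDer (G.contrData p hp)
  refine GSym.induction G.s_internal (p := fun ω => G.contr p hp ω = GSym.pd G.s_internal p ω) ω
    ?_ (fun n x hx a ha => ?_) (fun a b ha hb => by rw [map_add, map_add, ha, hb])
    (fun r a ha => by rw [map_smul, map_smul, ha])
  · rw [GSym.pd_one]
    refine (congrArg (Pres.der (G.contrData p hp)) ?_).trans (hD.map_algebraMap monoGr_one 1)
    exact (map_one (algebraMap k G.S)).symm
  · have e : p ∘ₗ tw G.s_internal n = sgn k n • p := by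
      refine ext_gr G.s_internal fun j y hy => ?_
      rw [LinearMap.comp_apply, tw_of_mem _ _ hy, map_smul, LinearMap.smul_apply]
      by_cases hj : j = -1
      · rw [hj, mul_neg, mul_one, sgn_neg]
      · rw [hp (j + 1) (by omega) y hy, smul_zero, smul_zero]
    have h3 : GSym.pd G.s_internal (sgn k n • p) a = sgn k n • GSym.pd G.s_internal p a := by
      simp only [GSym.pd, LinearMap.comp_apply, LinearMap.rTensor_smul, LinearMap.smul_apply,
        map_smul]
    rw [GSym.pd_cons _ _ hx, e, h3, ← ha]
    refine (hD _ _).trans ?_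
    rw [Pres.der_gen, tw_one_of_mem _ (monoGr_ι hx), LinearMap.smulRight_apply, smul_mul_assoc,
      one_mul, smul_mul_assoc, mul_smul_comm]
    rfl

variable {W} in
lemma exists_cecBar_hom (h : (W.IsTrivial ∧ Module.Finite k C.X) ∨ W.IsBigraded) :
    ∃ F : cecBar g C ⟶ ceDualBar g W,
      IsQIso (cecBar g C).d (ceDualBar g W).d (ADGCA.lin F) := by
  let P := (W.barPairing (W.wt_neg h) (W.wt_finite h)).toCE (barWt_family g W)
  exact ⟨P.toDuHom, IsQIso.of_bijective P.toDu_ceD ⟨P.toDu_injective, P.toDu_surjective⟩⟩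

/-- The morphism of basic subalgebras induced by a homomorphism compatible with the derivations. -/
def ADGCA.basicMap {A B : ADGCA k} {Y : Type u} {θ : Y → A.X →ₗ[k] A.X} {m : ℤ}
    {hθ : ∀ y, IsDer A.internal 1 (θ y)} {hm : ∀ y n, ∀ x ∈ A.gr n, θ y x ∈ A.gr (n + m)}
    {θ' : Y → B.X →ₗ[k] B.X} {m' : ℤ} {hθ' : ∀ y, IsDer B.internal 1 (θ' y)}
    {hm' : ∀ y n, ∀ x ∈ B.gr n, θ' y x ∈ B.gr (n + m')} (F : A ⟶ B)
    (hF : ∀ y x, θ' y (ADGCA.lin F x) = -ADGCA.lin F (θ y x)) :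
    A.basic θ m hθ hm ⟶ B.basic θ' m' hθ' hm' :=
  ADGCA.Hom.mk (((ADGCA.Hom.f F).comp (Subalgebra.val _)).codRestrict _ (fun x y => by
      have h := x.2 y
      refine ⟨(hF y x.1).trans ?_, ?_⟩
      · rw [h.1, map_zero, neg_zero]
      · refine (congrArg (θ' y) (ADGCA.Hom.map_d F x.1).symm).trans ((hF y _).trans ?_)
        rw [h.2, map_zero, neg_zero]))
    (fun n x hx => ADGCA.Hom.map_gr F n x.1 hx) (fun x => Subtype.ext (ADGCA.Hom.map_d F x.1))
    (fun x => ADGCA.Hom.map_aug F x.1)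

lemma ADGCA.basicMap_qiso {A B : ADGCA k} {Y : Type u} {θ : Y → A.X →ₗ[k] A.X} {m : ℤ}
    {hθ : ∀ y, IsDer A.internal 1 (θ y)} {hm : ∀ y n, ∀ x ∈ A.gr n, θ y x ∈ A.gr (n + m)}
    {θ' : Y → B.X →ₗ[k] B.X} {m' : ℤ} {hθ' : ∀ y, IsDer B.internal 1 (θ' y)}
    {hm' : ∀ y n, ∀ x ∈ B.gr n, θ' y x ∈ B.gr (n + m')} (F : A ⟶ B)
    (hF : ∀ y x, θ' y (ADGCA.lin F x) = -ADGCA.lin F (θ y x))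
    (hb : Function.Bijective (ADGCA.lin F)) :
    IsQIso (A.basic θ m hθ hm).d (B.basic θ' m' hθ' hm').d
      (ADGCA.lin (ADGCA.basicMap (hθ := hθ) (hm := hm) (hθ' := hθ') (hm' := hm') F hF)) := by
  have h0 : ∀ y x, θ' y (ADGCA.lin F x) = 0 → θ y x = 0 := fun y x h => by
    rw [hF, neg_eq_zero] at h
    exact hb.1 (h.trans (map_zero _).symm)
  refine IsQIso.of_bijective (fun x => Subtype.ext (ADGCA.Hom.map_d F x.1))
    ⟨fun x y h => Subtype.ext (hb.1 (congrArg Subtype.val h)), fun b => ?_⟩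
  obtain ⟨a, ha⟩ := hb.2 b.1
  refine ⟨⟨a, fun y => ⟨h0 y a ?_, h0 y _ ?_⟩⟩, Subtype.ext ha⟩
  · rw [ha]
    exact (b.2 y).1
  · refine (congrArg (θ' y) ((ADGCA.Hom.map_d F a).trans (congrArg B.d ha))).trans ?_
    exact (b.2 y).2

variable {W} in
lemma exists_cecPair_dualHom (h : (W.IsTrivial ∧ Module.Finite k C.X) ∨ W.IsBigraded) :
    ∃ F : cecPair g C ⟶ ceDualPair g W,
      IsQIso (cecPair g C).d (ceDualPair g W).d (ADGCA.lin F) := by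
  let P := (W.fullPairing (W.wt_neg h) (W.wt_finite h)).toCE (fullWt_family g W)
  have hu : ∀ y, gStarEv g C y = P.β.flip (unitElt W y) := fun y => TGen.ext fun φ c =>
    (TGen.lift_mk _ _ _).trans 
      ((W.fullPairing (W.wt_neg h) (W.wt_finite h)).gβ_mk φ c y (1 : W.A.X)).symm
  have hF : ∀ y ω, contr W y (P.toDu ω) =
      -P.toDu ((gStar g C.toN).contr (gStarEv g C y) (gStarEv_gr C y) ω) := by
    intro y ω
    rw [DGLC.contr_eq_pd, hu]
    refine P.du_ext fun a => (P.evS_ι_mul (unitElt_gr W y) ω a).trans ?_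
    rw [map_neg]
    rfl
  exact ⟨_, ADGCA.basicMap_qiso (B := ceDualFull g W) (m := 1) (hθ := fun _ => Pres.der_isDer _)
    (hm := fun _ => Pres.der_mem _) (hθ' := contr_isDer W) (hm' := contr_mem W) P.toDuHom hF
    ⟨P.toDu_injective, P.toDu_surjective⟩⟩

end DualComparison

end LieRep

end

theorem theorem6p8 {k : Type u} [Field k] [CharZero k] (g : Type u) [LieRing g] [LieAlgebra k g]
    [Module.Finite k g] (C : DGCC k) (hC : C.Conilpotent) (𝔞 : DGLA k) (p : C.omegaComm ⟶ 𝔞)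
    (hp : DGLA.QIso p) :
    (∃ (Q : DGLA k) (q : Q ⟶ 𝔞), Q.Cofibrant ∧ DGLA.QIso q) ∧
    ∀ (Q : DGLA k) (q : Q ⟶ 𝔞), Q.Cofibrant → DGLA.QIso q →
      ((HoIso (rep g Q) (cecBar g C) ∧ HoIso (repInv g Q) (cecPair g C)) ∧
        HomologyIso (rep g Q) (cecBar g C) ∧ HomologyIso (repInv g Q) (cecPair g C)) ∧
      ∀ W : C.Weighting, ((W.IsTrivial ∧ Module.Finite k C.X) ∨ W.IsBigraded) →
        (HoIso (rep g Q) (ceDualBar g W) ∧ HoIso (repInv g Q) (ceDualPair g W)) ∧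
          HomologyIso (rep g Q) (ceDualBar g W) ∧ HomologyIso (repInv g Q) (ceDualPair g W) := by
  have hΩ : C.omegaComm.Cofibrant := NDGCC.omega_cofibrant hC
  refine ⟨⟨C.omegaComm, p, hΩ, hp⟩, fun Q q hQ hq => ?_⟩
  obtain ⟨f, hf, hf'⟩ := exists_rep_qiso g hQ hΩ hq hp
  obtain ⟨F, hF⟩ := exists_cecPair_hom g C
  have hS := starRepHom_qiso (g := g) (D := C.reduced)
  have a1 : HoIso (rep g Q) (cecBar g C) :=
    (HoIso.of_qiso _ hf).trans (HoIso.of_qiso (starRepHom g C.reduced) hS).symm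
  have a2 : HoIso (repInv g Q) (cecPair g C) := (HoIso.of_qiso _ hf').trans (HoIso.of_qiso F hF).symm
  have b1 : HomologyIso (rep g Q) (cecBar g C) :=
    (HomologyIso.of_qiso _ hf).trans (HomologyIso.of_qiso (starRepHom g C.reduced) hS).symm
  have b2 : HomologyIso (repInv g Q) (cecPair g C) :=
    (HomologyIso.of_qiso _ hf').trans (HomologyIso.of_qiso F hF).symm
  refine ⟨⟨⟨a1, a2⟩, b1, b2⟩, fun W h => ?_⟩
  obtain ⟨G, hG⟩ := exists_cecBar_hom g h
  obtain ⟨G', hG'⟩ := exists_cecPair_dualHom g h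
  exact ⟨⟨a1.trans (HoIso.of_qiso G hG), a2.trans (HoIso.of_qiso G' hG')⟩,
    b1.trans (HomologyIso.of_qiso G hG), b2.trans (HomologyIso.of_qiso G' hG')⟩
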